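/- Let $\mathcal F=\mathbb R$ and $m=3$, or $\mathcal F=\mathbb C$ and $m=4$. Let $A_0,A_1,\dots,A_m$ be $n\times n$ Hermitian matrices over $\mathcal F$, let $c\in\mathbb R^m$ with $c_m\neq0$, and let each relation $\unlhd_i$ be either $\le$ or $=$. Write $A\bullet B=\operatorname{tr}(B^HA)$. Consider the quadratic program $$(HQP)\quad \min_{x\in\mathcal F^n}\ x^HA_0x\quad\text{s.t. } x^HA_ix\unlhd_i c_i\ (1\le i\le m),$$ with feasible set $\Omega$, its semidefinite relaxation and the dual of the relaxation $$(SP)\quad \min\ A_0\bullet X\quad\text{s.t. } A_i\bullet X\unlhd_i c_i\ (1\le i\le m),\ X\succeq0,$$ $$(SD)\quad \max\ -\sum_{i=1}^m c_i\mu_i\quad\text{s.t. } Z=A_0+\sum_{i=1}^m\mu_iA_i\succeq0,\ \mu\in\mathbb R^m,\ \mu_i\ge0\text{ whenever }\unlhd_i\text{ is }\le .$$ Let $v^*(HQP)$ and $v^*(SP)$ be the optimal values (infima in $[-\infty,+\infty]$, equal to $+\infty$ for an infeasible problem). Assume the Slater conditions: there is $X\succ0$ with $A_i\bullet X=c_i$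 for every equality constraint and $A_i\bullet X<c_i$ for every inequality constraint; and there is $\mu\in\mathbb R^m$ with $A_0+\sum_i\mu_iA_i\succ0$ and $\mu_i>0$ for every inequality constraint. Let $\hat X$ and $(\hat Z,\hat\mu)$ be any optimal solutions of $(SP)$ and $(SD)$. Put $B_i=A_i-\frac{c_i}{c_m}A_m$. The pair has Property $\mathcal I$ if all of the following hold: (I.1) $\hat\mu_i\ne0$ for every inequality constraint $i$; (I.2) $\operatorname{rank}\hat Z=n-2$; (I.3) $\operatorname{rank}\hat X=2$; (I.4) there are $x_1,x_2\in\mathcal F^n$ with $\hat X=x_1x_1^H+x_2x_2^H$ such that (a) $x_1^HB_1x_1=x_2^HB_1x_2=0$ and $\operatorname{Re}(x_1^HB_1x_2)\neq0$; (b) if $\mathcal F=\mathbb C$: $x_1^HB_2x_1=x_2^HB_2x_2=0$, $\operatorname{Re}(x_1^HB_2x_2)=0$ and $\operatorname{Im}(x_1^HB_2x_2)\ne0$; (c) $(x_1^HB_{m-1}x_1)(x_2^HB_{m-1}x_2)<0$. Then: 1. $v^*(SP)<v^*(HQP)$ or $\Omega=\emptyset$, if and only if the pair has Property $\mathcal I$.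 2. If the pair does not have Property $\mathcal I$, a global optimal solution of $(HQP)$ can be found from the pair in polynomial time. Precisely: for each of the two choices of $\mathcal F$ there are one program and one polynomial $p$ such that, for all $n$ and all data and pairs as above without Property $\mathcal I$, the program, started on the data and the pair, stops after at most $p(n)$ steps with an $x\in\Omega$ that minimizes $x^HA_0x$ over $\Omega$. Programs work in exact arithmetic on a memory of numbers of $\mathcal F$, addressed by integer registers with addition, truncated subtraction and comparison; they use no numerical constants other than integers and, for $\mathcal F=\mathbb C$, $\sqrt{-1}$. The elementary operations on numbers, at unit cost plus the cost of addressing the operands, are $+,-,\times,\div$, complex conjugation, comparison of real parts, and extraction of the $j$-th smallest real root of a univariate real polynomial whose degree is fixed by the program text. -/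

import Mathlib

open scoped ComplexOrder Matrix

/-! ## Homogeneous quadratic programs, the semidefinite relaxation and its dual -/

/-- Data of the problem: minimize `xᴴ A₀ x` subject to `xᴴ Aᵢ x ⊴ᵢ cᵢ` for `i : Fin m`, where
`x ∈ 𝕜ⁿ`, the matrices are Hermitian and each `⊴ᵢ` is `=` (`isEq i = true`) or `≤`
(`isEq i = false`). -/
structure HQP (𝕜 : Type) [RCLike 𝕜] (n m : ℕ) where
  A₀ : Matrix (Fin n) (Fin n) 𝕜
  A : Fin m → Matrix (Fin n) (Fin n) 𝕜
  c : Fin m → ℝ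
  isEq : Fin m → Bool
  hermitian₀ : A₀.IsHermitian
  hermitian : ∀ i, (A i).IsHermitian

/-- The inner product `A • B = tr (Bᴴ A)`. It is a real number when `A` and `B` are Hermitian, and
it is used for such matrices only. -/
noncomputable def matInner {𝕜 : Type} [RCLike 𝕜] {n : ℕ} (A B : Matrix (Fin n) (Fin n) 𝕜) : ℝ :=
  RCLike.re (Bᴴ * A).trace

/-- The number `xᴴ A y`. -/
noncomputable def sesq {𝕜 : Type} [RCLike 𝕜] {n : ℕ} (A : Matrix (Fin n) (Fin n) 𝕜)
    (x y : Fin n → 𝕜) : 𝕜 :=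
  star x ⬝ᵥ (A *ᵥ y)

/-- The quadratic form `xᴴ A x`, which is real when `A` is Hermitian. -/
noncomputable def quadForm {𝕜 : Type} [RCLike 𝕜] {n : ℕ} (A : Matrix (Fin n) (Fin n) 𝕜)
    (x : Fin n → 𝕜) : ℝ :=
  RCLike.re (sesq A x x)

/-- The matrix `x xᴴ`. -/
def outerSelf {𝕜 : Type} [RCLike 𝕜] {n : ℕ} (x : Fin n → 𝕜) : Matrix (Fin n) (Fin n) 𝕜 :=
  Matrix.vecMulVec x (star x)

namespace HQP

variable {𝕜 : Type} [RCLike 𝕜] {n m : ℕ} (P : HQP 𝕜 n m)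

/-- The constraint `t ⊴ᵢ cᵢ`. -/
def Rel (i : Fin m) (t : ℝ) : Prop :=
  if P.isEq i = true then t = P.c i else t ≤ P.c i

/-- The feasible set `Ω` of the quadratic program. -/
def feasibleSet : Set (Fin n → 𝕜) :=
  {x | ∀ i, P.Rel i (quadForm (P.A i) x)}

/-- `x` is a global optimal solution of the quadratic program. -/
def IsGlobalOpt (x : Fin n → 𝕜) : Prop :=
  x ∈ P.feasibleSet ∧ ∀ y ∈ P.feasibleSet, quadForm P.A₀ x ≤ quadForm P.A₀ y

/-- The optimal value of the quadratic program (`+∞` if it is infeasible). -/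
noncomputable def value : EReal :=
  ⨅ x ∈ P.feasibleSet, ((quadForm P.A₀ x : ℝ) : EReal)

/-- The feasible set of the semidefinite relaxation: `X ⪰ 0` and `Aᵢ • X ⊴ᵢ cᵢ`. -/
def sdpFeasibleSet : Set (Matrix (Fin n) (Fin n) 𝕜) :=
  {X | X.PosSemidef ∧ ∀ i, P.Rel i (matInner (P.A i) X)}

/-- `X` is an optimal solution of the semidefinite relaxation. -/
def IsSdpOpt (X : Matrix (Fin n) (Fin n) 𝕜) : Prop :=
  X ∈ P.sdpFeasibleSet ∧ ∀ Y ∈ P.sdpFeasibleSet, matInner P.A₀ X ≤ matInner P.A₀ Y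

/-- The optimal value of the semidefinite relaxation. -/
noncomputable def sdpValue : EReal :=
  ⨅ X ∈ P.sdpFeasibleSet, ((matInner P.A₀ X : ℝ) : EReal)

/-- The dual slack matrix `A₀ + ∑ μᵢ Aᵢ`. -/
noncomputable def slack (μ : Fin m → ℝ) : Matrix (Fin n) (Fin n) 𝕜 :=
  P.A₀ + ∑ i, ((μ i : ℝ) : 𝕜) • P.A i

/-- Feasibility of `(Z, μ)` for the dual: `Z = A₀ + ∑ μᵢ Aᵢ ⪰ 0` and `μᵢ ≥ 0` for every
inequality constraint. -/
def IsDualFeasible (Z : Matrix (Fin n) (Fin n) 𝕜) (μ : Fin m → ℝ) : Prop :=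
  Z = P.slack μ ∧ Z.PosSemidef ∧ ∀ i, P.isEq i = false → 0 ≤ μ i

/-- The dual objective `-∑ cᵢ μᵢ`, to be maximized. -/
def dualObj (μ : Fin m → ℝ) : ℝ := -∑ i, P.c i * μ i

/-- `(Z, μ)` is an optimal solution of the dual. -/
def IsDualOpt (Z : Matrix (Fin n) (Fin n) 𝕜) (μ : Fin m → ℝ) : Prop :=
  P.IsDualFeasible Z μ ∧ ∀ Z' μ', P.IsDualFeasible Z' μ' → P.dualObj μ' ≤ P.dualObj μ

/-- Slater condition of the semidefinite relaxation. -/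
def PrimalSlater : Prop :=
  ∃ X : Matrix (Fin n) (Fin n) 𝕜, X.PosDef ∧
    ∀ i, if P.isEq i = true then matInner (P.A i) X = P.c i else matInner (P.A i) X < P.c i

/-- Slater condition of the dual. -/
def DualSlater : Prop :=
  ∃ μ : Fin m → ℝ, (P.slack μ).PosDef ∧ ∀ i, P.isEq i = false → 0 < μ i

/-- The matrix `Aᵢ - (cᵢ / cₗ) Aₗ`. -/
noncomputable def reduced (l i : Fin m) : Matrix (Fin n) (Fin n) 𝕜 :=
  P.A i - ((P.c i / P.c l : ℝ) : 𝕜) • P.A l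

end HQP

/-- Property `I` of an optimal pair `X`, `(Z, μ)` for three real constraints. -/
def HQP.PropertyIReal {n : ℕ} (P : HQP ℝ n 3) (X Z : Matrix (Fin n) (Fin n) ℝ)
    (μ : Fin 3 → ℝ) : Prop :=
  (∀ i, P.isEq i = false → μ i ≠ 0) ∧
  Z.rank + 2 = n ∧
  X.rank = 2 ∧
  ∃ x₁ x₂ : Fin n → ℝ, X = outerSelf x₁ + outerSelf x₂ ∧
    (matInner (P.reduced 2 0) (outerSelf x₁) = 0 ∧
      matInner (P.reduced 2 0) (outerSelf x₂) = 0 ∧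
      sesq (P.reduced 2 0) x₁ x₂ ≠ 0) ∧
    matInner (P.reduced 2 1) (outerSelf x₁) * matInner (P.reduced 2 1) (outerSelf x₂) < 0

/-- Property `I` of an optimal pair `X`, `(Z, μ)` for four complex constraints. -/
def HQP.PropertyIComplex {n : ℕ} (P : HQP ℂ n 4) (X Z : Matrix (Fin n) (Fin n) ℂ)
    (μ : Fin 4 → ℝ) : Prop :=
  (∀ i, P.isEq i = false → μ i ≠ 0) ∧
  Z.rank + 2 = n ∧
  X.rank = 2 ∧
  ∃ x₁ x₂ : Fin n → ℂ, X = outerSelf x₁ + outerSelf x₂ ∧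
    (matInner (P.reduced 3 0) (outerSelf x₁) = 0 ∧
      matInner (P.reduced 3 0) (outerSelf x₂) = 0 ∧
      (sesq (P.reduced 3 0) x₁ x₂).re ≠ 0) ∧
    (matInner (P.reduced 3 1) (outerSelf x₁) = 0 ∧
      matInner (P.reduced 3 1) (outerSelf x₂) = 0 ∧
      (sesq (P.reduced 3 1) x₁ x₂).re = 0 ∧
      (sesq (P.reduced 3 1) x₁ x₂).im ≠ 0) ∧
    matInner (P.reduced 3 2) (outerSelf x₁) * matInner (P.reduced 3 2) (outerSelf x₂) < 0

/-! ## Exact-arithmetic programs with a step count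

A program is a finite text. It works on integer registers (used as sizes, counters and
addresses) and on an unbounded memory of cells, each of which holds one number of `𝕜`. Every
elementary instruction costs one step. Programs contain no numerical constants besides integers
and the imaginary unit. The only loops are `for` loops whose bound is fixed on entry, so every
program halts; each pass is charged. -/

namespace RealRAM

/-- Expressions over integer registers. Subtraction is truncated at `0`. -/
inductive NatExp
  | const (k : ℕ)
  | reg (v : ℕ)
  | add (a b : NatExp)
  | sub (a b : NatExp)

/-- The memory cell with indices `row`, `col` of the array number `arr`. -/
structure Cell where
  arr : ℕ
  row : NatExp
  col : NatExp

/-- Elementary operations on numbers. `root j [a₀, …, a_d]` is the `j`-th smallest real root,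
counted from `0`, of the univariate polynomial `∑ Re(a_k) X ^ k`. The degree `d` and the index `j`
are part of the program text, so the degrees of all root operations of a program are bounded. -/
inductive Operation
  | const (k : ℤ)
  | imagUnit
  | copy (a : Cell)
  | add (a b : Cell)
  | sub (a b : Cell)
  | mul (a b : Cell)
  | div (a b : Cell)
  | conj (a : Cell)
  | root (j : ℕ) (coeffs : List Cell)

/-- Programs. `ifLe a b p q` runs `p` if `Re a ≤ Re b` and `q` otherwise; `ifNatLe e f p q` is the
same test on integers; `loop v e p` runs `p` with register `v` set to `0, 1, …, e - 1` in turn. -/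
inductive Prog
  | skip
  | setNat (v : ℕ) (e : NatExp)
  | set (dst : Cell) (op : Operation)
  | seq (p q : Prog)
  | ifLe (a b : Cell) (p q : Prog)
  | ifNatLe (e f : NatExp) (p q : Prog)
  | loop (v : ℕ) (e : NatExp) (p : Prog)

/-- A memory state: the integer registers and the numbers `mem arr row col`. -/
structure Store (𝕜 : Type) where
  regs : ℕ → ℕ
  mem : ℕ → ℕ → ℕ → 𝕜

/-- The value of an integer expression. -/
def NatExp.eval (r : ℕ → ℕ) : NatExp → ℕ
  | .const k => k
  | .reg v => r v
  | .add a b => a.eval r + b.eval r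
  | .sub a b => a.eval r - b.eval r

/-- The number of operations in an integer expression, counting the reading of its atoms. -/
def NatExp.cost : NatExp → ℕ
  | .const _ => 1
  | .reg _ => 1
  | .add a b => a.cost + b.cost + 1
  | .sub a b => a.cost + b.cost + 1

variable {𝕜 : Type} [RCLike 𝕜]

/-- The content of a cell. -/
def Cell.read (s : Store 𝕜) (a : Cell) : 𝕜 :=
  s.mem a.arr (a.row.eval s.regs) (a.col.eval s.regs)

/-- The cost of computing the address of a cell and accessing it. -/
def Cell.cost (a : Cell) : ℕ := a.row.cost + a.col.cost + 1

/-- The `j`-th smallest real root, counted from `0`, of the polynomial with the given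
coefficients (lowest degree first); `0` if there is no such root or the polynomial is zero. -/
noncomputable def nthRealRoot (j : ℕ) (coeffs : List ℝ) : ℝ :=
  ((∑ k ∈ Finset.range coeffs.length,
    Polynomial.monomial k (coeffs.getD k 0)).roots.toFinset.sort (· ≤ ·)).getD j 0

/-- The result of an elementary operation (division by zero gives zero). -/
noncomputable def Operation.eval (s : Store 𝕜) : Operation → 𝕜
  | .const k => (k : 𝕜)
  | .imagUnit => RCLike.I
  | .copy a => a.read s
  | .add a b => a.read s + b.read s
  | .sub a b => a.read s - b.read s
  | .mul a b => a.read s * b.read s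
  | .div a b => a.read s / b.read s
  | .conj a => star (a.read s)
  | .root j l => ((nthRealRoot j (l.map fun a => RCLike.re (a.read s)) : ℝ) : 𝕜)

/-- The cost of an elementary operation: one step and the access to its operands. -/
def Operation.cost : Operation → ℕ
  | .const _ => 1
  | .imagUnit => 1
  | .copy a => a.cost + 1
  | .add a b => a.cost + b.cost + 1
  | .sub a b => a.cost + b.cost + 1
  | .mul a b => a.cost + b.cost + 1
  | .div a b => a.cost + b.cost + 1
  | .conj a => a.cost + 1
  | .root _ l => (l.map Cell.cost).sum + 1

/-- Write `k` to register `v`. -/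
def Store.setNat (s : Store 𝕜) (v k : ℕ) : Store 𝕜 :=
  { s with regs := fun w => if w = v then k else s.regs w }

/-- Write `z` to the cell `a`. -/
def Store.write (s : Store 𝕜) (a : Cell) (z : 𝕜) : Store 𝕜 :=
  { s with mem := fun b i j =>
      if b = a.arr ∧ i = a.row.eval s.regs ∧ j = a.col.eval s.regs then z else s.mem b i j }

open Classical in
/-- The final memory state of a program and the number of steps it took. -/
noncomputable def Prog.run : Prog → Store 𝕜 → Store 𝕜 × ℕ
  | .skip, s => (s, 1)
  | .setNat v e, s => (s.setNat v (e.eval s.regs), e.cost + 1)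
  | .set dst op, s => (s.write dst (op.eval s), op.cost + dst.cost)
  | .seq p q, s =>
      let r := p.run s
      let r' := q.run r.1
      (r'.1, r.2 + r'.2)
  | .ifLe a b p q, s =>
      let r := if RCLike.re (a.read s) ≤ RCLike.re (b.read s) then p.run s else q.run s
      (r.1, r.2 + a.cost + b.cost + 1)
  | .ifNatLe e f p q, s =>
      let r := if e.eval s.regs ≤ f.eval s.regs then p.run s else q.run s
      (r.1, r.2 + e.cost + f.cost + 1)
  | .loop v e p, s =>
      (List.range (e.eval s.regs)).foldl
        (fun st k =>
          let r := p.run (st.1.setNat v k)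
          (r.1, st.2 + r.2 + 1))
        (s, e.cost + 1)

/-- A matrix as a memory array, extended by zero. -/
def padMatrix {n : ℕ} (M : Matrix (Fin n) (Fin n) 𝕜) (i j : ℕ) : 𝕜 :=
  if h : i < n ∧ j < n then M ⟨i, h.1⟩ ⟨j, h.2⟩ else 0

/-- A real vector as a memory row, extended by zero. -/
def padVec {m : ℕ} (v : Fin m → ℝ) (j : ℕ) : 𝕜 :=
  if h : j < m then ((v ⟨j, h⟩ : ℝ) : 𝕜) else 0

/-- The input: the data of a quadratic program together with `X`, `Z` and `μ`. Register `0` holds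
`n`, register `i + 1` holds `1` or `0` according to whether constraint `i` is an equality or an
inequality. Array `0` is `A₀`, array `i + 1` is `Aᵢ` for `i < m`, array `m + 1` is `X`, array
`m + 2` is `Z`, and rows `0` and `1` of array `m + 3` are `c` and `μ`. All else is zero. -/
noncomputable def inputStore {n m : ℕ} (P : HQP 𝕜 n m) (X Z : Matrix (Fin n) (Fin n) 𝕜)
    (μ : Fin m → ℝ) : Store 𝕜 where
  regs v :=
    if v = 0 then n
    else if h : v - 1 < m then (if P.isEq ⟨v - 1, h⟩ = true then 1 else 0)
    else 0
  mem a i j :=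
    if a = 0 then padMatrix P.A₀ i j
    else if h : a - 1 < m then padMatrix (P.A ⟨a - 1, h⟩) i j
    else if a = m + 1 then padMatrix X i j
    else if a = m + 2 then padMatrix Z i j
    else if a = m + 3 then (if i = 0 then padVec P.c j else if i = 1 then padVec μ j else 0)
    else 0

/-- The output: the first `n` entries of column `0` of array number `a`. -/
def Store.outputVec (s : Store 𝕜) (a n : ℕ) : Fin n → 𝕜 := fun i => s.mem a i 0

end RealRAM

/-!
Both problems are treated at once, as problems with four constraints over `𝕜 = ℝ` or `𝕜 = ℂ`; a real
problem with three constraints is extended by the constraint `0 = 0` (`HQP.pad`). Call `x` good if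
it is feasible for the quadratic program and `xᴴ A₀ x ≤ A₀ • X`. Since `x xᴴ` is feasible for the
relaxation, good points are optimal (`HQP.IsGood.isGlobalOpt`). Since a feasible program attains its
minimum, there is a gap, or no feasible point, exactly if there is no good point (`HQP.gap_iff`).
Everything therefore follows from two facts: Property I excludes good points, and otherwise a fixed
program finds one.

Strong duality (`HQP.exists_dualObj_eq`) gives complementary slackness, so `Z X = 0`, and a point is
good if it lies in the kernel of `Z` and satisfies all constraints, with equality where `μᵢ ≠ 0`.
Dividing out the scale by means of a form with `Aₖ • X ≠ 0` leaves a homogeneous question: find a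
common zero in `ker Z` of the three balanced forms `Aⱼ - (tⱼ / tₖ) Aₖ`, `tⱼ = Aⱼ • X`
(`HQP.OptimalPair.isGood_rescale`). These forms are orthogonal to `X`. Hence `X` has a decomposition
into rank-one terms on which two of them vanish, obtained by rotating pairs of terms (`rotStep`).

If an inactive constraint has `μᵢ = 0`, a vector of this decomposition at which the form number `i`
is not positive suffices. Otherwise either the third form `B` vanishes at some vector, or it has
opposite signs at two vectors `x₁` and `x₂`. Combine the first two forms into `B₁ + i B₂` and let
`P`, `Q` be its cross coefficients on the span of `x₁` and `x₂`. If `|P| = |Q|`, the span contains a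
real line through `x₂` of zeros of `B₁`, `B₂`, and `B` changes sign on it
(`exists_common_zero_pair`). If `|P| ≠ |Q|`, the multiples of `x₁` and of `x₂` are the only zeros in
the span (`mul_eq_zero_of_diagForm`), so no good point exists if the span is all of `ker Z`; this is
Property I (`HQP.OptimalPair.not_isGood`). If there is a third vector `x₃` in `ker Z`, then
`a x₁ + ρ x₂ + x₃` is a zero of `B₁` and `B₂` along a curve `a = a(ρ)`, on which `B` is negative for
large `ρ` if it is negative at `x₂`. Either `B` vanishes on the curve, or the curve reaches a
parameter at which the equation for `a` degenerates to that of a real line on which `B` has a zero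
(`exists_zero_or_limit`, `exists_common_zero`).

All these points have coordinates that are obtained from the Gram matrices of three vectors by
arithmetic and by real roots of polynomials of fixed degrees. The list `candidates` contains them
all, and is defined over an arbitrary ring, so that it can be evaluated both in `𝕜` and in the ring
of functions of the machine state. The program computes the decomposition of `X` and a spanning set
of `ker Z` by deflation, rotates, and tests every candidate for every triple of vectors
(`RealRAM.Layout.solveAct`). The predicates `RealRAM.CompE` and `RealRAM.CompS` say that a value or
a transformation of the memory is computed by some program in polynomial time; they are preserved by
all constructions used.
-/

/-! ### Values that programs compute in polynomial time -/

namespace RealRAM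

/-- The numbers stored by a program, without its integer registers. -/
abbrev Mem (𝕜 : Type) := ℕ → ℕ → ℕ → 𝕜

/-- A number computed from registers and memory. -/
abbrev Val (𝕜 : Type) := (ℕ → ℕ) → Mem 𝕜 → 𝕜

/-- A transformation of the memory that may also read registers. -/
abbrev Act (𝕜 : Type) := (ℕ → ℕ) → Mem 𝕜 → Mem 𝕜

variable {𝕜 : Type}

/-- Two register states agree below `r`. -/
def RegAgree (r : ℕ) (ρ ρ' : ℕ → ℕ) : Prop := ∀ v < r, ρ v = ρ' v

/-- Two memories agree on the visible arrays; arrays from number `100` on are scratch space. -/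
def MemAgree (m m' : Mem 𝕜) : Prop := ∀ a < 100, m a = m' a

lemma RegAgree.refl (r : ℕ) (ρ : ℕ → ℕ) : RegAgree r ρ ρ := fun _ _ => rfl

lemma RegAgree.trans {r : ℕ} {ρ ρ' ρ'' : ℕ → ℕ} (h : RegAgree r ρ ρ') (h' : RegAgree r ρ' ρ'') :
    RegAgree r ρ ρ'' := fun v hv => (h v hv).trans (h' v hv)

lemma RegAgree.mono {r r' : ℕ} {ρ ρ' : ℕ → ℕ} (h : RegAgree r ρ ρ') (hr : r' ≤ r) :
    RegAgree r' ρ ρ' := fun v hv => h v (hv.trans_le hr)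

lemma RegAgree.update {r : ℕ} {ρ ρ' : ℕ → ℕ} (h : RegAgree r ρ ρ') (i : ℕ) :
    RegAgree (r + 1) (Function.update ρ r i) (Function.update ρ' r i) := by
  intro v hv
  by_cases hvr : v = r
  · subst hvr; simp
  · simp only [Function.update_of_ne hvr]
    exact h v (by omega)

lemma RegAgree.update_left (r : ℕ) (ρ : ℕ → ℕ) (i : ℕ) :
    RegAgree r (Function.update ρ r i) ρ := by
  intro v hv
  rw [Function.update_of_ne (by omega)]

lemma MemAgree.refl (m : Mem 𝕜) : MemAgree m m := fun _ _ => rfl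

lemma MemAgree.trans {m m' m'' : Mem 𝕜} (h : MemAgree m m') (h' : MemAgree m' m'') :
    MemAgree m m'' := fun a ha => (h a ha).trans (h' a ha)

/-- All registers mentioned by an integer expression are below `r`. -/
def NatExp.Below (r : ℕ) : NatExp → Prop
  | .const _ => True
  | .reg v => v < r
  | .add a b => a.Below r ∧ b.Below r
  | .sub a b => a.Below r ∧ b.Below r

lemma NatExp.Below.eval_eq {r : ℕ} {e : NatExp} (he : e.Below r) {ρ ρ' : ℕ → ℕ}
    (h : RegAgree r ρ ρ') : e.eval ρ = e.eval ρ' := by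
  induction e with
  | const k => rfl
  | reg v => exact h v he
  | add a b iha ihb => simp only [NatExp.eval, iha he.1, ihb he.2]
  | sub a b iha ihb => simp only [NatExp.eval, iha he.1, ihb he.2]

lemma NatExp.Below.mono {r r' : ℕ} {e : NatExp} (he : e.Below r) (h : r ≤ r') : e.Below r' := by
  induction e with
  | const k => trivial
  | reg v => exact lt_of_lt_of_le he h
  | add a b iha ihb => exact ⟨iha he.1, ihb he.2⟩
  | sub a b iha ihb => exact ⟨iha he.1, ihb he.2⟩

/-- The `k`-th scratch cell for intermediate values of expressions. -/
def tmp (k : ℕ) : Cell := ⟨100, .const k, .const 0⟩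

lemma write_tmp_mem (s : Store 𝕜) (k : ℕ) (z : 𝕜) (a i j : ℕ) (h : a ≠ 100 ∨ i < k) :
    (s.write (tmp k) z).mem a i j = s.mem a i j := by
  simp only [Store.write, tmp, NatExp.eval]
  rw [if_neg]
  omega

lemma write_tmp_val (s : Store 𝕜) (k : ℕ) (z : 𝕜) : (s.write (tmp k) z).mem 100 k 0 = z := by
  simp [Store.write, tmp, NatExp.eval]

variable [RCLike 𝕜]

/-- Invariant rule for `for` loops, with a uniform bound `c` on the cost of one pass. -/
lemma run_loop_inv (v : ℕ) (e : NatExp) (p : Prog) (s : Store 𝕜) (Inv : ℕ → Store 𝕜 → Prop)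
    (c : ℕ) (h0 : Inv 0 s)
    (hs : ∀ i < e.eval s.regs, ∀ s', Inv i s' →
      Inv (i + 1) (p.run (s'.setNat v i)).1 ∧ (p.run (s'.setNat v i)).2 ≤ c) :
    Inv (e.eval s.regs) ((Prog.loop v e p).run s).1 ∧
      ((Prog.loop v e p).run s).2 ≤ e.cost + 1 + e.eval s.regs * (c + 1) := by
  simp only [Prog.run]
  generalize e.eval s.regs = N at hs ⊢
  induction N with
  | zero => simpa using h0
  | succ N ih =>
    obtain ⟨h1, h2⟩ := ih fun i hi => hs i (hi.trans (Nat.lt_succ_self N))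
    rw [List.range_succ, List.foldl_append]
    simp only [List.foldl_cons, List.foldl_nil]
    obtain ⟨h3, h4⟩ := hs N (Nat.lt_succ_self N) _ h1
    refine ⟨h3, ?_⟩
    rw [Nat.add_mul, Nat.one_mul]
    omega

/-- Running `p` stores the value of `f` in scratch cell `k`, leaves registers below `r`, the
visible arrays and the scratch cells before `k` unchanged, and takes at most `q n` steps when
register `0` holds `n`. -/
structure Evaluates (r k : ℕ) (f : Val 𝕜) (p : Prog) (q : Polynomial ℕ) : Prop where
  cost_le : ∀ s : Store 𝕜, (p.run s).2 ≤ q.eval (s.regs 0)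
  regs : ∀ s : Store 𝕜, RegAgree r (p.run s).1.regs s.regs
  mem : ∀ (s : Store 𝕜) (a i j : ℕ), (a ≠ 100 ∨ i < k) → (p.run s).1.mem a i j = s.mem a i j
  val : ∀ s : Store 𝕜, (p.run s).1.mem 100 k 0 = f s.regs s.mem

/-- The value `f` depends only on registers below `r` and on visible arrays. -/
def Val.Local (r : ℕ) (f : Val 𝕜) : Prop :=
  ∀ ρ ρ' m m', RegAgree r ρ ρ' → MemAgree m m' → f ρ m = f ρ' m'

/-- The value `f` depends only on registers below `r` and on visible arrays, and programs compute
it in polynomial time. -/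
structure CompE (r : ℕ) (f : Val 𝕜) : Prop where
  loc : f.Local r
  prog : ∀ k, ∃ p q, Evaluates r k f p q

lemma Evaluates.memAgree {r k : ℕ} {f : Val 𝕜} {p : Prog} {q : Polynomial ℕ}
    (h : Evaluates r k f p q) (s : Store 𝕜) : MemAgree (p.run s).1.mem s.mem := by
  intro a ha
  funext i j
  exact h.mem s a i j (Or.inl (by omega))

/-- A value given by an operation that does not use scratch cells. -/
lemma CompE.leaf {r : ℕ} {f : Val 𝕜} (hf : f.Local r) (op : Operation)
    (hop : ∀ s : Store 𝕜, op.eval s = f s.regs s.mem) : CompE r f := by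
  refine ⟨hf, fun k => ⟨.set (tmp k) op, Polynomial.C (op.cost + (tmp k).cost), ?_⟩⟩
  refine ⟨fun s => by simp [Prog.run], fun s => RegAgree.refl _ _, fun s a i j h => ?_, fun s => ?_⟩
  · exact write_tmp_mem s k _ a i j h
  · simp only [Prog.run]
    rw [write_tmp_val, hop]

/-- The content of a memory cell. -/
def cellV (a : ℕ) (i j : NatExp) : Val 𝕜 := fun ρ m => m a (i.eval ρ) (j.eval ρ)

lemma CompE.cell {r a : ℕ} {i j : NatExp} (ha : a < 100) (hi : i.Below r) (hj : j.Below r) :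
    CompE r (cellV a i j : Val 𝕜) := by
  refine CompE.leaf ?_ (.copy ⟨a, i, j⟩) fun s => rfl
  intro ρ ρ' m m' hρ hm
  simp only [cellV, hi.eval_eq hρ, hj.eval_eq hρ, hm a ha]

/-- An integer constant. -/
def intV (k : ℤ) : Val 𝕜 := fun _ _ => (k : 𝕜)

lemma CompE.int {r : ℕ} (k : ℤ) : CompE r (intV k : Val 𝕜) :=
  CompE.leaf (fun _ _ _ _ _ _ => rfl) (.const k) fun _ => rfl

/-- The imaginary unit of `𝕜`. -/
def imagV : Val 𝕜 := fun _ _ => RCLike.I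

lemma CompE.imag {r : ℕ} : CompE r (imagV : Val 𝕜) :=
  CompE.leaf (fun _ _ _ _ _ _ => rfl) .imagUnit fun _ => rfl

lemma CompE.binary {r : ℕ} {f g : Val 𝕜} (hf : CompE r f) (hg : CompE r g) (φ : 𝕜 → 𝕜 → 𝕜)
    (mk : Cell → Cell → Operation)
    (hmk : ∀ (s : Store 𝕜) a b, (mk a b).eval s = φ (a.read s) (b.read s)) (hr : 0 < r) :
    CompE r (fun ρ m => φ (f ρ m) (g ρ m)) := by
  refine ⟨fun ρ ρ' m m' h h' => by simp only [hf.loc _ _ _ _ h h', hg.loc _ _ _ _ h h'],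
    fun k => ?_⟩
  obtain ⟨p₁, q₁, h₁⟩ := hf.prog k
  obtain ⟨p₂, q₂, h₂⟩ := hg.prog (k + 1)
  refine ⟨.seq p₁ (.seq p₂ (.set (tmp k) (mk (tmp k) (tmp (k + 1))))),
    q₁ + q₂ + Polynomial.C ((mk (tmp k) (tmp (k + 1))).cost + (tmp k).cost), ?_⟩
  constructor
  · intro s
    have c₁ := h₁.cost_le s
    have c₂ := h₂.cost_le (p₁.run s).1
    rw [h₁.regs s 0 hr] at c₂
    simp only [Prog.run, Polynomial.eval_add, Polynomial.eval_C]
    omega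
  · intro s
    exact (h₂.regs _).trans (h₁.regs s)
  · intro s a i j h
    simp only [Prog.run]
    rw [write_tmp_mem _ _ _ _ _ _ h, h₂.mem _ _ _ _ (by omega), h₁.mem _ _ _ _ h]
  · intro s
    simp only [Prog.run]
    rw [write_tmp_val, hmk]
    have e₁ : (tmp (k + 1)).read (p₂.run (p₁.run s).1).1 = g s.regs s.mem := by
      have := h₂.val (p₁.run s).1
      rw [hg.loc _ _ _ _ (h₁.regs s) (h₁.memAgree s)] at this
      exact this
    have e₂ : (tmp k).read (p₂.run (p₁.run s).1).1 = f s.regs s.mem := by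
      have := h₂.mem (p₁.run s).1 100 k 0 (Or.inr (Nat.lt_succ_self k))
      rw [h₁.val] at this
      exact this
    rw [e₁, e₂]

section
variable {r : ℕ} {f g : Val 𝕜}

lemma CompE.add (hr : 0 < r) (hf : CompE r f) (hg : CompE r g) : CompE r (f + g) :=
  hf.binary hg (· + ·) .add (fun _ _ _ => rfl) hr

lemma CompE.sub (hr : 0 < r) (hf : CompE r f) (hg : CompE r g) : CompE r (f - g) :=
  hf.binary hg (· - ·) .sub (fun _ _ _ => rfl) hr

lemma CompE.mul (hr : 0 < r) (hf : CompE r f) (hg : CompE r g) : CompE r (f * g) :=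
  hf.binary hg (· * ·) .mul (fun _ _ _ => rfl) hr

lemma CompE.div (hr : 0 < r) (hf : CompE r f) (hg : CompE r g) : CompE r (f / g) :=
  hf.binary hg (· / ·) .div (fun _ _ _ => rfl) hr

lemma CompE.conj (hr : 0 < r) (hf : CompE r f) : CompE r (star f) :=
  hf.binary hf (fun x _ => star x) (fun a _ => .conj a) (fun _ _ _ => rfl) hr

end

/-- Sum over the values `0, …, n - 1` of register `r`, where `n` is the content of register `0`. -/
def sumV (r : ℕ) (f : Val 𝕜) : Val 𝕜 :=
  fun ρ m => ∑ i ∈ Finset.range (ρ 0), f (Function.update ρ r i) m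

lemma CompE.sum {r : ℕ} {f : Val 𝕜} (hr : 0 < r) (hf : CompE (r + 1) f) :
    CompE r (sumV r f) := by
  refine ⟨fun ρ ρ' m m' h h' => ?_, fun k => ?_⟩
  · simp only [sumV, h 0 hr]
    exact Finset.sum_congr rfl fun i _ => hf.loc _ _ _ _ (h.update i) h'
  obtain ⟨p, q, hp⟩ := hf.prog (k + 1)
  refine ⟨.seq (.set (tmp k) (.const 0)) (.loop r (.reg 0)
      (.seq p (.set (tmp k) (.add (tmp k) (tmp (k + 1)))))),
    Polynomial.C ((Operation.const 0).cost + (tmp k).cost) + (Polynomial.C 2 +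
      Polynomial.X * (q + Polynomial.C ((Operation.add (tmp k) (tmp (k + 1))).cost +
        (tmp k).cost) + 1)), ?_⟩
  have key := fun s : Store 𝕜 => run_loop_inv r (.reg 0)
    (.seq p (.set (tmp k) (.add (tmp k) (tmp (k + 1))))) (s.write (tmp k) 0)
    (fun i s' => RegAgree r s'.regs s.regs ∧
      (∀ a i' j, (a ≠ 100 ∨ i' < k) → s'.mem a i' j = s.mem a i' j) ∧
      s'.mem 100 k 0 = ∑ x ∈ Finset.range i, f (Function.update s.regs r x) s.mem)
    (q.eval (s.regs 0) + ((Operation.add (tmp k) (tmp (k + 1))).cost + (tmp k).cost))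
    ⟨RegAgree.refl _ _, fun a i' j h => write_tmp_mem _ _ _ _ _ _ h, by
      rw [write_tmp_val]; simp⟩
    (by
      rintro i - s' ⟨h1, h2, h3⟩
      have hreg : RegAgree (r + 1) (s'.setNat r i).regs (Function.update s.regs r i) := by
        have : (s'.setNat r i).regs = Function.update s'.regs r i := by
          funext w; simp [Store.setNat, Function.update_apply]
        rw [this]; exact h1.update i
      have hmem : MemAgree (s'.setNat r i).mem s.mem := by
        intro a ha; funext i' j; exact h2 a i' j (Or.inl (by omega))
      have hreg' : RegAgree r (p.run (s'.setNat r i)).1.regs s.regs :=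
        ((hp.regs _).mono (Nat.le_succ r)).trans
          ((hreg.mono (Nat.le_succ r)).trans (RegAgree.update_left r _ i))
      refine ⟨⟨hreg', fun a i' j h => ?_, ?_⟩, ?_⟩
      · simp only [Prog.run]
        rw [write_tmp_mem _ _ _ _ _ _ h, hp.mem _ _ _ _ (by omega)]
        exact h2 a i' j h
      · simp only [Prog.run]
        rw [write_tmp_val]
        have e1 : (tmp k).read (p.run (s'.setNat r i)).1 = s'.mem 100 k 0 :=
          hp.mem (s'.setNat r i) 100 k 0 (Or.inr (Nat.lt_succ_self k))
        have e2 : (tmp (k + 1)).read (p.run (s'.setNat r i)).1 =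
            f (Function.update s.regs r i) s.mem :=
          (hp.val _).trans (hf.loc _ _ _ _ hreg hmem)
        simp only [Operation.eval]
        rw [e1, e2, h3, Finset.sum_range_succ]
      · have c := hp.cost_le (s'.setNat r i)
        rw [hreg 0 (by omega), Function.update_of_ne (by omega)] at c
        simp only [Prog.run]
        omega)
  constructor
  · intro s
    have := (key s).2
    simp only [Prog.run] at this ⊢
    simp only [Polynomial.eval_add, Polynomial.eval_C, Polynomial.eval_mul, Polynomial.eval_X,
      Polynomial.eval_one]
    simp only [NatExp.cost, NatExp.eval, Operation.eval, Int.cast_zero] at this ⊢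
    exact Nat.add_le_add_left this _
  · intro s
    have := (key s).1.1
    simp only [Prog.run, Operation.eval, Int.cast_zero] at this ⊢
    exact this
  · intro s
    have := (key s).1.2.1
    simp only [Prog.run, Operation.eval, Int.cast_zero] at this ⊢
    exact this
  · intro s
    have := (key s).1.2.2
    simp only [Prog.run, Operation.eval, Int.cast_zero] at this ⊢
    exact this

/-- The `j`-th real root of the polynomial whose coefficients are the real parts of the values in
`l`. -/
noncomputable def rootV (j : ℕ) (l : List (Val 𝕜)) : Val 𝕜 :=
  fun ρ m => ((nthRealRoot j (l.map fun f => RCLike.re (f ρ m)) : ℝ) : 𝕜)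

/-- A list of values can be evaluated into consecutive scratch cells. -/
lemma CompE.exists_list {r : ℕ} (hr : 0 < r) (l : List (Val 𝕜)) (hl : ∀ f ∈ l, CompE r f) :
    ∀ k, ∃ (p : Prog) (q : Polynomial ℕ), ∀ s : Store 𝕜,
      (p.run s).2 ≤ q.eval (s.regs 0) ∧ RegAgree r (p.run s).1.regs s.regs ∧
      (∀ a i j, (a ≠ 100 ∨ i < k) → (p.run s).1.mem a i j = s.mem a i j) ∧
      ((List.range' k l.length).map fun i => (p.run s).1.mem 100 i 0) =
        l.map fun f => f s.regs s.mem := by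
  induction l with
  | nil =>
    intro k
    exact ⟨.skip, 1, fun s => by simp [Prog.run, RegAgree.refl]⟩
  | cons f l ih =>
    intro k
    obtain ⟨p₁, q₁, h₁⟩ := (hl f (by simp)).prog k
    obtain ⟨p₂, q₂, h₂⟩ := ih (fun g hg => hl g (by simp [hg])) (k + 1)
    refine ⟨.seq p₁ p₂, q₁ + q₂, fun s => ?_⟩
    obtain ⟨a1, a2, a3, a4⟩ := h₂ (p₁.run s).1
    refine ⟨?_, a2.trans (h₁.regs s), fun a i j h => ?_, ?_⟩
    · have := h₁.cost_le s
      rw [h₁.regs s 0 hr] at a1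
      simp only [Prog.run, Polynomial.eval_add]
      omega
    · exact (a3 a i j (by omega)).trans (h₁.mem s a i j h)
    · simp only [Prog.run, List.length_cons, List.range'_succ, List.map_cons]
      rw [a3 100 k 0 (Or.inr (Nat.lt_succ_self k)), h₁.val, a4]
      congr 1
      refine List.map_congr_left fun g hg => ?_
      exact (hl g (by simp [hg])).loc _ _ _ _ (h₁.regs s) (h₁.memAgree s)

lemma CompE.root {r : ℕ} (hr : 0 < r) (j : ℕ) (l : List (Val 𝕜)) (hl : ∀ f ∈ l, CompE r f) :
    CompE r (rootV j l) := by
  refine ⟨fun ρ ρ' m m' h h' => ?_, fun k => ?_⟩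
  · simp only [rootV]
    congr 2
    exact List.map_congr_left fun g hg => by rw [(hl g hg).loc _ _ _ _ h h']
  obtain ⟨p, q, h⟩ := CompE.exists_list hr l hl k
  let op : Operation := .root j ((List.range' k l.length).map tmp)
  refine ⟨.seq p (.set (tmp k) op), q + Polynomial.C (op.cost + (tmp k).cost), ?_⟩
  constructor
  · intro s
    have := (h s).1
    simp only [Prog.run, Polynomial.eval_add, Polynomial.eval_C]
    omega
  · intro s; exact (h s).2.1
  · intro s a i j h'
    simp only [Prog.run]
    rw [write_tmp_mem _ _ _ _ _ _ h', (h s).2.2.1 _ _ _ h']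
  · intro s
    simp only [Prog.run]
    rw [write_tmp_val]
    simp only [op, Operation.eval, rootV, List.map_map]
    have := congrArg (List.map (fun z : 𝕜 => RCLike.re z)) (h s).2.2.2
    simp only [List.map_map] at this
    congr 2

/-- Selection by a comparison of integers. -/
def natIteV (e e' : NatExp) (f g : Val 𝕜) : Val 𝕜 :=
  fun ρ m => if e.eval ρ ≤ e'.eval ρ then f ρ m else g ρ m

lemma CompE.natIte {r : ℕ} {e e' : NatExp} {f g : Val 𝕜} (he : e.Below r) (he' : e'.Below r)
    (hf : CompE r f) (hg : CompE r g) : CompE r (natIteV e e' f g) := by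
  refine ⟨fun ρ ρ' m m' h h' => ?_, fun k => ?_⟩
  · simp only [natIteV, hf.loc _ _ _ _ h h', hg.loc _ _ _ _ h h', he.eval_eq h, he'.eval_eq h]
  obtain ⟨p₁, q₁, h₁⟩ := hf.prog k
  obtain ⟨p₂, q₂, h₂⟩ := hg.prog k
  refine ⟨.ifNatLe e e' p₁ p₂, q₁ + q₂ + Polynomial.C (e.cost + e'.cost + 1), ?_⟩
  constructor
  · intro s
    have c₁ := h₁.cost_le s
    have c₂ := h₂.cost_le s
    simp only [Prog.run, Polynomial.eval_add, Polynomial.eval_C]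
    split_ifs <;> omega
  · intro s
    simp only [Prog.run]
    split_ifs
    exacts [h₁.regs s, h₂.regs s]
  · intro s a i j h
    simp only [Prog.run]
    split_ifs
    exacts [h₁.mem s a i j h, h₂.mem s a i j h]
  · intro s
    simp only [Prog.run, natIteV]
    split_ifs
    exacts [h₁.val s, h₂.val s]

/-- The real part of a value. -/
def reV (f : Val 𝕜) : Val 𝕜 := (f + star f) / intV 2

lemma reV_apply (f : Val 𝕜) (ρ : ℕ → ℕ) (m : Mem 𝕜) :
    reV f ρ m = ((RCLike.re (f ρ m) : ℝ) : 𝕜) := by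
  simp only [reV, intV, Pi.div_apply, Pi.add_apply, Pi.star_apply, Int.cast_ofNat]
  rw [← starRingEnd_apply, RCLike.add_conj]
  field_simp

lemma CompE.re {r : ℕ} {f : Val 𝕜} (hr : 0 < r) (hf : CompE r f) : CompE r (reV f) :=
  ((hf.add hr (hf.conj hr))).div hr (CompE.int 2)

/-- The square root of the real part of a value (zero if the latter is negative). -/
noncomputable def sqrtV (f : Val 𝕜) : Val 𝕜 := rootV 1 [intV 0 - f, intV 0, intV 1]

lemma CompE.sqrt {r : ℕ} {f : Val 𝕜} (hr : 0 < r) (hf : CompE r f) : CompE r (sqrtV f) := by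
  refine CompE.root hr _ _ fun g hg => ?_
  simp only [List.mem_cons, List.not_mem_nil, or_false] at hg
  rcases hg with rfl | rfl | rfl
  exacts [(CompE.int 0).sub hr hf, CompE.int 0, CompE.int 1]

end RealRAM

/-! ### Memory transformations that programs realize in polynomial time -/

namespace RealRAM

variable {𝕜 : Type}

lemma setNat_regs (s : Store 𝕜) (r i : ℕ) :
    (s.setNat r i).regs = Function.update s.regs r i := by
  funext w; simp [Store.setNat, Function.update_apply]

lemma write_mem (s : Store 𝕜) (c : Cell) (z : 𝕜) (a i j : ℕ) :
    (s.write c z).mem a i j =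
      if a = c.arr ∧ i = c.row.eval s.regs ∧ j = c.col.eval s.regs then z else s.mem a i j := rfl

variable [RCLike 𝕜]

/-- The memory transformation `F` depends only on registers below `r` and on visible arrays, and a
program realizes it on the visible arrays in polynomial time, preserving registers below `r`. -/
structure CompS (r : ℕ) (F : Act 𝕜) : Prop where
  loc : ∀ ρ ρ' m m', RegAgree r ρ ρ' → MemAgree m m' → MemAgree (F ρ m) (F ρ' m')
  prog : ∃ (p : Prog) (q : Polynomial ℕ), ∀ s : Store 𝕜, (p.run s).2 ≤ q.eval (s.regs 0) ∧
    RegAgree r (p.run s).1.regs s.regs ∧ MemAgree (p.run s).1.mem (F s.regs s.mem)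

/-- Sequential composition. -/
def Act.then (F G : Act 𝕜) : Act 𝕜 := fun ρ m => G ρ (F ρ m)

lemma CompS.then {r : ℕ} {F G : Act 𝕜} (hr : 0 < r) (hF : CompS r F) (hG : CompS r G) :
    CompS r (F.then G) := by
  refine ⟨fun ρ ρ' m m' h h' => hG.loc _ _ _ _ h (hF.loc _ _ _ _ h h'), ?_⟩
  obtain ⟨p₁, q₁, h₁⟩ := hF.prog
  obtain ⟨p₂, q₂, h₂⟩ := hG.prog
  refine ⟨.seq p₁ p₂, q₁ + q₂, fun s => ?_⟩
  obtain ⟨a1, a2, a3⟩ := h₁ s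
  obtain ⟨b1, b2, b3⟩ := h₂ (p₁.run s).1
  refine ⟨?_, b2.trans a2, b3.trans (hG.loc _ _ _ _ a2 a3)⟩
  rw [a2 0 hr] at b1
  simp only [Prog.run, Polynomial.eval_add]
  omega

/-- The memory transformation that does nothing. -/
def Act.skip : Act 𝕜 := fun _ m => m

lemma CompS.skip {r : ℕ} : CompS r (Act.skip : Act 𝕜) :=
  ⟨fun _ _ _ _ _ h => h, .skip, 1, fun s => by
    simp [Prog.run, RegAgree.refl, Act.skip, MemAgree.refl]⟩

/-- Sequential composition of a list of memory transformations. -/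
def Act.list (l : List (Act 𝕜)) : Act 𝕜 := l.foldr Act.then Act.skip

lemma CompS.list {r : ℕ} (hr : 0 < r) (l : List (Act 𝕜)) (hl : ∀ F ∈ l, CompS r F) :
    CompS r (Act.list l) := by
  induction l with
  | nil => exact CompS.skip
  | cons F l ih =>
    exact CompS.then (F := F) (G := Act.list l) hr (hl F (by simp))
      (ih fun G hG => hl G (by simp [hG]))

/-- Iteration with register `r` running through `0, …, n - 1`, where `n` is the content of
register `0`. -/
def Act.loop (r : ℕ) (F : Act 𝕜) : Act 𝕜 := fun ρ m =>
  (List.range (ρ 0)).foldl (fun m i => F (Function.update ρ r i) m) m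

lemma CompS.loop {r : ℕ} {F : Act 𝕜} (hr : 0 < r) (hF : CompS (r + 1) F) :
    CompS r (Act.loop r F) := by
  refine ⟨fun ρ ρ' m m' h h' => ?_, ?_⟩
  · simp only [Act.loop, h 0 hr]
    induction List.range (ρ' 0) generalizing m m' with
    | nil => exact h'
    | cons i l ih => exact ih _ _ (hF.loc _ _ _ _ (h.update i) h')
  obtain ⟨p, q, hp⟩ := hF.prog
  refine ⟨.loop r (.reg 0) p, Polynomial.C 2 + Polynomial.X * (q + 1), fun s => ?_⟩
  have key := run_loop_inv r (.reg 0) p s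
    (fun i s' => RegAgree r s'.regs s.regs ∧ MemAgree s'.mem
      ((List.range i).foldl (fun m i => F (Function.update s.regs r i) m) s.mem))
    (q.eval (s.regs 0)) ⟨RegAgree.refl _ _, by simp [MemAgree.refl]⟩
    (by
      rintro i - s' ⟨h1, h2⟩
      have hreg : RegAgree (r + 1) (s'.setNat r i).regs (Function.update s.regs r i) := by
        rw [setNat_regs]; exact h1.update i
      obtain ⟨c1, c2, c3⟩ := hp (s'.setNat r i)
      refine ⟨⟨(c2.mono (Nat.le_succ r)).trans
          ((hreg.mono (Nat.le_succ r)).trans (RegAgree.update_left r _ i)), ?_⟩, ?_⟩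
      · rw [List.range_succ, List.foldl_append]
        exact c3.trans (hF.loc _ _ _ _ hreg h2)
      · rwa [hreg 0 (by omega), Function.update_of_ne (by omega)] at c1)
  refine ⟨?_, key.1.1, key.1.2⟩
  have := key.2
  simp only [Polynomial.eval_add, Polynomial.eval_C, Polynomial.eval_mul, Polynomial.eval_X,
    Polynomial.eval_one]
  simpa only [NatExp.cost, NatExp.eval] using this

open Classical in
/-- Selection by a comparison of real parts. -/
noncomputable def Act.ite (f g : Val 𝕜) (F G : Act 𝕜) : Act 𝕜 := fun ρ m =>
  if RCLike.re (f ρ m) ≤ RCLike.re (g ρ m) then F ρ m else G ρ m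

lemma CompS.ite {r : ℕ} {f g : Val 𝕜} {F G : Act 𝕜} (hr : 0 < r) (hf : CompE r f)
    (hg : CompE r g) (hF : CompS r F) (hG : CompS r G) : CompS r (Act.ite f g F G) := by
  refine ⟨fun ρ ρ' m m' h h' => ?_, ?_⟩
  · simp only [Act.ite, hf.loc _ _ _ _ h h', hg.loc _ _ _ _ h h']
    split_ifs
    exacts [hF.loc _ _ _ _ h h', hG.loc _ _ _ _ h h']
  obtain ⟨p₁, q₁, h₁⟩ := hf.prog 0
  obtain ⟨p₂, q₂, h₂⟩ := hg.prog 1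
  obtain ⟨p₃, q₃, h₃⟩ := hF.prog
  obtain ⟨p₄, q₄, h₄⟩ := hG.prog
  refine ⟨.seq p₁ (.seq p₂ (.ifLe (tmp 0) (tmp 1) p₃ p₄)),
    q₁ + q₂ + (q₃ + q₄ + Polynomial.C ((tmp 0).cost + (tmp 1).cost + 1)), fun s => ?_⟩
  have r1 := h₁.regs s
  have m1 := h₁.memAgree s
  have r2 := (h₂.regs (p₁.run s).1).trans r1
  have m2 := (h₂.memAgree (p₁.run s).1).trans m1
  have e₁ : (tmp 1).read (p₂.run (p₁.run s).1).1 = g s.regs s.mem := by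
    have := h₂.val (p₁.run s).1
    rw [hg.loc _ _ _ _ r1 m1] at this
    exact this
  have e₂ : (tmp 0).read (p₂.run (p₁.run s).1).1 = f s.regs s.mem := by
    have := h₂.mem (p₁.run s).1 100 0 0 (Or.inr Nat.one_pos)
    rw [h₁.val] at this
    exact this
  have c1 := h₁.cost_le s
  have c2 := h₂.cost_le (p₁.run s).1
  obtain ⟨c3, r3, m3⟩ := h₃ (p₂.run (p₁.run s).1).1
  obtain ⟨c4, r4, m4⟩ := h₄ (p₂.run (p₁.run s).1).1
  rw [r1 0 hr] at c2
  rw [r2 0 hr] at c3 c4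
  simp only [Prog.run, Act.ite, e₁, e₂, Polynomial.eval_add, Polynomial.eval_C]
  split_ifs
  · exact ⟨by omega, r3.trans r2, m3.trans (hF.loc _ _ _ _ r2 m2)⟩
  · exact ⟨by omega, r4.trans r2, m4.trans (hG.loc _ _ _ _ r2 m2)⟩

/-- Selection by a comparison of integers. -/
def Act.natIte (e e' : NatExp) (F G : Act 𝕜) : Act 𝕜 := fun ρ m =>
  if e.eval ρ ≤ e'.eval ρ then F ρ m else G ρ m

lemma CompS.natIte {r : ℕ} {e e' : NatExp} {F G : Act 𝕜} (he : e.Below r) (he' : e'.Below r)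
    (hF : CompS r F) (hG : CompS r G) : CompS r (Act.natIte e e' F G) := by
  refine ⟨fun ρ ρ' m m' h h' => ?_, ?_⟩
  · simp only [Act.natIte, he.eval_eq h, he'.eval_eq h]
    split_ifs
    exacts [hF.loc _ _ _ _ h h', hG.loc _ _ _ _ h h']
  obtain ⟨p₃, q₃, h₃⟩ := hF.prog
  obtain ⟨p₄, q₄, h₄⟩ := hG.prog
  refine ⟨.ifNatLe e e' p₃ p₄, q₃ + q₄ + Polynomial.C (e.cost + e'.cost + 1), fun s => ?_⟩
  obtain ⟨c3, r3, m3⟩ := h₃ s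
  obtain ⟨c4, r4, m4⟩ := h₄ s
  simp only [Prog.run, Act.natIte, Polynomial.eval_add, Polynomial.eval_C]
  split_ifs
  · exact ⟨by omega, r3, m3⟩
  · exact ⟨by omega, r4, m4⟩

/-- Simultaneous assignment to the first `n` entries of column `c` of array `a`. The value `f` is
evaluated with the row index in register `r`. -/
def setCol (r a : ℕ) (c : NatExp) (f : Val 𝕜) : Act 𝕜 := fun ρ m =>
  Function.update m a fun i j =>
    if i < ρ 0 ∧ j = c.eval ρ then f (Function.update ρ r i) m else m a i j

/-- Simultaneous assignment to the leading `n × n` block of array `a`. The value `f` is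
evaluated with the row and column indices in registers `r` and `r + 1`. -/
def setMat (r a : ℕ) (f : Val 𝕜) : Act 𝕜 := fun ρ m =>
  Function.update m a fun i j =>
    if i < ρ 0 ∧ j < ρ 0 then f (Function.update (Function.update ρ r i) (r + 1) j) m
    else m a i j

lemma CompS.setCol {r a : ℕ} {c : NatExp} {f : Val 𝕜} (hr : 0 < r) (ha : a < 100)
    (hc : c.Below r) (hf : CompE (r + 1) f) : CompS r (setCol r a c f) := by
  refine ⟨fun ρ ρ' m m' h h' b hb => ?_, ?_⟩
  · simp only [RealRAM.setCol, h 0 hr, hc.eval_eq h, Function.update_apply, h' a ha, h' b hb]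
    split_ifs
    · funext i j
      rw [hf.loc _ _ _ _ (h.update i) h']
    · rfl
  obtain ⟨p, q, hp⟩ := hf.prog 0
  -- the values are collected in array `101` first, since `f` may read the target column
  let w₁ : Prog := .set ⟨101, .reg r, .const 0⟩ (.copy (tmp 0))
  let w₂ : Prog := .set ⟨a, .reg r, c⟩ (.copy ⟨101, .reg r, .const 0⟩)
  refine ⟨.seq (.loop r (.reg 0) (.seq p w₁)) (.loop r (.reg 0) w₂),
    (Polynomial.C 2 + Polynomial.X * (q + Polynomial.C 8 + 1)) +
      (Polynomial.C 2 + Polynomial.X * (Polynomial.C (c.cost + 6) + 1)), fun s => ?_⟩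
  have k1 := run_loop_inv r (.reg 0) (.seq p w₁) s
    (fun i s' => RegAgree r s'.regs s.regs ∧ MemAgree s'.mem s.mem ∧
      ∀ x < i, s'.mem 101 x 0 = f (Function.update s.regs r x) s.mem)
    (q.eval (s.regs 0) + 8) ⟨RegAgree.refl _ _, MemAgree.refl _, by simp⟩
    (by
      rintro i - s' ⟨h1, h2, h3⟩
      have hreg : RegAgree (r + 1) (s'.setNat r i).regs (Function.update s.regs r i) := by
        rw [setNat_regs]; exact h1.update i
      have hreg2 := (hp.regs (s'.setNat r i)).trans hreg
      have hv : (p.run (s'.setNat r i)).1.mem 100 0 0 = f (Function.update s.regs r i) s.mem :=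
        (hp.val _).trans (hf.loc _ _ _ _ hreg h2)
      refine ⟨⟨(hreg2.mono (Nat.le_succ r)).trans (RegAgree.update_left r _ i), fun b hb => ?_,
        fun x hx => ?_⟩, ?_⟩
      · have := (hp.memAgree (s'.setNat r i)) b hb
        funext x y
        simp only [Prog.run, w₁, write_mem]
        rw [if_neg (by omega), this, ← h2 b hb]
        rfl
      · simp only [Prog.run, w₁, write_mem, NatExp.eval]
        have hri : (p.run (s'.setNat r i)).1.regs r = i := by
          rw [hreg2 r (Nat.lt_succ_self r)]; simp
        rw [hri]
        by_cases hxi : x = i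
        · subst hxi
          rw [if_pos (by simp)]
          exact hv
        · rw [if_neg (by omega), hp.mem _ _ _ _ (Or.inl (by omega))]
          exact h3 x (by omega)
      · have c1 := hp.cost_le (s'.setNat r i)
        rw [hreg 0 (by omega), Function.update_of_ne (by omega)] at c1
        simp only [Prog.run, w₁, Operation.cost, Cell.cost, NatExp.cost, tmp]
        omega)
  simp only [NatExp.eval] at k1
  obtain ⟨⟨r1, m1, v1⟩, c1⟩ := k1
  set s₁ := ((Prog.loop r (.reg 0) (.seq p w₁)).run s).1 with hs₁
  have k2 := run_loop_inv r (.reg 0) w₂ s₁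
    (fun i s' => RegAgree r s'.regs s.regs ∧ s'.mem 101 = s₁.mem 101 ∧
      ∀ b < 100, ∀ x y, s'.mem b x y = if b = a ∧ x < i ∧ y = c.eval s.regs then
        f (Function.update s.regs r x) s.mem else s.mem b x y)
    (c.cost + 6) ⟨r1, rfl, fun b hb x y => by simp [m1 b hb]⟩
    (by
      rintro i hi s' ⟨h1, h2, h3⟩
      simp only [NatExp.eval, r1 0 hr] at hi
      have hreg : RegAgree (r + 1) (s'.setNat r i).regs (Function.update s.regs r i) := by
        rw [setNat_regs]; exact h1.update i
      have hri : (s'.setNat r i).regs r = i := by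
        rw [hreg r (Nat.lt_succ_self r)]; simp
      have hcv : c.eval (s'.setNat r i).regs = c.eval s.regs :=
        hc.eval_eq ((hreg.mono (Nat.le_succ r)).trans (RegAgree.update_left r _ i))
      refine ⟨⟨(hreg.mono (Nat.le_succ r)).trans (RegAgree.update_left r _ i), ?_,
        fun b hb x y => ?_⟩, ?_⟩
      · funext x y
        simp only [Prog.run, w₂, write_mem]
        rw [if_neg (by omega), ← h2]
        rfl
      · simp only [Prog.run, w₂, write_mem, NatExp.eval, Operation.eval, Cell.read, hri, hcv]
        have e1 : (s'.setNat r i).mem 101 i 0 = f (Function.update s.regs r i) s.mem := by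
          rw [← v1 i hi, ← h2]; rfl
        rw [e1]
        have e2 : (s'.setNat r i).mem b x y = s'.mem b x y := rfl
        rw [e2, h3 b hb]
        by_cases hxi : x = i
        · subst hxi
          by_cases hb' : b = a <;> by_cases hy : y = c.eval s.regs <;> simp [hb', hy]
        · have : x < i + 1 ↔ x < i := by omega
          simp [hxi, this]
      · simp only [Prog.run, w₂, Operation.cost, Cell.cost, NatExp.cost]
        omega)
  simp only [NatExp.eval, r1 0 hr] at k2
  obtain ⟨⟨r2, -, v2⟩, c2⟩ := k2
  refine ⟨?_, r2, fun b hb => ?_⟩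
  · simp only [Prog.run] at c1 c2 hs₁ ⊢
    rw [← hs₁]
    simp only [Polynomial.eval_add, Polynomial.eval_C, Polynomial.eval_mul, Polynomial.eval_X,
      Polynomial.eval_one]
    exact Nat.add_le_add c1 c2
  · funext x y
    refine (v2 b hb x y).trans ?_
    simp only [RealRAM.setCol, Function.update_apply]
    by_cases hb' : b = a
    · subst hb'; simp
    · simp [hb']

lemma CompS.setMat {r a : ℕ} {f : Val 𝕜} (hr : 0 < r) (ha : a < 100)
    (hf : CompE (r + 2) f) : CompS r (setMat r a f) := by
  refine ⟨fun ρ ρ' m m' h h' b hb => ?_, ?_⟩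
  · simp only [RealRAM.setMat, h 0 hr, Function.update_apply, h' a ha, h' b hb]
    split_ifs
    · funext i j
      rw [hf.loc _ _ _ _ ((h.update i).update j) h']
    · rfl
  obtain ⟨p, q, hp⟩ := hf.prog 0
  -- the values are collected in array `101` first, since `f` may read the target array
  let w₁ : Prog := .set ⟨101, .reg r, .reg (r + 1)⟩ (.copy (tmp 0))
  let w₂ : Prog := .set ⟨a, .reg r, .reg (r + 1)⟩ (.copy ⟨101, .reg r, .reg (r + 1)⟩)
  refine ⟨.seq (.loop r (.reg 0) (.loop (r + 1) (.reg 0) (.seq p w₁)))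
      (.loop r (.reg 0) (.loop (r + 1) (.reg 0) w₂)),
    (Polynomial.C 2 + Polynomial.X * ((Polynomial.C 2 + Polynomial.X *
        (q + Polynomial.C 8 + 1)) + 1)) +
      (Polynomial.C 2 + Polynomial.X * ((Polynomial.C 2 + Polynomial.X *
        (Polynomial.C 7 + 1)) + 1)), fun s => ?_⟩
  set F : ℕ → ℕ → 𝕜 := fun x y =>
    f (Function.update (Function.update s.regs r x) (r + 1) y) s.mem with hF
  set n := s.regs 0 with hn
  have k1 := run_loop_inv r (.reg 0) (.loop (r + 1) (.reg 0) (.seq p w₁)) s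
    (fun i s' => RegAgree r s'.regs s.regs ∧ MemAgree s'.mem s.mem ∧
      ∀ x < i, ∀ y < n, s'.mem 101 x y = F x y)
    (2 + n * (q.eval n + 8 + 1)) ⟨RegAgree.refl _ _, MemAgree.refl _, by simp⟩
    (by
      rintro i - s' ⟨h1, h2, h3⟩
      have hreg : RegAgree (r + 1) (s'.setNat r i).regs (Function.update s.regs r i) := by
        rw [setNat_regs]; exact h1.update i
      have hn0 : (s'.setNat r i).regs 0 = n := by
        rw [hreg 0 (by omega), Function.update_of_ne (by omega)]
      have k := run_loop_inv (r + 1) (.reg 0) (.seq p w₁) (s'.setNat r i)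
        (fun j t => RegAgree (r + 1) t.regs (Function.update s.regs r i) ∧ MemAgree t.mem s.mem ∧
          (∀ x < i, ∀ y < n, t.mem 101 x y = F x y) ∧ ∀ y < j, t.mem 101 i y = F i y)
        (q.eval n + 8) ⟨hreg, h2, h3, by simp⟩
        (by
          rintro j - t ⟨t1, t2, t3, t4⟩
          have treg : RegAgree (r + 1 + 1) (t.setNat (r + 1) j).regs
              (Function.update (Function.update s.regs r i) (r + 1) j) := by
            rw [setNat_regs]; exact t1.update j
          have treg2 := (hp.regs (t.setNat (r + 1) j)).trans treg
          have hv : (p.run (t.setNat (r + 1) j)).1.mem 100 0 0 = F i j :=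
            (hp.val _).trans (hf.loc _ _ _ _ treg t2)
          have e1 : (p.run (t.setNat (r + 1) j)).1.regs r = i := by
            rw [treg2 r (by omega), Function.update_of_ne (by omega), Function.update_self]
          have e2 : (p.run (t.setNat (r + 1) j)).1.regs (r + 1) = j := by
            rw [treg2 (r + 1) (by omega), Function.update_self]
          have hw : ∀ x y, (Prog.run (.seq p w₁) (t.setNat (r + 1) j)).1.mem 101 x y =
              if x = i ∧ y = j then F i j else t.mem 101 x y := by
            intro x y
            simp only [Prog.run, w₁, write_mem, NatExp.eval, e1, e2]
            rw [hp.mem _ _ _ _ (Or.inl (by omega))]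
            simp only [true_and]
            split_ifs
            · exact hv
            · rfl
          refine ⟨⟨(treg2.mono (Nat.le_succ _)).trans (RegAgree.update_left _ _ j),
            fun b hb => ?_, fun x hx y hy => ?_, fun y hy => ?_⟩, ?_⟩
          · have := (hp.memAgree (t.setNat (r + 1) j)) b hb
            funext x y
            simp only [Prog.run, w₁, write_mem]
            rw [if_neg (by omega), this, ← t2 b hb]
            rfl
          · rw [hw, if_neg (by omega)]
            exact t3 x hx y hy
          · rw [hw]
            by_cases hyj : y = j
            · simp [hyj]
            · rw [if_neg (by omega)]
              exact t4 y (by omega)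
          · have c1 := hp.cost_le (t.setNat (r + 1) j)
            rw [treg 0 (by omega), Function.update_of_ne (by omega),
              Function.update_of_ne (by omega)] at c1
            change _ ≤ q.eval n at c1
            simp only [Prog.run, w₁, Operation.cost, Cell.cost, NatExp.cost, tmp]
            omega)
      simp only [NatExp.eval, hn0] at k
      obtain ⟨⟨g1, g2, g3, g4⟩, g5⟩ := k
      refine ⟨⟨(g1.mono (Nat.le_succ r)).trans (RegAgree.update_left r _ i), g2,
        fun x hx y hy => ?_⟩, ?_⟩
      · by_cases hxi : x = i
        · subst hxi; exact g4 y hy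
        · exact g3 x (by omega) y hy
      · simpa only [NatExp.cost] using g5)
  simp only [NatExp.eval] at k1
  obtain ⟨⟨r1, m1, v1⟩, c1⟩ := k1
  set s₁ := ((Prog.loop r (.reg 0) (.loop (r + 1) (.reg 0) (.seq p w₁))).run s).1 with hs₁
  have k2 := run_loop_inv r (.reg 0) (.loop (r + 1) (.reg 0) w₂) s₁
    (fun i s' => RegAgree r s'.regs s.regs ∧ s'.mem 101 = s₁.mem 101 ∧
      ∀ b < 100, ∀ x y, s'.mem b x y = if b = a ∧ x < i ∧ y < n then F x y else s.mem b x y)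
    (2 + n * (7 + 1)) ⟨r1, rfl, fun b hb x y => by simp [m1 b hb]⟩
    (by
      rintro i hi s' ⟨h1, h2, h3⟩
      simp only [NatExp.eval, r1 0 hr] at hi
      have hreg : RegAgree (r + 1) (s'.setNat r i).regs (Function.update s.regs r i) := by
        rw [setNat_regs]; exact h1.update i
      have hn0 : (s'.setNat r i).regs 0 = n := by
        rw [hreg 0 (by omega), Function.update_of_ne (by omega)]
      have k := run_loop_inv (r + 1) (.reg 0) w₂ (s'.setNat r i)
        (fun j t => RegAgree (r + 1) t.regs (Function.update s.regs r i) ∧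
          t.mem 101 = s₁.mem 101 ∧ ∀ b < 100, ∀ x y, t.mem b x y =
            if b = a ∧ y < n ∧ (x < i ∨ x = i ∧ y < j) then F x y else s.mem b x y)
        7 ⟨hreg, h2, fun b hb x y => by
          refine (h3 b hb x y).trans ?_
          refine if_congr ?_ rfl rfl
          constructor
          · rintro ⟨u1, u2, u3⟩; exact ⟨u1, u3, Or.inl u2⟩
          · rintro ⟨u1, u2, u3⟩; exact ⟨u1, by omega, u2⟩⟩
        (by
          rintro j hj t ⟨t1, t2, t3⟩
          simp only [NatExp.eval, hn0] at hj
          have treg : RegAgree (r + 1 + 1) (t.setNat (r + 1) j).regs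
              (Function.update (Function.update s.regs r i) (r + 1) j) := by
            rw [setNat_regs]; exact t1.update j
          have e1 : (t.setNat (r + 1) j).regs r = i := by
            rw [treg r (by omega), Function.update_of_ne (by omega), Function.update_self]
          have e2 : (t.setNat (r + 1) j).regs (r + 1) = j := by
            rw [treg (r + 1) (by omega), Function.update_self]
          refine ⟨⟨(treg.mono (Nat.le_succ _)).trans (RegAgree.update_left _ _ j), ?_,
            fun b hb x y => ?_⟩, ?_⟩
          · funext x y
            simp only [Prog.run, w₂, write_mem]
            rw [if_neg (by omega), ← t2]
            rfl
          · simp only [Prog.run, w₂, write_mem, NatExp.eval, Operation.eval, Cell.read, e1, e2]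
            have e3 : (t.setNat (r + 1) j).mem 101 i j = F i j := by
              rw [← v1 i hi j hj, ← t2]; rfl
            have e4 : (t.setNat (r + 1) j).mem b x y = t.mem b x y := rfl
            rw [e3, e4, t3 b hb]
            by_cases hxy : x = i ∧ y = j
            · obtain ⟨rfl, rfl⟩ := hxy
              by_cases hb' : b = a <;> simp [hb', hj]
            · have : (y < n ∧ (x < i ∨ x = i ∧ y < j + 1)) ↔ (y < n ∧ (x < i ∨ x = i ∧ y < j)) := by
                omega
              simp only [hxy, and_false, if_false, this]
          · simp only [Prog.run, w₂, Operation.cost, Cell.cost, NatExp.cost]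
            omega)
      simp only [NatExp.eval, hn0] at k
      obtain ⟨⟨g1, g2, g3⟩, g5⟩ := k
      refine ⟨⟨(g1.mono (Nat.le_succ r)).trans (RegAgree.update_left r _ i), g2,
        fun b hb x y => ?_⟩, ?_⟩
      · refine (g3 b hb x y).trans (if_congr ?_ rfl rfl)
        constructor
        · rintro ⟨u1, u2, u3⟩; exact ⟨u1, by omega, u2⟩
        · rintro ⟨u1, u2, u3⟩; exact ⟨u1, u3, by omega⟩
      · simpa only [NatExp.cost] using g5)
  simp only [NatExp.eval, r1 0 hr] at k2
  obtain ⟨⟨r2, -, v2⟩, c2⟩ := k2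
  refine ⟨?_, r2, fun b hb => ?_⟩
  · simp only [Prog.run] at c1 c2 hs₁ ⊢
    rw [← hs₁]
    simp only [Polynomial.eval_add, Polynomial.eval_C, Polynomial.eval_mul, Polynomial.eval_X,
      Polynomial.eval_one]
    exact Nat.add_le_add c1 c2
  · funext x y
    refine (v2 b hb x y).trans ?_
    simp only [RealRAM.setMat, Function.update_apply]
    by_cases hb' : b = a
    · subst hb'; simp [hF, hn]
    · simp [hb']

/-! ### Real roots -/

lemma exists_nthRealRoot (l : List ℝ) (x : ℝ)
    (hx : ∑ k ∈ Finset.range l.length, l.getD k 0 * x ^ k = 0)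
    (hl : ∃ k < l.length, l.getD k 0 ≠ 0) : ∃ j < l.length, nthRealRoot j l = x := by
  set p : Polynomial ℝ := ∑ k ∈ Finset.range l.length, Polynomial.monomial k (l.getD k 0) with hp
  have hp0 : p ≠ 0 := by
    obtain ⟨k, hk, hk0⟩ := hl
    intro h
    apply hk0
    have := congrArg (fun q => Polynomial.coeff q k) h
    simpa [hp, Polynomial.finsetSum_coeff, Polynomial.coeff_monomial, hk] using this
  have hroot : x ∈ p.roots.toFinset := by
    rw [Multiset.mem_toFinset, Polynomial.mem_roots hp0, Polynomial.IsRoot, hp,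
      Polynomial.eval_finsetSum]
    simpa [Polynomial.eval_monomial] using hx
  have hpos : 0 < l.length := by
    obtain ⟨k, hk, -⟩ := hl; omega
  have hdeg : p.natDegree < l.length := by
    refine lt_of_le_of_lt (Polynomial.natDegree_sum_le_of_forall_le (n := l.length - 1) _ _
      fun k hk => ?_) (by omega)
    refine (Polynomial.natDegree_monomial_le _).trans ?_
    have := Finset.mem_range.1 hk
    omega
  have hcard : (p.roots.toFinset.sort (· ≤ ·)).length < l.length := by
    rw [Finset.length_sort]
    exact lt_of_le_of_lt ((Multiset.toFinset_card_le _).trans (Polynomial.card_roots' p)) hdeg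
  have hmem : x ∈ p.roots.toFinset.sort (· ≤ ·) := (Finset.mem_sort _).2 hroot
  obtain ⟨j, hj, hjx⟩ := List.getElem_of_mem hmem
  refine ⟨j, hj.trans hcard, ?_⟩
  rw [nthRealRoot, ← hp, List.getD_eq_getElem _ _ hj, hjx]

/-- If there is a real root at all, the root operation with index `0` returns one. -/
lemma isRoot_nthRealRoot_zero (l : List ℝ) (x : ℝ)
    (hx : ∑ k ∈ Finset.range l.length, l.getD k 0 * x ^ k = 0)
    (hl : ∃ k < l.length, l.getD k 0 ≠ 0) :
    ∑ k ∈ Finset.range l.length, l.getD k 0 * nthRealRoot 0 l ^ k = 0 := by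
  obtain ⟨j, -, hj⟩ := exists_nthRealRoot l x hx hl
  set p : Polynomial ℝ := ∑ k ∈ Finset.range l.length, Polynomial.monomial k (l.getD k 0) with hp
  have heval : ∀ y, p.eval y = ∑ k ∈ Finset.range l.length, l.getD k 0 * y ^ k := fun y => by
    simp [hp, Polynomial.eval_finsetSum, Polynomial.eval_monomial]
  have hdef : ∀ j, nthRealRoot j l = (p.roots.toFinset.sort (· ≤ ·)).getD j 0 := fun j => rfl
  rw [← heval]
  by_cases h0 : 0 < (p.roots.toFinset.sort (· ≤ ·)).length
  · rw [hdef, List.getD_eq_getElem _ _ h0]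
    have := List.getElem_mem h0
    rw [Finset.mem_sort, Multiset.mem_toFinset] at this
    exact Polynomial.isRoot_of_mem_roots this
  · have hlen : (p.roots.toFinset.sort (· ≤ ·)) = [] := List.length_eq_zero_iff.1 (by omega)
    rw [hdef, hlen, List.getD_nil] at hj ⊢
    subst hj
    rw [heval, hx]

/-- The second smallest root of `X² - a` is the square root of `a`; if `a ≤ 0` there is no second
root, and both sides are zero. -/
lemma nthRealRoot_sqrt (a : ℝ) : nthRealRoot 1 [-a, 0, 1] = √a := by
  have hpoly : (∑ k ∈ Finset.range [-a, 0, 1].length,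
      Polynomial.monomial k ([-a, 0, 1].getD k 0) : Polynomial ℝ) =
      Polynomial.X ^ 2 - Polynomial.C a := by
    simp [Finset.sum_range_succ, Polynomial.X_pow_eq_monomial]
    ring
  rw [nthRealRoot, hpoly]
  have hne : (Polynomial.X ^ 2 - Polynomial.C a : Polynomial ℝ) ≠ 0 :=
    Polynomial.X_pow_sub_C_ne_zero (by norm_num) a
  rcases lt_trichotomy a 0 with ha | ha | ha
  · have : (Polynomial.X ^ 2 - Polynomial.C a : Polynomial ℝ).roots.toFinset = ∅ := by
      ext x
      simp only [Multiset.mem_toFinset, Polynomial.mem_roots hne, Finset.notMem_empty, iff_false]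
      simp only [Polynomial.IsRoot.def, Polynomial.eval_sub, Polynomial.eval_pow,
        Polynomial.eval_X, Polynomial.eval_C]
      nlinarith [sq_nonneg x]
    rw [this, Real.sqrt_eq_zero_of_nonpos ha.le]
    simp
  · subst ha
    have : (Polynomial.X ^ 2 - Polynomial.C 0 : Polynomial ℝ).roots.toFinset = {0} := by
      ext x
      simp only [Multiset.mem_toFinset, Polynomial.mem_roots hne, Finset.mem_singleton]
      simp
    rw [this]
    simp
  · have hs : 0 < √a := Real.sqrt_pos.2 ha
    have : (Polynomial.X ^ 2 - Polynomial.C a : Polynomial ℝ).roots.toFinset = {-√a, √a} := by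
      ext x
      simp only [Multiset.mem_toFinset, Polynomial.mem_roots hne, Finset.mem_insert,
        Finset.mem_singleton]
      simp only [Polynomial.IsRoot.def, Polynomial.eval_sub, Polynomial.eval_pow,
        Polynomial.eval_X, Polynomial.eval_C]
      constructor
      · intro h
        have : (x + √a) * (x - √a) = 0 := by nlinarith [Real.sq_sqrt ha.le]
        rcases mul_eq_zero.1 this with h | h
        · left; linarith
        · right; linarith
      · rintro (rfl | rfl) <;> simp [Real.sq_sqrt ha.le]
    rw [this]
    have hsort : ({-√a, √a} : Finset ℝ).sort (· ≤ ·) = [-√a, √a] := by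
      have h1 : (-√a) ∉ ({√a} : Finset ℝ) := by
        simp only [Finset.mem_singleton]; linarith
      rw [Finset.sort_insert (r := (· ≤ ·)) (by intro b hb; simp at hb; subst hb; linarith) h1]
      simp
    rw [hsort]
    simp

lemma sqrtV_apply (f : Val 𝕜) (ρ : ℕ → ℕ) (m : Mem 𝕜) :
    sqrtV f ρ m = ((√(RCLike.re (f ρ m)) : ℝ) : 𝕜) := by
  simp only [sqrtV, rootV, intV, List.map_cons, List.map_nil, Pi.sub_apply]
  rw [← nthRealRoot_sqrt]
  simp

end RealRAM

/-! ### Zeros of two forms on a three-dimensional space -/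

section Scalars

variable {𝕜 : Type} [RCLike 𝕜]

lemma mul_star_eq_norm_sq (z : 𝕜) : z * star z = ((‖z‖ ^ 2 : ℝ) : 𝕜) := by
  rw [← starRingEnd_apply, RCLike.mul_conj]; push_cast; rfl

lemma star_mul_eq_norm_sq (z : 𝕜) : star z * z = ((‖z‖ ^ 2 : ℝ) : 𝕜) := by
  rw [mul_comm, mul_star_eq_norm_sq]

/-- The quadratic function `a ↦ β ‖a‖² + 2 Re(conj a w) + γ`. -/
noncomputable def shiftedSq (β : ℝ) (w : 𝕜) (γ : ℝ) (a : 𝕜) : ℝ :=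
  β * ‖a‖ ^ 2 + 2 * RCLike.re (star a * w) + γ

lemma shiftedSq_add_mul (β : ℝ) (w : 𝕜) (γ : ℝ) (a e : 𝕜) (τ : ℝ) :
    shiftedSq β w γ (a + τ * e) = β * ‖e‖ ^ 2 * τ ^ 2 +
      2 * (β * RCLike.re (star a * e) + RCLike.re (star e * w)) * τ + shiftedSq β w γ a := by
  simp only [shiftedSq, ← RCLike.normSq_eq_def', RCLike.normSq_apply, RCLike.star_def,
    RCLike.mul_re, RCLike.mul_im, RCLike.conj_re, RCLike.conj_im, map_add, RCLike.ofReal_re,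
    RCLike.ofReal_im]
  ring

/-- An upward parabola that takes a non-positive value has a root. -/
lemma exists_root_of_le_zero {α β γ : ℝ} (hα : 0 < α) (τ₀ : ℝ)
    (h : α * τ₀ ^ 2 + β * τ₀ + γ ≤ 0) : ∃ τ : ℝ, α * τ ^ 2 + β * τ + γ = 0 := by
  have hd : 0 ≤ β ^ 2 - 4 * α * γ := by nlinarith [sq_nonneg (2 * α * τ₀ + β)]
  refine ⟨(-β + √(β ^ 2 - 4 * α * γ)) / (2 * α), ?_⟩
  have hs := Real.sq_sqrt hd
  generalize √(β ^ 2 - 4 * α * γ) = s at hs ⊢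
  field_simp
  linear_combination hs

lemma exists_shiftedSq_eq_zero {β : ℝ} (hβ : 0 < β) (w : 𝕜) (γ : ℝ) {a₀ e : 𝕜} (he : e ≠ 0)
    (τ₀ : ℝ) (h : shiftedSq β w γ (a₀ + τ₀ * e) ≤ 0) :
    ∃ τ : ℝ, shiftedSq β w γ (a₀ + τ * e) = 0 := by
  have hα : 0 < β * ‖e‖ ^ 2 := mul_pos hβ (pow_pos (norm_pos_iff.2 he) 2)
  simp only [shiftedSq_add_mul] at h ⊢
  exact exists_root_of_le_zero hα τ₀ h

/-- The minimum of the quadratic function is attained at `-w / β`. -/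
lemma shiftedSq_min_le {β : ℝ} (hβ : 0 < β) (w : 𝕜) (γ : ℝ) (a : 𝕜) :
    shiftedSq β w γ (0 + ((-β⁻¹ : ℝ) : 𝕜) * w) ≤ shiftedSq β w γ a := by
  rw [shiftedSq_add_mul]
  simp only [shiftedSq, ← RCLike.normSq_eq_def', RCLike.normSq_apply, RCLike.star_def,
    RCLike.mul_re, RCLike.conj_re, RCLike.conj_im, map_zero]
  have : 0 ≤ β⁻¹ * ((β * RCLike.re a + RCLike.re w) ^ 2 + (β * RCLike.im a + RCLike.im w) ^ 2) := by
    positivity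
  have e : β⁻¹ * ((β * RCLike.re a + RCLike.re w) ^ 2 + (β * RCLike.im a + RCLike.im w) ^ 2) =
      β * (RCLike.re a ^ 2 + RCLike.im a ^ 2) + 2 * (RCLike.re a * RCLike.re w +
        RCLike.im a * RCLike.im w) + β⁻¹ * (RCLike.re w ^ 2 + RCLike.im w ^ 2) := by
    field_simp; ring
  rw [e] at this
  have e2 : β * (RCLike.re w * RCLike.re w + RCLike.im w * RCLike.im w) * (-β⁻¹) ^ 2 =
      β⁻¹ * (RCLike.re w ^ 2 + RCLike.im w ^ 2) := by field_simp
  nlinarith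

/-- The sublevel sets of the quadratic function are bounded. -/
lemma norm_le_of_shiftedSq_neg {β : ℝ} (hβ : 0 < β) {w : 𝕜} {γ : ℝ} {a : 𝕜} {K₁ K₂ : ℝ}
    (hK₂ : 0 ≤ K₂) (hw : ‖w‖ ≤ K₁) (hγ : -K₂ ≤ γ) (h : shiftedSq β w γ a < 0) :
    ‖a‖ ≤ (2 * K₁ + K₂) / β + 1 := by
  by_contra hlt
  push Not at hlt
  have hK₁ : 0 ≤ K₁ := (norm_nonneg w).trans hw
  have e1 : -(‖a‖ * K₁) ≤ RCLike.re (star a * w) := by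
    have h3 := RCLike.abs_re_le_norm (star a * w)
    rw [norm_mul, norm_star] at h3
    have h5 := mul_le_mul_of_nonneg_left hw (norm_nonneg a)
    linarith [neg_abs_le (RCLike.re (star a * w))]
  have h1 : 1 ≤ ‖a‖ := by
    have : 0 ≤ (2 * K₁ + K₂) / β := by positivity
    linarith
  have h2 : 2 * K₁ + K₂ < β * ‖a‖ := by
    have : (2 * K₁ + K₂) / β < ‖a‖ := by linarith
    rw [div_lt_iff₀ hβ] at this
    linarith
  have h3 : (2 * K₁ + K₂) * ‖a‖ ≤ β * ‖a‖ * ‖a‖ :=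
    mul_le_mul_of_nonneg_right h2.le (norm_nonneg a)
  have h4 : K₂ * 1 ≤ K₂ * ‖a‖ := mul_le_mul_of_nonneg_left h1 hK₂
  simp only [shiftedSq] at h
  nlinarith

lemma RCLike.star_eq_self_of_I_eq_zero (h : (RCLike.I : 𝕜) = 0) (z : 𝕜) : star z = z := by
  rw [← RCLike.re_add_im z, h]
  simp [RCLike.star_def]

/-- The real solution space of `conj e * P + e * Q = 0` for `‖P‖ = ‖Q‖ ≠ 0` is spanned by either of
the two listed vectors that is not zero. -/
lemma exists_direction {P Q f : 𝕜} (hPQ : ‖P‖ = ‖Q‖) (hQ : Q ≠ 0)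
    (hf : star f * P + f * Q = 0) :
    ∃ e ∈ [star Q - P, RCLike.I * (star Q + P)], (e ≠ 0 ∨ (RCLike.I : 𝕜) = 0) ∧
      star e * P + e * Q = 0 ∧ (e ≠ 0 → ∃ τ : ℝ, f = τ * e) := by
  have hn : P * star P = Q * star Q := by
    rw [mul_star_eq_norm_sq, mul_star_eq_norm_sq, hPQ]
  have sI : star (RCLike.I : 𝕜) = -RCLike.I := RCLike.conj_I
  have h1 : star (star Q - P) * P + (star Q - P) * Q = 0 := by
    simp only [star_sub, star_star]; linear_combination -hn
  have h2 : star (RCLike.I * (star Q + P)) * P + RCLike.I * (star Q + P) * Q = 0 := by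
    simp only [star_mul, star_add, star_star, sI]; linear_combination -(RCLike.I : 𝕜) * hn
  -- two solutions `f`, `e` satisfy `conj e * f = e * conj f`, so `f / e` is real
  have key : ∀ e : 𝕜, star e * P + e * Q = 0 → e ≠ 0 → ∃ τ : ℝ, f = τ * e := by
    intro e he he0
    have hcross : star e * f = e * star f := by
      have : Q * (star e * f - e * star f) = 0 := by
        linear_combination star e * hf - star f * he
      exact sub_eq_zero.1 ((mul_eq_zero.1 this).resolve_left hQ)
    have hreal : star (star e * f) = star e * f := by
      rw [star_mul, star_star, hcross, mul_comm]
    obtain ⟨r, hr⟩ := RCLike.conj_eq_iff_real.1 hreal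
    have hne : ‖e‖ ^ 2 ≠ 0 := pow_ne_zero 2 (norm_ne_zero_iff.2 he0)
    refine ⟨r / ‖e‖ ^ 2, ?_⟩
    have h3 : e * (star e * f) = ((‖e‖ ^ 2 : ℝ) : 𝕜) * f := by
      rw [← mul_assoc, mul_star_eq_norm_sq]
    have hne' : ((‖e‖ ^ 2 : ℝ) : 𝕜) ≠ 0 := RCLike.ofReal_ne_zero.2 hne
    rw [hr] at h3
    rw [RCLike.ofReal_div, div_mul_eq_mul_div, eq_div_iff hne']
    linear_combination -h3
  by_cases he : star Q - P = 0
  · refine ⟨_, by simp, ?_, h2, fun h => key _ h2 h⟩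
    rw [← sub_eq_zero.1 he]
    by_cases hI : (RCLike.I : 𝕜) = 0
    · exact Or.inr hI
    · left
      refine mul_ne_zero hI ?_
      rw [← two_mul]
      exact mul_ne_zero two_ne_zero (star_ne_zero.2 hQ)
  · exact ⟨_, by simp, Or.inl he, h1, fun h => key _ h1 h⟩

/-- A point of the affine real line `conj a * P + a * Q + R = 0` at which the quadratic function is
non-positive yields a zero of the latter on the line through `-R / (2 Q)` along one of four
directions. If `P` and `Q` vanish, then `-R / (2 Q)` stands for `0`. -/
lemma exists_zero_on_line {P Q R : 𝕜} {β : ℝ} (hβ : 0 < β) (w : 𝕜) (γ : ℝ)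
    (hI : (RCLike.I : 𝕜) = 0 → Q = 0) (hPQ : ‖P‖ = ‖Q‖) {a : 𝕜}
    (ha : star a * P + a * Q + R = 0) (hle : shiftedSq β w γ a ≤ 0) :
    ∃ e ∈ [star Q - P, RCLike.I * (star Q + P), 1, w], e ≠ 0 ∧ ∃ τ : ℝ,
      star (-R / (2 * Q) + τ * e) * P + (-R / (2 * Q) + τ * e) * Q + R = 0 ∧
      shiftedSq β w γ (-R / (2 * Q) + τ * e) = 0 := by
  by_cases hQ : Q = 0
  · have hP : P = 0 := by rw [← norm_eq_zero, hPQ, hQ, norm_zero]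
    have hR : R = 0 := by simpa [hP, hQ] using ha
    subst hQ hP hR
    simp only [neg_zero, zero_div, mul_zero, add_zero, true_and]
    have hmin := (shiftedSq_min_le hβ w γ a).trans hle
    by_cases hw : w = 0
    · subst hw
      refine ⟨1, by simp, one_ne_zero, ?_⟩
      exact exists_shiftedSq_eq_zero hβ 0 γ one_ne_zero 0 (by simpa using hmin)
    · exact ⟨w, by simp, hw, exists_shiftedSq_eq_zero hβ w γ hw _ hmin⟩
  · have hn : P * star P = Q * star Q := by
      rw [mul_star_eq_norm_sq, mul_star_eq_norm_sq, hPQ]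
    have hQs : star Q ≠ 0 := star_ne_zero.2 hQ
    have hcons : star R * P = R * star Q := by
      have hst : a * star P + star a * star Q + star R = 0 := by
        simpa using congrArg star ha
      linear_combination P * hst - star Q * ha - a * hn
    have h0 : star (-R / (2 * Q)) * P + (-R / (2 * Q)) * Q + R = 0 := by
      simp only [star_div₀, star_neg, star_mul, star_ofNat]
      field_simp
      linear_combination -hcons
    have hf : star (a - (-R / (2 * Q))) * P + (a - (-R / (2 * Q))) * Q = 0 := by
      rw [star_sub]
      linear_combination ha - h0
    obtain ⟨e, he, hne, hez, heq⟩ := exists_direction hPQ hQ hf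
    have hne' : e ≠ 0 := hne.resolve_right fun h => hQ (hI h)
    obtain ⟨τ₀, hτ₀⟩ := heq hne'
    have hle' : shiftedSq β w γ (-R / (2 * Q) + τ₀ * e) ≤ 0 := by
      rw [← hτ₀, add_sub_cancel]; exact hle
    obtain ⟨τ, hτ⟩ := exists_shiftedSq_eq_zero hβ w γ hne' τ₀ hle'
    refine ⟨e, ?_, hne', τ, ?_, hτ⟩
    · simp only [List.mem_cons, List.not_mem_nil, or_false] at he ⊢
      tauto
    · have : star (τ : 𝕜) = τ := RCLike.conj_ofReal τ
      rw [star_add, star_mul, this]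
      linear_combination h0 + (τ : 𝕜) * hez

/-- `a = (R conj Q - conj R P) / (‖P‖² - ‖Q‖²)` solves `conj a * P + a * Q + R = 0`. -/
lemma star_mul_add_mul_eq {P Q R : 𝕜} (h : ‖P‖ ^ 2 - ‖Q‖ ^ 2 ≠ 0) :
    star ((R * star Q - star R * P) / ((‖P‖ ^ 2 - ‖Q‖ ^ 2 : ℝ) : 𝕜)) * P +
      (R * star Q - star R * P) / ((‖P‖ ^ 2 - ‖Q‖ ^ 2 : ℝ) : 𝕜) * Q + R = 0 := by
  have hs : star ((‖P‖ ^ 2 - ‖Q‖ ^ 2 : ℝ) : 𝕜) = ((‖P‖ ^ 2 - ‖Q‖ ^ 2 : ℝ) : 𝕜) :=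
    RCLike.conj_ofReal _
  have h' : ((‖P‖ ^ 2 - ‖Q‖ ^ 2 : ℝ) : 𝕜) ≠ 0 := RCLike.ofReal_ne_zero.2 h
  have hd : ((‖P‖ ^ 2 - ‖Q‖ ^ 2 : ℝ) : 𝕜) = P * star P - Q * star Q := by
    rw [RCLike.ofReal_sub, mul_star_eq_norm_sq, mul_star_eq_norm_sq]
  rw [star_div₀, hs]
  field_simp
  rw [hd]
  simp only [star_sub, star_mul, star_star]
  ring

set_option maxHeartbeats 1000000 in
/-- Along the curve of solutions `a(ρ)` of `conj a * P(ρ) + a * Q(ρ) + R(ρ) = 0`, where `P`, `Q`,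
`R` are affine in `ρ`, either the form vanishes somewhere, or it stays negative up to the largest
`ρ` with `‖P‖ = ‖Q‖`; then `a(ρ)` stays bounded and has a limit point, at which the form is
non-positive. -/
lemma exists_zero_or_limit (M12 M21 M31 σ M33 B12 B13 : 𝕜) {B11 B22 : ℝ} (B23 B33 : ℝ)
    (hlt : ‖M21‖ < ‖M12‖) (h11 : 0 < B11) (h22 : B22 < 0) :
    (∃ ρ : ℝ, ‖ρ * M12‖ ^ 2 - ‖ρ * M21 + M31‖ ^ 2 ≠ 0 ∧
      shiftedSq B11 (ρ * B12 + B13) (ρ ^ 2 * B22 + 2 * ρ * B23 + B33)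
        (((ρ * σ + M33) * star (ρ * M21 + M31) - star (ρ * σ + M33) * (ρ * M12)) /
          ((‖ρ * M12‖ ^ 2 - ‖ρ * M21 + M31‖ ^ 2 : ℝ) : 𝕜)) = 0) ∨
    ∃ ρ : ℝ, ‖ρ * M12‖ ^ 2 - ‖ρ * M21 + M31‖ ^ 2 = 0 ∧ ∃ a : 𝕜,
      star a * (ρ * M12) + a * (ρ * M21 + M31) + (ρ * σ + M33) = 0 ∧
      shiftedSq B11 (ρ * B12 + B13) (ρ ^ 2 * B22 + 2 * ρ * B23 + B33) a ≤ 0 := by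
  set Δ : ℝ → ℝ := fun ρ => ‖(ρ : 𝕜) * M12‖ ^ 2 - ‖(ρ : 𝕜) * M21 + M31‖ ^ 2 with hΔ
  set a : ℝ → 𝕜 := fun ρ => ((ρ * σ + M33) * star (ρ * M21 + M31) -
    star (ρ * σ + M33) * (ρ * M12)) / ((Δ ρ : ℝ) : 𝕜) with ha
  set q : 𝕜 → ℝ → ℝ := fun a ρ =>
    shiftedSq B11 (ρ * B12 + B13) (ρ ^ 2 * B22 + 2 * ρ * B23 + B33) a with hq
  change (∃ ρ, Δ ρ ≠ 0 ∧ q (a ρ) ρ = 0) ∨ ∃ ρ, Δ ρ = 0 ∧ ∃ a : 𝕜, _ ∧ q a ρ ≤ 0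
  by_contra hcon
  push Not at hcon
  obtain ⟨hA, hB⟩ := hcon
  set d2 : ℝ := ‖M12‖ ^ 2 - ‖M21‖ ^ 2 with hd2
  have hd2pos : 0 < d2 := by
    have := norm_nonneg M21
    nlinarith
  set d1 : ℝ := -2 * RCLike.re (M21 * star M31) with hd1
  set d0 : ℝ := -‖M31‖ ^ 2 with hd0
  have hΔeq : ∀ ρ, Δ ρ = d2 * ρ ^ 2 + d1 * ρ + d0 := by
    intro ρ
    simp only [hΔ, hd2, hd1, hd0, ← RCLike.normSq_eq_def', RCLike.normSq_apply, RCLike.star_def,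
      RCLike.mul_re, RCLike.mul_im, RCLike.conj_re, RCLike.conj_im, map_add, RCLike.ofReal_re,
      RCLike.ofReal_im]
    ring
  have hd0' : d0 ≤ 0 := by simp only [hd0]; nlinarith [sq_nonneg ‖M31‖]
  have hdisc : 0 ≤ d1 ^ 2 - 4 * d2 * d0 := by nlinarith [sq_nonneg d1]
  set ρ₀ : ℝ := (-d1 + √(d1 ^ 2 - 4 * d2 * d0)) / (2 * d2) with hρ₀
  have hρ₀' : 2 * d2 * ρ₀ = -d1 + √(d1 ^ 2 - 4 * d2 * d0) := by rw [hρ₀]; field_simp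
  have hsq := Real.sq_sqrt hdisc
  have hsn := Real.sqrt_nonneg (d1 ^ 2 - 4 * d2 * d0)
  have hΔ0 : Δ ρ₀ = 0 := by
    rw [hΔeq]
    have : 4 * d2 * (d2 * ρ₀ ^ 2 + d1 * ρ₀ + d0) = 0 := by nlinarith
    exact (mul_eq_zero.1 this).resolve_left (by positivity)
  have hΔpos : ∀ ρ, ρ₀ < ρ → 0 < Δ ρ := by
    intro ρ hρ
    have h1 : Δ ρ = (ρ - ρ₀) * (d2 * (ρ - ρ₀) + √(d1 ^ 2 - 4 * d2 * d0)) := by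
      have := hΔ0
      rw [hΔeq] at this ⊢
      linear_combination this + (ρ - ρ₀) * hρ₀'
    rw [h1]
    have : 0 < ρ - ρ₀ := sub_pos.2 hρ
    positivity
  -- beyond the largest zero `ρ₀` of `Δ` the curve is defined, and the form is continuous along it
  have hcont : ContinuousOn (fun ρ => q (a ρ) ρ) (Set.Ioi ρ₀) := by
    have haC : ContinuousOn a (Set.Ioi ρ₀) := by
      refine ContinuousOn.div (by fun_prop) (by fun_prop) fun ρ hρ => ?_
      exact RCLike.ofReal_ne_zero.2 (hΔpos ρ hρ).ne'
    simp only [hq, shiftedSq]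
    have : Continuous fun x : 𝕜 => star x := continuous_star
    fun_prop
  -- far away the form is negative; in terms of `u = 1 / ρ` this is continuity at `u = 0`
  have hneg : ∃ ρ, ρ₀ < ρ ∧ q (a ρ) ρ < 0 := by
    set b : ℝ → 𝕜 := fun u => u * ((σ + u * M33) * star (M21 + u * M31) -
      star (σ + u * M33) * M12) / ((‖M12‖ ^ 2 - ‖M21 + u * M31‖ ^ 2 : ℝ) : 𝕜) with hb
    set h : ℝ → ℝ := fun u => shiftedSq B11 (B12 + u * B13) (B22 + 2 * u * B23 + u ^ 2 * B33) (b u)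
      with hh
    have hbc : ContinuousAt b 0 := by
      refine ContinuousAt.div (by fun_prop) (by fun_prop) ?_
      rw [RCLike.ofReal_zero, zero_mul, add_zero]
      exact RCLike.ofReal_ne_zero.2 hd2pos.ne'
    have hhc : ContinuousAt h 0 := by
      simp only [hh, shiftedSq]
      fun_prop
    have hh0 : h 0 = B22 := by simp [hh, hb, shiftedSq]
    have hev : ∀ᶠ u in nhds (0 : ℝ), h u < 0 :=
      hhc.eventually_lt_const (by rw [hh0]; exact h22)
    have hev2 : ∀ᶠ u in nhds (0 : ℝ), u * ρ₀ < 1 := by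
      have : ContinuousAt (fun u : ℝ => u * ρ₀) 0 := by fun_prop
      exact this.eventually_lt_const (by simp)
    have hev3 : ∀ᶠ u in nhdsWithin (0 : ℝ) (Set.Ioi 0), h u < 0 ∧ u * ρ₀ < 1 ∧ 0 < u :=
      ((hev.and hev2).filter_mono nhdsWithin_le_nhds).and self_mem_nhdsWithin |>.mono
        fun u hu => ⟨hu.1.1, hu.1.2, hu.2⟩
    obtain ⟨u, hu1, hu2, hu3⟩ := hev3.exists
    have hu' : (u : 𝕜) ≠ 0 := RCLike.ofReal_ne_zero.2 hu3.ne'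
    have hlt' : ρ₀ < u⁻¹ := by
      rw [← one_div, lt_div_iff₀ hu3]; linarith
    refine ⟨u⁻¹, hlt', ?_⟩
    have hau : a u⁻¹ = ((u⁻¹ : ℝ) : 𝕜) * b u := by
      have hΔu : Δ u⁻¹ = (u⁻¹) ^ 2 * (‖M12‖ ^ 2 - ‖M21 + u * M31‖ ^ 2) := by
        have e : ((u⁻¹ : ℝ) : 𝕜) * M21 + M31 = ((u⁻¹ : ℝ) : 𝕜) * (M21 + u * M31) := by
          push_cast; field_simp
        simp only [hΔ]
        rw [e, norm_mul, norm_mul, RCLike.norm_ofReal, mul_pow, mul_pow, sq_abs]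
        ring
      have hne : ‖M12‖ ^ 2 - ‖M21 + u * M31‖ ^ 2 ≠ 0 := by
        intro h0
        have := hΔpos _ hlt'
        rw [hΔu, h0, mul_zero] at this
        exact this.false
      have hne' := (RCLike.ofReal_ne_zero (K := 𝕜)).2 hne
      have hsu : star (u : 𝕜) = u := RCLike.conj_ofReal u
      simp only [ha, hb]
      rw [hΔu]
      simp only [star_add, star_mul, RCLike.ofReal_mul, RCLike.ofReal_pow, RCLike.ofReal_inv,
        star_inv₀, hsu]
      field_simp
    have hqu : q (a u⁻¹) u⁻¹ = (u⁻¹) ^ 2 * h u := by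
      rw [hau]
      simp only [hq, hh, shiftedSq]
      simp only [← RCLike.normSq_eq_def', RCLike.normSq_apply, RCLike.star_def,
        RCLike.mul_re, RCLike.mul_im, RCLike.conj_re, RCLike.conj_im, map_add, RCLike.ofReal_re,
        RCLike.ofReal_im]
      field_simp
      ring
    rw [hqu]
    exact mul_neg_of_pos_of_neg (by positivity) hu1
  have hall : ∀ ρ, ρ₀ < ρ → q (a ρ) ρ < 0 := by
    intro ρ hρ
    by_contra hge
    push Not at hge
    obtain ⟨ρ', hρ', hn⟩ := hneg
    obtain ⟨x, hx, hx0⟩ := (isPreconnected_Ioi (a := ρ₀)).intermediate_value (Set.mem_Ioi.2 hρ')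
      (Set.mem_Ioi.2 hρ) hcont (show (0 : ℝ) ∈ Set.Icc _ _ from ⟨hn.le, hge⟩)
    exact hA x (hΔpos x hx).ne' hx0
  -- negativity of the form keeps `a ρ` bounded as `ρ` decreases to `ρ₀`
  set K1 : ℝ := (|ρ₀| + 1) * ‖B12‖ + ‖B13‖ with hK1
  set K2 : ℝ := (|ρ₀| + 1) ^ 2 * |B22| + 2 * (|ρ₀| + 1) * |B23| + |B33| with hK2
  set C : ℝ := (2 * K1 + K2) / B11 + 1 with hC
  have hK2n : 0 ≤ K2 := by positivity
  have hbound : ∀ ρ, ρ₀ < ρ → ρ ≤ ρ₀ + 1 → ‖a ρ‖ ≤ C := by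
    intro ρ h1 h2
    have hρabs : |ρ| ≤ |ρ₀| + 1 := by
      rw [abs_le]; constructor <;> [linarith [neg_abs_le ρ₀]; linarith [le_abs_self ρ₀]]
    refine norm_le_of_shiftedSq_neg h11 hK2n ?_ ?_ (hall ρ h1)
    · refine (norm_add_le _ _).trans ?_
      rw [norm_mul, RCLike.norm_ofReal]
      exact add_le_add (mul_le_mul_of_nonneg_right hρabs (norm_nonneg _)) le_rfl
    · have h3 : |ρ ^ 2 * B22 + 2 * ρ * B23 + B33| ≤ K2 := by
        refine (abs_add_le _ _).trans
          (add_le_add ((abs_add_le _ _).trans (add_le_add ?_ ?_)) le_rfl)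
        · rw [abs_mul, abs_pow]
          gcongr
        · rw [abs_mul, abs_mul, abs_of_pos (two_pos (α := ℝ))]
          gcongr
      linarith [neg_abs_le (ρ ^ 2 * B22 + 2 * ρ * B23 + B33)]
  set s : ℕ → ℝ := fun n => ρ₀ + 1 / ((n : ℝ) + 1) with hs
  have hs1 : ∀ n, ρ₀ < s n := fun n => by
    simp only [hs]; have : (0 : ℝ) < 1 / ((n : ℝ) + 1) := by positivity
    linarith
  have hs2 : ∀ n, s n ≤ ρ₀ + 1 := fun n => by
    simp only [hs]
    have : 1 / ((n : ℝ) + 1) ≤ 1 := by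
      rw [div_le_one (by positivity)]; linarith [(Nat.cast_nonneg n : (0 : ℝ) ≤ n)]
    linarith
  have hslim : Filter.Tendsto s Filter.atTop (nhds ρ₀) := by
    have := (tendsto_one_div_add_atTop_nhds_zero_nat (𝕜 := ℝ)).const_add ρ₀
    rwa [add_zero] at this
  obtain ⟨a', -, φ, hφ, hlim⟩ := tendsto_subseq_of_bounded
    (Metric.isBounded_closedBall (x := (0 : 𝕜)) (r := C)) (x := fun n => a (s n))
    fun n => by simpa using hbound _ (hs1 n) (hs2 n)
  have hslim' := hslim.comp hφ.tendsto_atTop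
  have hpair : Filter.Tendsto (fun n => (a (s (φ n)), s (φ n))) Filter.atTop (nhds (a', ρ₀)) :=
    hlim.prodMk_nhds hslim'
  have hE : star a' * (ρ₀ * M12) + a' * (ρ₀ * M21 + M31) + (ρ₀ * σ + M33) = 0 := by
    have hc : Continuous fun x : 𝕜 × ℝ =>
      star x.1 * (x.2 * M12) + x.1 * (x.2 * M21 + M31) + (x.2 * σ + M33) := by fun_prop
    have h1 := (hc.tendsto (a', ρ₀)).comp hpair
    refine tendsto_nhds_unique h1 ?_
    refine Filter.Tendsto.congr (f₁ := fun _ => (0 : 𝕜)) (fun n => ?_) tendsto_const_nhds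
    exact (star_mul_add_mul_eq (hΔpos _ (hs1 _)).ne').symm
  have hQ : q a' ρ₀ ≤ 0 := by
    have hc : Continuous fun x : 𝕜 × ℝ => q x.1 x.2 := by
      simp only [hq, shiftedSq]; fun_prop
    have h1 := (hc.tendsto (a', ρ₀)).comp hpair
    exact le_of_tendsto h1 (Filter.Eventually.of_forall fun n => (hall _ (hs1 _)).le)
  exact absurd hQ (not_le.2 (hB ρ₀ hΔ0 a' hE))

end Scalars

/-! ### Hermitian forms and rank-one terms -/

section Forms

variable {𝕜 : Type} [RCLike 𝕜] {n : ℕ}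

section
variable (A B : Matrix (Fin n) (Fin n) 𝕜) (x y z : Fin n → 𝕜) (c : 𝕜)

lemma sesq_add_right : sesq A x (y + z) = sesq A x y + sesq A x z := by
  simp [sesq, Matrix.mulVec_add]

lemma sesq_add_left : sesq A (x + y) z = sesq A x z + sesq A y z := by
  simp [sesq, add_dotProduct]

lemma sesq_smul_right : sesq A x (c • y) = c * sesq A x y := by
  simp [sesq, Matrix.mulVec_smul]

lemma sesq_smul_left : sesq A (c • x) y = star c * sesq A x y := by
  simp [sesq, star_smul, smul_dotProduct]

lemma sesq_sub_right : sesq A x (y - z) = sesq A x y - sesq A x z := by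
  simp [sesq, Matrix.mulVec_sub]

lemma sesq_sub_left : sesq A (x - y) z = sesq A x z - sesq A y z := by
  simp [sesq, sub_dotProduct]

lemma sesq_matrix_add : sesq (A + B) x y = sesq A x y + sesq B x y := by
  simp [sesq, Matrix.add_mulVec]

lemma sesq_matrix_sub : sesq (A - B) x y = sesq A x y - sesq B x y := by
  simp [sesq, Matrix.sub_mulVec]

lemma sesq_matrix_smul : sesq (c • A) x y = c * sesq A x y := by
  simp [sesq, Matrix.smul_mulVec]

lemma sesq_zero_matrix : sesq (0 : Matrix (Fin n) (Fin n) 𝕜) x y = 0 := by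
  simp [sesq]

lemma sesq_matrix_sum {ι : Type*} (s : Finset ι) (F : ι → Matrix (Fin n) (Fin n) 𝕜) :
    sesq (∑ i ∈ s, F i) x y = ∑ i ∈ s, sesq (F i) x y := by
  classical
  induction s using Finset.induction_on with
  | empty => simp [sesq]
  | insert i s hi ih => rw [Finset.sum_insert hi, Finset.sum_insert hi, sesq_matrix_add, ih]

variable {A}

lemma star_sesq (hA : A.IsHermitian) : star (sesq A x y) = sesq A y x := by
  rw [sesq, sesq, Matrix.star_dotProduct, star_star, Matrix.star_mulVec, hA.eq,
    ← Matrix.dotProduct_mulVec]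

lemma sesq_self (hA : A.IsHermitian) : sesq A x x = (quadForm A x : 𝕜) := by
  have h : (starRingEnd 𝕜) (sesq A x x) = sesq A x x := star_sesq x x hA
  exact (RCLike.conj_eq_iff_re.1 h).symm

end

lemma posSemidef_iff_quadForm {A : Matrix (Fin n) (Fin n) 𝕜} (hA : A.IsHermitian) :
    A.PosSemidef ↔ ∀ x, 0 ≤ quadForm A x := by
  rw [Matrix.posSemidef_iff_dotProduct_mulVec, and_iff_right hA]
  refine forall_congr' fun x => ?_
  change 0 ≤ sesq A x x ↔ _
  rw [sesq_self x hA, ← RCLike.ofReal_zero, RCLike.ofReal_le_ofReal]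

lemma Matrix.PosSemidef.quadForm_nonneg {A : Matrix (Fin n) (Fin n) 𝕜} (hA : A.PosSemidef)
    (x : Fin n → 𝕜) : 0 ≤ quadForm A x :=
  (posSemidef_iff_quadForm hA.isHermitian).1 hA x

lemma Matrix.PosDef.quadForm_pos {A : Matrix (Fin n) (Fin n) 𝕜} (hA : A.PosDef)
    {x : Fin n → 𝕜} (hx : x ≠ 0) : 0 < quadForm A x := by
  have h := hA.dotProduct_mulVec_pos hx
  change 0 < sesq A x x at h
  rwa [sesq_self x hA.isHermitian, ← RCLike.ofReal_zero, RCLike.ofReal_lt_ofReal] at h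

lemma Matrix.PosSemidef.mulVec_eq_zero {A : Matrix (Fin n) (Fin n) 𝕜} (hA : A.PosSemidef)
    {x : Fin n → 𝕜} (hx : quadForm A x = 0) : A *ᵥ x = 0 := by
  refine (hA.dotProduct_mulVec_zero_iff x).1 ?_
  change sesq A x x = 0
  rw [sesq_self x hA.isHermitian, hx, RCLike.ofReal_zero]

lemma matInner_outerSelf (A : Matrix (Fin n) (Fin n) 𝕜) (x : Fin n → 𝕜) :
    matInner A (outerSelf x) = quadForm A x := by
  rw [matInner, quadForm, sesq, outerSelf, Matrix.conjTranspose_vecMulVec, star_star,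
    Matrix.vecMulVec_mul, Matrix.trace_vecMulVec, dotProduct_comm, ← Matrix.dotProduct_mulVec]

lemma matInner_add_left (A B X : Matrix (Fin n) (Fin n) 𝕜) :
    matInner (A + B) X = matInner A X + matInner B X := by
  simp [matInner, Matrix.mul_add]

lemma matInner_sub_left (A B X : Matrix (Fin n) (Fin n) 𝕜) :
    matInner (A - B) X = matInner A X - matInner B X := by
  simp [matInner, Matrix.mul_sub]

lemma matInner_smul_left (r : ℝ) (A X : Matrix (Fin n) (Fin n) 𝕜) :
    matInner ((r : 𝕜) • A) X = r * matInner A X := by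
  simp [matInner, RCLike.smul_re]

lemma matInner_add_right (A X Y : Matrix (Fin n) (Fin n) 𝕜) :
    matInner A (X + Y) = matInner A X + matInner A Y := by
  simp [matInner, Matrix.add_mul]

lemma matInner_zero_right (A : Matrix (Fin n) (Fin n) 𝕜) : matInner A 0 = 0 := by
  simp [matInner]

lemma matInner_sum_right {ι : Type*} (s : Finset ι) (A : Matrix (Fin n) (Fin n) 𝕜)
    (F : ι → Matrix (Fin n) (Fin n) 𝕜) :
    matInner A (∑ i ∈ s, F i) = ∑ i ∈ s, matInner A (F i) := by
  classical
  induction s using Finset.induction_on with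
  | empty => simp [matInner_zero_right]
  | insert i s hi ih => rw [Finset.sum_insert hi, Finset.sum_insert hi, matInner_add_right, ih]

lemma matInner_sum_left {ι : Type*} (s : Finset ι) (X : Matrix (Fin n) (Fin n) 𝕜)
    (F : ι → Matrix (Fin n) (Fin n) 𝕜) :
    matInner (∑ i ∈ s, F i) X = ∑ i ∈ s, matInner (F i) X := by
  classical
  induction s using Finset.induction_on with
  | empty => simp [matInner]
  | insert i s hi ih => rw [Finset.sum_insert hi, Finset.sum_insert hi, matInner_add_left, ih]

lemma outerSelf_mulVec (x w : Fin n → 𝕜) : outerSelf x *ᵥ w = (star x ⬝ᵥ w) • x := by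
  ext i
  simp [outerSelf, Matrix.mulVec, dotProduct, Matrix.vecMulVec_apply, Finset.mul_sum, mul_comm,
    mul_left_comm]

lemma outerSelf_isHermitian (x : Fin n → 𝕜) : (outerSelf x).IsHermitian := by
  rw [Matrix.IsHermitian, outerSelf, Matrix.conjTranspose_vecMulVec, star_star]

lemma outerSelf_posSemidef (x : Fin n → 𝕜) : (outerSelf x).PosSemidef :=
  Matrix.posSemidef_vecMulVec_self_star x

lemma outerSelf_zero : outerSelf (0 : Fin n → 𝕜) = 0 := by
  ext; simp [outerSelf, Matrix.vecMulVec_apply]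

lemma sesq_outerSelf (g x y : Fin n → 𝕜) :
    sesq (outerSelf g) x y = (star x ⬝ᵥ g) * (star g ⬝ᵥ y) := by
  rw [sesq, outerSelf_mulVec, dotProduct_smul, smul_eq_mul, mul_comm]

/-! ### Deflation of positive semidefinite matrices -/

/-- The vector `S z / √(zᴴ S z)`, which is zero if the denominator is. -/
noncomputable def deflVec (S : Matrix (Fin n) (Fin n) 𝕜) (z : Fin n → 𝕜) : Fin n → 𝕜 :=
  fun i => (S *ᵥ z) i / ((√(quadForm S z) : ℝ) : 𝕜)

lemma star_deflVec_dotProduct {S : Matrix (Fin n) (Fin n) 𝕜} (hS : S.IsHermitian)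
    (z w : Fin n → 𝕜) :
    star (deflVec S z) ⬝ᵥ w = sesq S z w / ((√(quadForm S z) : ℝ) : 𝕜) := by
  have h : deflVec S z = (((√(quadForm S z))⁻¹ : ℝ) : 𝕜) • (S *ᵥ z) := by
    ext i; simp [deflVec, div_eq_inv_mul]
  rw [h, star_smul, smul_dotProduct, Matrix.star_mulVec, hS.eq, ← Matrix.dotProduct_mulVec,
    ← sesq, smul_eq_mul, div_eq_inv_mul]
  congr 1
  rw [RCLike.star_def, RCLike.conj_ofReal, RCLike.ofReal_inv]

/-- Subtracting the rank-one term of `deflVec S z` keeps `S` positive semidefinite, adds `z` to the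
null space and keeps the vectors that are there already. -/
lemma deflate_spec {S : Matrix (Fin n) (Fin n) 𝕜} (hS : S.PosSemidef) (z : Fin n → 𝕜) :
    (S - outerSelf (deflVec S z)).PosSemidef ∧ (S - outerSelf (deflVec S z)) *ᵥ z = 0 ∧
      (∀ w, S *ᵥ w = 0 → (S - outerSelf (deflVec S z)) *ᵥ w = 0) ∧
      ∀ v, S *ᵥ v = v → star z ⬝ᵥ v = 0 → (S - outerSelf (deflVec S z)) *ᵥ v = v := by
  have hH := hS.isHermitian
  have hsub : ∀ w, (S - outerSelf (deflVec S z)) *ᵥ w =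
      S *ᵥ w - (sesq S z w / ((√(quadForm S z) : ℝ) : 𝕜)) • deflVec S z := by
    intro w
    rw [Matrix.sub_mulVec, outerSelf_mulVec, star_deflVec_dotProduct hH]
  have hzero : ∀ w, sesq S z w = 0 → (S - outerSelf (deflVec S z)) *ᵥ w = S *ᵥ w := by
    intro w hw
    rw [hsub, hw, zero_div, zero_smul, sub_zero]
  refine ⟨?_, ?_, fun w hw => ?_, fun v hv hzv => ?_⟩
  · rw [posSemidef_iff_quadForm (hH.sub (outerSelf_isHermitian _))]
    intro x
    rcases (hS.quadForm_nonneg z).eq_or_lt with h0 | hpos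
    · have : outerSelf (deflVec S z) = 0 := by
        have : deflVec S z = 0 := by ext i; simp [deflVec, ← h0]
        rw [this, outerSelf_zero]
      rw [this, sub_zero]
      exact hS.quadForm_nonneg x
    · -- the value at `x` is the value of `S` at the projection of `x` along `z`
      set d := quadForm S z with hd
      have hd' : (d : 𝕜) ≠ 0 := RCLike.ofReal_ne_zero.2 hpos.ne'
      set l : 𝕜 := sesq S z x / (d : 𝕜) with hl
      have hs : ((√d : ℝ) : 𝕜) * ((√d : ℝ) : 𝕜) = (d : 𝕜) := by
        rw [← RCLike.ofReal_mul, Real.mul_self_sqrt hpos.le]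
      have hs0 : ((√d : ℝ) : 𝕜) ≠ 0 := RCLike.ofReal_ne_zero.2 (Real.sqrt_pos.2 hpos).ne'
      have key : sesq (S - outerSelf (deflVec S z)) x x = sesq S (x - l • z) (x - l • z) := by
        have e1 : star x ⬝ᵥ deflVec S z = star (sesq S z x / ((√d : ℝ) : 𝕜)) := by
          rw [hd, ← star_deflVec_dotProduct hH, Matrix.star_dotProduct]
        have e2 : star ((√d : ℝ) : 𝕜) = ((√d : ℝ) : 𝕜) := RCLike.conj_ofReal _
        have e3 : star (d : 𝕜) = d := RCLike.conj_ofReal _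
        rw [sesq_matrix_sub, sesq_outerSelf, star_deflVec_dotProduct hH, ← hd, e1]
        simp only [sesq_sub_left, sesq_sub_right, sesq_smul_left, sesq_smul_right]
        rw [sesq_self z hH, ← hd, ← star_sesq z x hH, hl, star_div₀, star_div₀, e2, e3]
        field_simp
        rw [sq, hs]
        field_simp
        ring
      have := congrArg RCLike.re key
      change quadForm _ x = quadForm _ _ at this
      rw [this]
      exact hS.quadForm_nonneg _
  · rcases (hS.quadForm_nonneg z).eq_or_lt with h0 | hpos
    · have hSz := hS.mulVec_eq_zero h0.symm
      rw [hzero z (by rw [sesq, hSz, dotProduct_zero]), hSz]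
    · rw [hsub, sesq_self z hH]
      ext i
      have hs : ((√(quadForm S z) : ℝ) : 𝕜) * ((√(quadForm S z) : ℝ) : 𝕜) =
          ((quadForm S z : ℝ) : 𝕜) := by
        rw [← RCLike.ofReal_mul, Real.mul_self_sqrt hpos.le]
      have hs0 : ((√(quadForm S z) : ℝ) : 𝕜) ≠ 0 :=
        RCLike.ofReal_ne_zero.2 (Real.sqrt_pos.2 hpos).ne'
      simp only [Pi.sub_apply, Pi.smul_apply, smul_eq_mul, deflVec, Pi.zero_apply]
      rw [← hs]
      field_simp
      ring
  · rw [hzero w (by rw [sesq, hw, dotProduct_zero]), hw]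
  · rw [hzero v (by rw [sesq, hv, hzv]), hv]

/-! ### Rotation of a pair of rank-one terms -/

section Rotation

variable (x y : Fin n → 𝕜) (e : 𝕜) (τ : ℝ)

/-- The normalizing factor of a rotation. -/
noncomputable def rotNorm (e : 𝕜) (τ : ℝ) : ℝ := √(1 + τ ^ 2 * ‖e‖ ^ 2)

/-- The first vector of a rotated pair. -/
noncomputable def rotFst : Fin n → 𝕜 := fun i => (x i + τ * e * y i) / (rotNorm e τ : 𝕜)

/-- The second vector of a rotated pair. -/
noncomputable def rotSnd : Fin n → 𝕜 := fun i => (y i - τ * star e * x i) / (rotNorm e τ : 𝕜)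

lemma rotNorm_pos : 0 < rotNorm e τ := Real.sqrt_pos.2 (by positivity)

lemma rotFst_eq : rotFst x y e τ = (((rotNorm e τ)⁻¹ : ℝ) : 𝕜) • (x + (τ * e : 𝕜) • y) := by
  ext i; simp [rotFst, div_eq_inv_mul]

lemma rotSnd_eq :
    rotSnd x y e τ = (((rotNorm e τ)⁻¹ : ℝ) : 𝕜) • (y - (τ * star e : 𝕜) • x) := by
  ext i; simp [rotSnd, div_eq_inv_mul]

lemma outerSelf_rot :
    outerSelf (rotFst x y e τ) + outerSelf (rotSnd x y e τ) = outerSelf x + outerSelf y := by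
  have hs : ((rotNorm e τ : ℝ) : 𝕜) * (rotNorm e τ : 𝕜) = 1 + (τ : 𝕜) ^ 2 * (e * star e) := by
    rw [← RCLike.ofReal_mul, rotNorm, Real.mul_self_sqrt (by positivity), mul_star_eq_norm_sq]
    push_cast; ring
  have hs0 : ((rotNorm e τ : ℝ) : 𝕜) ≠ 0 := RCLike.ofReal_ne_zero.2 (rotNorm_pos e τ).ne'
  have e2 : star ((rotNorm e τ : ℝ) : 𝕜) = (rotNorm e τ : 𝕜) := RCLike.conj_ofReal _
  have e3 : star (τ : 𝕜) = τ := RCLike.conj_ofReal _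
  ext i j
  simp only [outerSelf, Matrix.add_apply, Matrix.vecMulVec_apply, Pi.star_apply, rotFst, rotSnd,
    star_div₀, star_add, star_sub, star_mul, star_star, e2, e3]
  field_simp
  rw [sq, hs]
  ring

lemma quadForm_real_smul (A : Matrix (Fin n) (Fin n) 𝕜) (r : ℝ) (x : Fin n → 𝕜) :
    quadForm A ((r : 𝕜) • x) = r ^ 2 * quadForm A x := by
  rw [quadForm, sesq_smul_left, sesq_smul_right, RCLike.star_def, RCLike.conj_ofReal,
    ← mul_assoc, ← RCLike.ofReal_mul, RCLike.re_ofReal_mul, quadForm, sq]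

lemma quadForm_add_smul {A : Matrix (Fin n) (Fin n) 𝕜} (hA : A.IsHermitian) (x y : Fin n → 𝕜)
    (c : 𝕜) : quadForm A (x + c • y) =
      quadForm A x + 2 * RCLike.re (c * sesq A x y) + ‖c‖ ^ 2 * quadForm A y := by
  have h : RCLike.re (star c * sesq A y x) = RCLike.re (c * sesq A x y) := by
    rw [← star_sesq x y hA, ← star_mul, mul_comm, RCLike.star_def, RCLike.conj_re]
  rw [quadForm, sesq_add_left, sesq_add_right, sesq_add_right, sesq_smul_left, sesq_smul_left,
    sesq_smul_right, sesq_smul_right, ← mul_assoc, star_mul_eq_norm_sq, map_add, map_add, map_add,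
    h, RCLike.re_ofReal_mul, quadForm, quadForm]
  ring

variable {A : Matrix (Fin n) (Fin n) 𝕜}

lemma quadForm_rotFst (hA : A.IsHermitian) : quadForm A (rotFst x y e τ) =
    ((rotNorm e τ)⁻¹) ^ 2 *
      (quadForm A x + 2 * RCLike.re (e * sesq A x y) * τ + ‖e‖ ^ 2 * quadForm A y * τ ^ 2) := by
  rw [rotFst_eq, quadForm_real_smul, quadForm_add_smul hA, mul_assoc, RCLike.re_ofReal_mul,
    norm_mul, RCLike.norm_ofReal, mul_pow, sq_abs]
  ring

lemma quadForm_rotSnd (hA : A.IsHermitian) : quadForm A (rotSnd x y e τ) =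
    ((rotNorm e τ)⁻¹) ^ 2 *
      (quadForm A y - 2 * RCLike.re (e * sesq A x y) * τ + ‖e‖ ^ 2 * quadForm A x * τ ^ 2) := by
  have h : RCLike.re (star e * sesq A y x) = RCLike.re (e * sesq A x y) := by
    rw [← star_sesq x y hA, ← star_mul, mul_comm, RCLike.star_def, RCLike.conj_re]
  rw [rotSnd_eq, quadForm_real_smul, sub_eq_add_neg, ← neg_smul, quadForm_add_smul hA, neg_mul,
    mul_assoc, map_neg, RCLike.re_ofReal_mul, h, norm_neg, norm_mul, RCLike.norm_ofReal, norm_star,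
    mul_pow, sq_abs]
  ring

end Rotation

end Forms

/-! ### Strong duality and complementarity -/

section Duality

variable {𝕜 : Type} [RCLike 𝕜] {n m : ℕ}

lemma continuous_quadForm : Continuous fun p : Matrix (Fin n) (Fin n) 𝕜 × (Fin n → 𝕜) =>
    quadForm p.1 p.2 := by
  unfold quadForm sesq
  exact RCLike.continuous_re.comp (Continuous.dotProduct (continuous_star.comp continuous_snd)
    (Continuous.matrix_mulVec continuous_fst continuous_snd))

lemma exists_sphere_of_ne_zero {x : Fin n → 𝕜} (hx : x ≠ 0) :
    ((‖x‖⁻¹ : ℝ) : 𝕜) • x ∈ Metric.sphere (0 : Fin n → 𝕜) 1 := by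
  rw [mem_sphere_zero_iff_norm, norm_smul, RCLike.norm_ofReal, abs_of_nonneg (by positivity),
    inv_mul_cancel₀ (norm_ne_zero_iff.2 hx)]

/-- A not necessarily Hermitian matrix has positive quadratic form off zero. -/
def IsAccretive (Y : Matrix (Fin n) (Fin n) 𝕜) : Prop := ∀ x, x ≠ 0 → 0 < quadForm Y x

lemma isOpen_isAccretive : IsOpen {Y : Matrix (Fin n) (Fin n) 𝕜 | IsAccretive Y} := by
  have h : {Y : Matrix (Fin n) (Fin n) 𝕜 | IsAccretive Y} =
      {Y | ∀ x ∈ Metric.sphere (0 : Fin n → 𝕜) 1, 0 < quadForm Y x} := by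
    ext Y
    refine ⟨fun h x hx => h x ?_, fun h x hx => ?_⟩
    · rintro rfl
      simp at hx
    · have h1 := h _ (exists_sphere_of_ne_zero hx)
      rw [quadForm_real_smul] at h1
      exact (pos_iff_pos_of_mul_pos h1).1 (pow_pos (inv_pos.2 (norm_pos_iff.2 hx)) 2)
  rw [h, isOpen_iff_eventually]
  intro Y hY
  refine (isCompact_sphere (0 : Fin n → 𝕜) 1).eventually_forall_of_forall_eventually
    (P := fun Y x => 0 < quadForm Y x) fun x hx => ?_
  exact continuous_quadForm.continuousAt.eventually_const_lt (hY x hx)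

/-- `Y ↦ A • Y` as a real linear functional. -/
noncomputable def matInnerLin (A : Matrix (Fin n) (Fin n) 𝕜) :
    Matrix (Fin n) (Fin n) 𝕜 →ₗ[ℝ] ℝ where
  toFun := matInner A
  map_add' := matInner_add_right A
  map_smul' r Y := by simp [matInner, RCLike.smul_re]

lemma matInner_real_smul_right (A Y : Matrix (Fin n) (Fin n) 𝕜) (r : ℝ) :
    matInner A (r • Y) = r * matInner A Y := (matInnerLin A).map_smul r Y

lemma matInner_conjTranspose_right {A : Matrix (Fin n) (Fin n) 𝕜} (hA : A.IsHermitian)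
    (Y : Matrix (Fin n) (Fin n) 𝕜) : matInner A Yᴴ = matInner A Y := by
  have h : (Yᴴᴴ * A).trace = star (Yᴴ * A).trace := by
    rw [← Matrix.trace_conjTranspose, Matrix.conjTranspose_mul, hA.eq, Matrix.trace_mul_comm]
  rw [matInner, h, RCLike.star_def, RCLike.conj_re, matInner]

lemma quadForm_conjTranspose (Y : Matrix (Fin n) (Fin n) 𝕜) (x : Fin n → 𝕜) :
    quadForm Yᴴ x = quadForm Y x := by
  have h : sesq Yᴴ x x = star (sesq Y x x) := by
    rw [sesq, sesq, Matrix.star_dotProduct, Matrix.star_mulVec, Matrix.conjTranspose_conjTranspose,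
      ← Matrix.dotProduct_mulVec]
  rw [quadForm, h, RCLike.star_def, RCLike.conj_re, quadForm]

lemma quadForm_add_matrix (A B : Matrix (Fin n) (Fin n) 𝕜) (x : Fin n → 𝕜) :
    quadForm (A + B) x = quadForm A x + quadForm B x := by
  rw [quadForm, sesq_matrix_add, map_add, quadForm, quadForm]

lemma quadForm_sub_matrix (A B : Matrix (Fin n) (Fin n) 𝕜) (x : Fin n → 𝕜) :
    quadForm (A - B) x = quadForm A x - quadForm B x := by
  rw [quadForm, sesq_matrix_sub, map_sub, quadForm, quadForm]

lemma quadForm_ofReal_smul_matrix (A : Matrix (Fin n) (Fin n) 𝕜) (r : ℝ) (x : Fin n → 𝕜) :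
    quadForm ((r : 𝕜) • A) x = r * quadForm A x := by
  rw [quadForm, sesq_matrix_smul, RCLike.re_ofReal_mul, quadForm]

lemma quadForm_real_smul_matrix (A : Matrix (Fin n) (Fin n) 𝕜) (r : ℝ) (x : Fin n → 𝕜) :
    quadForm (r • A) x = r * quadForm A x := by
  have : r • A = (r : 𝕜) • A := by ext; simp [RCLike.real_smul_eq_coe_mul]
  rw [this, quadForm_ofReal_smul_matrix]

lemma quadForm_sum_matrix {ι : Type*} (s : Finset ι) (F : ι → Matrix (Fin n) (Fin n) 𝕜)
    (x : Fin n → 𝕜) : quadForm (∑ i ∈ s, F i) x = ∑ i ∈ s, quadForm (F i) x := by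
  rw [quadForm, sesq_matrix_sum, map_sum]; rfl

lemma quadForm_zero (A : Matrix (Fin n) (Fin n) 𝕜) : quadForm A 0 = 0 := by
  simp [quadForm, sesq]

open scoped MatrixOrder Matrix.Norms.L2Operator in
/-- A positive semidefinite matrix is a sum of rank-one terms. -/
lemma Matrix.PosSemidef.exists_sum_outerSelf {X : Matrix (Fin n) (Fin n) 𝕜} (hX : X.PosSemidef) :
    ∃ g : Fin n → Fin n → 𝕜, X = ∑ l, outerSelf (g l) := by
  obtain ⟨B, rfl⟩ : ∃ B : Matrix (Fin n) (Fin n) 𝕜, X = Bᴴ * B :=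
    CStarAlgebra.nonneg_iff_eq_star_mul_self.1 (Matrix.nonneg_iff_posSemidef.2 hX)
  refine ⟨fun l => star (B l), ?_⟩
  ext i j
  simp [Matrix.mul_apply, Matrix.sum_apply, outerSelf, Matrix.vecMulVec_apply]

lemma matInner_nonneg {Z X : Matrix (Fin n) (Fin n) 𝕜} (hZ : Z.PosSemidef) (hX : X.PosSemidef) :
    0 ≤ matInner Z X := by
  obtain ⟨g, rfl⟩ := hX.exists_sum_outerSelf
  rw [matInner_sum_right]
  exact Finset.sum_nonneg fun l _ => by
    rw [matInner_outerSelf]; exact hZ.quadForm_nonneg _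

namespace HQP

variable (P : HQP 𝕜 n m)

lemma Rel.le {P : HQP 𝕜 n m} {i : Fin m} {t : ℝ} (h : P.Rel i t) : t ≤ P.c i := by
  unfold Rel at h
  split_ifs at h
  exacts [h.le, h]

lemma Rel.eq {P : HQP 𝕜 n m} {i : Fin m} {t : ℝ} (h : P.Rel i t) (hi : P.isEq i = true) :
    t = P.c i := by
  unfold Rel at h
  rwa [if_pos hi] at h

lemma slack_isHermitian (μ : Fin m → ℝ) : (P.slack μ).IsHermitian := by
  unfold slack
  refine P.hermitian₀.add ?_
  rw [Matrix.IsHermitian, Matrix.conjTranspose_sum]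
  refine Finset.sum_congr rfl fun i _ => ?_
  rw [Matrix.conjTranspose_smul, (P.hermitian i).eq, RCLike.star_def, RCLike.conj_ofReal]

lemma quadForm_slack (μ : Fin m → ℝ) (x : Fin n → 𝕜) :
    quadForm (P.slack μ) x = quadForm P.A₀ x + ∑ i, μ i * quadForm (P.A i) x := by
  rw [slack, quadForm_add_matrix, quadForm_sum_matrix]
  simp only [quadForm_ofReal_smul_matrix]

lemma matInner_slack (μ : Fin m → ℝ) (X : Matrix (Fin n) (Fin n) 𝕜) :
    matInner (P.slack μ) X = matInner P.A₀ X + ∑ i, μ i * matInner (P.A i) X := by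
  rw [slack, matInner_add_left, matInner_sum_left]
  simp only [matInner_smul_left]

variable {P}

set_option maxHeartbeats 1000000 in
/-- Under the primal Slater condition, the dual attains the value of an optimal solution of the
relaxation. The proof separates the cone of accretive matrices, together with positive slacks, from
the affine space of all points with optimal objective and exact constraints. -/
theorem exists_dualObj_eq (hS : P.PrimalSlater) {X : Matrix (Fin n) (Fin n) 𝕜}
    (hX : P.IsSdpOpt X) :
    ∃ Z μ, P.IsDualFeasible Z μ ∧ P.dualObj μ = matInner P.A₀ X := by
  classical
  set v := matInner P.A₀ X with hv
  let E := Matrix (Fin n) (Fin n) 𝕜 × ℝ × (Fin m → ℝ)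
  let L : E →ₗ[ℝ] ℝ × (Fin m → ℝ) :=
    { toFun := fun e => (matInner P.A₀ e.1 + e.2.1,
        fun j => matInner (P.A j) e.1 + if P.isEq j = true then 0 else e.2.2 j)
      map_add' := by
        rintro ⟨Y, r, t⟩ ⟨Y', r', t'⟩
        refine Prod.ext ?_ (funext fun j => ?_)
        · change matInner P.A₀ (Y + Y') + (r + r') =
            matInner P.A₀ Y + r + (matInner P.A₀ Y' + r')
          rw [matInner_add_right]; ring
        · change (matInner (P.A j) (Y + Y') + if P.isEq j = true then 0 else t j + t' j) =
            (matInner (P.A j) Y + if P.isEq j = true then 0 else t j) +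
              (matInner (P.A j) Y' + if P.isEq j = true then 0 else t' j)
          rw [matInner_add_right]
          split_ifs <;> ring
      map_smul' := by
        rintro c ⟨Y, r, t⟩
        refine Prod.ext ?_ (funext fun j => ?_)
        · change matInner P.A₀ (c • Y) + c * r = c * (matInner P.A₀ Y + r)
          rw [matInner_real_smul_right]; ring
        · change (matInner (P.A j) (c • Y) + if P.isEq j = true then 0 else c * t j) =
            c * (matInner (P.A j) Y + if P.isEq j = true then 0 else t j)
          rw [matInner_real_smul_right]
          split_ifs <;> ring }
  let U : Set E := {e | IsAccretive e.1 ∧ 0 < e.2.1 ∧ ∀ j, 0 < e.2.2 j}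
  let F : Set E := {e | L e = (v, P.c)}
  have hUconv : Convex ℝ U := by
    rintro e ⟨h1, h2, h3⟩ e' ⟨h1', h2', h3'⟩ a b ha hb hab
    have hpos : ∀ {s t : ℝ}, 0 < s → 0 < t → 0 < a * s + b * t := by
      intro s t hs ht
      rcases ha.eq_or_lt with rfl | ha
      · have : b = 1 := by linarith
        subst this; simpa using ht
      · positivity
    refine ⟨fun x hx => ?_, hpos h2 h2', fun j => hpos (h3 j) (h3' j)⟩
    change 0 < quadForm (a • e.1 + b • e'.1) x
    rw [quadForm_add_matrix, quadForm_real_smul_matrix, quadForm_real_smul_matrix]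
    exact hpos (h1 x hx) (h1' x hx)
  have hUopen : IsOpen U := by
    have h1 : IsOpen {e : E | IsAccretive e.1} := isOpen_isAccretive.preimage continuous_fst
    have h2 : IsOpen {e : E | 0 < e.2.1} := isOpen_lt continuous_const (by fun_prop)
    have h3 : IsOpen {e : E | ∀ j, 0 < e.2.2 j} := by
      have : {e : E | ∀ j, 0 < e.2.2 j} = ⋂ j, {e : E | 0 < e.2.2 j} := by ext; simp
      rw [this]
      exact isOpen_iInter_of_finite fun j => isOpen_lt continuous_const (by fun_prop)
    exact h1.inter (h2.inter h3)
  have hFconv : Convex ℝ F := by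
    intro e he e' he' a b ha hb hab
    change L _ = _
    rw [map_add, map_smul, map_smul, he, he', ← add_smul, hab, one_smul]
  -- a common point would yield, by its Hermitian part, a better point of the relaxation
  have hdisj : Disjoint U F := by
    rw [Set.disjoint_left]
    rintro e ⟨h1, h2, h3⟩ he
    have he1 : matInner P.A₀ e.1 + e.2.1 = v := congrArg Prod.fst he
    have he2 : ∀ j, (matInner (P.A j) e.1 + if P.isEq j = true then 0 else e.2.2 j) = P.c j :=
      fun j => congrFun (congrArg Prod.snd he) j
    set H : Matrix (Fin n) (Fin n) 𝕜 := (1 / 2 : ℝ) • (e.1 + e.1ᴴ) with hH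
    have hin : ∀ {A : Matrix (Fin n) (Fin n) 𝕜}, A.IsHermitian → matInner A H = matInner A e.1 := by
      intro A hA
      rw [hH, matInner_real_smul_right, matInner_add_right, matInner_conjTranspose_right hA]
      ring
    have hHh : H.IsHermitian := by
      rw [hH, Matrix.IsHermitian, Matrix.conjTranspose_smul, star_trivial,
        Matrix.conjTranspose_add, Matrix.conjTranspose_conjTranspose, add_comm]
    have hHp : H.PosSemidef := by
      rw [posSemidef_iff_quadForm hHh]
      intro x
      rw [hH, quadForm_real_smul_matrix, quadForm_add_matrix, quadForm_conjTranspose]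
      by_cases hx : x = 0
      · rw [hx, quadForm_zero]; norm_num
      · have := h1 x hx
        linarith
    have hfeas : H ∈ P.sdpFeasibleSet := by
      refine ⟨hHp, fun j => ?_⟩
      have h4 := he2 j
      unfold Rel
      rw [hin (P.hermitian j)]
      split_ifs at h4 ⊢
      · linarith
      · linarith [h3 j]
    have := hX.2 H hfeas
    rw [hin P.hermitian₀] at this
    linarith
  obtain ⟨f, u, hfU, hfF⟩ := geometric_hahn_banach_open hUconv hUopen hFconv hdisj
  let e₀ : E := (X, 0, fun j => P.c j - matInner (P.A j) X)
  have he₀ : L e₀ = (v, P.c) := by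
    refine Prod.ext ?_ (funext fun j => ?_)
    · change matInner P.A₀ X + 0 = v
      rw [add_zero]
    · change (matInner (P.A j) X + if P.isEq j = true then 0 else P.c j - matInner (P.A j) X) = _
      split_ifs with hj
      · rw [add_zero]; exact (hX.1.2 j).eq hj
      · ring
  -- `f` is bounded below on the fibre `F` of `L`, so it factors through `L`
  have hker : ∀ k ∈ LinearMap.ker L, f k = 0 := by
    intro k hk
    by_contra hne
    have h1 := hfF (e₀ + ((u - f e₀ - 1) / f k) • k) (by
      change L _ = _
      rw [map_add, map_smul, LinearMap.mem_ker.1 hk, smul_zero, add_zero, he₀])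
    rw [map_add, map_smul, smul_eq_mul, div_mul_cancel₀ _ hne] at h1
    linarith
  obtain ⟨g, hg⟩ : ∃ g : Module.Dual ℝ (ℝ × (Fin m → ℝ)), ∀ e, f e = g (L e) := by
    have h1 : (f : E →ₗ[ℝ] ℝ) ∈ (LinearMap.ker L).dualAnnihilator :=
      (Submodule.mem_dualAnnihilator _).2 hker
    rw [← LinearMap.range_dualMap_eq_dualAnnihilator_ker] at h1
    obtain ⟨g, hg⟩ := h1
    exact ⟨g, fun e => (LinearMap.congr_fun hg e).symm⟩
  set y₀ : ℝ := -g (1, 0) with hy₀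
  set y : Fin m → ℝ := fun j => -g (0, Pi.single j 1) with hy
  have hgy : ∀ (a : ℝ) (b : Fin m → ℝ), g (a, b) = -(y₀ * a + ∑ j, y j * b j) := by
    intro a b
    have h1 : (a, b) = a • ((1 : ℝ), (0 : Fin m → ℝ)) +
        ∑ j, b j • ((0 : ℝ), (Pi.single j (1 : ℝ) : Fin m → ℝ)) := by
      refine Prod.ext ?_ (funext fun k => ?_)
      · simp [Prod.fst_sum]
      · simp [Prod.snd_sum, Finset.sum_apply, Pi.single_apply]
    rw [h1, map_add, map_smul, map_sum]
    simp only [map_smul, smul_eq_mul, hy₀, hy]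
    rw [neg_add, ← Finset.sum_neg_distrib]
    congr 1
    · ring
    · exact Finset.sum_congr rfl fun j _ => by ring
  obtain ⟨Y, hYpd, hYc⟩ := hS
  let e₁ : E := (Y, 1, fun j => if P.isEq j = true then 1 else P.c j - matInner (P.A j) Y)
  have he₁ : e₁ ∈ U := by
    refine ⟨fun x hx => hYpd.quadForm_pos hx, one_pos, fun j => ?_⟩
    have := hYc j
    change 0 < if P.isEq j = true then (1 : ℝ) else P.c j - matInner (P.A j) Y
    split_ifs at this ⊢
    · exact one_pos
    · linarith
  -- points of the closed cone move into `U` when `e₁` is added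
  have hmem : ∀ e : E, (∀ x, 0 ≤ quadForm e.1 x) → 0 ≤ e.2.1 → (∀ j, 0 ≤ e.2.2 j) →
      ∀ s t : ℝ, 0 ≤ s → 0 < t → s • e + t • e₁ ∈ U := by
    intro e h1 h2 h3 s t hs ht
    refine ⟨fun x hx => ?_, ?_, fun j => ?_⟩
    · change 0 < quadForm (s • e.1 + t • e₁.1) x
      rw [quadForm_add_matrix, quadForm_real_smul_matrix, quadForm_real_smul_matrix]
      have := mul_nonneg hs (h1 x)
      have := mul_pos ht (he₁.1 x hx)
      linarith
    · change 0 < s * e.2.1 + t * e₁.2.1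
      have := mul_nonneg hs h2
      have := mul_pos ht he₁.2.1
      linarith
    · change 0 < s * e.2.2 j + t * e₁.2.2 j
      have := mul_nonneg hs (h3 j)
      have := mul_pos ht (he₁.2.2 j)
      linarith
  have hu0 : 0 ≤ u := by
    by_contra hneg
    push Not at hneg
    have h1 : ∀ t : ℝ, 0 < t → t * f e₁ < u := by
      intro t ht
      have := hfU _ (hmem 0 (by simp [quadForm, sesq]) le_rfl (fun _ => le_rfl) 0 t le_rfl ht)
      simpa using this
    have h2 := h1 1 one_pos
    have h3 : f e₁ < 0 := by linarith
    have h4 := h1 (u / (2 * f e₁)) (div_pos_of_neg_of_neg hneg (by linarith))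
    have h5 : u / (2 * f e₁) * f e₁ = u / 2 := by
      have := h3.ne
      field_simp
    linarith
  have hle : ∀ e : E, (∀ x, 0 ≤ quadForm e.1 x) → 0 ≤ e.2.1 → (∀ j, 0 ≤ e.2.2 j) → f e ≤ 0 := by
    intro e h1 h2 h3
    by_contra hpos
    push Not at hpos
    have h4 : 0 ≤ (u + |f e₁|) / f e := by positivity
    have h5 := hfU _ (hmem e h1 h2 h3 _ 1 h4 one_pos)
    rw [map_add, map_smul, map_smul, smul_eq_mul, smul_eq_mul, div_mul_cancel₀ _ hpos.ne'] at h5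
    linarith [neg_abs_le (f e₁)]
  have hfe₀ : f e₀ = 0 := by
    refine le_antisymm (hle e₀ (fun x => hX.1.1.quadForm_nonneg x) le_rfl fun j => ?_)
      (hu0.trans (hfF e₀ he₀))
    exact sub_nonneg.2 (hX.1.2 j).le
  have hu : u = 0 := le_antisymm (hfe₀ ▸ hfF e₀ he₀) hu0
  have hfe₁ : f e₁ < 0 := hu ▸ hfU e₁ he₁
  have hvc : y₀ * v + ∑ j, y j * P.c j = 0 := by
    have := hfe₀
    rw [hg, he₀, hgy] at this
    linarith
  have hy₀n : 0 ≤ y₀ := by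
    have := hle (0, 1, 0) (by simp [quadForm, sesq]) zero_le_one (fun _ => le_rfl)
    rw [hg] at this
    have h2 : L (0, 1, 0) = (1, 0) := by
      refine Prod.ext ?_ (funext fun j => ?_)
      · change matInner P.A₀ 0 + 1 = 1
        rw [matInner_zero_right, zero_add]
      · change (matInner (P.A j) 0 + if P.isEq j = true then 0 else (0 : ℝ)) = 0
        rw [matInner_zero_right, ite_self, zero_add]
    rw [h2] at this
    linarith
  have hyn : ∀ i, P.isEq i = false → 0 ≤ y i := by
    intro i hi
    have := hle (0, 0, Pi.single i 1) (by simp [quadForm, sesq]) le_rfl (fun j => by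
      change 0 ≤ (Pi.single i (1 : ℝ) : Fin m → ℝ) j
      rw [Pi.single_apply]; split_ifs <;> norm_num)
    rw [hg] at this
    have h2 : L (0, 0, Pi.single i 1) = (0, Pi.single i 1) := by
      refine Prod.ext ?_ (funext fun j => ?_)
      · change matInner P.A₀ 0 + 0 = 0
        rw [matInner_zero_right, zero_add]
      · change (matInner (P.A j) 0 + if P.isEq j = true then 0 else
          (Pi.single i (1 : ℝ) : Fin m → ℝ) j) = (Pi.single i (1 : ℝ) : Fin m → ℝ) j
        rw [matInner_zero_right, zero_add]
        split_ifs with hj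
        · rw [Pi.single_apply, if_neg]
          rintro rfl
          rw [hi] at hj
          exact Bool.false_ne_true hj
        · rfl
    rw [h2] at this
    linarith
  -- for `y₀ = 0` the Slater point `e₁` would satisfy `f e₁ = 0`
  have hy₀p : 0 < y₀ := by
    refine lt_of_le_of_ne hy₀n fun h0 => ?_
    have h1 := hfe₁
    have h2 : L e₁ = (matInner P.A₀ Y + 1, P.c) := by
      refine Prod.ext rfl (funext fun j => ?_)
      change (matInner (P.A j) Y + if P.isEq j = true then 0 else
        (if P.isEq j = true then 1 else P.c j - matInner (P.A j) Y)) = P.c j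
      have := hYc j
      split_ifs at this ⊢
      · linarith
      · ring
    rw [hg, h2, hgy, ← h0] at h1
    rw [← h0] at hvc
    linarith
  refine ⟨P.slack fun j => y j / y₀, fun j => y j / y₀, ⟨rfl, ?_, fun i hi =>
    div_nonneg (hyn i hi) hy₀n⟩, ?_⟩
  · rw [posSemidef_iff_quadForm (P.slack_isHermitian _)]
    intro x
    have h1 := hle (outerSelf x, 0, 0) (fun w => (outerSelf_posSemidef x).quadForm_nonneg w) le_rfl
      (fun _ => le_rfl)
    rw [hg] at h1
    have h2 : L (outerSelf x, 0, 0) = (quadForm P.A₀ x, fun j => quadForm (P.A j) x) := by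
      refine Prod.ext ?_ (funext fun j => ?_)
      · change matInner P.A₀ (outerSelf x) + 0 = _
        rw [matInner_outerSelf, add_zero]
      · change (matInner (P.A j) (outerSelf x) + if P.isEq j = true then 0 else (0 : ℝ)) = _
        rw [matInner_outerSelf, ite_self, add_zero]
    rw [h2, hgy] at h1
    have h3 : y₀ * quadForm (P.slack fun j => y j / y₀) x =
        y₀ * quadForm P.A₀ x + ∑ j, y j * quadForm (P.A j) x := by
      rw [quadForm_slack, mul_add, Finset.mul_sum]
      congr 1
      exact Finset.sum_congr rfl fun j _ => by field_simp
    have h4 : 0 ≤ y₀ * quadForm (P.slack fun j => y j / y₀) x := by rw [h3]; linarith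
    exact nonneg_of_mul_nonneg_right h4 hy₀p
  · have h1 : y₀ * P.dualObj (fun j => y j / y₀) = y₀ * v := by
      rw [dualObj, mul_neg, Finset.mul_sum]
      have : ∑ i, y₀ * (P.c i * (y i / y₀)) = ∑ j, y j * P.c j :=
        Finset.sum_congr rfl fun j _ => by field_simp
      rw [this]
      linarith
    exact mul_left_cancel₀ hy₀p.ne' h1

/-- Complementary slackness for optimal solutions of the relaxation and its dual. -/
theorem complementarity (hS : P.PrimalSlater) {X Z : Matrix (Fin n) (Fin n) 𝕜} {μ : Fin m → ℝ}
    (hX : P.IsSdpOpt X) (hZ : P.IsDualOpt Z μ) :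
    matInner Z X = 0 ∧ ∀ i, μ i * (matInner (P.A i) X - P.c i) = 0 := by
  obtain ⟨Z', μ', hfeas, hobj⟩ := exists_dualObj_eq hS hX
  have h1 := hZ.2 Z' μ' hfeas
  rw [hobj] at h1
  have h2 : 0 ≤ matInner Z X := matInner_nonneg hZ.1.2.1 hX.1.1
  have h3 : matInner Z X = matInner P.A₀ X + ∑ i, μ i * matInner (P.A i) X := by
    rw [hZ.1.1, matInner_slack]
  have h4 : ∀ i, μ i * (matInner (P.A i) X - P.c i) ≤ 0 := by
    intro i
    by_cases hi : P.isEq i = true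
    · rw [(hX.1.2 i).eq hi, sub_self, mul_zero]
    · exact mul_nonpos_of_nonneg_of_nonpos (hZ.1.2.2 i (by simpa using hi))
        (sub_nonpos.2 (hX.1.2 i).le)
  have h5 : ∑ i, μ i * (matInner (P.A i) X - P.c i) =
      ∑ i, μ i * matInner (P.A i) X - ∑ i, P.c i * μ i := by
    rw [← Finset.sum_sub_distrib]
    exact Finset.sum_congr rfl fun i _ => by ring
  have h6 : ∑ i, μ i * (matInner (P.A i) X - P.c i) ≤ 0 := Finset.sum_nonpos fun i _ => h4 i
  rw [dualObj] at h1
  refine ⟨by linarith, fun i => ?_⟩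
  have h7 : ∑ i, μ i * (matInner (P.A i) X - P.c i) = 0 := by linarith
  exact (Finset.sum_eq_zero_iff_of_nonpos fun i _ => h4 i).1 h7 i (Finset.mem_univ i)

/-- Under the dual Slater condition the quadratic program attains its value if it is feasible. -/
theorem exists_isGlobalOpt (hD : P.DualSlater) (hne : P.feasibleSet.Nonempty) :
    ∃ x, P.IsGlobalOpt x := by
  obtain ⟨μ, hpd, hμ⟩ := hD
  obtain ⟨x₀, hx₀⟩ := hne
  have hc : ∀ A : Matrix (Fin n) (Fin n) 𝕜, Continuous (quadForm A) := fun A =>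
    continuous_quadForm.comp (Continuous.prodMk_right A)
  have hclosed : IsClosed P.feasibleSet := by
    have : P.feasibleSet = ⋂ i, {x | P.Rel i (quadForm (P.A i) x)} := by
      ext; simp [feasibleSet]
    rw [this]
    refine isClosed_iInter fun i => ?_
    unfold Rel
    split_ifs
    · exact isClosed_eq (hc _) continuous_const
    · exact isClosed_le (hc _) continuous_const
  by_cases hsp : (Metric.sphere (0 : Fin n → 𝕜) 1).Nonempty
  · obtain ⟨w, hw, hmin⟩ := (isCompact_sphere (0 : Fin n → 𝕜) 1).exists_isMinOn hsp
      (hc (P.slack μ)).continuousOn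
    have hw0 : w ≠ 0 := by rintro rfl; simp at hw
    set ε := quadForm (P.slack μ) w with hε
    have hεp : 0 < ε := hpd.quadForm_pos hw0
    -- the positive definite slack matrix bounds the sublevel set of `x₀`
    have hge : ∀ x, ε * ‖x‖ ^ 2 ≤ quadForm (P.slack μ) x := by
      intro x
      by_cases hx : x = 0
      · rw [hx, quadForm_zero, norm_zero]; simp
      · have h1 : ε ≤ quadForm (P.slack μ) (((‖x‖⁻¹ : ℝ) : 𝕜) • x) :=
          hmin (exists_sphere_of_ne_zero hx)
        rw [quadForm_real_smul, inv_pow, ← div_eq_inv_mul,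
          le_div_iff₀ (pow_pos (norm_pos_iff.2 hx) 2)] at h1
        exact h1
    set K := quadForm P.A₀ x₀ + ∑ i, μ i * P.c i with hK
    have hcomp : IsCompact (P.feasibleSet ∩ {x | quadForm P.A₀ x ≤ quadForm P.A₀ x₀}) := by
      refine Metric.isCompact_of_isClosed_isBounded
        (hclosed.inter (isClosed_le (hc _) continuous_const)) ?_
      refine (Metric.isBounded_closedBall (x := (0 : Fin n → 𝕜)) (r := K / ε + 1)).subset ?_
      rintro x ⟨hx1, hx2⟩
      rw [mem_closedBall_zero_iff]
      have h1 : quadForm (P.slack μ) x ≤ K := by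
        rw [quadForm_slack]
        refine add_le_add hx2 (Finset.sum_le_sum fun i _ => ?_)
        by_cases hi : P.isEq i = true
        · rw [(hx1 i).eq hi]
        · exact mul_le_mul_of_nonneg_left (hx1 i).le (hμ i (by simpa using hi)).le
      have h2 := (hge x).trans h1
      have h3 : ‖x‖ ^ 2 ≤ K / ε := by rw [le_div_iff₀ hεp]; linarith
      nlinarith [sq_nonneg (‖x‖ - 1)]
    obtain ⟨x, hx, hxmin⟩ := hcomp.exists_isMinOn ⟨x₀, hx₀, le_refl (quadForm P.A₀ x₀)⟩
      (hc P.A₀).continuousOn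
    refine ⟨x, hx.1, fun y hy => ?_⟩
    by_cases hle : quadForm P.A₀ y ≤ quadForm P.A₀ x₀
    · exact hxmin ⟨hy, hle⟩
    · exact (show quadForm P.A₀ x ≤ quadForm P.A₀ x₀ from hx.2).trans (not_le.1 hle).le
  · have hsub : ∀ x : Fin n → 𝕜, x = 0 := by
      intro x
      by_contra hx
      exact hsp ⟨_, exists_sphere_of_ne_zero hx⟩
    exact ⟨x₀, hx₀, fun y _ => by rw [hsub x₀, hsub y]⟩

end HQP

end Duality

/-! ### Common zeros of three Hermitian forms -/

section CommonZeros

variable {𝕜 : Type} [RCLike 𝕜] {n : ℕ}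

/-- The coefficient of `conj a * b` in the value of `B₁ + i B₂` at `a x + b y`, if `x` comes first
in the chosen basis. The factor is `1` over the complex numbers. Over the reals, where
`RCLike.I = 0` and only `B₁` counts, it is `2`, since both cross terms are collected here. -/
noncomputable def upForm (B₁ B₂ : Matrix (Fin n) (Fin n) 𝕜) (x y : Fin n → 𝕜) : 𝕜 :=
  (2 + RCLike.I * RCLike.I) * (sesq B₁ x y + RCLike.I * sesq B₂ x y)

/-- The coefficient of `conj a * b` in the value of `B₁ + i B₂` at `a x + b y`, if `x` comes second
in the chosen basis. The factor is `1` over the complex numbers and `0` over the reals. -/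
noncomputable def lowForm (B₁ B₂ : Matrix (Fin n) (Fin n) 𝕜) (x y : Fin n → 𝕜) : 𝕜 :=
  -(RCLike.I * RCLike.I) * (sesq B₁ x y + RCLike.I * sesq B₂ x y)

/-- The values of `B₁` and `B₂` at `x`, combined into one number. -/
noncomputable def diagForm (B₁ B₂ : Matrix (Fin n) (Fin n) 𝕜) (x : Fin n → 𝕜) : 𝕜 :=
  sesq B₁ x x + RCLike.I * sesq B₂ x x

variable {B₁ B₂ B : Matrix (Fin n) (Fin n) 𝕜}

lemma lowForm_eq_zero (hI : (RCLike.I : 𝕜) = 0) (x y : Fin n → 𝕜) : lowForm B₁ B₂ x y = 0 := by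
  simp [lowForm, hI]

lemma diagForm_comb (h₁ : B₁.IsHermitian) (x₁ x₂ x₃ : Fin n → 𝕜)
    (a b c : 𝕜) : diagForm B₁ B₂ (a • x₁ + b • x₂ + c • x₃) =
      star a * a * diagForm B₁ B₂ x₁ + star b * b * diagForm B₁ B₂ x₂ +
      star c * c * diagForm B₁ B₂ x₃ + (star a * b * upForm B₁ B₂ x₁ x₂ +
      star b * a * lowForm B₁ B₂ x₂ x₁) + (star a * c * upForm B₁ B₂ x₁ x₃ +
      star c * a * lowForm B₁ B₂ x₃ x₁) + (star b * c * upForm B₁ B₂ x₂ x₃ +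
      star c * b * lowForm B₁ B₂ x₃ x₂) := by
  simp only [diagForm, upForm, lowForm, sesq_add_left, sesq_add_right, sesq_smul_left,
    sesq_smul_right]
  rcases RCLike.I_mul_I (K := 𝕜) with hI | hI
  · have hs := RCLike.star_eq_self_of_I_eq_zero hI
    have e : ∀ {A : Matrix (Fin n) (Fin n) 𝕜}, A.IsHermitian → ∀ x y, sesq A x y = sesq A y x :=
      fun hA x y => by rw [← star_sesq y x hA, hs]
    rw [hI, e h₁ x₂ x₁, e h₁ x₃ x₁, e h₁ x₃ x₂, hs a, hs b, hs c]
    ring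
  · rw [hI]
    ring

lemma diagForm_smul (c : 𝕜) (x : Fin n → 𝕜) :
    diagForm B₁ B₂ (c • x) = star c * c * diagForm B₁ B₂ x := by
  simp only [diagForm, sesq_smul_left, sesq_smul_right]
  ring

lemma quadForm_eq_zero_of_diagForm (h₁ : B₁.IsHermitian) (h₂ : B₂.IsHermitian)
    (hreal : (RCLike.I : 𝕜) = 0 → B₂ = 0) {x : Fin n → 𝕜} (h : diagForm B₁ B₂ x = 0) :
    quadForm B₁ x = 0 ∧ quadForm B₂ x = 0 := by
  rw [diagForm, sesq_self x h₁, sesq_self x h₂] at h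
  have hre := congrArg RCLike.re h
  rw [map_add, mul_comm, RCLike.re_ofReal_mul, RCLike.I_re, mul_zero, add_zero, RCLike.ofReal_re,
    map_zero] at hre
  refine ⟨hre, ?_⟩
  rcases RCLike.I_mul_I (K := 𝕜) with hI | hI
  · rw [hreal hI]
    simp [quadForm, sesq_zero_matrix]
  · have hI0 : (RCLike.I : 𝕜) ≠ 0 := by
      intro h0; rw [h0, mul_zero] at hI; exact neg_ne_zero.2 one_ne_zero hI.symm
    rw [hre, RCLike.ofReal_zero, zero_add] at h
    exact RCLike.ofReal_eq_zero.1 ((mul_eq_zero.1 h).resolve_left hI0)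

lemma diagForm_eq_zero (h₁ : B₁.IsHermitian) (h₂ : B₂.IsHermitian) {x : Fin n → 𝕜}
    (hx₁ : quadForm B₁ x = 0) (hx₂ : quadForm B₂ x = 0) : diagForm B₁ B₂ x = 0 := by
  rw [diagForm, sesq_self x h₁, sesq_self x h₂, hx₁, hx₂, RCLike.ofReal_zero, mul_zero, add_zero]

/-- Vectors on which a Hermitian form has opposite signs are linearly independent. -/
lemma pair_independent {x₁ x₂ : Fin n → 𝕜} (h : quadForm B x₁ * quadForm B x₂ < 0) :
    ∀ a b : 𝕜, a • x₁ + b • x₂ = 0 → a = 0 ∧ b = 0 := by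
  have hsm : ∀ (c : 𝕜) (x : Fin n → 𝕜), quadForm B (c • x) = ‖c‖ ^ 2 * quadForm B x := by
    intro c x
    rw [quadForm, sesq_smul_left, sesq_smul_right, ← mul_assoc, star_mul_eq_norm_sq,
      RCLike.re_ofReal_mul, quadForm]
  have h1 : quadForm B x₁ ≠ 0 := by rintro h0; rw [h0, zero_mul] at h; exact h.false
  have h2 : quadForm B x₂ ≠ 0 := by rintro h0; rw [h0, mul_zero] at h; exact h.false
  intro a b hab
  have h3 : a • x₁ = (-b) • x₂ := by rw [neg_smul]; exact eq_neg_of_add_eq_zero_left hab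
  have h4 : ‖a‖ ^ 2 * quadForm B x₁ = ‖b‖ ^ 2 * quadForm B x₂ := by
    rw [← hsm, h3, hsm, norm_neg]
  have h5 : ‖a‖ ^ 2 * (quadForm B x₁) ^ 2 = ‖b‖ ^ 2 * (quadForm B x₁ * quadForm B x₂) := by
    linear_combination quadForm B x₁ * h4
  have h6 : 0 ≤ ‖a‖ ^ 2 * (quadForm B x₁) ^ 2 := by positivity
  have h7 : ‖b‖ ^ 2 * (quadForm B x₁ * quadForm B x₂) ≤ 0 :=
    mul_nonpos_of_nonneg_of_nonpos (by positivity) h.le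
  have hb : b = 0 := by
    have h8 : ‖b‖ ^ 2 * (quadForm B x₁ * quadForm B x₂) = 0 := by linarith
    simpa using (mul_eq_zero.1 h8).resolve_right h.ne
  refine ⟨?_, hb⟩
  rw [hb, norm_zero, zero_pow two_ne_zero, zero_mul] at h4
  simpa using (mul_eq_zero.1 h4).resolve_right h1

/-- On the span of two zeros `x₁`, `x₂` of `B₁` and `B₂` whose cross terms differ in absolute value,
only the multiples of `x₁` and of `x₂` are zeros. -/
lemma mul_eq_zero_of_diagForm (h₁ : B₁.IsHermitian) {x₁ x₂ : Fin n → 𝕜}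
    (hx₁ : diagForm B₁ B₂ x₁ = 0) (hx₂ : diagForm B₁ B₂ x₂ = 0)
    (hne : ‖upForm B₁ B₂ x₁ x₂‖ ≠ ‖lowForm B₁ B₂ x₂ x₁‖) {a b : 𝕜}
    (h : diagForm B₁ B₂ (a • x₁ + b • x₂) = 0) : a = 0 ∨ b = 0 := by
  have h3 := diagForm_comb (B₂ := B₂) h₁ x₁ x₂ 0 a b 0
  rw [smul_zero, add_zero, h, hx₁, hx₂] at h3
  simp only [star_zero, mul_zero, zero_mul, add_zero, zero_add] at h3
  by_contra hcon
  push Not at hcon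
  obtain ⟨ha, hb⟩ := hcon
  have h4 := congrArg norm (eq_neg_of_add_eq_zero_left h3.symm)
  rw [norm_neg, norm_mul, norm_mul, norm_mul, norm_mul, norm_star, norm_star,
    mul_comm ‖b‖ ‖a‖] at h4
  exact hne (mul_left_cancel₀ (mul_ne_zero (norm_ne_zero_iff.2 ha) (norm_ne_zero_iff.2 hb)) h4)

lemma quadForm_comb (hB : B.IsHermitian) (x₁ x₂ x₃ : Fin n → 𝕜) (a : 𝕜) (ρ : ℝ) :
    quadForm B (a • x₁ + (ρ : 𝕜) • x₂ + x₃) = shiftedSq (quadForm B x₁)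
      (ρ * sesq B x₁ x₂ + sesq B x₁ x₃)
      (ρ ^ 2 * quadForm B x₂ + 2 * ρ * RCLike.re (sesq B x₂ x₃) + quadForm B x₃) a := by
  have h1 : a • x₁ + (ρ : 𝕜) • x₂ + x₃ = (x₃ + (ρ : 𝕜) • x₂) + a • x₁ := by abel
  have h2 : RCLike.re (a * sesq B (x₃ + (ρ : 𝕜) • x₂) x₁) =
      RCLike.re (star a * (ρ * sesq B x₁ x₂ + sesq B x₁ x₃)) := by
    rw [sesq_add_left, sesq_smul_left, ← star_sesq x₁ x₂ hB, ← star_sesq x₁ x₃ hB, ← star_mul,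
      ← star_add, ← RCLike.conj_re, ← RCLike.star_def, star_mul, star_star]
    ring_nf
  have h3 : RCLike.re (sesq B x₃ x₂) = RCLike.re (sesq B x₂ x₃) := by
    rw [← star_sesq x₂ x₃ hB, RCLike.star_def, RCLike.conj_re]
  rw [h1, quadForm_add_smul hB, h2, quadForm_add_smul hB, RCLike.re_ofReal_mul, h3,
    RCLike.norm_ofReal, sq_abs, shiftedSq]
  ring

lemma quadForm_smul (c : 𝕜) (x : Fin n → 𝕜) : quadForm B (c • x) = ‖c‖ ^ 2 * quadForm B x := by
  rw [quadForm, sesq_smul_left, sesq_smul_right, ← mul_assoc, star_mul_eq_norm_sq,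
    RCLike.re_ofReal_mul, quadForm]

lemma quadForm_neg_matrix (A : Matrix (Fin n) (Fin n) 𝕜) (x : Fin n → 𝕜) :
    quadForm (-A) x = -quadForm A x := by
  have := quadForm_sub_matrix 0 A x
  rwa [zero_sub, show quadForm (0 : Matrix (Fin n) (Fin n) 𝕜) x = 0 by
    simp [quadForm, sesq_zero_matrix], zero_sub] at this

section Three

variable (B₁ B₂ : Matrix (Fin n) (Fin n) 𝕜) (x₁ x₂ x₃ : Fin n → 𝕜) (ρ : ℝ)

/-- The coefficient `P` of `conj a` in the condition `conj a * P + a * Q + R = 0` for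
`a x₁ + ρ x₂ + x₃` to be a common zero of `B₁` and `B₂`; `P`, `Q` and `R` are affine in `ρ`. -/
noncomputable def coefP : 𝕜 := ρ * upForm B₁ B₂ x₁ x₂

/-- The coefficient `Q` of `a`, see `coefP`. -/
noncomputable def coefQ : 𝕜 := ρ * lowForm B₁ B₂ x₂ x₁ + lowForm B₁ B₂ x₃ x₁

/-- The constant term `R`, see `coefP`. -/
noncomputable def coefR : 𝕜 :=
  ρ * (upForm B₁ B₂ x₂ x₃ + lowForm B₁ B₂ x₃ x₂) + diagForm B₁ B₂ x₃

/-- The determinant `‖P‖² - ‖Q‖²` of the real linear map `a ↦ conj a * P + a * Q`. -/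
noncomputable def coefDet : 𝕜 :=
  coefP B₁ B₂ x₁ x₂ ρ * star (coefP B₁ B₂ x₁ x₂ ρ) -
    coefQ B₁ B₂ x₁ x₂ x₃ ρ * star (coefQ B₁ B₂ x₁ x₂ x₃ ρ)

/-- The solution `a`, multiplied by the determinant. -/
noncomputable def coefNum : 𝕜 :=
  coefR B₁ B₂ x₂ x₃ ρ * star (coefQ B₁ B₂ x₁ x₂ x₃ ρ) -
    star (coefR B₁ B₂ x₂ x₃ ρ) * coefP B₁ B₂ x₁ x₂ ρ

/-- The directions in which a common zero is sought when the determinant vanishes. -/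
noncomputable def lineDirs (B : Matrix (Fin n) (Fin n) 𝕜) : List 𝕜 :=
  [star (coefQ B₁ B₂ x₁ x₂ x₃ ρ) - coefP B₁ B₂ x₁ x₂ ρ,
    RCLike.I * (star (coefQ B₁ B₂ x₁ x₂ x₃ ρ) + coefP B₁ B₂ x₁ x₂ ρ), 1,
    ρ * sesq B x₁ x₂ + sesq B x₁ x₃]

/-- The base point of the line of zeros when the determinant vanishes. -/
noncomputable def lineBase : 𝕜 := -coefR B₁ B₂ x₂ x₃ ρ / (2 * coefQ B₁ B₂ x₁ x₂ x₃ ρ)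

lemma coefDet_eq : coefDet B₁ B₂ x₁ x₂ x₃ ρ =
    ((‖coefP B₁ B₂ x₁ x₂ ρ‖ ^ 2 - ‖coefQ B₁ B₂ x₁ x₂ x₃ ρ‖ ^ 2 : ℝ) : 𝕜) := by
  rw [coefDet, mul_star_eq_norm_sq, mul_star_eq_norm_sq, RCLike.ofReal_sub]

variable {B₁ B₂ x₁ x₂ x₃}

lemma diagForm_of_coef (h₁ : B₁.IsHermitian)
    (hx₁ : diagForm B₁ B₂ x₁ = 0) (hx₂ : diagForm B₁ B₂ x₂ = 0)
    (hx₃ : upForm B₁ B₂ x₁ x₃ = 0) (ρ : ℝ) {a : 𝕜}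
    (ha : star a * coefP B₁ B₂ x₁ x₂ ρ + a * coefQ B₁ B₂ x₁ x₂ x₃ ρ +
      coefR B₁ B₂ x₂ x₃ ρ = 0) : diagForm B₁ B₂ (a • x₁ + (ρ : 𝕜) • x₂ + x₃) = 0 := by
  have h := diagForm_comb (B₂ := B₂) h₁ x₁ x₂ x₃ a ρ 1
  have hs : star (ρ : 𝕜) = ρ := RCLike.conj_ofReal ρ
  rw [one_smul, hx₁, hx₂, hx₃, star_one, hs] at h
  rw [h]
  simp only [coefP, coefQ, coefR] at ha
  linear_combination ha

/-- A three-dimensional space that contains two zeros of `B₁`, `B₂` at which `B` has opposite signs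
contains a common zero of the three forms, of one of two explicit shapes. -/
theorem exists_common_zero (h₁ : B₁.IsHermitian) (hB : B.IsHermitian)
    (hx₁ : diagForm B₁ B₂ x₁ = 0) (hx₂ : diagForm B₁ B₂ x₂ = 0)
    (hx₃ : upForm B₁ B₂ x₁ x₃ = 0)
    (hlt : ‖lowForm B₁ B₂ x₂ x₁‖ < ‖upForm B₁ B₂ x₁ x₂‖)
    (hsign : quadForm B x₁ * quadForm B x₂ < 0) :
    (∃ ρ : ℝ, coefDet B₁ B₂ x₁ x₂ x₃ ρ ≠ 0 ∧
      quadForm B (coefNum B₁ B₂ x₁ x₂ x₃ ρ • x₁ + (coefDet B₁ B₂ x₁ x₂ x₃ ρ * ρ) • x₂ +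
        coefDet B₁ B₂ x₁ x₂ x₃ ρ • x₃) = 0 ∧
      diagForm B₁ B₂ (coefNum B₁ B₂ x₁ x₂ x₃ ρ • x₁ + (coefDet B₁ B₂ x₁ x₂ x₃ ρ * ρ) • x₂ +
        coefDet B₁ B₂ x₁ x₂ x₃ ρ • x₃) = 0) ∨
    ∃ ρ : ℝ, coefDet B₁ B₂ x₁ x₂ x₃ ρ = 0 ∧ ∃ e ∈ lineDirs B₁ B₂ x₁ x₂ x₃ ρ B, e ≠ 0 ∧ ∃ τ : ℝ,
      quadForm B ((lineBase B₁ B₂ x₁ x₂ x₃ ρ + τ * e) • x₁ + (ρ : 𝕜) • x₂ + x₃) = 0 ∧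
      diagForm B₁ B₂ ((lineBase B₁ B₂ x₁ x₂ x₃ ρ + τ * e) • x₁ + (ρ : 𝕜) • x₂ + x₃) = 0 := by
  -- changing the sign of `B` changes only the sign of the last direction
  wlog hpos : 0 < quadForm B x₁ generalizing B with H
  · have hneg : quadForm B x₁ < 0 := by
      refine lt_of_le_of_ne (not_lt.1 hpos) fun h0 => ?_
      rw [h0, zero_mul] at hsign; exact hsign.false
    have h := H (B := -B) hB.neg (by simpa [quadForm_neg_matrix] using hsign)
      (by rw [quadForm_neg_matrix]; linarith)
    simp only [quadForm_neg_matrix, neg_eq_zero] at h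
    refine h.imp_right ?_
    rintro ⟨ρ, hρ, e, he, he0, τ, hτ⟩
    refine ⟨ρ, hρ, ?_⟩
    by_cases hlast : e = -(ρ * sesq B x₁ x₂ + sesq B x₁ x₃)
    · refine ⟨_, by simp [lineDirs], neg_ne_zero.1 (hlast ▸ he0), -τ, ?_⟩
      have : ((-τ : ℝ) : 𝕜) * (ρ * sesq B x₁ x₂ + sesq B x₁ x₃) = τ * e := by
        rw [hlast]; push_cast; ring
      rw [this]
      exact hτ
    · refine ⟨e, ?_, he0, τ, hτ⟩
      have hs : ∀ x y : Fin n → 𝕜, sesq (-B) x y = -sesq B x y := by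
        intro x y
        rw [← zero_sub B, sesq_matrix_sub, sesq_zero_matrix, zero_sub]
      simp only [lineDirs, List.mem_cons, List.not_mem_nil, or_false, hs] at he ⊢
      rcases he with h | h | h | h
      · exact Or.inl h
      · exact Or.inr (Or.inl h)
      · exact Or.inr (Or.inr (Or.inl h))
      · exact absurd (by rw [h]; ring) hlast
  have hneg : quadForm B x₂ < 0 := by
    by_contra hge
    exact hsign.not_ge (mul_nonneg hpos.le (not_lt.1 hge))
  rcases exists_zero_or_limit (upForm B₁ B₂ x₁ x₂) (lowForm B₁ B₂ x₂ x₁) (lowForm B₁ B₂ x₃ x₁)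
    (upForm B₁ B₂ x₂ x₃ + lowForm B₁ B₂ x₃ x₂) (diagForm B₁ B₂ x₃) (sesq B x₁ x₂) (sesq B x₁ x₃)
    (RCLike.re (sesq B x₂ x₃)) (quadForm B x₃) hlt hpos hneg with ⟨ρ, hΔ, hq⟩ | ⟨ρ, hΔ, a, ha, hq⟩
  · left
    change ‖coefP B₁ B₂ x₁ x₂ ρ‖ ^ 2 - ‖coefQ B₁ B₂ x₁ x₂ x₃ ρ‖ ^ 2 ≠ 0 at hΔ
    have hd : coefDet B₁ B₂ x₁ x₂ x₃ ρ ≠ 0 := by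
      rw [coefDet_eq]; exact RCLike.ofReal_ne_zero.2 hΔ
    set a : 𝕜 := coefNum B₁ B₂ x₁ x₂ x₃ ρ / coefDet B₁ B₂ x₁ x₂ x₃ ρ with ha
    have hvec : coefNum B₁ B₂ x₁ x₂ x₃ ρ • x₁ + (coefDet B₁ B₂ x₁ x₂ x₃ ρ * ρ) • x₂ +
        coefDet B₁ B₂ x₁ x₂ x₃ ρ • x₃ =
        coefDet B₁ B₂ x₁ x₂ x₃ ρ • (a • x₁ + (ρ : 𝕜) • x₂ + x₃) := by
      rw [smul_add, smul_add, smul_smul, smul_smul, ha, mul_div_cancel₀ _ hd]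
    have hz := star_mul_add_mul_eq (R := coefR B₁ B₂ x₂ x₃ ρ) hΔ
    rw [← coefDet_eq] at hz
    have hdz := diagForm_of_coef h₁ hx₁ hx₂ hx₃ ρ (a := a) hz
    refine ⟨ρ, hd, ?_, ?_⟩
    · rw [hvec, quadForm_smul, quadForm_comb hB]
      have : shiftedSq (quadForm B x₁) (ρ * sesq B x₁ x₂ + sesq B x₁ x₃)
        (ρ ^ 2 * quadForm B x₂ + 2 * ρ * RCLike.re (sesq B x₂ x₃) + quadForm B x₃) a = 0 := by
        rw [← hq, ha, coefDet_eq]; rfl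
      rw [this, mul_zero]
    · rw [hvec, diagForm_smul, hdz, mul_zero]
  · right
    change ‖coefP B₁ B₂ x₁ x₂ ρ‖ ^ 2 - ‖coefQ B₁ B₂ x₁ x₂ x₃ ρ‖ ^ 2 = 0 at hΔ
    have hn : ‖coefP B₁ B₂ x₁ x₂ ρ‖ = ‖coefQ B₁ B₂ x₁ x₂ x₃ ρ‖ :=
      (pow_left_inj₀ (norm_nonneg _) (norm_nonneg _) two_ne_zero).1 (sub_eq_zero.1 hΔ)
    obtain ⟨e, he, he0, τ, hτ1, hτ2⟩ := exists_zero_on_line hpos _ _ (fun hI => by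
      simp [coefQ, lowForm_eq_zero hI]) hn ha hq
    refine ⟨ρ, by rw [coefDet_eq, hΔ, RCLike.ofReal_zero], e, he, he0, τ, ?_, ?_⟩
    · rw [quadForm_comb hB]
      exact hτ2
    · exact diagForm_of_coef h₁ hx₁ hx₂ hx₃ ρ hτ1

end Three

lemma exists_quadratic_root {α β γ : ℝ} (h : α * γ < 0) : ∃ τ : ℝ, α * τ ^ 2 + β * τ + γ = 0 := by
  rcases lt_or_ge 0 α with hα | hα
  · exact exists_root_of_le_zero hα 0 (by nlinarith)
  · have hα' : α < 0 := lt_of_le_of_ne hα (by rintro rfl; simp at h)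
    obtain ⟨τ, hτ⟩ := exists_root_of_le_zero (α := -α) (β := -β) (γ := -γ) (by linarith) 0
      (by nlinarith)
    exact ⟨τ, by linarith⟩

/-- The directions in which a common zero is sought when the cross terms of two zeros have the same
absolute value. -/
noncomputable def pairDirs (B₁ B₂ : Matrix (Fin n) (Fin n) 𝕜) (x₁ x₂ : Fin n → 𝕜) : List 𝕜 :=
  [star (lowForm B₁ B₂ x₂ x₁) - upForm B₁ B₂ x₁ x₂,
    RCLike.I * (star (lowForm B₁ B₂ x₂ x₁) + upForm B₁ B₂ x₁ x₂), 1]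

/-- If the cross terms of two zeros of `B₁`, `B₂` have the same absolute value and `B` has opposite
signs at them, a real line through the second one consists of zeros of `B₁` and `B₂`, and `B`
vanishes somewhere on it. -/
lemma exists_common_zero_pair (h₁ : B₁.IsHermitian) (hB : B.IsHermitian)
    {x₁ x₂ : Fin n → 𝕜} (hx₁ : diagForm B₁ B₂ x₁ = 0) (hx₂ : diagForm B₁ B₂ x₂ = 0)
    (heq : ‖upForm B₁ B₂ x₁ x₂‖ = ‖lowForm B₁ B₂ x₂ x₁‖)
    (hsign : quadForm B x₁ * quadForm B x₂ < 0) :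
    ∃ w ∈ pairDirs B₁ B₂ x₁ x₂, w ≠ 0 ∧ ∃ τ : ℝ,
      quadForm B ((τ * w : 𝕜) • x₁ + x₂) = 0 ∧ diagForm B₁ B₂ ((τ * w : 𝕜) • x₁ + x₂) = 0 := by
  obtain ⟨w, hw, hw0, hsol⟩ : ∃ w ∈ pairDirs B₁ B₂ x₁ x₂, w ≠ 0 ∧
      star w * upForm B₁ B₂ x₁ x₂ + w * lowForm B₁ B₂ x₂ x₁ = 0 := by
    by_cases hQ : lowForm B₁ B₂ x₂ x₁ = 0
    · have hP : upForm B₁ B₂ x₁ x₂ = 0 := by rw [← norm_eq_zero, heq, hQ, norm_zero]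
      exact ⟨1, by simp [pairDirs], one_ne_zero, by rw [hP, hQ]; simp⟩
    · obtain ⟨e, he, hne, hez, -⟩ := exists_direction heq hQ (f := 0) (by simp)
      refine ⟨e, ?_, hne.resolve_right fun hI => hQ (lowForm_eq_zero hI _ _), hez⟩
      simp only [List.mem_cons, List.not_mem_nil, or_false, pairDirs] at he ⊢
      tauto
  refine ⟨w, hw, hw0, ?_⟩
  have hq : ∀ τ : ℝ, quadForm B ((τ * w : 𝕜) • x₁ + x₂) = ‖w‖ ^ 2 * quadForm B x₁ * τ ^ 2 +
      2 * RCLike.re (w * sesq B x₂ x₁) * τ + quadForm B x₂ := by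
    intro τ
    rw [add_comm, quadForm_add_smul hB, mul_assoc, RCLike.re_ofReal_mul, norm_mul,
      RCLike.norm_ofReal, mul_pow, sq_abs]
    ring
  obtain ⟨τ, hτ⟩ := exists_quadratic_root (α := ‖w‖ ^ 2 * quadForm B x₁)
    (β := 2 * RCLike.re (w * sesq B x₂ x₁)) (γ := quadForm B x₂) (by
      rw [mul_assoc]
      exact mul_neg_of_pos_of_neg (pow_pos (norm_pos_iff.2 hw0) 2) hsign)
  refine ⟨τ, by rw [hq, hτ], ?_⟩
  have h := diagForm_comb (B₂ := B₂) h₁ x₁ x₂ 0 (τ * w) 1 0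
  have hs : star (τ : 𝕜) = τ := RCLike.conj_ofReal τ
  rw [one_smul, smul_zero, add_zero, hx₁, hx₂, star_mul, hs, star_one, star_zero] at h
  rw [h]
  linear_combination (τ : 𝕜) * hsol

end CommonZeros

/-! ### Polynomials as coefficient lists -/

section PolyList

/-- The sum of two polynomials, given by their coefficient lists (lowest degree first). -/
def polyAdd {R : Type} [Add R] : List R → List R → List R
  | [], l => l
  | a :: l, [] => a :: l
  | a :: l, b :: l' => (a + b) :: polyAdd l l'

/-- The product of two polynomials, given by their coefficient lists. -/
def polyMul {R : Type} [Add R] [Mul R] [Zero R] : List R → List R → List R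
  | [], _ => []
  | a :: l, l' => polyAdd (l'.map (a * ·)) (0 :: polyMul l l')

/-- The value of a polynomial given by its coefficient list. -/
def polyEval {R : Type} [Add R] [Mul R] [Zero R] (x : R) : List R → R
  | [] => 0
  | a :: l => a + x * polyEval x l

/-- The value of the sesquilinear form with Gram matrix `g` at a vector whose three coordinates are
polynomials in one real variable. -/
def polyForm {R : Type} [Add R] [Mul R] [Zero R] [Star R] (g : Fin 3 → Fin 3 → R)
    (T : Fin 3 → List R) : List R :=
  let term := fun p q => polyMul ((T p).map star) (polyMul (T q) [g p q])
  let row := fun p => polyAdd (term p 0) (polyAdd (term p 1) (term p 2))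
  polyAdd (row 0) (polyAdd (row 1) (row 2))

variable {R S : Type} [CommRing R] [CommRing S]

lemma polyEval_add (x : R) (l l' : List R) :
    polyEval x (polyAdd l l') = polyEval x l + polyEval x l' := by
  induction l generalizing l' with
  | nil => simp [polyAdd, polyEval]
  | cons a l ih =>
    cases l' with
    | nil => simp [polyAdd, polyEval]
    | cons b l' => simp only [polyAdd, polyEval, ih]; ring

lemma polyEval_smul (x a : R) (l : List R) :
    polyEval x (l.map (a * ·)) = a * polyEval x l := by
  induction l with
  | nil => simp [polyEval]
  | cons b l ih => simp only [List.map_cons, polyEval, ih]; ring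

lemma polyEval_mul (x : R) (l l' : List R) :
    polyEval x (polyMul l l') = polyEval x l * polyEval x l' := by
  induction l with
  | nil => simp [polyMul, polyEval]
  | cons a l ih => simp only [polyMul, polyEval, polyEval_add, polyEval_smul, ih]; ring

lemma polyEval_star [StarRing R] {x : R} (hx : star x = x) (l : List R) :
    polyEval x (l.map star) = star (polyEval x l) := by
  induction l with
  | nil => simp [polyEval]
  | cons a l ih => simp only [List.map_cons, polyEval, ih, star_add, star_mul', hx]

lemma polyEval_form [StarRing R] {x : R} (hx : star x = x) (g : Fin 3 → Fin 3 → R)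
    (T : Fin 3 → List R) : polyEval x (polyForm g T) =
      ∑ p, ∑ q, star (polyEval x (T p)) * (polyEval x (T q) * g p q) := by
  have h : ∀ a : R, polyEval x [a] = a := fun a => by simp [polyEval]
  simp only [polyForm, polyEval_add, polyEval_mul, polyEval_star hx, h, Fin.sum_univ_three]
  ring

lemma map_polyAdd (φ : R →+* S) (l l' : List R) :
    (polyAdd l l').map φ = polyAdd (l.map φ) (l'.map φ) := by
  induction l generalizing l' with
  | nil => simp [polyAdd]
  | cons a l ih =>
    cases l' with
    | nil => simp [polyAdd]
    | cons b l' => simp [polyAdd, ih]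

lemma map_polyMul (φ : R →+* S) (l l' : List R) :
    (polyMul l l').map φ = polyMul (l.map φ) (l'.map φ) := by
  induction l with
  | nil => simp [polyMul]
  | cons a l ih => simp [polyMul, map_polyAdd, ih, Function.comp_def]

lemma map_polyEval (φ : R →+* S) (x : R) (l : List R) :
    φ (polyEval x l) = polyEval (φ x) (l.map φ) := by
  induction l with
  | nil => simp [polyEval]
  | cons a l ih => simp [polyEval, ih]

lemma map_polyForm [StarRing R] [StarRing S] (φ : R →+* S) (hφ : ∀ a, φ (star a) = star (φ a))
    (g : Fin 3 → Fin 3 → R) (T : Fin 3 → List R) :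
    (polyForm g T).map φ = polyForm (fun p q => φ (g p q)) (fun p => (T p).map φ) := by
  simp [polyForm, map_polyAdd, map_polyMul, Function.comp_def, hφ]

end PolyList

/-! ### The candidates for a common zero -/

section Candidates

/-- Triples of polynomials in one real variable. For a suitable value of the variable one of them
gives the coordinates of a common zero of three Hermitian forms with Gram matrices `g₁`, `g₂`, `g`,
with respect to three given vectors: the first triple is the first vector, the next three are the
points of `exists_common_zero_pair`, and the others are those of `exists_common_zero`. The arguments
`I` and `rt` stand for the imaginary unit and the extraction of real roots, so that the same
definition serves for numbers and for expressions of the machine. -/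
def candidateTriples {R : Type} [CommRing R] [StarRing R] [Div R] (I : R) (rt : ℕ → List R → R)
    (g₁ g₂ g : Fin 3 → Fin 3 → R) : List (Fin 3 → List R) :=
  let up := fun p q => (2 + I * I) * (g₁ p q + I * g₂ p q)
  let low := fun p q => -(I * I) * (g₁ p q + I * g₂ p q)
  let r₀ := g₁ 2 2 + I * g₂ 2 2
  let r₁ := up 1 2 + low 2 1
  let num : List R := [r₀ * star (low 2 0) - star r₀ * 0, r₀ * star (low 1 0) +
    r₁ * star (low 2 0) - star r₀ * up 0 1, r₁ * star (low 1 0) - star r₁ * up 0 1]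
  let det : List R := [-(low 2 0 * star (low 2 0)),
    -(low 1 0 * star (low 2 0) + low 2 0 * star (low 1 0)),
    up 0 1 * star (up 0 1) - low 1 0 * star (low 1 0)]
  [![[1], [], []], ![[0, star (low 1 0) - up 0 1], [1], []],
    ![[0, I * (star (low 1 0) + up 0 1)], [1], []], ![[0, 1], [1], []],
    ![num, 0 :: det, det]] ++
    (List.range 3).flatMap fun j =>
      let ρ := rt j det
      let P := ρ * up 0 1
      let Q := ρ * low 1 0 + low 2 0
      let base := -(ρ * r₁ + r₀) / (2 * Q)
      [![[base, star Q - P], [ρ], [1]], ![[base, I * (star Q + P)], [ρ], [1]],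
        ![[base, 1], [ρ], [1]], ![[base, ρ * g 0 1 + g 0 2], [ρ], [1]]]

/-- The triples of coordinates obtained from `candidateTriples` by inserting the real zeros of the
third form. -/
def candidates {R : Type} [CommRing R] [StarRing R] [Div R] (I : R) (rt : ℕ → List R → R)
    (g₁ g₂ g : Fin 3 → Fin 3 → R) : List (Fin 3 → R) :=
  (candidateTriples I rt g₁ g₂ g).flatMap fun T =>
    (List.range (polyForm g T).length).map fun j => fun p => polyEval (rt j (polyForm g T)) (T p)

section Map

variable {R S : Type} [CommRing R] [StarRing R] [Div R] [CommRing S] [StarRing S] [Div S]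

lemma map_candidateTriples (φ : R →+* S) (hstar : ∀ a, φ (star a) = star (φ a))
    (hdiv : ∀ a b, φ (a / b) = φ a / φ b) (I : R) (rt : ℕ → List R → R) (rt' : ℕ → List S → S)
    (hrt : ∀ j l, φ (rt j l) = rt' j (l.map φ)) (g₁ g₂ g : Fin 3 → Fin 3 → R) :
    (candidateTriples I rt g₁ g₂ g).map (fun T p => (T p).map φ) = candidateTriples (φ I) rt'
      (fun p q => φ (g₁ p q)) (fun p q => φ (g₂ p q)) (fun p q => φ (g p q)) := by
  have hvec : ∀ a b c : List R, (fun p => (![a, b, c] p).map φ) =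
      ![a.map φ, b.map φ, c.map φ] := by
    intro a b c
    funext p
    fin_cases p <;> rfl
  simp only [candidateTriples, List.map_append, List.map_flatMap, List.map_cons, List.map_nil,
    hvec, map_add, map_sub, map_mul, map_neg, map_one, map_zero, map_ofNat, hstar, hdiv, hrt]

lemma map_candidates (φ : R →+* S) (hstar : ∀ a, φ (star a) = star (φ a))
    (hdiv : ∀ a b, φ (a / b) = φ a / φ b) (I : R) (rt : ℕ → List R → R) (rt' : ℕ → List S → S)
    (hrt : ∀ j l, φ (rt j l) = rt' j (l.map φ)) (g₁ g₂ g : Fin 3 → Fin 3 → R) :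
    (candidates I rt g₁ g₂ g).map (fun T p => φ (T p)) = candidates (φ I) rt'
      (fun p q => φ (g₁ p q)) (fun p q => φ (g₂ p q)) (fun p q => φ (g p q)) := by
  rw [candidates, candidates, ← map_candidateTriples φ hstar hdiv I rt rt' hrt]
  have hlen : ∀ T : Fin 3 → List R, (polyForm g T).length =
      (polyForm (fun p q => φ (g p q)) fun p => (T p).map φ).length := fun T => by
    rw [← map_polyForm φ hstar, List.length_map]
  simp only [List.map_flatMap, List.flatMap_map, List.map_map, Function.comp_def, map_polyEval,
    hrt, map_polyForm φ hstar, hlen]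

/-- All candidates lie in every subring that contains the Gram matrices and is closed under the
operations of the machine. -/
lemma mem_of_mem_candidates (K : Subring R) (hstar : ∀ a ∈ K, star a ∈ K)
    (hdiv : ∀ a ∈ K, ∀ b ∈ K, a / b ∈ K) {I : R} (hI : I ∈ K) {rt : ℕ → List R → R}
    (hrt : ∀ j l, (∀ a ∈ l, a ∈ K) → rt j l ∈ K) {g₁ g₂ g : Fin 3 → Fin 3 → R}
    (hg₁ : ∀ i j, g₁ i j ∈ K) (hg₂ : ∀ i j, g₂ i j ∈ K) (hg : ∀ i j, g i j ∈ K) :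
    ∀ T ∈ candidates I rt g₁ g₂ g, ∀ i, T i ∈ K := by
  let _ : StarRing K :=
    { star := fun a => ⟨star a.1, hstar _ a.2⟩
      star_involutive := fun a => Subtype.ext (star_star a.1)
      star_mul := fun a b => Subtype.ext (star_mul a.1 b.1)
      star_add := fun a b => Subtype.ext (star_add a.1 b.1) }
  let _ : Div K := ⟨fun a b => ⟨a.1 / b.1, hdiv _ a.2 _ b.2⟩⟩
  let rt' : ℕ → List K → K := fun j l => ⟨rt j (l.map K.subtype), hrt j _ fun a ha => by
    obtain ⟨b, -, rfl⟩ := List.mem_map.1 ha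
    exact b.2⟩
  have h := map_candidates K.subtype (fun _ => rfl) (fun _ _ => rfl) ⟨I, hI⟩ rt' rt
    (fun _ _ => rfl) (fun p q => ⟨g₁ p q, hg₁ p q⟩) (fun p q => ⟨g₂ p q, hg₂ p q⟩)
    (fun p q => ⟨g p q, hg p q⟩)
  intro T hT i
  have hT' : T ∈ candidates (K.subtype ⟨I, hI⟩) rt (fun p q => K.subtype ⟨g₁ p q, hg₁ p q⟩)
    (fun p q => K.subtype ⟨g₂ p q, hg₂ p q⟩) (fun p q => K.subtype ⟨g p q, hg p q⟩) := hT
  rw [← h, List.mem_map] at hT'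
  obtain ⟨T', -, rfl⟩ := hT'
  exact (T' i).2

end Map

end Candidates

section Roots

variable {𝕜 : Type} [RCLike 𝕜] {n : ℕ}

/-- The root operation of the machine, applied to a list of coefficients. -/
noncomputable def realRoot (j : ℕ) (l : List 𝕜) : 𝕜 :=
  ((RealRAM.nthRealRoot j (l.map RCLike.re) : ℝ) : 𝕜)

/-- The Gram matrix of three vectors with respect to a sesquilinear form. -/
noncomputable def gram (B : Matrix (Fin n) (Fin n) 𝕜) (x : Fin 3 → Fin n → 𝕜) (p q : Fin 3) : 𝕜 :=
  sesq B (x p) (x q)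

/-- The linear combination of three vectors with given coefficients. -/
def combine (x : Fin 3 → Fin n → 𝕜) (c : Fin 3 → 𝕜) : Fin n → 𝕜 :=
  c 0 • x 0 + c 1 • x 1 + c 2 • x 2

lemma sum_getD_mul_pow (x : ℝ) (l : List ℝ) :
    ∑ k ∈ Finset.range l.length, l.getD k 0 * x ^ k = polyEval x l := by
  induction l with
  | nil => simp [polyEval]
  | cons a l ih =>
    rw [List.length_cons, Finset.sum_range_succ', polyEval, ← ih, Finset.mul_sum, add_comm]
    congr 1
    · simp
    · refine Finset.sum_congr rfl fun k _ => ?_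
      rw [List.getD_cons_succ]
      ring

lemma re_polyEval (x : ℝ) (l : List 𝕜) :
    RCLike.re (polyEval (x : 𝕜) l) = polyEval x (l.map RCLike.re) := by
  induction l with
  | nil => simp [polyEval]
  | cons a l ih => rw [polyEval, map_add, RCLike.re_ofReal_mul, ih]; rfl

/-- The root operation finds every real root of the real part of a polynomial. -/
lemma exists_realRoot (x : ℝ) (l : List 𝕜) (hx : RCLike.re (polyEval (x : 𝕜) l) = 0)
    (hl : ∃ a ∈ l, RCLike.re a ≠ 0) : ∃ j < l.length, realRoot j l = (x : 𝕜) := by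
  rw [re_polyEval, ← sum_getD_mul_pow] at hx
  obtain ⟨a, ha, ha0⟩ := hl
  obtain ⟨k, hk, rfl⟩ := List.getElem_of_mem ha
  obtain ⟨j, hj, h⟩ := RealRAM.exists_nthRealRoot (l.map RCLike.re) x hx
    ⟨k, by simpa using hk, by simpa [List.getD_eq_getElem?_getD, hk] using ha0⟩
  exact ⟨j, by simpa using hj, by rw [realRoot, h]⟩

lemma quadForm_combine (B : Matrix (Fin n) (Fin n) 𝕜) (x : Fin 3 → Fin n → 𝕜)
    (T : Fin 3 → List 𝕜) (τ : ℝ) :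
    RCLike.re (polyEval (τ : 𝕜) (polyForm (gram B x) T)) =
      quadForm B (combine x fun p => polyEval (τ : 𝕜) (T p)) := by
  rw [polyEval_form (RCLike.conj_ofReal τ)]
  simp only [quadForm, combine, gram, sesq_add_left, sesq_add_right, sesq_smul_left,
    sesq_smul_right, Fin.sum_univ_three]
  congr 1
  ring

variable {B₁ B₂ B : Matrix (Fin n) (Fin n) 𝕜} {x : Fin 3 → Fin n → 𝕜}

lemma exists_mem_candidates {T : Fin 3 → List 𝕜}
    (hT : T ∈ candidateTriples RCLike.I realRoot (gram B₁ x) (gram B₂ x) (gram B x))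
    (hne : ∃ a ∈ polyForm (gram B x) T, RCLike.re a ≠ 0) {τ : ℝ}
    (hτ : quadForm B (combine x fun p => polyEval (τ : 𝕜) (T p)) = 0) :
    (fun p => polyEval (τ : 𝕜) (T p)) ∈
      candidates RCLike.I realRoot (gram B₁ x) (gram B₂ x) (gram B x) := by
  rw [← quadForm_combine] at hτ
  obtain ⟨j, hj, h⟩ := exists_realRoot τ _ hτ hne
  exact List.mem_flatMap.2 ⟨T, hT, List.mem_map.2 ⟨j, List.mem_range.2 hj, by rw [h]⟩⟩

/-- The first vector is among the candidates. -/
lemma exists_candidate_fst : ∃ c ∈ candidates RCLike.I realRoot (gram B₁ x) (gram B₂ x) (gram B x),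
    combine x c = x 0 := by
  refine ⟨_, List.mem_flatMap.2 ⟨![[1], [], []], by simp [candidateTriples],
    List.mem_map.2 ⟨0, ?_, rfl⟩⟩, ?_⟩
  · simp [polyForm, polyMul, polyAdd]
  · simp [combine, polyEval]

lemma exists_candidate_pair (h₁ : B₁.IsHermitian) (hB : B.IsHermitian)
    (hx₁ : diagForm B₁ B₂ (x 0) = 0) (hx₂ : diagForm B₁ B₂ (x 1) = 0)
    (heq : ‖upForm B₁ B₂ (x 0) (x 1)‖ = ‖lowForm B₁ B₂ (x 1) (x 0)‖)
    (hsign : quadForm B (x 0) * quadForm B (x 1) < 0) :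
    ∃ c ∈ candidates RCLike.I realRoot (gram B₁ x) (gram B₂ x) (gram B x),
      quadForm B (combine x c) = 0 ∧ diagForm B₁ B₂ (combine x c) = 0 ∧
      ∃ w : 𝕜, combine x c = w • x 0 + x 1 := by
  obtain ⟨w, hw, hw0, τ, hτ, hd⟩ := exists_common_zero_pair h₁ hB hx₁ hx₂ heq hsign
  have hv : combine x (fun p => polyEval (τ : 𝕜) (![[0, w], [1], []] p)) =
      (τ * w : 𝕜) • x 0 + x 1 := by
    simp [combine, polyEval]
  have hq0 : quadForm B (x 0) ≠ 0 := by rintro h0; rw [h0, zero_mul] at hsign; exact hsign.false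
  refine ⟨_, exists_mem_candidates (T := ![[0, w], [1], []]) (τ := τ) ?_ ?_ (by rw [hv, hτ]),
    by rw [hv, hτ], by rw [hv, hd], _, hv⟩
  · simp only [pairDirs, List.mem_cons, List.not_mem_nil, or_false, upForm, lowForm] at hw
    simp only [candidateTriples, gram, List.mem_append, List.mem_cons]
    rcases hw with rfl | rfl | rfl <;> simp
  · refine ⟨star w * (w * gram B x 0 0), by simp [polyForm, polyMul, polyAdd], ?_⟩
    rw [← mul_assoc, star_mul_eq_norm_sq, RCLike.re_ofReal_mul]
    exact mul_ne_zero (by simpa using hw0) hq0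

lemma exists_candidate_triple (h₁ : B₁.IsHermitian) (hB : B.IsHermitian)
    (hx₁ : diagForm B₁ B₂ (x 0) = 0) (hx₂ : diagForm B₁ B₂ (x 1) = 0)
    (hx₃ : upForm B₁ B₂ (x 0) (x 2) = 0)
    (hlt : ‖lowForm B₁ B₂ (x 1) (x 0)‖ < ‖upForm B₁ B₂ (x 0) (x 1)‖)
    (hsign : quadForm B (x 0) * quadForm B (x 1) < 0) :
    ∃ c ∈ candidates RCLike.I realRoot (gram B₁ x) (gram B₂ x) (gram B x),
      quadForm B (combine x c) = 0 ∧ diagForm B₁ B₂ (combine x c) = 0 ∧ c 2 ≠ 0 := by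
  set det : List 𝕜 := [-(lowForm B₁ B₂ (x 2) (x 0) * star (lowForm B₁ B₂ (x 2) (x 0))),
    -(lowForm B₁ B₂ (x 1) (x 0) * star (lowForm B₁ B₂ (x 2) (x 0)) +
      lowForm B₁ B₂ (x 2) (x 0) * star (lowForm B₁ B₂ (x 1) (x 0))),
    upForm B₁ B₂ (x 0) (x 1) * star (upForm B₁ B₂ (x 0) (x 1)) -
      lowForm B₁ B₂ (x 1) (x 0) * star (lowForm B₁ B₂ (x 1) (x 0))] with hdet
  have hs : ∀ ρ : ℝ, star (ρ : 𝕜) = ρ := RCLike.conj_ofReal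
  have hq0 : quadForm B (x 0) ≠ 0 := by rintro h0; rw [h0, zero_mul] at hsign; exact hsign.false
  have hq1 : quadForm B (x 1) ≠ 0 := by rintro h0; rw [h0, mul_zero] at hsign; exact hsign.false
  have hd2 : upForm B₁ B₂ (x 0) (x 1) * star (upForm B₁ B₂ (x 0) (x 1)) -
      lowForm B₁ B₂ (x 1) (x 0) * star (lowForm B₁ B₂ (x 1) (x 0)) =
      ((‖upForm B₁ B₂ (x 0) (x 1)‖ ^ 2 - ‖lowForm B₁ B₂ (x 1) (x 0)‖ ^ 2 : ℝ) : 𝕜) := by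
    rw [mul_star_eq_norm_sq, mul_star_eq_norm_sq, RCLike.ofReal_sub]
  have hpos : 0 < ‖upForm B₁ B₂ (x 0) (x 1)‖ ^ 2 - ‖lowForm B₁ B₂ (x 1) (x 0)‖ ^ 2 :=
    sub_pos.2 (pow_lt_pow_left₀ hlt (norm_nonneg _) two_ne_zero)
  have hdeval : ∀ ρ : ℝ, polyEval (ρ : 𝕜) det = coefDet B₁ B₂ (x 0) (x 1) (x 2) ρ := by
    intro ρ
    simp only [hdet, polyEval, coefDet, coefP, coefQ, star_add, star_mul', hs]
    ring
  rcases exists_common_zero h₁ hB hx₁ hx₂ hx₃ hlt hsign with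
    ⟨ρ, hΔ, hq, hd⟩ | ⟨ρ, hΔ, e, he, he0, τ, hq, hd⟩
  · set num : List 𝕜 := [diagForm B₁ B₂ (x 2) * star (lowForm B₁ B₂ (x 2) (x 0)) -
        star (diagForm B₁ B₂ (x 2)) * 0,
      diagForm B₁ B₂ (x 2) * star (lowForm B₁ B₂ (x 1) (x 0)) +
        (upForm B₁ B₂ (x 1) (x 2) + lowForm B₁ B₂ (x 2) (x 1)) *
          star (lowForm B₁ B₂ (x 2) (x 0)) -
        star (diagForm B₁ B₂ (x 2)) * upForm B₁ B₂ (x 0) (x 1),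
      (upForm B₁ B₂ (x 1) (x 2) + lowForm B₁ B₂ (x 2) (x 1)) *
          star (lowForm B₁ B₂ (x 1) (x 0)) -
        star (upForm B₁ B₂ (x 1) (x 2) + lowForm B₁ B₂ (x 2) (x 1)) *
          upForm B₁ B₂ (x 0) (x 1)] with hnum
    have hneval : polyEval (ρ : 𝕜) num = coefNum B₁ B₂ (x 0) (x 1) (x 2) ρ := by
      simp only [hnum, polyEval, coefNum, coefP, coefQ, coefR, star_add, star_mul', hs]
      ring
    have hv : combine x (fun p => polyEval (ρ : 𝕜) (![num, 0 :: det, det] p)) =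
        coefNum B₁ B₂ (x 0) (x 1) (x 2) ρ • x 0 +
          (coefDet B₁ B₂ (x 0) (x 1) (x 2) ρ * ρ) • x 1 +
          coefDet B₁ B₂ (x 0) (x 1) (x 2) ρ • x 2 := by
      change polyEval (ρ : 𝕜) num • x 0 + (0 + ρ * polyEval (ρ : 𝕜) det) • x 1 +
        polyEval (ρ : 𝕜) det • x 2 = _
      rw [hneval, hdeval, zero_add, mul_comm (ρ : 𝕜)]
    refine ⟨_, exists_mem_candidates (T := ![num, 0 :: det, det]) (τ := ρ) ?_ ?_ (by rw [hv, hq]),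
      by rw [hv, hq], by rw [hv, hd], ?_⟩
    · simp only [candidateTriples, List.mem_append, List.mem_cons]
      refine Or.inl (Or.inr (Or.inr (Or.inr (Or.inr (Or.inl rfl)))))
    · -- the coefficient of `ρ ^ 6`
      refine ⟨_, List.mem_of_getElem? (i := 6) (a := ((star ((‖upForm B₁ B₂ (x 0) (x 1)‖ ^ 2 -
        ‖lowForm B₁ B₂ (x 1) (x 0)‖ ^ 2 : ℝ) : 𝕜)) * (((‖upForm B₁ B₂ (x 0) (x 1)‖ ^ 2 -
        ‖lowForm B₁ B₂ (x 1) (x 0)‖ ^ 2 : ℝ) : 𝕜) * gram B x 1 1))) ?_, ?_⟩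
      · rw [← hd2, hnum, hdet]
        generalize lowForm B₁ B₂ (x 1) (x 0) = l10
        generalize lowForm B₁ B₂ (x 2) (x 0) = l20
        generalize lowForm B₁ B₂ (x 2) (x 1) = l21
        generalize upForm B₁ B₂ (x 0) (x 1) = u01
        generalize upForm B₁ B₂ (x 1) (x 2) = u12
        generalize diagForm B₁ B₂ (x 2) = r
        simp [polyForm, polyMul, polyAdd]
      · rw [hs, ← mul_assoc, ← RCLike.ofReal_mul, RCLike.re_ofReal_mul]
        exact mul_ne_zero (mul_self_ne_zero.2 hpos.ne') hq1
    · change polyEval (ρ : 𝕜) det ≠ 0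
      rwa [hdeval]
  · have hre : RCLike.re (polyEval (ρ : 𝕜) det) = 0 := by rw [hdeval, hΔ, map_zero]
    obtain ⟨j, hj, hroot⟩ := exists_realRoot ρ det hre
      ⟨_, List.mem_cons_of_mem _ (List.mem_cons_of_mem _ (List.mem_cons_self ..)), by
        rw [hd2, RCLike.ofReal_re]; exact hpos.ne'⟩
    set a₀ := lineBase B₁ B₂ (x 0) (x 1) (x 2) ρ with ha₀
    have hv : combine x (fun p => polyEval (τ : 𝕜) (![[a₀, e], [(ρ : 𝕜)], [1]] p)) =
        (a₀ + τ * e) • x 0 + (ρ : 𝕜) • x 1 + x 2 := by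
      simp [combine, polyEval]
    refine ⟨_, exists_mem_candidates (T := ![[a₀, e], [(ρ : 𝕜)], [1]]) (τ := τ) ?_ ?_
      (by rw [hv, hq]), by rw [hv, hq], by rw [hv, hd], by simp [polyEval]⟩
    · simp only [candidateTriples, List.mem_append]
      refine Or.inr (List.mem_flatMap.2 ⟨j, List.mem_range.2 hj, ?_⟩)
      change _ ∈ [_, _, _, _]
      have hroot' : realRoot j [-((lowForm B₁ B₂ (x 2) (x 0) * star (lowForm B₁ B₂ (x 2) (x 0)))),
        -(lowForm B₁ B₂ (x 1) (x 0) * star (lowForm B₁ B₂ (x 2) (x 0)) +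
        lowForm B₁ B₂ (x 2) (x 0) * star (lowForm B₁ B₂ (x 1) (x 0))),
        upForm B₁ B₂ (x 0) (x 1) * star (upForm B₁ B₂ (x 0) (x 1)) -
        lowForm B₁ B₂ (x 1) (x 0) * star (lowForm B₁ B₂ (x 1) (x 0))] = (ρ : 𝕜) := hroot
      simp only [lowForm, upForm, gram] at hroot' ⊢
      rw [hroot']
      simp only [lineDirs, lineBase, coefQ, coefP, coefR, lowForm, upForm, diagForm,
        List.mem_cons, List.not_mem_nil, or_false] at he ha₀ ⊢
      rcases he with rfl | rfl | rfl | rfl <;> rw [ha₀] <;> simp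
    · refine ⟨star e * (e * gram B x 0 0), by simp [polyForm, polyMul, polyAdd], ?_⟩
      rw [← mul_assoc, star_mul_eq_norm_sq, RCLike.re_ofReal_mul]
      exact mul_ne_zero (by simpa using he0) hq0

end Roots

/-! ### Points as good as the relaxation -/

namespace HQP

variable {𝕜 : Type} [RCLike 𝕜] {n m : ℕ}

/-- The matrix `Aⱼ - (tⱼ / tₖ) Aₖ` with `tᵢ = Aᵢ • X`; it is orthogonal to `X` if `tₖ ≠ 0`. -/
noncomputable def balanced (P : HQP 𝕜 n m) (X : Matrix (Fin n) (Fin n) 𝕜) (k j : Fin m) :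
    Matrix (Fin n) (Fin n) 𝕜 :=
  P.A j - ((matInner (P.A j) X / matInner (P.A k) X : ℝ) : 𝕜) • P.A k

/-- A feasible point of the quadratic program whose value is at most that of `X` in the
relaxation. -/
def IsGood (P : HQP 𝕜 n m) (X : Matrix (Fin n) (Fin n) 𝕜) (x : Fin n → 𝕜) : Prop :=
  x ∈ P.feasibleSet ∧ quadForm P.A₀ x ≤ matInner P.A₀ X

/-- The multiple of `x` at which the form `Aₖ` has the value `Aₖ • X`, provided that `xᴴ Aₖ x` is
not zero and has the same sign. -/
noncomputable def rescale (P : HQP 𝕜 n m) (X : Matrix (Fin n) (Fin n) 𝕜) (k : Fin m)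
    (x : Fin n → 𝕜) : Fin n → 𝕜 :=
  ((√(matInner (P.A k) X / quadForm (P.A k) x) : ℝ) : 𝕜) • x

/-- What is used of an optimal pair: feasibility, complementarity, and a strictly feasible point of
the dual. -/
structure OptimalPair (P : HQP 𝕜 n m) (X Z : Matrix (Fin n) (Fin n) 𝕜) (μ : Fin m → ℝ) :
    Prop where
  slater : P.DualSlater
  primal : P.IsSdpOpt X
  slack_eq : Z = P.slack μ
  slack_posSemidef : Z.PosSemidef
  nonneg : ∀ i, P.isEq i = false → 0 ≤ μ i
  orthogonal : matInner Z X = 0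
  complementary : ∀ i, μ i * (matInner (P.A i) X - P.c i) = 0

lemma optimalPair {P : HQP 𝕜 n m} (hS : P.PrimalSlater) (hD : P.DualSlater)
    {X Z : Matrix (Fin n) (Fin n) 𝕜} {μ : Fin m → ℝ} (hX : P.IsSdpOpt X)
    (hZ : P.IsDualOpt Z μ) : P.OptimalPair X Z μ where
  slater := hD
  primal := hX
  slack_eq := hZ.1.1
  slack_posSemidef := hZ.1.2.1
  nonneg := hZ.1.2.2
  orthogonal := (P.complementarity hS hX hZ).1
  complementary := (P.complementarity hS hX hZ).2

lemma balanced_isHermitian (P : HQP 𝕜 n m) (X : Matrix (Fin n) (Fin n) 𝕜) (k j : Fin m) :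
    (P.balanced X k j).IsHermitian := by
  rw [balanced, Matrix.IsHermitian, Matrix.conjTranspose_sub, Matrix.conjTranspose_smul,
    (P.hermitian j).eq, (P.hermitian k).eq, RCLike.star_def, RCLike.conj_ofReal]

lemma quadForm_balanced (P : HQP 𝕜 n m) (X : Matrix (Fin n) (Fin n) 𝕜) (k j : Fin m)
    (x : Fin n → 𝕜) : quadForm (P.balanced X k j) x = quadForm (P.A j) x -
      matInner (P.A j) X / matInner (P.A k) X * quadForm (P.A k) x := by
  rw [balanced, quadForm_sub_matrix, quadForm_ofReal_smul_matrix]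

lemma matInner_balanced (P : HQP 𝕜 n m) {X : Matrix (Fin n) (Fin n) 𝕜} {k : Fin m} (j : Fin m)
    (hk : matInner (P.A k) X ≠ 0) : matInner (P.balanced X k j) X = 0 := by
  rw [balanced, matInner_sub_left, matInner_smul_left, div_mul_cancel₀ _ hk, sub_self]

lemma quadForm_balanced_self (P : HQP 𝕜 n m) {X : Matrix (Fin n) (Fin n) 𝕜} {k : Fin m}
    (hk : matInner (P.A k) X ≠ 0) (x : Fin n → 𝕜) : quadForm (P.balanced X k k) x = 0 := by
  rw [quadForm_balanced, div_self hk, one_mul, sub_self]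

namespace OptimalPair

variable {P : HQP 𝕜 n m} {X Z : Matrix (Fin n) (Fin n) 𝕜} {μ : Fin m → ℝ}

lemma primal_value (h : P.OptimalPair X Z μ) :
    matInner P.A₀ X = -∑ j, μ j * matInner (P.A j) X := by
  have := h.orthogonal
  rw [h.slack_eq, matInner_slack] at this
  linarith

lemma quadForm_objective (h : P.OptimalPair X Z μ) {x : Fin n → 𝕜} (hx : Z *ᵥ x = 0) :
    quadForm P.A₀ x = -∑ j, μ j * quadForm (P.A j) x := by
  have h1 : quadForm Z x = 0 := by rw [quadForm, sesq, hx, dotProduct_zero, map_zero]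
  rw [h.slack_eq, quadForm_slack] at h1
  linarith

/-- On the kernel of the dual slack matrix some combination of the constraint forms is positive,
with a positive weight for each inactive constraint. -/
lemma exists_weights (h : P.OptimalPair X Z μ) : ∃ δ : Fin m → ℝ,
    (∀ x, Z *ᵥ x = 0 → x ≠ 0 → 0 < ∑ j, δ j * quadForm (P.A j) x) ∧
    0 ≤ ∑ j, δ j * matInner (P.A j) X ∧ ∀ i, P.isEq i = false → μ i = 0 → 0 < δ i := by
  obtain ⟨μ', hpos, hμ'⟩ := h.slater
  refine ⟨fun j => μ' j - μ j, fun x hx hx0 => ?_, ?_, fun i hi h0 => by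
    simpa [h0] using hμ' i hi⟩
  · have h1 := hpos.quadForm_pos hx0
    have h2 := h.quadForm_objective hx
    rw [quadForm_slack] at h1
    simp only [sub_mul, Finset.sum_sub_distrib]
    linarith
  · have h1 := matInner_nonneg hpos.posSemidef h.primal.1.1
    have h2 := h.primal_value
    rw [matInner_slack] at h1
    simp only [sub_mul, Finset.sum_sub_distrib]
    linarith

/-- A vector of the kernel of `Z` on which all balanced forms vanish, except that inactive
constraints may be negative, gives a good point. -/
lemma isGood_rescale (h : P.OptimalPair X Z μ) {k : Fin m} {x : Fin n → 𝕜}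
    (hx : Z *ᵥ x = 0) (hx0 : x ≠ 0)
    (hbal : ∀ j, quadForm (P.balanced X k j) x = 0 ∨
      (P.isEq j = false ∧ μ j = 0 ∧ quadForm (P.balanced X k j) x ≤ 0)) :
    P.IsGood X (P.rescale X k x) := by
  obtain ⟨δ, hδ, hδX, hδ0⟩ := h.exists_weights
  set r := quadForm (P.A k) x / matInner (P.A k) X with hr
  have hq : ∀ j, quadForm (P.A j) x = r * matInner (P.A j) X ∨
      (P.isEq j = false ∧ μ j = 0 ∧ quadForm (P.A j) x ≤ r * matInner (P.A j) X) := by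
    intro j
    have e : quadForm (P.balanced X k j) x = quadForm (P.A j) x - r * matInner (P.A j) X := by
      rw [quadForm_balanced, hr]; ring
    simpa only [sub_eq_zero, sub_nonpos, e] using hbal j
  have hrpos : 0 < r := by
    have h1 : ∑ j, δ j * quadForm (P.A j) x ≤ r * ∑ j, δ j * matInner (P.A j) X := by
      rw [Finset.mul_sum]
      refine Finset.sum_le_sum fun j _ => ?_
      rcases hq j with h2 | ⟨h2, h3, h4⟩
      · rw [h2]; exact le_of_eq (by ring)
      · nlinarith [hδ0 j h2 h3]
    exact pos_of_mul_pos_left ((hδ x hx hx0).trans_le h1) hδX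
  have hs : matInner (P.A k) X / quadForm (P.A k) x = r⁻¹ := by rw [hr, inv_div]
  have hval : ∀ A : Matrix (Fin n) (Fin n) 𝕜,
      quadForm A (P.rescale X k x) = r⁻¹ * quadForm A x := by
    intro A
    rw [rescale, quadForm_real_smul, hs, Real.sq_sqrt (inv_nonneg.2 hrpos.le)]
  have hq' : ∀ j, quadForm (P.A j) (P.rescale X k x) = matInner (P.A j) X ∨
      (P.isEq j = false ∧ μ j = 0 ∧
        quadForm (P.A j) (P.rescale X k x) ≤ matInner (P.A j) X) := by
    intro j
    rcases hq j with h2 | ⟨h2, h3, h4⟩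
    · left; rw [hval, h2, inv_mul_cancel_left₀ hrpos.ne']
    · refine Or.inr ⟨h2, h3, ?_⟩
      rw [hval, inv_mul_le_iff₀ hrpos]
      exact h4
  refine ⟨fun j => ?_, le_of_eq ?_⟩
  · have hj := h.primal.1.2 j
    rcases hq' j with h2 | ⟨h2, -, h4⟩
    · rwa [h2]
    · have := hj.le
      rw [Rel, if_neg (by simp [h2])]
      exact h4.trans this
  · rw [h.quadForm_objective (x := P.rescale X k x) (by rw [rescale, Matrix.mulVec_smul, hx,
      smul_zero]), h.primal_value]
    congr 1
    refine Finset.sum_congr rfl fun j _ => ?_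
    rcases hq' j with h2 | ⟨-, h3, -⟩
    · rw [h2]
    · rw [h3, zero_mul, zero_mul]

/-- If at most an inactive constraint is nonzero at `X`, the origin is good. -/
lemma isGood_zero (h : P.OptimalPair X Z μ) {i : Fin m} (hi : P.isEq i = false) (hμ : μ i = 0)
    (ht : ∀ k, k ≠ i → matInner (P.A k) X = 0) : P.IsGood X 0 := by
  obtain ⟨δ, -, hδX, hδ0⟩ := h.exists_weights
  have hsum : ∀ ν : Fin m → ℝ, ∑ j, ν j * matInner (P.A j) X = ν i * matInner (P.A i) X :=
    fun ν => Finset.sum_eq_single i (fun j _ hj => by rw [ht j hj, mul_zero]) (by simp)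
  have hti : 0 ≤ matInner (P.A i) X := by
    rw [hsum] at hδX
    exact nonneg_of_mul_nonneg_right hδX (hδ0 i hi hμ)
  refine ⟨fun j => ?_, ?_⟩
  · rw [quadForm_zero]
    have hj := h.primal.1.2 j
    by_cases hji : j = i
    · subst hji
      rw [Rel, if_neg (by simp [hi])]
      exact hti.trans hj.le
    · rwa [ht j hji] at hj
  · rw [quadForm_zero, h.primal_value, hsum, hμ]
    simp

lemma mulVec_eq_zero (h : P.OptimalPair X Z μ) {ι : Type} [Fintype ι] {w : ι → Fin n → 𝕜}
    (hw : X = ∑ l, outerSelf (w l)) (l : ι) : Z *ᵥ w l = 0 := by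
  have h1 := h.orthogonal
  rw [hw, matInner_sum_right] at h1
  simp only [matInner_outerSelf] at h1
  have h2 := (Finset.sum_eq_zero_iff_of_nonneg fun l _ =>
    h.slack_posSemidef.quadForm_nonneg (w l)).1 h1 l (Finset.mem_univ l)
  exact h.slack_posSemidef.mulVec_eq_zero h2

end OptimalPair

end HQP

/-! ### Property I as an obstruction -/

section Kernel

variable {𝕜 : Type} [RCLike 𝕜] {n : ℕ} {x₁ x₂ : Fin n → 𝕜}

lemma finrank_span_pair (h : ∀ a b : 𝕜, a • x₁ + b • x₂ = 0 → a = 0 ∧ b = 0) :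
    Module.finrank 𝕜 (Submodule.span 𝕜 {x₁, x₂}) = 2 := by
  have hli : LinearIndependent 𝕜 ![x₁, x₂] := LinearIndependent.pair_iff.2 h
  have hr : Set.range ![x₁, x₂] = {x₁, x₂} := by simp [Set.pair_comm]
  rw [← hr]
  simpa using finrank_span_eq_card hli

/-- If two independent vectors lie in the kernel, they span it exactly if the rank is `n - 2`. -/
lemma rank_add_two_iff {Z : Matrix (Fin n) (Fin n) 𝕜}
    (h : ∀ a b : 𝕜, a • x₁ + b • x₂ = 0 → a = 0 ∧ b = 0) (h₁ : Z *ᵥ x₁ = 0) (h₂ : Z *ᵥ x₂ = 0) :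
    Z.rank + 2 = n ↔ ∀ x, Z *ᵥ x = 0 → ∃ a b : 𝕜, a • x₁ + b • x₂ = x := by
  have hle : Submodule.span 𝕜 {x₁, x₂} ≤ LinearMap.ker Z.mulVecLin := by
    rw [Submodule.span_le]
    rintro x (rfl | rfl) <;> simpa
  have hdim := LinearMap.finrank_range_add_finrank_ker Z.mulVecLin
  rw [Module.finrank_fin_fun, ← Matrix.rank] at hdim
  constructor
  · intro hr x hx
    have heq := Submodule.eq_of_le_of_finrank_eq hle (by rw [finrank_span_pair h]; omega)
    have : x ∈ Submodule.span 𝕜 {x₁, x₂} := by rw [heq]; simpa using hx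
    exact Submodule.mem_span_pair.1 this
  · intro hx
    have heq : Submodule.span 𝕜 {x₁, x₂} = LinearMap.ker Z.mulVecLin :=
      le_antisymm hle fun x hxk => Submodule.mem_span_pair.2 (hx x (by simpa using hxk))
    rw [← heq, finrank_span_pair h] at hdim
    exact hdim

lemma rank_outerSelf_add_outerSelf (h : ∀ a b : 𝕜, a • x₁ + b • x₂ = 0 → a = 0 ∧ b = 0) :
    (outerSelf x₁ + outerSelf x₂).rank = 2 := by
  have hli : LinearIndependent 𝕜 ![x₁, x₂] := LinearIndependent.pair_iff.2 h
  set G : Matrix (Fin 2) (Fin n) 𝕜 := Matrix.of ![x₁, x₂] with hG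
  have hX : outerSelf x₁ + outerSelf x₂ = Gᵀ * Gᵀᴴ := by
    ext i j
    simp [outerSelf, Matrix.vecMulVec, Matrix.mul_apply, hG, Fin.sum_univ_two]
  rw [hX, Matrix.rank_self_mul_conjTranspose, Matrix.rank_transpose]
  have : LinearIndependent 𝕜 G.row := hli
  simpa using this.rank_matrix

lemma outerSelf_smul (c : 𝕜) (x : Fin n → 𝕜) :
    outerSelf (c • x) = ((‖c‖ ^ 2 : ℝ) : 𝕜) • outerSelf x := by
  ext i j
  simp only [outerSelf, Matrix.vecMulVec_apply, Matrix.smul_apply, Pi.smul_apply, Pi.star_apply,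
    smul_eq_mul, star_mul, ← mul_star_eq_norm_sq]
  ring

end Kernel

namespace HQP

variable {𝕜 : Type} [RCLike 𝕜] {n : ℕ}

/-- A common form of Property I for the real and the complex problem. A real problem with three
constraints is viewed as a problem with four constraints, with the zero matrix as `A₁`. -/
def GeneralProperty (P : HQP 𝕜 n 4) (X Z : Matrix (Fin n) (Fin n) 𝕜) (μ : Fin 4 → ℝ) : Prop :=
  (∀ i, P.isEq i = false → μ i ≠ 0) ∧ Z.rank + 2 = n ∧ X.rank = 2 ∧
  ∃ x₁ x₂ : Fin n → 𝕜, X = outerSelf x₁ + outerSelf x₂ ∧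
    diagForm (P.reduced 3 0) (P.reduced 3 1) x₁ = 0 ∧
    diagForm (P.reduced 3 0) (P.reduced 3 1) x₂ = 0 ∧
    ‖upForm (P.reduced 3 0) (P.reduced 3 1) x₁ x₂‖ ≠
      ‖lowForm (P.reduced 3 0) (P.reduced 3 1) x₂ x₁‖ ∧
    quadForm (P.reduced 3 2) x₁ * quadForm (P.reduced 3 2) x₂ < 0

lemma reduced_isHermitian {m : ℕ} (P : HQP 𝕜 n m) (k j : Fin m) :
    (P.reduced k j).IsHermitian := by
  rw [reduced, Matrix.IsHermitian, Matrix.conjTranspose_sub, Matrix.conjTranspose_smul,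
    (P.hermitian j).eq, (P.hermitian k).eq, RCLike.star_def, RCLike.conj_ofReal]

lemma quadForm_reduced {m : ℕ} (P : HQP 𝕜 n m) (k j : Fin m) (x : Fin n → 𝕜) :
    quadForm (P.reduced k j) x =
      quadForm (P.A j) x - P.c j / P.c k * quadForm (P.A k) x := by
  rw [reduced, quadForm_sub_matrix, quadForm_ofReal_smul_matrix]

/-- Over the reals, the constraint number `1` is the dummy constraint by which a problem with three
constraints is extended. The condition `RCLike.I = 0` distinguishes the reals. -/
def IsPadded (P : HQP 𝕜 n 4) : Prop := (RCLike.I : 𝕜) = 0 → P.A 1 = 0 ∧ P.isEq 1 = true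

namespace OptimalPair

variable {P : HQP 𝕜 n 4} {X Z : Matrix (Fin n) (Fin n) 𝕜} {μ : Fin 4 → ℝ}

lemma active (h : P.OptimalPair X Z μ) {i : Fin 4} (hi : P.isEq i = false → μ i ≠ 0) :
    matInner (P.A i) X = P.c i := by
  cases hb : P.isEq i
  · have := (mul_eq_zero.1 (h.complementary i)).resolve_left (hi hb)
    linarith
  · exact (h.primal.1.2 i).eq hb

lemma matInner_one (h : P.OptimalPair X Z μ) (hp : P.IsPadded) (hI : (RCLike.I : 𝕜) = 0) :
    matInner (P.A 1) X = 0 ∧ P.c 1 = 0 := by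
  have h1 : matInner (P.A 1) X = 0 := by rw [(hp hI).1]; simp [matInner]
  exact ⟨h1, by rw [← (h.primal.1.2 1).eq (hp hI).2, h1]⟩

lemma balanced_one (h : P.OptimalPair X Z μ) (hp : P.IsPadded) (k : Fin 4)
    (hI : (RCLike.I : 𝕜) = 0) : P.balanced X k 1 = 0 := by
  rw [balanced, (h.matInner_one hp hI).1, (hp hI).1]
  simp

/-- Property I rules out good points: such a point would lie in the kernel of `Z`, where the zeros
of the first two forms are the multiples of `x₁` and of `x₂`. -/
theorem not_isGood (h : P.OptimalPair X Z μ) (hc : P.c 3 ≠ 0)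
    (hG : P.GeneralProperty X Z μ) (x : Fin n → 𝕜) : ¬ P.IsGood X x := by
  rintro ⟨hx, hobj⟩
  obtain ⟨hact, hZ, -, x₁, x₂, hX, hx₁, hx₂, hne, hsign⟩ := hG
  have hq : ∀ j, quadForm (P.A j) x ≤ P.c j := fun j => (hx j).le
  have hterm : ∀ j, μ j * (quadForm (P.A j) x - P.c j) ≤ 0 := by
    intro j
    cases hb : P.isEq j
    · exact mul_nonpos_of_nonneg_of_nonpos (h.nonneg j hb) (sub_nonpos.2 (hq j))
    · rw [(hx j).eq hb, sub_self, mul_zero]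
  have hZx : quadForm Z x ≤ ∑ j, μ j * (quadForm (P.A j) x - P.c j) := by
    have h1 := h.primal_value
    simp only [h.active (hact _)] at h1
    rw [h.slack_eq, quadForm_slack]
    simp only [mul_sub, Finset.sum_sub_distrib]
    linarith
  have hsum : ∑ j, μ j * (quadForm (P.A j) x - P.c j) = 0 :=
    le_antisymm (Finset.sum_nonpos fun j _ => hterm j)
      ((h.slack_posSemidef.quadForm_nonneg x).trans hZx)
  have hzero := (Finset.sum_eq_zero_iff_of_nonpos fun j _ => hterm j).1 hsum
  have htight : ∀ j, quadForm (P.A j) x = P.c j := by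
    intro j
    cases hb : P.isEq j
    · have := (mul_eq_zero.1 (hzero j (Finset.mem_univ j))).resolve_left (hact j hb)
      linarith
    · exact (hx j).eq hb
  have hker : Z *ᵥ x = 0 := h.slack_posSemidef.mulVec_eq_zero
    (le_antisymm (hZx.trans hsum.le) (h.slack_posSemidef.quadForm_nonneg x))
  have hX' : X = ∑ l, outerSelf (![x₁, x₂] l) := by rw [hX, Fin.sum_univ_two]; rfl
  obtain ⟨a, b, rfl⟩ := (rank_add_two_iff (pair_independent hsign)
    (h.mulVec_eq_zero hX' 0) (h.mulVec_eq_zero hX' 1)).1 hZ x hker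
  have hred : ∀ j, quadForm (P.reduced 3 j) (a • x₁ + b • x₂) = 0 := by
    intro j
    rw [quadForm_reduced, htight, htight, div_mul_cancel₀ _ hc, sub_self]
  have hd := diagForm_eq_zero (P.reduced_isHermitian 3 0) (P.reduced_isHermitian 3 1)
    (hred 0) (hred 1)
  have h2 := hred 2
  have hx0 : a • x₁ + b • x₂ ≠ 0 := by
    intro h0
    have := htight 3
    rw [h0, quadForm_zero] at this
    exact hc this.symm
  have hs₁ : quadForm (P.reduced 3 2) x₁ ≠ 0 := left_ne_zero_of_mul hsign.ne
  have hs₂ : quadForm (P.reduced 3 2) x₂ ≠ 0 := right_ne_zero_of_mul hsign.ne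
  rcases mul_eq_zero_of_diagForm (P.reduced_isHermitian 3 0) hx₁ hx₂ hne hd with rfl | rfl
  · rw [zero_smul, zero_add] at h2 hx0
    rw [quadForm_smul] at h2
    have := (mul_eq_zero.1 h2).resolve_right hs₂
    exact hx0 (by rw [norm_eq_zero.1 (pow_eq_zero_iff two_ne_zero |>.1 this), zero_smul])
  · rw [zero_smul, add_zero] at h2 hx0
    rw [quadForm_smul] at h2
    have := (mul_eq_zero.1 h2).resolve_right hs₁
    exact hx0 (by rw [norm_eq_zero.1 (pow_eq_zero_iff two_ne_zero |>.1 this), zero_smul])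

end OptimalPair

end HQP

/-! ### Without Property I some candidate is good -/

section Third

variable {𝕜 : Type} [RCLike 𝕜] {n : ℕ}

/-- The vector `z`, modified by a multiple of `y` so that one of its cross terms with `x`
vanishes. -/
noncomputable def adjust (B₁ B₂ : Matrix (Fin n) (Fin n) 𝕜) (x y z : Fin n → 𝕜) : Fin n → 𝕜 :=
  z - (upForm B₁ B₂ x z / upForm B₁ B₂ x y) • y

lemma upForm_adjust {B₁ B₂ : Matrix (Fin n) (Fin n) 𝕜} {x y : Fin n → 𝕜} (z : Fin n → 𝕜)
    (h : upForm B₁ B₂ x y ≠ 0) : upForm B₁ B₂ x (adjust B₁ B₂ x y z) = 0 := by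
  have : upForm B₁ B₂ x (adjust B₁ B₂ x y z) = upForm B₁ B₂ x z -
      upForm B₁ B₂ x z / upForm B₁ B₂ x y * upForm B₁ B₂ x y := by
    rw [adjust]
    generalize upForm B₁ B₂ x z / upForm B₁ B₂ x y = s
    simp only [upForm, sesq_sub_right, sesq_smul_right]
    ring
  rw [this, div_mul_cancel₀ _ h, sub_self]

lemma mulVec_combine {Z : Matrix (Fin n) (Fin n) 𝕜} {x : Fin 3 → Fin n → 𝕜}
    (hx : ∀ p, Z *ᵥ x p = 0) (c : Fin 3 → 𝕜) : Z *ᵥ combine x c = 0 := by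
  simp [combine, Matrix.mulVec_add, Matrix.mulVec_smul, hx]

/-- If vectors with `∑ q(wₗ) = 0` are not all zeros of the quadratic form `q`, then `q` takes values
of both signs on them. -/
lemma exists_opposite_sign {ι : Type} [Fintype ι] {q : ι → ℝ} (hq : ∑ l, q l = 0) {l : ι}
    (hl : q l ≠ 0) : ∃ l', q l * q l' < 0 := by
  by_contra! hcon
  have h1 : q l * ∑ l', q l' = 0 := by rw [hq, mul_zero]
  rw [Finset.mul_sum, Finset.sum_eq_zero_iff_of_nonneg fun i _ => hcon i] at h1
  exact hl (mul_self_eq_zero.1 (h1 l (Finset.mem_univ l)))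

lemma exists_nonpos {w : Fin n → Fin n → 𝕜} {B : Matrix (Fin n) (Fin n) 𝕜}
    (hw : ∑ l, quadForm B (w l) = 0) (h0 : ∃ l, w l ≠ 0) : ∃ l, w l ≠ 0 ∧ quadForm B (w l) ≤ 0 := by
  obtain ⟨l, hl⟩ := h0
  by_cases hq : quadForm B (w l) = 0
  · exact ⟨l, hl, hq.le⟩
  · obtain ⟨l', hl'⟩ := exists_opposite_sign (q := fun l => quadForm B (w l)) hw hq
    rcases lt_or_gt_of_ne hq with h | h
    · exact ⟨l, hl, h.le⟩
    · have h' : quadForm B (w l') < 0 := by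
        by_contra hge
        exact hl'.not_ge (mul_nonneg h.le (not_lt.1 hge))
      refine ⟨l', ?_, h'.le⟩
      intro h0
      rw [h0, quadForm_zero] at h'
      exact h'.false

end Third

namespace HQP

variable {𝕜 : Type} [RCLike 𝕜] {n : ℕ}

/-- Every decomposition of `X` into vectors on which the forms number `j₁` and `j₂` vanish, together
with a generating set `N` of the kernel of `Z`, gives a good candidate. -/
def FindsGood (P : HQP 𝕜 n 4) (X Z : Matrix (Fin n) (Fin n) 𝕜) (k i j₁ j₂ : Fin 4) : Prop :=
  ∀ W N : Fin n → Fin n → 𝕜, X = ∑ l, outerSelf (W l) →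
    (∀ l, quadForm (P.balanced X k j₁) (W l) = 0) →
    (∀ l, quadForm (P.balanced X k j₂) (W l) = 0) →
    (∀ l, Z *ᵥ N l = 0) → (∀ x, Z *ᵥ x = 0 → x ∈ Submodule.span 𝕜 (Set.range N)) →
    ∃ l₁ l₂ l₃ : Fin n,
      let y := ![W l₁, W l₂, adjust (P.balanced X k j₁) (P.balanced X k j₂) (W l₁) (W l₂) (N l₃)]
      ∃ c ∈ candidates RCLike.I realRoot (gram (P.balanced X k j₁) y)
        (gram (P.balanced X k j₂) y) (gram (P.balanced X k i) y),
        P.IsGood X (P.rescale X k (combine y c))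

namespace OptimalPair

variable {P : HQP 𝕜 n 4} {X Z : Matrix (Fin n) (Fin n) 𝕜} {μ : Fin 4 → ℝ}

lemma sum_quadForm_balanced {k : Fin 4} (hk : matInner (P.A k) X ≠ 0) (j : Fin 4)
    {W : Fin n → Fin n → 𝕜} (hW : X = ∑ l, outerSelf (W l)) :
    ∑ l, quadForm (P.balanced X k j) (W l) = 0 := by
  have := P.matInner_balanced j hk
  conv at this => lhs; rw [hW, matInner_sum_right]
  simp only [matInner_outerSelf] at this
  rwa [← hW] at this

lemma exists_ne_zero {k : Fin 4} (hk : matInner (P.A k) X ≠ 0)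
    {W : Fin n → Fin n → 𝕜} (hW : X = ∑ l, outerSelf (W l)) : ∃ l, W l ≠ 0 := by
  by_contra! hcon
  apply hk
  rw [hW]
  simp [hcon, outerSelf_zero, matInner_zero_right]

/-- An inactive constraint may be violated downwards, so the vectors of the decomposition
suffice. -/
lemma findsGood_of_inactive (h : P.OptimalPair X Z μ) {k i j₁ j₂ : Fin 4}
    (hk : matInner (P.A k) X ≠ 0) (hi : P.isEq i = false) (hμ : μ i = 0)
    (hall : ∀ j, j = k ∨ j = i ∨ j = j₁ ∨ j = j₂) : P.FindsGood X Z k i j₁ j₂ := by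
  intro W N hW h1 h2 hN hspan
  obtain ⟨l, hl, hle⟩ := exists_nonpos (sum_quadForm_balanced hk i hW) (exists_ne_zero hk hW)
  obtain ⟨c, hc, hc'⟩ := exists_candidate_fst (B₁ := P.balanced X k j₁) (B₂ := P.balanced X k j₂)
    (B := P.balanced X k i)
    (x := ![W l, W l, adjust (P.balanced X k j₁) (P.balanced X k j₂) (W l) (W l) (N l)])
  refine ⟨l, l, l, c, hc, ?_⟩
  rw [hc']
  refine h.isGood_rescale (h.mulVec_eq_zero hW l) hl fun j => ?_
  rcases hall j with rfl | rfl | rfl | rfl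
  · exact Or.inl (P.quadForm_balanced_self hk _)
  · exact Or.inr ⟨hi, hμ, hle⟩
  · exact Or.inl (h1 l)
  · exact Or.inl (h2 l)

lemma isGood_of_zero (h : P.OptimalPair X Z μ) (hp : P.IsPadded)
    (h3 : matInner (P.A 3) X ≠ 0) {x : Fin n → 𝕜} (hx : Z *ᵥ x = 0) (hx0 : x ≠ 0)
    (hd : diagForm (P.balanced X 3 0) (P.balanced X 3 1) x = 0)
    (h2 : quadForm (P.balanced X 3 2) x = 0) : P.IsGood X (P.rescale X 3 x) := by
  obtain ⟨h0, h1⟩ := quadForm_eq_zero_of_diagForm (P.balanced_isHermitian X 3 0)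
    (P.balanced_isHermitian X 3 1) (h.balanced_one hp 3) hd
  refine h.isGood_rescale hx hx0 fun j => Or.inl ?_
  fin_cases j
  exacts [h0, h1, h2, P.quadForm_balanced_self h3 _]

/-- If the vectors of a decomposition of `X` lie in the span of two of them, and these two are the
only zeros of the first two forms there, then the pair has Property I. -/
lemma generalProperty_of_span (h : P.OptimalPair X Z μ)
    (hact : ∀ i, P.isEq i = false → μ i ≠ 0) {W : Fin n → Fin n → 𝕜}
    (hW : X = ∑ l, outerSelf (W l))
    (hd : ∀ l, diagForm (P.reduced 3 0) (P.reduced 3 1) (W l) = 0) {l₁ l₂ : Fin n}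
    (hne : ‖upForm (P.reduced 3 0) (P.reduced 3 1) (W l₁) (W l₂)‖ ≠
      ‖lowForm (P.reduced 3 0) (P.reduced 3 1) (W l₂) (W l₁)‖)
    (hsign : quadForm (P.reduced 3 2) (W l₁) * quadForm (P.reduced 3 2) (W l₂) < 0)
    (hspan : ∀ x, Z *ᵥ x = 0 → ∃ a b : 𝕜, a • W l₁ + b • W l₂ = x) :
    P.GeneralProperty X Z μ := by
  have hker := h.mulVec_eq_zero hW
  have hind := pair_independent hsign
  choose a b hab using fun l => hspan (W l) (hker l)
  have hprod : ∀ l, a l = 0 ∨ b l = 0 := fun l =>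
    mul_eq_zero_of_diagForm (P.reduced_isHermitian 3 0) (hd l₁) (hd l₂) hne
      (by rw [hab l]; exact hd l)
  have houter : ∀ l, outerSelf (W l) = ((‖a l‖ ^ 2 : ℝ) : 𝕜) • outerSelf (W l₁) +
      ((‖b l‖ ^ 2 : ℝ) : 𝕜) • outerSelf (W l₂) := by
    intro l
    rw [← hab l]
    rcases hprod l with h0 | h0 <;> rw [h0] <;> simp [outerSelf_smul]
  have hpos : ∀ c : Fin n → 𝕜, ∀ l, c l ≠ 0 → 0 < ∑ l, ‖c l‖ ^ 2 := fun c l hl =>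
    Finset.sum_pos' (fun _ _ => by positivity) ⟨l, Finset.mem_univ l, by positivity⟩
  have hα : 0 < ∑ l, ‖a l‖ ^ 2 := by
    refine hpos a l₁ fun h0 => one_ne_zero (α := 𝕜) (hind 1 (-b l₁) ?_).1
    have := hab l₁
    rw [h0, zero_smul, zero_add] at this
    rw [one_smul, neg_smul, this, add_neg_cancel]
  have hβ : 0 < ∑ l, ‖b l‖ ^ 2 := by
    refine hpos b l₂ fun h0 => one_ne_zero (α := 𝕜) (hind (-a l₂) 1 ?_).2
    have := hab l₂
    rw [h0, zero_smul, add_zero] at this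
    rw [one_smul, neg_smul, this, neg_add_cancel]
  set α := √(∑ l, ‖a l‖ ^ 2) with hα'
  set β := √(∑ l, ‖b l‖ ^ 2) with hβ'
  have hα0 : 0 < α := Real.sqrt_pos.2 hα
  have hβ0 : 0 < β := Real.sqrt_pos.2 hβ
  have hX : X = outerSelf ((α : 𝕜) • W l₁) + outerSelf ((β : 𝕜) • W l₂) := by
    rw [outerSelf_smul, outerSelf_smul, RCLike.norm_ofReal, RCLike.norm_ofReal, sq_abs, sq_abs,
      hα', hβ', Real.sq_sqrt hα.le, Real.sq_sqrt hβ.le, hW,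
      Finset.sum_congr rfl fun l _ => houter l]
    simp only [Finset.sum_add_distrib, ← Finset.sum_smul, RCLike.ofReal_sum]
  have hsign' : quadForm (P.reduced 3 2) ((α : 𝕜) • W l₁) *
      quadForm (P.reduced 3 2) ((β : 𝕜) • W l₂) < 0 := by
    rw [quadForm_real_smul, quadForm_real_smul]
    have : 0 < α ^ 2 * β ^ 2 := by positivity
    nlinarith
  refine ⟨hact, (rank_add_two_iff hind (hker l₁) (hker l₂)).2 hspan, ?_, _, _, hX, ?_, ?_, ?_,
    hsign'⟩
  · rw [hX]
    exact rank_outerSelf_add_outerSelf (pair_independent hsign')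
  · rw [diagForm_smul, hd, mul_zero]
  · rw [diagForm_smul, hd, mul_zero]
  · have hu : ‖upForm (P.reduced 3 0) (P.reduced 3 1) ((α : 𝕜) • W l₁) ((β : 𝕜) • W l₂)‖ =
        α * β * ‖upForm (P.reduced 3 0) (P.reduced 3 1) (W l₁) (W l₂)‖ := by
      have : upForm (P.reduced 3 0) (P.reduced 3 1) ((α : 𝕜) • W l₁) ((β : 𝕜) • W l₂) =
          star (α : 𝕜) * β * upForm (P.reduced 3 0) (P.reduced 3 1) (W l₁) (W l₂) := by
        simp only [upForm, sesq_smul_left, sesq_smul_right]; ring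
      rw [this, norm_mul, norm_mul, norm_star, RCLike.norm_ofReal, RCLike.norm_ofReal,
        abs_of_pos hα0, abs_of_pos hβ0]
    have hl : ‖lowForm (P.reduced 3 0) (P.reduced 3 1) ((β : 𝕜) • W l₂) ((α : 𝕜) • W l₁)‖ =
        α * β * ‖lowForm (P.reduced 3 0) (P.reduced 3 1) (W l₂) (W l₁)‖ := by
      have : lowForm (P.reduced 3 0) (P.reduced 3 1) ((β : 𝕜) • W l₂) ((α : 𝕜) • W l₁) =
          star (β : 𝕜) * α * lowForm (P.reduced 3 0) (P.reduced 3 1) (W l₂) (W l₁) := by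
        simp only [lowForm, sesq_smul_left, sesq_smul_right]; ring
      rw [this, norm_mul, norm_mul, norm_star, RCLike.norm_ofReal, RCLike.norm_ofReal,
        abs_of_pos hα0, abs_of_pos hβ0, mul_comm β α]
    rw [hu, hl]
    exact fun h0 => hne (mul_left_cancel₀ (mul_pos hα0 hβ0).ne' h0)

/-- After exchanging two vectors if necessary, the first cross term dominates. -/
lemma exists_dominant {B₁ B₂ B : Matrix (Fin n) (Fin n) 𝕜} {W : Fin n → Fin n → 𝕜} {l₁ l₂ : Fin n}
    (hne : ‖upForm B₁ B₂ (W l₁) (W l₂)‖ ≠ ‖lowForm B₁ B₂ (W l₂) (W l₁)‖)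
    (hsign : quadForm B (W l₁) * quadForm B (W l₂) < 0) : ∃ l₁ l₂,
      ‖lowForm B₁ B₂ (W l₂) (W l₁)‖ < ‖upForm B₁ B₂ (W l₁) (W l₂)‖ ∧
      quadForm B (W l₁) * quadForm B (W l₂) < 0 := by
  rcases lt_or_gt_of_ne hne.symm with hlt | hgt
  · exact ⟨l₁, l₂, hlt, hsign⟩
  · rcases RCLike.I_mul_I (K := 𝕜) with hI | hI
    · rw [lowForm_eq_zero hI, norm_zero] at hgt
      exact absurd hgt (norm_nonneg _).not_gt
    · have e : ∀ x y, upForm B₁ B₂ x y = lowForm B₁ B₂ x y := fun x y => by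
        rw [upForm, lowForm, hI]; norm_num
      refine ⟨l₂, l₁, ?_, by rwa [mul_comm]⟩
      rwa [e, ← e (W l₁)]

/-- If all multipliers of inequalities are nonzero and Property I fails, a candidate is a common
zero of the three balanced forms: a vector of the decomposition, a point in the span of two of them,
or a point that involves a third vector of the kernel of `Z`. -/
lemma findsGood_of_active (h : P.OptimalPair X Z μ) (hp : P.IsPadded) (hc : P.c 3 ≠ 0)
    (hact : ∀ i, P.isEq i = false → μ i ≠ 0) (hG : ¬ P.GeneralProperty X Z μ) :
    P.FindsGood X Z 3 2 0 1 := by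
  intro W N hW h0 h1 hN hspan
  have ht : ∀ i, matInner (P.A i) X = P.c i := fun i => h.active (hact i)
  have hk : matInner (P.A 3) X ≠ 0 := by rwa [ht]
  have hker := h.mulVec_eq_zero hW
  have hred : ∀ j, P.reduced 3 j = P.balanced X 3 j := fun j => by
    rw [reduced, balanced, ht, ht]
  have hd : ∀ l, diagForm (P.balanced X 3 0) (P.balanced X 3 1) (W l) = 0 := fun l =>
    diagForm_eq_zero (P.balanced_isHermitian X 3 0) (P.balanced_isHermitian X 3 1) (h0 l) (h1 l)
  obtain ⟨l, hl⟩ := exists_ne_zero hk hW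
  by_cases hq : quadForm (P.balanced X 3 2) (W l) = 0
  · obtain ⟨c, hcm, hc'⟩ := exists_candidate_fst (B₁ := P.balanced X 3 0)
      (B₂ := P.balanced X 3 1) (B := P.balanced X 3 2)
      (x := ![W l, W l, adjust (P.balanced X 3 0) (P.balanced X 3 1) (W l) (W l) (N l)])
    refine ⟨l, l, l, c, hcm, ?_⟩
    rw [hc']
    exact h.isGood_of_zero hp hk (hker l) hl (hd l) hq
  obtain ⟨l', hsign⟩ := exists_opposite_sign
    (q := fun l => quadForm (P.balanced X 3 2) (W l)) (sum_quadForm_balanced hk 2 hW) hq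
  by_cases heq : ‖upForm (P.balanced X 3 0) (P.balanced X 3 1) (W l) (W l')‖ =
      ‖lowForm (P.balanced X 3 0) (P.balanced X 3 1) (W l') (W l)‖
  · set y := ![W l, W l', adjust (P.balanced X 3 0) (P.balanced X 3 1) (W l) (W l') (N l)]
      with hy
    obtain ⟨c, hcm, hc1, hc2, w, hw⟩ := exists_candidate_pair (x := y)
      (P.balanced_isHermitian X 3 0) (P.balanced_isHermitian X 3 2) (hd l) (hd l') heq hsign
    refine ⟨l, l', l, c, hcm, ?_⟩
    refine h.isGood_of_zero hp hk ?_ ?_ hc2 hc1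
    · rw [hw, Matrix.mulVec_add, Matrix.mulVec_smul]
      change w • (Z *ᵥ W l) + Z *ᵥ W l' = 0
      rw [hker, hker, smul_zero, zero_add]
    · rw [hw]
      intro hz
      exact one_ne_zero (α := 𝕜) (pair_independent hsign w 1 (by rw [one_smul]; exact hz)).2
  obtain ⟨l₁, l₂, hlt, hsign⟩ := exists_dominant heq hsign
  by_cases hall : ∀ l₃, N l₃ ∈ Submodule.span 𝕜 {W l₁, W l₂}
  · refine absurd ?_ hG
    refine h.generalProperty_of_span hact hW (l₁ := l₁) (l₂ := l₂) ?_ ?_ ?_ ?_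
    · simpa only [hred] using hd
    · simpa only [hred] using hlt.ne'
    · simpa only [hred] using hsign
    · intro x hx
      refine Submodule.mem_span_pair.1 (Submodule.span_le.2 ?_ (hspan x hx))
      rintro _ ⟨l₃, rfl⟩
      exact hall l₃
  push Not at hall
  obtain ⟨l₃, hl₃⟩ := hall
  have hup : upForm (P.balanced X 3 0) (P.balanced X 3 1) (W l₁) (W l₂) ≠ 0 :=
    norm_ne_zero_iff.1 ((norm_nonneg _).trans_lt hlt).ne'
  set y := ![W l₁, W l₂, adjust (P.balanced X 3 0) (P.balanced X 3 1) (W l₁) (W l₂) (N l₃)]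
    with hy
  obtain ⟨c, hcm, hc1, hc2, hc3⟩ := exists_candidate_triple (x := y)
    (P.balanced_isHermitian X 3 0) (P.balanced_isHermitian X 3 2) (hd l₁) (hd l₂)
    (upForm_adjust (N l₃) hup) hlt hsign
  refine ⟨l₁, l₂, l₃, c, hcm, h.isGood_of_zero hp hk (mulVec_combine ?_ c) ?_ hc2 hc1⟩
  · intro p
    fin_cases p
    · exact hker l₁
    · exact hker l₂
    · change Z *ᵥ adjust _ _ _ _ _ = 0
      rw [adjust, Matrix.mulVec_sub, Matrix.mulVec_smul, hN, hker, smul_zero, sub_zero]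
  · intro hz
    refine hl₃ (Submodule.mem_span_pair.2 ?_)
    set s := upForm (P.balanced X 3 0) (P.balanced X 3 1) (W l₁) (N l₃) /
      upForm (P.balanced X 3 0) (P.balanced X 3 1) (W l₁) (W l₂) with hs
    have hz' : c 0 • W l₁ + c 1 • W l₂ + c 2 • (N l₃ - s • W l₂) = 0 := hz
    refine ⟨-(c 2)⁻¹ * c 0, s - (c 2)⁻¹ * c 1, ?_⟩
    have := congrArg (fun v => (c 2)⁻¹ • v) hz'
    simp only [smul_add, smul_smul, inv_mul_cancel₀ hc3, one_smul, smul_zero] at this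
    rw [sub_smul, neg_mul, neg_smul]
    rw [← sub_eq_zero, ← neg_eq_zero, ← this]
    abel

/-- Without Property I, the origin is good or some choice of the balancing form `k`, of the form `i`
treated last, and of the forms `j₁`, `j₂` leads to a good candidate. -/
theorem isGood_zero_or_findsGood (h : P.OptimalPair X Z μ) (hp : P.IsPadded) (hc : P.c 3 ≠ 0)
    (hG : ¬ P.GeneralProperty X Z μ) : P.IsGood X 0 ∨ ∃ k i j₁ j₂ : Fin 4,
      ((RCLike.I : 𝕜) = 0 → j₂ = 1) ∧ matInner (P.A k) X ≠ 0 ∧ P.FindsGood X Z k i j₁ j₂ := by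
  by_cases hact : ∀ i, P.isEq i = false → μ i ≠ 0
  · refine Or.inr ⟨3, 2, 0, 1, fun _ => rfl, ?_, h.findsGood_of_active hp hc hact hG⟩
    rwa [h.active (hact 3)]
  push Not at hact
  obtain ⟨i, hi, hμ⟩ := hact
  by_cases ht : ∀ k, k ≠ i → matInner (P.A k) X = 0
  · exact Or.inl (h.isGood_zero hi hμ ht)
  push Not at ht
  obtain ⟨k, hki, hk⟩ := ht
  -- over the reals the dummy constraint is neither `k` nor `i`, and it can be taken as `j₂`
  have hperm : ∀ k i : Fin 4, k ≠ i → ∃ j₁ j₂, (∀ j, j = k ∨ j = i ∨ j = j₁ ∨ j = j₂) ∧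
      (k ≠ 1 → i ≠ 1 → j₂ = 1) := by decide
  obtain ⟨j₁, j₂, hall, hj⟩ := hperm k i hki
  refine Or.inr ⟨k, i, j₁, j₂, fun hI => hj ?_ ?_, hk,
    h.findsGood_of_inactive hk hi hμ hall⟩
  · rintro rfl
    exact hk (h.matInner_one hp hI).1
  · rintro rfl
    rw [(hp hI).2] at hi
    exact Bool.noConfusion hi

end OptimalPair

end HQP

/-! ### Vectors and matrices in the memory -/

namespace RealRAM

variable {𝕜 : Type}

/-- Column `c` of array `a`. -/
def colOf (n : ℕ) (m : Mem 𝕜) (a c : ℕ) : Fin n → 𝕜 := fun i => m a i c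

/-- The leading `n × n` block of array `a`. -/
def matOf (n : ℕ) (m : Mem 𝕜) (a : ℕ) : Matrix (Fin n) (Fin n) 𝕜 := Matrix.of fun i j => m a i j

/-- The memory transformation changes only arrays whose number is in `S`. -/
def Act.Modifies (S : Set ℕ) (F : Act 𝕜) : Prop := ∀ ρ m a, a ∉ S → F ρ m a = m a

lemma Act.Modifies.mono {S T : Set ℕ} {F : Act 𝕜} (h : F.Modifies S) (hST : S ⊆ T) :
    F.Modifies T := fun ρ m a ha => h ρ m a fun h' => ha (hST h')

lemma Act.Modifies.then {S : Set ℕ} {F G : Act 𝕜} (hF : F.Modifies S) (hG : G.Modifies S) :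
    (F.then G).Modifies S := fun ρ m a ha => (hG ρ _ a ha).trans (hF ρ m a ha)

lemma Act.Modifies.skip {S : Set ℕ} : (Act.skip : Act 𝕜).Modifies S := fun _ _ _ _ => rfl

lemma Act.Modifies.list {S : Set ℕ} {l : List (Act 𝕜)} (hl : ∀ F ∈ l, F.Modifies S) :
    (Act.list l).Modifies S := by
  induction l with
  | nil => exact Act.Modifies.skip
  | cons F l ih =>
    exact Act.Modifies.then (F := F) (G := Act.list l) (hl F (by simp))
      (ih fun G hG => hl G (by simp [hG]))

lemma Act.Modifies.loop {S : Set ℕ} {r : ℕ} {F : Act 𝕜} (hF : F.Modifies S) :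
    (Act.loop r F).Modifies S := by
  intro ρ m a ha
  simp only [Act.loop]
  generalize List.range (ρ 0) = l
  induction l generalizing m with
  | nil => rfl
  | cons i l ih => exact (ih _).trans (hF _ m a ha)

lemma Act.Modifies.natIte {S : Set ℕ} {e e' : NatExp} {F G : Act 𝕜} (hF : F.Modifies S)
    (hG : G.Modifies S) : (Act.natIte e e' F G).Modifies S := by
  intro ρ m a ha
  simp only [Act.natIte]
  split_ifs
  exacts [hF ρ m a ha, hG ρ m a ha]

lemma setCol_modifies (r a : ℕ) (c : NatExp) (f : Val 𝕜) : (setCol r a c f).Modifies {a} :=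
  fun _ _ _ hb => Function.update_of_ne hb _ _

lemma setMat_modifies (r a : ℕ) (f : Val 𝕜) : (setMat r a f).Modifies {a} :=
  fun _ _ _ hb => Function.update_of_ne hb _ _

/-- Invariant rule for loops. -/
lemma Act.loop_inv (r : ℕ) (F : Act 𝕜) (ρ : ℕ → ℕ) (m : Mem 𝕜) (Inv : ℕ → Mem 𝕜 → Prop)
    (h0 : Inv 0 m) (hs : ∀ i < ρ 0, ∀ m', Inv i m' → Inv (i + 1) (F (Function.update ρ r i) m')) :
    Inv (ρ 0) (Act.loop r F ρ m) := by
  simp only [Act.loop]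
  generalize ρ 0 = N at hs ⊢
  induction N with
  | zero => exact h0
  | succ N ih =>
    rw [List.range_succ, List.foldl_append]
    exact hs N (Nat.lt_succ_self N) _ (ih fun i hi => hs i (hi.trans (Nat.lt_succ_self N)))

/-- If one pass of a loop reaches `Q`, and all passes preserve `Q` and the invariant `Inv`, then the
loop reaches `Q`. -/
lemma Act.loop_reaches (r : ℕ) (F : Act 𝕜) (ρ : ℕ → ℕ) (m : Mem 𝕜) (Inv Q : Mem 𝕜 → Prop)
    (h0 : Inv m) (hI : ∀ i m', Inv m' → Inv (F (Function.update ρ r i) m'))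
    (hQ : ∀ i m', Inv m' → Q m' → Q (F (Function.update ρ r i) m')) {i₀ : ℕ} (hi₀ : i₀ < ρ 0)
    (h : ∀ m', Inv m' → Q (F (Function.update ρ r i₀) m')) : Q (Act.loop r F ρ m) := by
  refine (Act.loop_inv r F ρ m (fun i m' => Inv m' ∧ (i₀ < i → Q m')) ⟨h0, by simp⟩ ?_).2 hi₀
  rintro i - m' ⟨h1, h2⟩
  refine ⟨hI i m' h1, fun hi => ?_⟩
  rcases Nat.lt_succ_iff_lt_or_eq.1 hi with h3 | rfl
  · exact hQ i m' h1 (h2 h3)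
  · exact h m' h1

/-- The analogue of `Act.loop_reaches` for sequential composition of a list. -/
lemma Act.list_reaches {l : List (Act 𝕜)} {F₀ : Act 𝕜} (hF₀ : F₀ ∈ l) (ρ : ℕ → ℕ) (m : Mem 𝕜)
    (Inv Q : Mem 𝕜 → Prop) (h0 : Inv m) (hI : ∀ F ∈ l, ∀ m', Inv m' → Inv (F ρ m'))
    (hQ : ∀ F ∈ l, ∀ m', Inv m' → Q m' → Q (F ρ m')) (h : ∀ m', Inv m' → Q (F₀ ρ m')) :
    Q (Act.list l ρ m) := by
  have hpres : ∀ (l : List (Act 𝕜)) (m : Mem 𝕜), Inv m → (∀ F ∈ l, ∀ m', Inv m' → Inv (F ρ m')) →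
      (∀ F ∈ l, ∀ m', Inv m' → Q m' → Q (F ρ m')) → Q m → Q (Act.list l ρ m) := by
    intro l
    induction l with
    | nil => exact fun m _ _ _ hm => hm
    | cons F l ih =>
      intro m hm hI hQ hq
      exact ih _ (hI F (by simp) m hm) (fun G hG => hI G (by simp [hG]))
        (fun G hG => hQ G (by simp [hG])) (hQ F (by simp) m hm hq)
  induction l generalizing m with
  | nil => simp at hF₀
  | cons F l ih =>
    rcases List.mem_cons.1 hF₀ with rfl | hmem
    · exact hpres l _ (hI _ (by simp) m h0) (fun G hG => hI G (by simp [hG]))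
        (fun G hG => hQ G (by simp [hG])) (h m h0)
    · exact ih hmem _ (hI F (by simp) m h0) (fun G hG => hI G (by simp [hG]))
        (fun G hG => hQ G (by simp [hG]))

section Col

variable {n r a : ℕ} {ρ : ℕ → ℕ} {m : Mem 𝕜}

lemma colOf_setCol_self (hn : ρ 0 = n) (c : NatExp) (f : Val 𝕜) :
    colOf n (setCol r a c f ρ m) a (c.eval ρ) = fun i : Fin n => f (Function.update ρ r i) m := by
  funext i
  simp [colOf, setCol, hn]

lemma colOf_setCol_of_ne {c : NatExp} {f : Val 𝕜} {k : ℕ} (hk : k ≠ c.eval ρ) :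
    colOf n (setCol r a c f ρ m) a k = colOf n m a k := by
  funext i
  simp [colOf, setCol, hk]

lemma colOf_congr {m m' : Mem 𝕜} (h : m' a = m a) (c : ℕ) : colOf n m' a c = colOf n m a c := by
  funext i
  exact congrFun₂ h i c

lemma matOf_congr {m m' : Mem 𝕜} (h : m' a = m a) : matOf n m' a = matOf n m a := by
  ext i j
  exact congrFun₂ h i j

lemma matOf_setMat_self (hn : ρ 0 = n) (f : Val 𝕜) :
    matOf n (setMat r a f ρ m) a = Matrix.of fun i j : Fin n =>
      f (Function.update (Function.update ρ r i) (r + 1) j) m := by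
  ext i j
  simp [matOf, setMat, hn]

end Col

variable [RCLike 𝕜]

lemma Act.Modifies.ite {S : Set ℕ} {f g : Val 𝕜} {F G : Act 𝕜} (hF : F.Modifies S)
    (hG : G.Modifies S) : (Act.ite f g F G).Modifies S := by
  intro ρ m a ha
  simp only [Act.ite]
  split_ifs
  exacts [hF ρ m a ha, hG ρ m a ha]

lemma sumV_apply {n r : ℕ} {ρ : ℕ → ℕ} (hn : ρ 0 = n) (f : Val 𝕜) (m : Mem 𝕜) :
    sumV r f ρ m = ∑ i : Fin n, f (Function.update ρ r i) m := by
  subst hn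
  exact Finset.sum_range _

lemma NatExp.Below.eval_update {e : NatExp} {r : ℕ} (he : e.Below r) (ρ : ℕ → ℕ) (i : ℕ) :
    e.eval (Function.update ρ r i) = e.eval ρ :=
  he.eval_eq (RegAgree.update_left r ρ i)

/-- The value `xᴴ A y` for the matrix in array `a` and two columns; registers from `r` on are
used. -/
def formV (r a x : ℕ) (cx : NatExp) (y : ℕ) (cy : NatExp) : Val 𝕜 :=
  sumV r (sumV (r + 1) (star (cellV x (.reg r) cx) *
    (cellV a (.reg r) (.reg (r + 1)) * cellV y (.reg (r + 1)) cy)))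

section Form

variable {n r a x y : ℕ} {cx cy : NatExp} {ρ : ℕ → ℕ}

lemma formV_apply (hn : ρ 0 = n) (hr : 0 < r) (hcx : cx.Below r) (hcy : cy.Below r)
    (m : Mem 𝕜) : formV r a x cx y cy ρ m =
      sesq (matOf n m a) (colOf n m x (cx.eval ρ)) (colOf n m y (cy.eval ρ)) := by
  rw [formV, sumV_apply hn]
  simp only [sesq, dotProduct, Matrix.mulVec, Finset.mul_sum]
  refine Finset.sum_congr rfl fun i _ => ?_
  rw [sumV_apply (n := n) (by rw [Function.update_of_ne hr.ne, hn])]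
  refine Finset.sum_congr rfl fun j _ => ?_
  have hcx' := hcx.mono (Nat.le_succ r)
  have hcy' := hcy.mono (Nat.le_succ r)
  simp [cellV, NatExp.eval, hcx'.eval_update, hcx.eval_update, hcy'.eval_update, hcy.eval_update,
    colOf, matOf]

lemma CompE.form (hr : 0 < r) (ha : a < 100) (hx : x < 100) (hy : y < 100) (hcx : cx.Below r)
    (hcy : cy.Below r) : CompE r (formV r a x cx y cy : Val 𝕜) := by
  have b0 : NatExp.Below (r + 1 + 1) (.reg r) := by simp only [NatExp.Below]; omega
  have b1 : NatExp.Below (r + 1 + 1) (.reg (r + 1)) := by simp only [NatExp.Below]; omega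
  refine CompE.sum hr (CompE.sum (by omega) ?_)
  exact ((CompE.cell hx b0 (hcx.mono (by omega))).conj (by omega)).mul (by omega)
    ((CompE.cell ha b0 b1).mul (by omega) (CompE.cell hy b1 (hcy.mono (by omega))))

end Form

/-- The value `A • X` for two matrices in the memory; registers from `r` on are used. -/
def innerV (r a x : ℕ) : Val 𝕜 :=
  reV (sumV r (sumV (r + 1) (star (cellV x (.reg (r + 1)) (.reg r)) *
    cellV a (.reg (r + 1)) (.reg r))))

lemma innerV_apply {n r a x : ℕ} {ρ : ℕ → ℕ} (hn : ρ 0 = n) (hr : 0 < r) (m : Mem 𝕜) :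
    innerV r a x ρ m = ((matInner (matOf n m a) (matOf n m x) : ℝ) : 𝕜) := by
  rw [innerV, reV_apply, sumV_apply hn]
  simp only [matInner, Matrix.trace, Matrix.diag, Matrix.mul_apply]
  congr 2
  refine Finset.sum_congr rfl fun i _ => ?_
  rw [sumV_apply (n := n) (by rw [Function.update_of_ne hr.ne, hn])]
  refine Finset.sum_congr rfl fun j _ => ?_
  simp [cellV, NatExp.eval, matOf]

lemma CompE.inner {r a x : ℕ} (hr : 0 < r) (ha : a < 100) (hx : x < 100) :
    CompE r (innerV r a x : Val 𝕜) := by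
  have b0 : NatExp.Below (r + 1 + 1) (.reg r) := by simp only [NatExp.Below]; omega
  have b1 : NatExp.Below (r + 1 + 1) (.reg (r + 1)) := by simp only [NatExp.Below]; omega
  exact CompE.re hr (CompE.sum hr (CompE.sum (by omega)
    (((CompE.cell hx b1 b0).conj (by omega)).mul (by omega) (CompE.cell ha b1 b0))))

/-! ### The deflation procedure -/

/-- Deflate the matrix in array `s` successively by the columns of array `z`, and collect the
rank-one terms in the columns of array `g`. -/
noncomputable def deflateAct (r s z g : ℕ) : Act 𝕜 :=
  Act.loop r ((setCol (r + 1) g (.reg r)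
    (sumV (r + 2) (cellV s (.reg (r + 1)) (.reg (r + 2)) * cellV z (.reg (r + 2)) (.reg r)) /
      sqrtV (formV (r + 2) s z (.reg r) z (.reg r)))).then
    (setMat (r + 1) s (cellV s (.reg (r + 1)) (.reg (r + 2)) -
      cellV g (.reg (r + 1)) (.reg r) * star (cellV g (.reg (r + 2)) (.reg r)))))

lemma CompS.deflate {r s z g : ℕ} (hr : 0 < r) (hs : s < 100) (hz : z < 100) (hg : g < 100) :
    CompS r (deflateAct r s z g : Act 𝕜) := by
  have b : ∀ i j, i < j → NatExp.Below j (.reg i) := fun i j h => h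
  refine CompS.loop hr (CompS.then (by omega) (CompS.setCol (by omega) hg (b _ _ (by omega)) ?_)
    (CompS.setMat (by omega) hs ?_))
  · exact CompE.div (by omega) (CompE.sum (by omega) (CompE.mul (by omega)
      (CompE.cell hs (b _ _ (by omega)) (b _ _ (by omega)))
      (CompE.cell hz (b _ _ (by omega)) (b _ _ (by omega)))))
      (CompE.sqrt (by omega) (CompE.form (by omega) hs hz hz (b _ _ (by omega))
        (b _ _ (by omega))))
  · exact CompE.sub (by omega) (CompE.cell hs (b _ _ (by omega)) (b _ _ (by omega)))
      (CompE.mul (by omega) (CompE.cell hg (b _ _ (by omega)) (b _ _ (by omega)))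
        (CompE.conj (by omega) (CompE.cell hg (b _ _ (by omega)) (b _ _ (by omega)))))

lemma deflateAct_modifies (r s z g : ℕ) : (deflateAct r s z g : Act 𝕜).Modifies {s, g} :=
  Act.Modifies.loop (Act.Modifies.then ((setCol_modifies _ _ _ _).mono (by simp))
    ((setMat_modifies _ _ _).mono (by simp)))

lemma deflateAct_spec {n r s z g : ℕ} {ρ : ℕ → ℕ} (hn : ρ 0 = n) (hr : 0 < r) (hsz : s ≠ z)
    (hsg : s ≠ g) (hzg : z ≠ g) (m : Mem 𝕜) (hS : (matOf n m s).PosSemidef) :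
    (matOf n (deflateAct r s z g ρ m) s).PosSemidef ∧
    (∀ k < n, matOf n (deflateAct r s z g ρ m) s *ᵥ colOf n m z k = 0) ∧
    matOf n m s = matOf n (deflateAct r s z g ρ m) s +
      ∑ k ∈ Finset.range n, outerSelf (colOf n (deflateAct r s z g ρ m) g k) ∧
    ∀ v, matOf n m s *ᵥ v = v → (∀ k < n, star (colOf n m z k) ⬝ᵥ v = 0) →
      matOf n (deflateAct r s z g ρ m) s *ᵥ v = v := by
  have key := Act.loop_inv r ((setCol (r + 1) g (.reg r)
    (sumV (r + 2) (cellV s (.reg (r + 1)) (.reg (r + 2)) * cellV z (.reg (r + 2)) (.reg r)) /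
      sqrtV (formV (r + 2) s z (.reg r) z (.reg r)))).then
    (setMat (r + 1) s (cellV s (.reg (r + 1)) (.reg (r + 2)) -
      cellV g (.reg (r + 1)) (.reg r) * star (cellV g (.reg (r + 2)) (.reg r))))) ρ m
    (fun i m' => m' z = m z ∧ (matOf n m' s).PosSemidef ∧
      (∀ k < i, matOf n m' s *ᵥ colOf n m z k = 0) ∧
      matOf n m s = matOf n m' s + ∑ k ∈ Finset.range i, outerSelf (colOf n m' g k) ∧
      ∀ v, matOf n m s *ᵥ v = v → (∀ k < n, star (colOf n m z k) ⬝ᵥ v = 0) →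
        matOf n m' s *ᵥ v = v)
    ⟨rfl, hS, by simp, by simp, fun v hv _ => hv⟩ ?_
  · rw [hn] at key
    exact key.2
  rintro k hk m₁ ⟨h1, h2, h3, h4, h5⟩
  rw [hn] at hk
  set ρ' := Function.update ρ r k with hρ'
  have hn' : ρ' 0 = n := by rw [hρ', Function.update_of_ne hr.ne, hn]
  set m₂ := setCol (r + 1) g (.reg r) (sumV (r + 2) (cellV s (.reg (r + 1)) (.reg (r + 2)) *
    cellV z (.reg (r + 2)) (.reg r)) / sqrtV (formV (r + 2) s z (.reg r) z (.reg r))) ρ' m₁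
    with hm₂
  set m₃ := setMat (r + 1) s (cellV s (.reg (r + 1)) (.reg (r + 2)) -
      cellV g (.reg (r + 1)) (.reg r) * star (cellV g (.reg (r + 2)) (.reg r))) ρ' m₂ with hm₃
  have hrk : NatExp.eval ρ' (.reg r) = k := by simp [hρ', NatExp.eval]
  have e2 : ∀ b, b ≠ g → m₂ b = m₁ b := fun b hb => setCol_modifies _ _ _ _ _ _ _ (by simpa)
  have e3 : ∀ b, b ≠ s → m₃ b = m₂ b := fun b hb => setMat_modifies _ _ _ _ _ _ (by simpa)
  have hcol : colOf n m₂ g k = deflVec (matOf n m₁ s) (colOf n m z k) := by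
    have := colOf_setCol_self (r := r + 1) (a := g) (m := m₁) hn' (.reg r)
      (sumV (r + 2) (cellV s (.reg (r + 1)) (.reg (r + 2)) *
        cellV z (.reg (r + 2)) (.reg r)) / sqrtV (formV (r + 2) s z (.reg r) z (.reg r)))
    rw [hrk] at this
    rw [hm₂, this, ← colOf_congr h1]
    funext i
    have hn'' : Function.update ρ' (r + 1) (i : ℕ) 0 = n := by
      rw [Function.update_of_ne (by omega), hn']
    have hrk' : NatExp.eval (Function.update ρ' (r + 1) (i : ℕ)) (.reg r) = k := by
      simp [NatExp.eval, hρ']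
    rw [Pi.div_apply, Pi.div_apply, sqrtV_apply, formV_apply hn'' (by omega)
      (by simp only [NatExp.Below]; omega) (by simp only [NatExp.Below]; omega), hrk',
      sumV_apply hn'', deflVec]
    congr 1
    simp only [Matrix.mulVec, dotProduct]
    refine Finset.sum_congr rfl fun j _ => ?_
    simp [cellV, NatExp.eval, hρ', matOf, colOf]
  have hmat : matOf n m₃ s = matOf n m₁ s - outerSelf (deflVec (matOf n m₁ s) (colOf n m z k)) := by
    rw [hm₃, matOf_setMat_self hn', ← hcol]
    ext i j
    simp [cellV, NatExp.eval, hρ', outerSelf, Matrix.vecMulVec_apply, colOf, matOf, e2 s hsg,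
      Function.update_of_ne (show r ≠ r + 1 + 1 by omega)]
  obtain ⟨d1, d2, d3, d4⟩ := deflate_spec h2 (colOf n m z k)
  refine ⟨?_, ?_, ?_, ?_, ?_⟩
  · change m₃ z = m z
    rw [e3 z hsz.symm, e2 z hzg, h1]
  · change (matOf n m₃ s).PosSemidef
    rwa [hmat]
  · intro k' hk'
    change matOf n m₃ s *ᵥ _ = 0
    rw [hmat]
    rcases Nat.lt_succ_iff_lt_or_eq.1 hk' with h | rfl
    · exact d3 _ (h3 k' h)
    · exact d2
  · change matOf n m s = matOf n m₃ s + ∑ k ∈ Finset.range (k + 1), outerSelf (colOf n m₃ g k)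
    have hold : ∀ k' ∈ Finset.range k,
        outerSelf (colOf n m₃ g k') = outerSelf (colOf n m₁ g k') := by
      intro k' hk'
      rw [colOf_congr (e3 g hsg.symm), hm₂, colOf_setCol_of_ne]
      rw [hrk]
      exact (Finset.mem_range.1 hk').ne
    rw [Finset.sum_range_succ, Finset.sum_congr rfl hold, colOf_congr (e3 g hsg.symm), hcol, hmat,
      h4]
    abel
  · intro v hv hz
    change matOf n m₃ s *ᵥ v = v
    rw [hmat]
    exact d4 v (h5 v hv hz) (hz k hk)

end RealRAM

/-! ### The rotation procedure -/

section RotationStep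

variable {𝕜 : Type} [RCLike 𝕜] {n : ℕ}

/-- A direction `e` in which the pair `x`, `y` can be rotated without changing the values of the
form `C`, if `C` vanishes on `x` and `y`. If `xᴴ C y = 0`, the quotient of zero by zero is zero, and
the direction is `1`. -/
noncomputable def rotDir (C : Matrix (Fin n) (Fin n) 𝕜) (x y : Fin n → 𝕜) : 𝕜 :=
  RCLike.I * star (sesq C x y) + (1 - sesq C x y / sesq C x y)

/-- A rotation parameter for which the form `D` vanishes on the first vector of the rotated pair. -/
noncomputable def rotRoot (D : Matrix (Fin n) (Fin n) 𝕜) (e : 𝕜) (x y : Fin n → 𝕜) : ℝ :=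
  RealRAM.nthRealRoot 0 [quadForm D x, 2 * RCLike.re (e * sesq D x y), ‖e‖ ^ 2 * quadForm D y]

lemma re_rotDir_mul (C : Matrix (Fin n) (Fin n) 𝕜) (x y : Fin n → 𝕜) :
    RCLike.re (rotDir C x y * sesq C x y) = 0 := by
  by_cases h : sesq C x y = 0
  · simp [h]
  · rw [rotDir, div_self h, sub_self, add_zero, mul_assoc, star_mul_eq_norm_sq, mul_comm,
      RCLike.re_ofReal_mul, RCLike.I_re, mul_zero]

lemma rotDir_ne_zero {C : Matrix (Fin n) (Fin n) 𝕜} (h : (RCLike.I : 𝕜) ≠ 0 ∨ C = 0)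
    (x y : Fin n → 𝕜) : rotDir C x y ≠ 0 := by
  by_cases hp : sesq C x y = 0
  · simp [rotDir, hp]
  · rcases h with h | rfl
    · rw [rotDir, div_self hp, sub_self, add_zero]
      exact mul_ne_zero h (by simpa using hp)
    · exact absurd (sesq_zero_matrix x y) hp

lemma rotRoot_spec {D : Matrix (Fin n) (Fin n) 𝕜} {e : 𝕜} {x y : Fin n → 𝕜} (he : e ≠ 0)
    (hxy : quadForm D x * quadForm D y < 0) :
    quadForm D x + 2 * RCLike.re (e * sesq D x y) * rotRoot D e x y +
      ‖e‖ ^ 2 * quadForm D y * rotRoot D e x y ^ 2 = 0 := by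
  have hpos : 0 < ‖e‖ ^ 2 := by positivity
  unfold rotRoot
  generalize RCLike.re (e * sesq D x y) = b
  obtain ⟨τ, hτ⟩ := exists_quadratic_root (α := ‖e‖ ^ 2 * quadForm D y)
    (β := 2 * b) (γ := quadForm D x) (by nlinarith)
  have := RealRAM.isRoot_nthRealRoot_zero
    [quadForm D x, 2 * b, ‖e‖ ^ 2 * quadForm D y] τ
    (by simp [Finset.sum_range_succ]; linarith)
    ⟨0, by simp, by rintro h0; simp at h0; rw [h0, zero_mul] at hxy; exact hxy.false⟩
  simpa [Finset.sum_range_succ] using this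

/-- One step of the procedure: rotate the vectors number `l` and `j` if `D` has opposite signs at
them, so that `D` vanishes at the first. -/
noncomputable def rotStep (C D : Matrix (Fin n) (Fin n) 𝕜) (l j : ℕ) (w : ℕ → Fin n → 𝕜) :
    ℕ → Fin n → 𝕜 :=
  open Classical in
  if 0 ≤ quadForm D (w l) * quadForm D (w j) then w else
    let e := rotDir C (w l) (w j)
    let τ := rotRoot D e (w l) (w j)
    Function.update (Function.update w l (rotFst (w l) (w j) e τ)) j (rotSnd (w l) (w j) e τ)

/-- The state of the procedure: the decomposition of `X`, the zeros of `C`, and the zeros of `D`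
among the first `l` vectors. -/
structure RotInv (X C D : Matrix (Fin n) (Fin n) 𝕜) (l : ℕ) (w : ℕ → Fin n → 𝕜) : Prop where
  sum_eq : X = ∑ k ∈ Finset.range n, outerSelf (w k)
  fst_zero : ∀ k < n, quadForm C (w k) = 0
  snd_zero : ∀ k < l, quadForm D (w k) = 0

variable {X C D : Matrix (Fin n) (Fin n) 𝕜}

lemma RotInv.step {l j : ℕ} {w : ℕ → Fin n → 𝕜} (hC : C.IsHermitian) (hD : D.IsHermitian)
    (hCD : (RCLike.I : 𝕜) ≠ 0 ∨ C = 0 ∨ D = 0) (hl : l < n) (hj : j < n)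
    (h : RotInv X C D l w)
    (hin : quadForm D (w l) = 0 ∨ ∀ k < j, 0 ≤ quadForm D (w l) * quadForm D (w k)) :
    RotInv X C D l (rotStep C D l j w) ∧ (quadForm D (rotStep C D l j w l) = 0 ∨
      ∀ k < j + 1, 0 ≤ quadForm D (rotStep C D l j w l) * quadForm D (rotStep C D l j w k)) := by
  classical
  by_cases hs : 0 ≤ quadForm D (w l) * quadForm D (w j)
  · rw [rotStep, if_pos hs]
    refine ⟨h, hin.imp_right fun hk k hkj => ?_⟩
    rcases Nat.lt_succ_iff_lt_or_eq.1 hkj with h1 | rfl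
    exacts [hk k h1, hs]
  · rw [rotStep, if_neg hs]
    push Not at hs
    have hlj : l ≠ j := by
      rintro rfl
      exact hs.not_ge (mul_self_nonneg _)
    have he : rotDir C (w l) (w j) ≠ 0 := by
      refine rotDir_ne_zero ?_ _ _
      rcases hCD with h1 | h1 | h1
      · exact Or.inl h1
      · exact Or.inr h1
      · rw [h1] at hs
        simp [quadForm, sesq_zero_matrix] at hs
    have hre := re_rotDir_mul C (w l) (w j)
    set e := rotDir C (w l) (w j) with he'
    set τ := rotRoot D e (w l) (w j) with hτ
    set v := Function.update (Function.update w l (rotFst (w l) (w j) e τ)) j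
      (rotSnd (w l) (w j) e τ) with hv
    have hvl : v l = rotFst (w l) (w j) e τ := by
      rw [hv, Function.update_of_ne hlj, Function.update_self]
    have hvj : v j = rotSnd (w l) (w j) e τ := by rw [hv, Function.update_self]
    have hvk : ∀ k, k ≠ l → k ≠ j → v k = w k := fun k h1 h2 => by
      rw [hv, Function.update_of_ne h2, Function.update_of_ne h1]
    have hD0 : quadForm D (v l) = 0 := by
      rw [hvl, quadForm_rotFst _ _ _ _ hD, rotRoot_spec he hs, mul_zero]
    change RotInv X C D l v ∧ (quadForm D (v l) = 0 ∨ _)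
    refine ⟨⟨?_, ?_, ?_⟩, Or.inl hD0⟩
    · have hsub : ({l, j} : Finset ℕ) ⊆ Finset.range n := by
        intro k hk
        rcases Finset.mem_insert.1 hk with rfl | hk
        · exact Finset.mem_range.2 hl
        · rw [Finset.mem_singleton.1 hk]; exact Finset.mem_range.2 hj
      rw [h.sum_eq, ← Finset.sum_sdiff hsub, ← Finset.sum_sdiff hsub, Finset.sum_pair hlj,
        Finset.sum_pair hlj, hvl, hvj, outerSelf_rot]
      congr 1
      refine Finset.sum_congr rfl fun k hk => ?_
      simp only [Finset.mem_sdiff, Finset.mem_insert, Finset.mem_singleton, not_or] at hk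
      rw [hvk k hk.2.1 hk.2.2]
    · intro k hk
      by_cases h1 : k = j
      · rw [h1, hvj, quadForm_rotSnd _ _ _ _ hC, hre, h.fst_zero l hl, h.fst_zero j hj]
        ring
      · by_cases h2 : k = l
        · rw [h2, hvl, quadForm_rotFst _ _ _ _ hC, hre, h.fst_zero l hl, h.fst_zero j hj]
          ring
        · rw [hvk k h2 h1, h.fst_zero k hk]
    · intro k hk
      have h1 : k ≠ j := by
        rintro rfl
        rw [h.snd_zero k hk, mul_zero] at hs
        exact hs.false
      rw [hvk k hk.ne h1, h.snd_zero k hk]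

/-- When all partners of the vector number `l` have been treated, `D` vanishes at it, since the
values of `D` add up to zero. -/
lemma RotInv.next {l : ℕ} {w : ℕ → Fin n → 𝕜} (hX : matInner D X = 0) (hl : l < n)
    (h : RotInv X C D l w)
    (hin : quadForm D (w l) = 0 ∨ ∀ k < n, 0 ≤ quadForm D (w l) * quadForm D (w k)) :
    RotInv X C D (l + 1) w := by
  refine ⟨h.sum_eq, h.fst_zero, fun k hk => ?_⟩
  rcases Nat.lt_succ_iff_lt_or_eq.1 hk with h1 | rfl
  · exact h.snd_zero k h1
  · rcases hin with h1 | h1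
    · exact h1
    · have h2 : ∑ i ∈ Finset.range n, quadForm D (w k) * quadForm D (w i) = 0 := by
        rw [← Finset.mul_sum]
        have := hX
        rw [h.sum_eq, matInner_sum_right] at this
        simp only [matInner_outerSelf] at this
        rw [this, mul_zero]
      have h3 := (Finset.sum_eq_zero_iff_of_nonneg fun i hi => h1 i (Finset.mem_range.1 hi)).1 h2
        k (Finset.mem_range.2 hl)
      exact mul_self_eq_zero.1 h3

end RotationStep

namespace RealRAM

variable {𝕜 : Type} [RCLike 𝕜]

/-- The direction of `rotDir` for columns of array `w` given by two registers. -/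
noncomputable def rotDirV (r b w c : ℕ) : Val 𝕜 :=
  imagV * star (formV b c w (.reg r) w (.reg (r + 1))) +
    (intV 1 - formV b c w (.reg r) w (.reg (r + 1)) / formV b c w (.reg r) w (.reg (r + 1)))

/-- The parameter of `rotRoot` for columns of array `w` given by two registers. -/
noncomputable def rotRootV (r b w c d : ℕ) : Val 𝕜 :=
  rootV 0 [formV b d w (.reg r) w (.reg r),
    intV 2 * reV (rotDirV r b w c * formV b d w (.reg r) w (.reg (r + 1))),
    rotDirV r b w c * star (rotDirV r b w c) * formV b d w (.reg (r + 1)) w (.reg (r + 1))]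

/-- The normalizing factor of the rotation. -/
noncomputable def rotNormV (r b w c d : ℕ) : Val 𝕜 :=
  sqrtV (intV 1 + rotRootV r b w c d * rotRootV r b w c d *
    (rotDirV r b w c * star (rotDirV r b w c)))

/-- The program for `rotStep`; the new vectors are collected in array `y`. -/
noncomputable def rotStepAct (r w c d y : ℕ) : Act 𝕜 :=
  Act.ite (intV 0) (formV (r + 2) d w (.reg r) w (.reg r) *
      formV (r + 2) d w (.reg (r + 1)) w (.reg (r + 1))) Act.skip
    (((setCol (r + 2) y (.const 0) ((cellV w (.reg (r + 2)) (.reg r) +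
        rotRootV r (r + 3) w c d * rotDirV r (r + 3) w c * cellV w (.reg (r + 2)) (.reg (r + 1))) /
        rotNormV r (r + 3) w c d)).then
      (setCol (r + 2) y (.const 1) ((cellV w (.reg (r + 2)) (.reg (r + 1)) -
        rotRootV r (r + 3) w c d * star (rotDirV r (r + 3) w c) *
        cellV w (.reg (r + 2)) (.reg r)) / rotNormV r (r + 3) w c d))).then
    ((setCol (r + 2) w (.reg r) (cellV y (.reg (r + 2)) (.const 0))).then
      (setCol (r + 2) w (.reg (r + 1)) (cellV y (.reg (r + 2)) (.const 1)))))

/-- Rotate pairs of columns of array `w` until the form in array `d` vanishes on all of them, while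
the form in array `c` keeps vanishing. -/
noncomputable def rotateAct (r w c d y : ℕ) : Act 𝕜 :=
  Act.loop r (Act.loop (r + 1) (rotStepAct r w c d y))

section Comp

variable {r b w c d y : ℕ}

lemma CompE.rotDir (hb : r + 1 < b) (hw : w < 100) (hc : c < 100) :
    CompE b (rotDirV r b w c : Val 𝕜) := by
  have hp : CompE b (formV b c w (.reg r) w (.reg (r + 1)) : Val 𝕜) :=
    CompE.form (by omega) hc hw hw (by simp only [NatExp.Below]; omega)
      (by simp only [NatExp.Below]; omega)
  exact CompE.add (by omega) (CompE.imag.mul (by omega) (hp.conj (by omega)))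
    (CompE.sub (by omega) (CompE.int 1) (hp.div (by omega) hp))

lemma CompE.rotRoot (hb : r + 1 < b) (hw : w < 100) (hc : c < 100) (hd : d < 100) :
    CompE b (rotRootV r b w c d : Val 𝕜) := by
  have hp : ∀ i j, i < b → j < b → CompE b (formV b d w (.reg i) w (.reg j) : Val 𝕜) :=
    fun i j hi hj => CompE.form (by omega) hd hw hw hi hj
  have he := CompE.rotDir (𝕜 := 𝕜) hb hw hc
  refine CompE.root (by omega) _ _ ?_
  simp only [List.forall_mem_cons, List.not_mem_nil, false_implies, implies_true, and_true]
  exact ⟨hp _ _ (by omega) (by omega),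
    CompE.mul (by omega) (CompE.int 2) (CompE.re (by omega) (he.mul (by omega)
      (hp _ _ (by omega) (by omega)))),
    CompE.mul (by omega) (he.mul (by omega) (he.conj (by omega)))
      (hp _ _ (by omega) (by omega))⟩

lemma CompE.rotNorm (hb : r + 1 < b) (hw : w < 100) (hc : c < 100) (hd : d < 100) :
    CompE b (rotNormV r b w c d : Val 𝕜) := by
  have he := CompE.rotDir (𝕜 := 𝕜) hb hw hc
  have hτ := CompE.rotRoot (𝕜 := 𝕜) hb hw hc hd
  exact CompE.sqrt (by omega) (CompE.add (by omega) (CompE.int 1) (CompE.mul (by omega)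
    (hτ.mul (by omega) hτ) (he.mul (by omega) (he.conj (by omega)))))

lemma CompS.rotate (hr : 0 < r) (hw : w < 100) (hc : c < 100) (hd : d < 100) (hy : y < 100) :
    CompS r (rotateAct r w c d y : Act 𝕜) := by
  have he := CompE.rotDir (𝕜 := 𝕜) (r := r) (b := r + 3) (by omega) hw hc
  have hτ := CompE.rotRoot (𝕜 := 𝕜) (r := r) (b := r + 3) (by omega) hw hc hd
  have hN := CompE.rotNorm (𝕜 := 𝕜) (r := r) (b := r + 3) (by omega) hw hc hd
  have hf : ∀ i, i < r + 2 → CompE (r + 2) (formV (r + 2) d w (.reg i) w (.reg i) : Val 𝕜) :=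
    fun i hi => CompE.form (by omega) hd hw hw hi hi
  have hcell : ∀ i, i < r + 3 → CompE (r + 3) (cellV w (.reg (r + 2)) (.reg i) : Val 𝕜) :=
    fun i hi => CompE.cell hw (by simp only [NatExp.Below]; omega) hi
  have hcy : ∀ i, CompE (r + 2 + 1) (cellV y (.reg (r + 2)) (.const i) : Val 𝕜) :=
    fun i => CompE.cell hy (by simp only [NatExp.Below]; omega) trivial
  have hb : ∀ i, i < r + 2 → NatExp.Below (r + 2) (.reg i) := fun i hi => hi
  refine CompS.loop hr (CompS.loop (by omega) (CompS.ite (by omega) (CompE.int 0)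
    ((hf _ (by omega)).mul (by omega) (hf _ (by omega))) CompS.skip
    (CompS.then (by omega) (CompS.then (by omega) ?_ ?_) (CompS.then (by omega) ?_ ?_))))
  · exact CompS.setCol (by omega) hy trivial (CompE.div (by omega) (CompE.add (by omega)
      (hcell _ (by omega)) (CompE.mul (by omega) (hτ.mul (by omega) he) (hcell _ (by omega)))) hN)
  · exact CompS.setCol (by omega) hy trivial (CompE.div (by omega) (CompE.sub (by omega)
      (hcell _ (by omega)) (CompE.mul (by omega) (hτ.mul (by omega) (he.conj (by omega)))
      (hcell _ (by omega)))) hN)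
  · exact CompS.setCol (by omega) hw (hb _ (by omega)) (hcy 0)
  · exact CompS.setCol (by omega) hw (hb _ (by omega)) (hcy 1)

lemma rotateAct_modifies (r w c d y : ℕ) : (rotateAct r w c d y : Act 𝕜).Modifies {w, y} := by
  have h1 : ∀ c f, (setCol (r + 2) w c f : Act 𝕜).Modifies {w, y} :=
    fun _ _ => (setCol_modifies _ _ _ _).mono (by simp)
  have h2 : ∀ c f, (setCol (r + 2) y c f : Act 𝕜).Modifies {w, y} :=
    fun _ _ => (setCol_modifies _ _ _ _).mono (by simp)
  exact Act.Modifies.loop (Act.Modifies.loop (Act.Modifies.ite Act.Modifies.skip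
    (Act.Modifies.then (Act.Modifies.then (h2 _ _) (h2 _ _))
      (Act.Modifies.then (h1 _ _) (h1 _ _)))))

end Comp

section Spec

variable {n r b w c d y : ℕ} {ρ : ℕ → ℕ}

lemma rotDirV_apply (hn : ρ 0 = n) (hb : r + 1 < b) (m : Mem 𝕜) :
    rotDirV r b w c ρ m =
      _root_.rotDir (matOf n m c) (colOf n m w (ρ r)) (colOf n m w (ρ (r + 1))) := by
  have hp := formV_apply (a := c) (x := w) (y := w) (cx := .reg r) (cy := .reg (r + 1)) (r := b)
    hn (by omega) (by simp only [NatExp.Below]; omega) (by simp only [NatExp.Below]; omega) m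
  simp only [rotDirV, Pi.add_apply, Pi.mul_apply, Pi.sub_apply, Pi.div_apply, Pi.star_apply, hp,
    intV, imagV, Int.cast_one, _root_.rotDir, NatExp.eval]

lemma rotRootV_apply (hn : ρ 0 = n) (hb : r + 1 < b) (m : Mem 𝕜) :
    rotRootV r b w c d ρ m = ((_root_.rotRoot (matOf n m d) (rotDirV r b w c ρ m)
      (colOf n m w (ρ r)) (colOf n m w (ρ (r + 1))) : ℝ) : 𝕜) := by
  have hp : ∀ i j, i < b → j < b → formV b d w (.reg i) w (.reg j) ρ m =
      sesq (matOf n m d) (colOf n m w (ρ i)) (colOf n m w (ρ j)) :=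
    fun i j hi hj => formV_apply (cx := .reg i) (cy := .reg j) hn (by omega) hi hj m
  simp only [rotRootV, rootV, List.map_cons, List.map_nil, Pi.mul_apply, Pi.star_apply,
    hp _ _ (show r < b by omega) (show r < b by omega),
    hp _ _ (show r < b by omega) (show r + 1 < b by omega),
    hp _ _ (show r + 1 < b by omega) (show r + 1 < b by omega), intV, reV_apply, _root_.rotRoot]
  rw [mul_star_eq_norm_sq, RCLike.re_ofReal_mul, Int.cast_ofNat, ← RCLike.ofReal_ofNat,
    ← RCLike.ofReal_mul, RCLike.ofReal_re]
  rfl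

lemma rotNormV_apply (hn : ρ 0 = n) (hb : r + 1 < b) (m : Mem 𝕜) :
    rotNormV r b w c d ρ m = ((_root_.rotNorm (rotDirV r b w c ρ m)
      (_root_.rotRoot (matOf n m d) (rotDirV r b w c ρ m)
        (colOf n m w (ρ r)) (colOf n m w (ρ (r + 1)))) : ℝ) : 𝕜) := by
  simp only [rotNormV, sqrtV_apply, Pi.add_apply, Pi.mul_apply, Pi.star_apply,
    rotRootV_apply hn hb m, mul_star_eq_norm_sq, intV, _root_.rotNorm]
  rw [Int.cast_one, ← RCLike.ofReal_mul, ← RCLike.ofReal_mul, ← RCLike.ofReal_one,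
    ← RCLike.ofReal_add, RCLike.ofReal_re, sq (_root_.rotRoot _ _ _ _)]

lemma rotStepAct_spec (hn : ρ 0 = n) (hr : 0 < r) (hyw : y ≠ w)
    (hyc : y ≠ c) (hyd : y ≠ d) (m : Mem 𝕜) (hD : (matOf n m d).IsHermitian) :
    colOf n (rotStepAct r w c d y ρ m) w =
      rotStep (matOf n m c) (matOf n m d) (ρ r) (ρ (r + 1)) (colOf n m w) := by
  have hform : ∀ i, i < r + 2 → formV (r + 2) d w (.reg i) w (.reg i) ρ m =
      ((quadForm (matOf n m d) (colOf n m w (ρ i)) : ℝ) : 𝕜) := fun i hi => by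
    rw [formV_apply (cx := .reg i) (cy := .reg i) hn (by omega) hi hi, sesq_self _ hD]
    rfl
  rw [rotStepAct, Act.ite, rotStep]
  simp only [Pi.mul_apply, hform r (by omega), hform (r + 1) (by omega), intV, Int.cast_zero,
    map_zero, RCLike.re_ofReal_mul, RCLike.ofReal_re]
  split_ifs with h
  · rfl
  have hreg : ∀ (i j : ℕ), j < r + 2 → Function.update ρ (r + 2) i j = ρ j := fun i j hj =>
    Function.update_of_ne (by omega) _ _
  have hn' : ∀ i, Function.update ρ (r + 2) i 0 = n := fun i => by rw [hreg i 0 (by omega), hn]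
  set f₀ : Val 𝕜 := (cellV w (.reg (r + 2)) (.reg r) +
    rotRootV r (r + 3) w c d * rotDirV r (r + 3) w c * cellV w (.reg (r + 2)) (.reg (r + 1))) /
    rotNormV r (r + 3) w c d with hf₀
  set f₁ : Val 𝕜 := (cellV w (.reg (r + 2)) (.reg (r + 1)) -
    rotRootV r (r + 3) w c d * star (rotDirV r (r + 3) w c) *
    cellV w (.reg (r + 2)) (.reg r)) / rotNormV r (r + 3) w c d with hf₁
  set m₁ := setCol (r + 2) y (.const 0) f₀ ρ m with hm₁
  set m₂ := setCol (r + 2) y (.const 1) f₁ ρ m₁ with hm₂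
  set m₃ := setCol (r + 2) w (.reg r) (cellV y (.reg (r + 2)) (.const 0)) ρ m₂ with hm₃
  set m₄ := setCol (r + 2) w (.reg (r + 1)) (cellV y (.reg (r + 2)) (.const 1)) ρ m₃ with hm₄
  change colOf n m₄ w = _
  have e1 : ∀ b, b ≠ y → m₁ b = m b := fun b hb => setCol_modifies _ _ _ _ _ _ _ (by simpa)
  have e2 : ∀ b, b ≠ y → m₂ b = m₁ b := fun b hb => setCol_modifies _ _ _ _ _ _ _ (by simpa)
  have e3 : ∀ b, b ≠ w → m₃ b = m₂ b := fun b hb => setCol_modifies _ _ _ _ _ _ _ (by simpa)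
  set x₁ := colOf n m w (ρ r) with hx₁
  set x₂ := colOf n m w (ρ (r + 1)) with hx₂
  set e := _root_.rotDir (matOf n m c) x₁ x₂ with he
  set τ := _root_.rotRoot (matOf n m d) e x₁ x₂ with hτ
  have hvals : ∀ m' : Mem 𝕜, m' w = m w → m' c = m c → m' d = m d → ∀ i : ℕ,
      rotDirV r (r + 3) w c (Function.update ρ (r + 2) i) m' = e ∧
      rotRootV r (r + 3) w c d (Function.update ρ (r + 2) i) m' = (τ : 𝕜) ∧
      rotNormV r (r + 3) w c d (Function.update ρ (r + 2) i) m' = (_root_.rotNorm e τ : 𝕜) := by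
    intro m' hw hc hd i
    have h1 : rotDirV r (r + 3) w c (Function.update ρ (r + 2) i) m' = e := by
      rw [rotDirV_apply (hn' i) (by omega), hreg i r (by omega), hreg i (r + 1) (by omega),
        matOf_congr hc, colOf_congr hw, colOf_congr hw]
    rw [rotRootV_apply (hn' i) (by omega) m', rotNormV_apply (hn' i) (by omega) m', h1,
      hreg i r (by omega), hreg i (r + 1) (by omega), matOf_congr hd, colOf_congr hw,
      colOf_congr hw]
    exact ⟨rfl, rfl, rfl⟩
  have hcell : ∀ (m' : Mem 𝕜) (i j : ℕ), j < r + 2 →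
      cellV w (.reg (r + 2)) (.reg j) (Function.update ρ (r + 2) i) m' = m' w i (ρ j) := by
    intro m' i j hj
    simp only [cellV, NatExp.eval, Function.update_self, hreg i j hj]
  have hy0 : colOf n m₂ y 0 = rotFst x₁ x₂ e τ := by
    rw [hm₂, colOf_setCol_of_ne (by simp [NatExp.eval])]
    refine (colOf_setCol_self hn (.const 0) f₀).trans (funext fun i => ?_)
    obtain ⟨h1, h2, h3⟩ := hvals m rfl rfl rfl i
    simp only [hf₀, Pi.div_apply, Pi.add_apply, Pi.mul_apply, h1, h2, h3,
      hcell m i r (by omega), hcell m i (r + 1) (by omega)]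
    rfl
  have hy1 : colOf n m₂ y 1 = rotSnd x₁ x₂ e τ := by
    refine (colOf_setCol_self hn (.const 1) f₁).trans (funext fun i => ?_)
    obtain ⟨h1, h2, h3⟩ := hvals m₁ (e1 w hyw.symm) (e1 c hyc.symm) (e1 d hyd.symm) i
    simp only [hf₁, Pi.div_apply, Pi.sub_apply, Pi.mul_apply, Pi.star_apply, h1, h2, h3,
      hcell m₁ i r (by omega), hcell m₁ i (r + 1) (by omega), e1 w hyw.symm]
    rfl
  have hcopy : ∀ (m' : Mem 𝕜) (k i : ℕ),
      cellV y (.reg (r + 2)) (.const k) (Function.update ρ (r + 2) i) m' = m' y i k := by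
    intro m' k i
    simp [cellV, NatExp.eval]
  have hw3 : colOf n m₃ w (ρ r) = rotFst x₁ x₂ e τ := by
    refine (colOf_setCol_self hn (.reg r) _).trans ?_
    simp only [hcopy]
    exact hy0
  have hw4 : colOf n m₄ w (ρ (r + 1)) = rotSnd x₁ x₂ e τ := by
    refine (colOf_setCol_self hn (.reg (r + 1)) _).trans ?_
    simp only [hcopy, e3 y hyw]
    exact hy1
  funext k
  by_cases hk1 : k = ρ (r + 1)
  · subst hk1
    rw [hw4, Function.update_self]
  · rw [Function.update_of_ne hk1, hm₄, colOf_setCol_of_ne (by simpa [NatExp.eval] using hk1)]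
    by_cases hk : k = ρ r
    · subst hk
      rw [hw3, Function.update_self]
    · rw [Function.update_of_ne hk, hm₃, colOf_setCol_of_ne (by simpa [NatExp.eval] using hk),
        colOf_congr ((e2 w hyw.symm).trans (e1 w hyw.symm))]

/-- The rotation procedure makes the form `D` vanish on all vectors of a decomposition of `X`, if
`D • X = 0` and the form `C` vanishes already. -/
lemma rotateAct_spec (hn : ρ 0 = n) (hr : 0 < r) (hwc : w ≠ c) (hwd : w ≠ d) (hyw : y ≠ w)
    (hyc : y ≠ c) (hyd : y ≠ d) (m : Mem 𝕜) (hC : (matOf n m c).IsHermitian)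
    (hD : (matOf n m d).IsHermitian)
    (hCD : (RCLike.I : 𝕜) ≠ 0 ∨ matOf n m c = 0 ∨ matOf n m d = 0)
    {X : Matrix (Fin n) (Fin n) 𝕜} (hX : matInner (matOf n m d) X = 0)
    (h0 : RotInv X (matOf n m c) (matOf n m d) 0 (colOf n m w)) :
    RotInv X (matOf n m c) (matOf n m d) n (colOf n (rotateAct r w c d y ρ m) w) := by
  set C := matOf n m c with hCdef
  set D := matOf n m d with hDdef
  have key := Act.loop_inv r (Act.loop (r + 1) (rotStepAct r w c d y)) ρ m
    (fun l m' => m' c = m c ∧ m' d = m d ∧ RotInv X C D l (colOf n m' w)) ⟨rfl, rfl, h0⟩ ?_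
  · rw [hn] at key
    exact key.2.2
  rintro l hl m₁ ⟨hc1, hd1, hinv⟩
  rw [hn] at hl
  have hn1 : Function.update ρ r l 0 = n := by rw [Function.update_of_ne hr.ne, hn]
  have key2 := Act.loop_inv (r + 1) (rotStepAct r w c d y) (Function.update ρ r l) m₁
    (fun j m' => m' c = m c ∧ m' d = m d ∧ RotInv X C D l (colOf n m' w) ∧
      (quadForm D (colOf n m' w l) = 0 ∨
        ∀ k < j, 0 ≤ quadForm D (colOf n m' w l) * quadForm D (colOf n m' w k)))
    ⟨hc1, hd1, hinv, Or.inr (by simp)⟩ ?_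
  · rw [hn1] at key2
    exact ⟨key2.1, key2.2.1, key2.2.2.1.next hX hl key2.2.2.2⟩
  rintro j hj m₂ ⟨hc2, hd2, hinv2, hin⟩
  rw [hn1] at hj
  set ρ' := Function.update (Function.update ρ r l) (r + 1) j with hρ'
  have hn2 : ρ' 0 = n := by rw [hρ', Function.update_of_ne (by omega), hn1]
  have hl' : ρ' r = l := by
    rw [hρ', Function.update_of_ne (by omega), Function.update_self]
  have hj' : ρ' (r + 1) = j := by rw [hρ', Function.update_self]
  have hmod : ∀ b, b ≠ w → b ≠ y → rotStepAct r w c d y ρ' m₂ b = m₂ b := by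
    have h1 : ∀ c f, (setCol (r + 2) w c f : Act 𝕜).Modifies {w, y} :=
      fun _ _ => (setCol_modifies _ _ _ _).mono (by simp)
    have h2 : ∀ c f, (setCol (r + 2) y c f : Act 𝕜).Modifies {w, y} :=
      fun _ _ => (setCol_modifies _ _ _ _).mono (by simp)
    intro b hbw hby
    exact (Act.Modifies.ite Act.Modifies.skip (Act.Modifies.then (Act.Modifies.then (h2 _ _)
      (h2 _ _)) (Act.Modifies.then (h1 _ _) (h1 _ _))) : (rotStepAct r w c d y).Modifies {w, y})
      ρ' m₂ b (by simp [hbw, hby])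
  have hspec := rotStepAct_spec (ρ := ρ') hn2 hr hyw hyc hyd m₂
    (by rw [matOf_congr hd2]; exact hD)
  rw [hl', hj', matOf_congr hc2, matOf_congr hd2] at hspec
  obtain ⟨s1, s2⟩ := hinv2.step hC hD hCD hl hj hin
  refine ⟨(hmod c hwc.symm hyc.symm).trans hc2, (hmod d hwd.symm hyd.symm).trans hd2, ?_, ?_⟩
  · rw [hspec]; exact s1
  · rw [hspec]; exact s2

end Spec

end RealRAM

/-! ### Testing candidates -/

namespace RealRAM

variable {𝕜 : Type} [RCLike 𝕜]

/-- The places of the input and of the output: the arrays that hold the constraint matrices, the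
matrices `X` and `Z`, and the vector `c` (in row `0`), the columns of the entries of `c`, the
integer expressions that tell whether a constraint is an equality (by a nonzero value), and the
array whose column `0` is the output. The matrix `A₀` is always in array `0`. -/
structure Layout where
  matA : Fin 4 → ℕ
  matX : ℕ
  matZ : ℕ
  vecC : ℕ
  colC : Fin 4 → ℕ
  flag : Fin 4 → NatExp
  out : ℕ

namespace Layout

/-- The numbers of the arrays that hold the input. -/
def inputs (L : Layout) : Set ℕ := {a | a = 0 ∨ (∃ j, a = L.matA j) ∨ a = L.matX ∨ a = L.matZ ∨
  a = L.vecC}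

/-- The input arrays are disjoint from the working arrays, whose numbers are `10, …, 49`, and from
the output; registers from number `6` on are free. -/
structure Valid (L : Layout) : Prop where
  inputs_lt : ∀ a ∈ L.inputs, a < 100 ∧ (a < 10 ∨ 50 ≤ a) ∧ a ≠ L.out
  out_lt : L.out < 10
  flag_below : ∀ j, (L.flag j).Below 6

/-- The memory holds the given problem and pair of matrices. -/
structure Holds (L : Layout) {n : ℕ} (P : HQP 𝕜 n 4) (X Z : Matrix (Fin n) (Fin n) 𝕜)
    (m : Mem 𝕜) : Prop where
  objective : matOf n m 0 = P.A₀
  constraint : ∀ j, matOf n m (L.matA j) = P.A j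
  primal : matOf n m L.matX = X
  slack : matOf n m L.matZ = Z
  bound : ∀ j, m L.vecC 0 (L.colC j) = (P.c j : 𝕜)

/-- The registers hold the size and the types of the constraints. -/
def RegsHold (L : Layout) {n : ℕ} (P : HQP 𝕜 n 4) (ρ : ℕ → ℕ) : Prop :=
  ρ 0 = n ∧ ∀ j, 1 ≤ (L.flag j).eval ρ ↔ P.isEq j = true

variable {L : Layout} {n : ℕ} {P : HQP 𝕜 n 4} {X Z : Matrix (Fin n) (Fin n) 𝕜}

lemma Holds.congr {m m' : Mem 𝕜} (h : L.Holds P X Z m) (hm : ∀ a ∈ L.inputs, m' a = m a) :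
    L.Holds P X Z m' where
  objective := (matOf_congr (hm 0 (Or.inl rfl))).trans h.objective
  constraint j := (matOf_congr (hm _ (Or.inr (Or.inl ⟨j, rfl⟩)))).trans (h.constraint j)
  primal := (matOf_congr (hm _ (Or.inr (Or.inr (Or.inl rfl))))).trans h.primal
  slack := (matOf_congr (hm _ (Or.inr (Or.inr (Or.inr (Or.inl rfl)))))).trans h.slack
  bound j := by rw [hm _ (Or.inr (Or.inr (Or.inr (Or.inr rfl))))]; exact h.bound j

lemma RegsHold.update (hL : L.Valid) {ρ : ℕ → ℕ} (h : L.RegsHold P ρ) {r : ℕ} (hr : 6 ≤ r)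
    (i : ℕ) : L.RegsHold P (Function.update ρ r i) := by
  refine ⟨by rw [Function.update_of_ne (by omega)]; exact h.1, fun j => ?_⟩
  rw [((hL.flag_below j).mono hr).eval_update]
  exact h.2 j

section Test

variable (L) (r : ℕ)

/-- Run `F` if column `4` of array `30` satisfies the constraint number `j`. -/
noncomputable def guardAct (j : Fin 4) (F : Act 𝕜) : Act 𝕜 :=
  let q := formV r (L.matA j) 30 (.const 4) 30 (.const 4)
  let c := cellV L.vecC (.const 0) (.const (L.colC j))
  Act.natIte (.const 1) (L.flag j) (Act.ite q c (Act.ite c q F Act.skip) Act.skip)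
    (Act.ite q c F Act.skip)

/-- Copy column `4` of array `30` to the output if it is a good point. -/
noncomputable def testAct : Act 𝕜 :=
  guardAct L r 0 (guardAct L r 1 (guardAct L r 2 (guardAct L r 3
    (Act.ite (formV r 0 30 (.const 4) 30 (.const 4)) (innerV r 0 L.matX)
      (setCol r L.out (.const 0) (cellV 30 (.reg r) (.const 4))) Act.skip))))

/-- Form the linear combination of the columns `0`, `1`, `2` of array `30` with the given
coefficients, rescale it by means of the form number `k`, and test the result. -/
noncomputable def tryAct (k : Fin 4) (T : Fin 3 → Val 𝕜) : Act 𝕜 :=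
  (setCol r 30 (.const 3) (T 0 * cellV 30 (.reg r) (.const 0) +
      T 1 * cellV 30 (.reg r) (.const 1) + T 2 * cellV 30 (.reg r) (.const 2))).then
    ((setCol r 30 (.const 4) (sqrtV (innerV (r + 1) (L.matA k) L.matX /
      formV (r + 1) (L.matA k) 30 (.const 3) 30 (.const 3)) *
        cellV 30 (.reg r) (.const 3))).then (L.testAct r))

end Test

variable {r : ℕ} {ρ : ℕ → ℕ}

lemma Valid.matA_lt (hL : L.Valid) (j : Fin 4) : L.matA j < 100 :=
  (hL.inputs_lt _ (Or.inr (Or.inl ⟨j, rfl⟩))).1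

lemma Valid.matX_lt (hL : L.Valid) : L.matX < 100 :=
  (hL.inputs_lt _ (Or.inr (Or.inr (Or.inl rfl)))).1

lemma Valid.matZ_lt (hL : L.Valid) : L.matZ < 100 :=
  (hL.inputs_lt _ (Or.inr (Or.inr (Or.inr (Or.inl rfl))))).1

lemma Valid.vecC_lt (hL : L.Valid) : L.vecC < 100 :=
  (hL.inputs_lt _ (Or.inr (Or.inr (Or.inr (Or.inr rfl))))).1

lemma compS_guard (hL : L.Valid) (hr : 6 ≤ r) (j : Fin 4) {F : Act 𝕜} (hF : CompS r F) :
    CompS r (L.guardAct r j F) := by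
  have hq : CompE r (formV r (L.matA j) 30 (.const 4) 30 (.const 4) : Val 𝕜) :=
    CompE.form (by omega) (hL.matA_lt j) (by omega) (by omega) trivial trivial
  have hc : CompE r (cellV L.vecC (.const 0) (.const (L.colC j)) : Val 𝕜) :=
    CompE.cell hL.vecC_lt trivial trivial
  exact CompS.natIte trivial ((hL.flag_below j).mono hr)
    (CompS.ite (by omega) hq hc (CompS.ite (by omega) hc hq hF CompS.skip) CompS.skip)
    (CompS.ite (by omega) hq hc hF CompS.skip)

lemma compS_test (hL : L.Valid) (hr : 6 ≤ r) : CompS r (L.testAct r : Act 𝕜) := by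
  have h0 : NatExp.Below (r + 1) (.reg r) := Nat.lt_succ_self r
  refine compS_guard hL hr 0 (compS_guard hL hr 1 (compS_guard hL hr 2 (compS_guard hL hr 3 ?_)))
  exact CompS.ite (by omega) (CompE.form (by omega) (by omega) (by omega) (by omega) trivial
    trivial) (CompE.inner (by omega) (by omega) hL.matX_lt)
    (CompS.setCol (by omega) (hL.out_lt.trans (by omega)) trivial
      (CompE.cell (by omega) h0 trivial)) CompS.skip

lemma compS_try (hL : L.Valid) (hr : 6 ≤ r) (k : Fin 4) {T : Fin 3 → Val 𝕜}
    (hT : ∀ p, CompE (r + 1) (T p)) : CompS r (L.tryAct r k T) := by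
  have h0 : NatExp.Below (r + 1) (.reg r) := Nat.lt_succ_self r
  have hcell : ∀ p, CompE (r + 1) (cellV 30 (.reg r) (.const p) : Val 𝕜) := fun p =>
    CompE.cell (by omega) h0 trivial
  refine CompS.then (by omega) (CompS.setCol (by omega) (by omega) trivial ?_)
    (CompS.then (by omega) (CompS.setCol (by omega) (by omega) trivial ?_) (compS_test hL hr))
  · exact CompE.add (by omega) (CompE.add (by omega) ((hT 0).mul (by omega) (hcell 0))
      ((hT 1).mul (by omega) (hcell 1))) ((hT 2).mul (by omega) (hcell 2))
  · exact CompE.mul (by omega) (CompE.sqrt (by omega) (CompE.div (by omega)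
      (CompE.inner (by omega) (hL.matA_lt k) hL.matX_lt)
      (CompE.form (by omega) (hL.matA_lt k) (by omega) (by omega) trivial trivial))) (hcell 3)

lemma guardAct_modifies {S : Set ℕ} (j : Fin 4) {F : Act 𝕜} (hF : F.Modifies S) :
    (L.guardAct r j F).Modifies S :=
  Act.Modifies.natIte (Act.Modifies.ite (Act.Modifies.ite hF Act.Modifies.skip)
    Act.Modifies.skip) (Act.Modifies.ite hF Act.Modifies.skip)

lemma testAct_modifies : (L.testAct r : Act 𝕜).Modifies {L.out} :=
  guardAct_modifies 0 (guardAct_modifies 1 (guardAct_modifies 2 (guardAct_modifies 3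
    (Act.Modifies.ite (setCol_modifies _ _ _ _) Act.Modifies.skip))))

lemma tryAct_modifies (k : Fin 4) (T : Fin 3 → Val 𝕜) :
    (L.tryAct r k T).Modifies {30, L.out} :=
  Act.Modifies.then ((setCol_modifies _ _ _ _).mono (by simp))
    (Act.Modifies.then ((setCol_modifies _ _ _ _).mono (by simp))
      (testAct_modifies.mono (by simp)))

lemma formV_const (hn : ρ 0 = n) (hr : 0 < r) (m : Mem 𝕜) (a p q : ℕ) :
    formV r a 30 (.const p) 30 (.const q) ρ m =
      sesq (matOf n m a) (colOf n m 30 p) (colOf n m 30 q) :=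
  formV_apply (cx := .const p) (cy := .const q) hn hr trivial trivial m

open Classical in
lemma guardAct_apply (hr : 6 ≤ r) (hρ : L.RegsHold P ρ) {m : Mem 𝕜} (hm : L.Holds P X Z m)
    (j : Fin 4) (F : Act 𝕜) : L.guardAct r j F ρ m =
      if P.Rel j (quadForm (P.A j) (colOf n m 30 4)) then F ρ m else m := by
  have hq : RCLike.re (formV r (L.matA j) 30 (.const 4) 30 (.const 4) ρ m) =
      quadForm (P.A j) (colOf n m 30 4) := by
    rw [formV_const hρ.1 (by omega), hm.constraint]; rfl
  have hc : RCLike.re (cellV L.vecC (.const 0) (.const (L.colC j)) ρ m : 𝕜) = P.c j := by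
    rw [cellV]
    simp only [NatExp.eval]
    rw [hm.bound, RCLike.ofReal_re]
  simp only [guardAct, Act.natIte, Act.ite, hq, hc, HQP.Rel, ← hρ.2 j, NatExp.eval, Act.skip]
  split_ifs <;> first | rfl | (exfalso; order)

open Classical in
lemma testAct_apply (hr : 6 ≤ r) (hρ : L.RegsHold P ρ) {m : Mem 𝕜}
    (hm : L.Holds P X Z m) : L.testAct r ρ m =
      if P.IsGood X (colOf n m 30 4) then
        setCol r L.out (.const 0) (cellV 30 (.reg r) (.const 4)) ρ m else m := by
  have hq : RCLike.re (formV r 0 30 (.const 4) 30 (.const 4) ρ m) =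
      quadForm P.A₀ (colOf n m 30 4) := by
    rw [formV_const hρ.1 (by omega), hm.objective]; rfl
  have ht : RCLike.re (innerV r 0 L.matX ρ m) = matInner P.A₀ X := by
    rw [innerV_apply hρ.1 (by omega), hm.objective, hm.primal, RCLike.ofReal_re]
  have hgood : P.IsGood X (colOf n m 30 4) ↔ (P.Rel 0 (quadForm (P.A 0) (colOf n m 30 4)) ∧
      P.Rel 1 (quadForm (P.A 1) (colOf n m 30 4)) ∧ P.Rel 2 (quadForm (P.A 2) (colOf n m 30 4)) ∧
      P.Rel 3 (quadForm (P.A 3) (colOf n m 30 4))) ∧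
      quadForm P.A₀ (colOf n m 30 4) ≤ matInner P.A₀ X := by
    simp [HQP.IsGood, HQP.feasibleSet, Fin.forall_fin_succ]
  rw [testAct, guardAct_apply hr hρ hm, guardAct_apply hr hρ hm, guardAct_apply hr hρ hm,
    guardAct_apply hr hρ hm, Act.ite, hq, ht]
  simp only [hgood, Act.skip]
  split_ifs <;> first | rfl | (exfalso; tauto)

/-- The point that is currently in the output column is good. -/
def OutGood (L : Layout) (P : HQP 𝕜 n 4) (X : Matrix (Fin n) (Fin n) 𝕜) (m : Mem 𝕜) : Prop :=
  P.IsGood X (colOf n m L.out 0)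

lemma outGood_test (hr : 6 ≤ r) (hρ : L.RegsHold P ρ) {m : Mem 𝕜}
    (hm : L.Holds P X Z m) (h : L.OutGood P X m ∨ P.IsGood X (colOf n m 30 4)) :
    L.OutGood P X (L.testAct r ρ m) := by
  rw [testAct_apply hr hρ hm]
  split_ifs with hg
  · have := colOf_setCol_self (r := r) (a := L.out) (m := m) hρ.1 (.const 0)
      (cellV 30 (.reg r) (.const 4))
    rw [OutGood]
    change P.IsGood X (colOf n _ L.out (NatExp.eval ρ (.const 0)))
    rw [this]
    convert hg using 1
    funext i
    simp [cellV, NatExp.eval, colOf]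
  · exact h.resolve_right hg

lemma outGood_try (hL : L.Valid) (hr : 6 ≤ r) (hρ : L.RegsHold P ρ) {m : Mem 𝕜}
    (hm : L.Holds P X Z m) (k : Fin 4) (T : Fin 3 → Val 𝕜)
    (h : L.OutGood P X m ∨ ∃ c : Fin 3 → 𝕜, (∀ i p, T p (Function.update ρ r i) m = c p) ∧
      P.IsGood X (P.rescale X k
        (combine ![colOf n m 30 0, colOf n m 30 1, colOf n m 30 2] c))) :
    L.OutGood P X (L.tryAct r k T ρ m) := by
  have hin : ∀ a ∈ L.inputs, a ≠ 30 := fun a ha => by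
    have := (hL.inputs_lt a ha).2.1; omega
  have hn := hρ.1
  set f₃ : Val 𝕜 := T 0 * cellV 30 (.reg r) (.const 0) +
      T 1 * cellV 30 (.reg r) (.const 1) + T 2 * cellV 30 (.reg r) (.const 2) with hf₃
  set m₁ := setCol r 30 (.const 3) f₃ ρ m with hm₁
  set f₄ : Val 𝕜 := sqrtV (innerV (r + 1) (L.matA k) L.matX /
      formV (r + 1) (L.matA k) 30 (.const 3) 30 (.const 3)) *
        cellV 30 (.reg r) (.const 3) with hf₄
  set m₂ := setCol r 30 (.const 4) f₄ ρ m₁ with hm₂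
  have e1 : ∀ a, a ≠ 30 → m₁ a = m a := fun a ha => setCol_modifies _ _ _ _ _ _ _ (by simpa)
  have e2 : ∀ a, a ≠ 30 → m₂ a = m₁ a := fun a ha => setCol_modifies _ _ _ _ _ _ _ (by simpa)
  have hH1 : L.Holds P X Z m₁ := hm.congr fun a ha => e1 a (hin a ha)
  have hH2 : L.Holds P X Z m₂ := hH1.congr fun a ha => e2 a (hin a ha)
  have ho : L.out ≠ 30 := by have := hL.out_lt; omega
  refine outGood_test hr hρ hH2 ?_
  rcases h with h | ⟨c, hc, hg⟩
  · left
    rwa [OutGood, colOf_congr (e2 _ ho), colOf_congr (e1 _ ho)]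
  · right
    have hv : colOf n m₁ 30 3 =
        combine ![colOf n m 30 0, colOf n m 30 1, colOf n m 30 2] c := by
      refine (colOf_setCol_self hn (.const 3) f₃).trans (funext fun i => ?_)
      simp [hf₃, hc, cellV, NatExp.eval, combine, colOf]
    have hv' : colOf n m₂ 30 4 = P.rescale X k (colOf n m₁ 30 3) := by
      refine (colOf_setCol_self hn (.const 4) f₄).trans (funext fun i => ?_)
      have hn' : Function.update ρ r (i : ℕ) 0 = n := by
        rw [Function.update_of_ne (by omega), hn]
      have hs : RCLike.re (sesq (P.A k) (colOf n m₁ 30 3) (colOf n m₁ 30 3)) =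
        quadForm (P.A k) (colOf n m₁ 30 3) := rfl
      simp only [hf₄, Pi.mul_apply, sqrtV_apply, Pi.div_apply, innerV_apply hn' (Nat.succ_pos r),
        formV_const hn' (Nat.succ_pos r), hH1.constraint, hH1.primal, HQP.rescale, Pi.smul_apply,
        smul_eq_mul]
      rw [sesq_self _ (P.hermitian k), ← RCLike.ofReal_div, RCLike.ofReal_re]
      simp [cellV, NatExp.eval, colOf]
    rw [hv', hv]
    exact hg

end Layout

end RealRAM

/-! ### The search -/

namespace RealRAM

variable {𝕜 : Type} [RCLike 𝕜]

/-- The expressions for the coordinates of the candidates, for the three forms in the arrays `20`,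
`21`, `22` and the three vectors in array `30`. -/
noncomputable def candidateVals (b : ℕ) : List (Fin 3 → Val 𝕜) :=
  candidates imagV rootV (fun p q => formV b 20 30 (.const p) 30 (.const q))
    (fun p q => formV b 21 30 (.const p) 30 (.const q))
    (fun p q => formV b 22 30 (.const p) 30 (.const q))

lemma compE_candidateVals {b : ℕ} (hb : 0 < b) :
    ∀ T ∈ (candidateVals b : List (Fin 3 → Val 𝕜)), ∀ p, CompE b (T p) := by
  let K : Subring (Val 𝕜) :=
    { carrier := {f | CompE b f}
      mul_mem' := fun hf hg => hf.mul hb hg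
      one_mem' := by
        have : (1 : Val 𝕜) = intV 1 := by funext ρ m; simp [intV]
        rw [Set.mem_ofPred_eq, this]; exact CompE.int 1
      add_mem' := fun hf hg => hf.add hb hg
      zero_mem' := by
        have : (0 : Val 𝕜) = intV 0 := by funext ρ m; simp [intV]
        rw [Set.mem_ofPred_eq, this]; exact CompE.int 0
      neg_mem' := by
        intro f hf
        have : -f = intV 0 - f := by funext ρ m; simp [intV]
        rw [Set.mem_ofPred_eq, this]; exact (CompE.int 0).sub hb hf }
  have hform : ∀ a < 100, ∀ p q : Fin 3, formV b a 30 (.const p) 30 (.const q) ∈ K :=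
    fun a ha p q => CompE.form hb ha (by omega) (by omega) trivial trivial
  exact mem_of_mem_candidates K (fun f hf => CompE.conj hb hf)
    (fun f hf g hg => CompE.div hb hf hg) CompE.imag (fun j l hl => CompE.root hb j l hl)
    (hform 20 (by omega)) (hform 21 (by omega)) (hform 22 (by omega))

lemma candidateVals_apply {n b : ℕ} (hb : 0 < b) {ρ : ℕ → ℕ} (hn : ρ 0 = n) (m : Mem 𝕜) :
    (candidateVals b).map (fun T p => T p ρ m) =
      candidates RCLike.I realRoot
        (gram (matOf n m 20) ![colOf n m 30 0, colOf n m 30 1, colOf n m 30 2])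
        (gram (matOf n m 21) ![colOf n m 30 0, colOf n m 30 1, colOf n m 30 2])
        (gram (matOf n m 22) ![colOf n m 30 0, colOf n m 30 1, colOf n m 30 2]) := by
  let φ : Val 𝕜 →+* 𝕜 := (Pi.evalRingHom (fun _ : Mem 𝕜 => 𝕜) m).comp
    (Pi.evalRingHom (fun _ : ℕ → ℕ => Mem 𝕜 → 𝕜) ρ)
  have h := map_candidates φ (fun _ => rfl) (fun _ _ => rfl) imagV rootV realRoot
    (fun j l => by simp only [realRoot, List.map_map]; rfl)
    (fun p q => formV b 20 30 (.const p) 30 (.const q))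
    (fun p q => formV b 21 30 (.const p) 30 (.const q))
    (fun p q => formV b 22 30 (.const p) 30 (.const q))
  have hg : ∀ a, (fun p q : Fin 3 => φ (formV b a 30 (.const p) 30 (.const q))) =
      gram (matOf n m a) ![colOf n m 30 0, colOf n m 30 1, colOf n m 30 2] := by
    intro a
    funext p q
    change formV b a 30 (.const p) 30 (.const q) ρ m = _
    have hcol : ∀ p : Fin 3, ![colOf n m 30 0, colOf n m 30 1, colOf n m 30 2] p =
        colOf n m 30 p := by
      intro p
      fin_cases p <;> rfl
    rw [gram, hcol, hcol]
    exact formV_apply (cx := .const p) (cy := .const q) hn hb trivial trivial m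
  rw [hg, hg, hg] at h
  exact h

attribute [irreducible] candidateVals

lemma exists_mem_of_map_eq {α β ι : Type*} {l : List α} {l' : List β} {c : β} (hc : c ∈ l')
    (φ : ι → α → β) (p : ι → Prop) {i₀ : ι} (hi₀ : p i₀) (h : ∀ i, p i → l.map (φ i) = l') :
    ∃ T ∈ l, ∀ i, p i → φ i T = c := by
  obtain ⟨j, hj, rfl⟩ := List.getElem_of_mem hc
  have hj' : j < l.length := by
    rw [← h i₀ hi₀, List.length_map] at hj
    exact hj
  refine ⟨_, List.getElem_mem hj', fun i hi => ?_⟩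
  simp only [← h i hi, List.getElem_map]

/-- Every candidate is the value of one of the expressions, in every state that agrees with the
given one in the forms and in the three vectors. -/
lemma exists_candidateVal {n b : ℕ} (hb : 0 < b) {ρ : ℕ → ℕ} (hn : ρ 0 = n) (m : Mem 𝕜)
    {c : Fin 3 → 𝕜} (hc : c ∈ candidates RCLike.I realRoot
      (gram (matOf n m 20) ![colOf n m 30 0, colOf n m 30 1, colOf n m 30 2])
      (gram (matOf n m 21) ![colOf n m 30 0, colOf n m 30 1, colOf n m 30 2])
      (gram (matOf n m 22) ![colOf n m 30 0, colOf n m 30 1, colOf n m 30 2])) :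
    ∃ T ∈ (candidateVals b : List (Fin 3 → Val 𝕜)), ∀ (ρ' : ℕ → ℕ) (m' : Mem 𝕜), ρ' 0 = n →
      (∀ a, 20 ≤ a → a ≤ 22 → m' a = m a) → (∀ q < 3, colOf n m' 30 q = colOf n m 30 q) →
      ∀ p, T p ρ' m' = c p := by
  obtain ⟨T, hT, h⟩ := exists_mem_of_map_eq (l := candidateVals b) hc
    (fun (i : (ℕ → ℕ) × Mem 𝕜) T p => T p i.1 i.2)
    (fun i => i.1 0 = n ∧ (∀ a, 20 ≤ a → a ≤ 22 → i.2 a = m a) ∧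
      ∀ q < 3, colOf n i.2 30 q = colOf n m 30 q) (i₀ := (ρ, m))
    ⟨hn, fun _ _ _ => rfl, fun _ _ => rfl⟩ (by
      rintro ⟨ρ', m'⟩ ⟨hn', hm, hq⟩
      have h := candidateVals_apply hb hn' m'
      rw [matOf_congr (hm 20 (by omega) (by omega)), matOf_congr (hm 21 (by omega) (by omega)),
        matOf_congr (hm 22 (by omega) (by omega)), hq 0 (by omega), hq 1 (by omega),
        hq 2 (by omega)] at h
      exact h)
  exact ⟨T, hT, fun ρ' m' hn' hm hq p => congrFun (h (ρ', m') ⟨hn', hm, hq⟩) p⟩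

/-- The cross term of `upForm` for a column of array `30` and another column. -/
noncomputable def upV (b : ℕ) (cx : NatExp) (y : ℕ) (cy : NatExp) : Val 𝕜 :=
  (intV 2 + imagV * imagV) * (formV b 20 30 cx y cy + imagV * formV b 21 30 cx y cy)

lemma upV_apply {n b y : ℕ} {cx cy : NatExp} {ρ : ℕ → ℕ} (hn : ρ 0 = n) (hb : 0 < b)
    (hcx : cx.Below b) (hcy : cy.Below b) (m : Mem 𝕜) : upV b cx y cy ρ m =
      upForm (matOf n m 20) (matOf n m 21) (colOf n m 30 (cx.eval ρ))
        (colOf n m y (cy.eval ρ)) := by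
  simp only [upV, Pi.mul_apply, Pi.add_apply, formV_apply hn hb hcx hcy, intV, imagV, upForm,
    Int.cast_ofNat]

lemma CompE.up {b y : ℕ} {cx cy : NatExp} (hb : 0 < b) (hy : y < 100) (hcx : cx.Below b)
    (hcy : cy.Below b) : CompE b (upV b cx y cy : Val 𝕜) := by
  have hf : ∀ a < 100, CompE b (formV b a 30 cx y cy : Val 𝕜) := fun a ha =>
    CompE.form hb ha (by omega) hy hcx hcy
  exact CompE.mul hb (CompE.add hb (CompE.int 2) (CompE.imag.mul hb CompE.imag))
    (CompE.add hb (hf 20 (by omega)) (CompE.imag.mul hb (hf 21 (by omega))))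

namespace Layout

/-- Prepare three vectors in array `30`: the columns of array `25` given by the first two loop
registers and the adjusted column of array `13` given by the third. -/
noncomputable def prepareAct (r : ℕ) : Act 𝕜 :=
  (setCol (r + 3) 30 (.const 0) (cellV 25 (.reg (r + 3)) (.reg r))).then
    ((setCol (r + 3) 30 (.const 1) (cellV 25 (.reg (r + 3)) (.reg (r + 1)))).then
      (setCol (r + 3) 30 (.const 2) (cellV 13 (.reg (r + 3)) (.reg (r + 2)) -
        upV (r + 4) (.const 0) 13 (.reg (r + 2)) / upV (r + 4) (.const 0) 30 (.const 1) *
          cellV 30 (.reg (r + 3)) (.const 1))))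

/-- One pass of the search: the preparation of three vectors and the tests. -/
noncomputable def bodyAct (L : Layout) (r : ℕ) (k : Fin 4) : Act 𝕜 :=
  (prepareAct r).then (Act.list ((candidateVals (r + 4)).map (L.tryAct (r + 3) k)))

/-- Test all candidates for all triples of vectors. -/
noncomputable def searchAct (L : Layout) (r : ℕ) (k : Fin 4) : Act 𝕜 :=
  Act.loop r (Act.loop (r + 1) (Act.loop (r + 2) (L.bodyAct r k)))

variable {L : Layout} {n : ℕ} {P : HQP 𝕜 n 4} {X Z : Matrix (Fin n) (Fin n) 𝕜} {r : ℕ} {ρ : ℕ → ℕ}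

lemma compS_prepare : CompS (r + 3) (prepareAct r : Act 𝕜) := by
  have hb : ∀ i < r + 4, NatExp.Below (r + 3 + 1) (.reg i) := fun i hi => hi
  refine CompS.then (by omega) (CompS.setCol (by omega) (by omega) trivial
    (CompE.cell (by omega) (hb _ (by omega)) (hb _ (by omega)))) (CompS.then (by omega)
      (CompS.setCol (by omega) (by omega) trivial
        (CompE.cell (by omega) (hb _ (by omega)) (hb _ (by omega))))
      (CompS.setCol (by omega) (by omega) trivial ?_))
  exact CompE.sub (by omega) (CompE.cell (by omega) (hb _ (by omega)) (hb _ (by omega)))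
    (CompE.mul (by omega) (CompE.div (by omega)
      (CompE.up (by omega) (by omega) trivial (hb _ (by omega)))
      (CompE.up (by omega) (by omega) trivial trivial))
      (CompE.cell (by omega) (hb _ (by omega)) trivial))

lemma compS_search (hL : L.Valid) (hr : 6 ≤ r) (k : Fin 4) :
    CompS r (L.searchAct r k : Act 𝕜) := by
  refine CompS.loop (by omega) (CompS.loop (by omega) (CompS.loop (by omega)
    (CompS.then (by omega) compS_prepare (CompS.list (by omega) _ ?_))))
  simp only [List.mem_map]
  rintro _ ⟨T, hT, rfl⟩
  exact compS_try hL (by omega) k (compE_candidateVals (by omega) T hT)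

lemma prepareAct_modifies : (prepareAct r : Act 𝕜).Modifies {30} :=
  Act.Modifies.then (setCol_modifies _ _ _ _) (Act.Modifies.then (setCol_modifies _ _ _ _)
    (setCol_modifies _ _ _ _))

lemma tries_modifies (k : Fin 4) : (Act.list ((candidateVals (r + 4)).map
    (L.tryAct (r + 3) k)) : Act 𝕜).Modifies {30, L.out} := by
  refine Act.Modifies.list ?_
  simp only [List.mem_map]
  rintro _ ⟨T, -, rfl⟩
  exact tryAct_modifies k T

lemma prepareAct_spec (hn : ρ 0 = n) (m : Mem 𝕜) :
    colOf n (prepareAct r ρ m) 30 0 = colOf n m 25 (ρ r) ∧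
    colOf n (prepareAct r ρ m) 30 1 = colOf n m 25 (ρ (r + 1)) ∧
    colOf n (prepareAct r ρ m) 30 2 = adjust (matOf n m 20) (matOf n m 21)
      (colOf n m 25 (ρ r)) (colOf n m 25 (ρ (r + 1))) (colOf n m 13 (ρ (r + 2))) := by
  set m₁ := setCol (r + 3) 30 (.const 0) (cellV 25 (.reg (r + 3)) (.reg r)) ρ m with hm₁
  set m₂ := setCol (r + 3) 30 (.const 1) (cellV 25 (.reg (r + 3)) (.reg (r + 1))) ρ m₁ with hm₂
  set f : Val 𝕜 := cellV 13 (.reg (r + 3)) (.reg (r + 2)) -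
    upV (r + 4) (.const 0) 13 (.reg (r + 2)) / upV (r + 4) (.const 0) 30 (.const 1) *
      cellV 30 (.reg (r + 3)) (.const 1) with hf
  change colOf n (setCol (r + 3) 30 (.const 2) f ρ m₂) 30 0 = _ ∧
    colOf n (setCol (r + 3) 30 (.const 2) f ρ m₂) 30 1 = _ ∧
    colOf n (setCol (r + 3) 30 (.const 2) f ρ m₂) 30 2 = _
  have e1 : ∀ a, a ≠ 30 → m₁ a = m a := fun a ha => setCol_modifies _ _ _ _ _ _ _ (by simpa)
  have e2 : ∀ a, a ≠ 30 → m₂ a = m a := fun a ha =>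
    (setCol_modifies _ _ _ _ _ _ _ (by simpa)).trans (e1 a ha)
  have hreg : ∀ i j, j < r + 3 → Function.update ρ (r + 3) i j = ρ j := fun i j hj =>
    Function.update_of_ne (by omega) _ _
  have h0 : colOf n m₂ 30 0 = colOf n m 25 (ρ r) := by
    rw [hm₂, colOf_setCol_of_ne (by simp [NatExp.eval])]
    refine (colOf_setCol_self hn (.const 0) _).trans (funext fun i => ?_)
    simp only [cellV, NatExp.eval, Function.update_self, hreg _ r (by omega), colOf]
  have h1 : colOf n m₂ 30 1 = colOf n m 25 (ρ (r + 1)) := by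
    refine (colOf_setCol_self hn (.const 1) _).trans (funext fun i => ?_)
    simp only [cellV, NatExp.eval, Function.update_self, hreg _ (r + 1) (by omega), colOf,
      e1 25 (by omega)]
  refine ⟨?_, ?_, ?_⟩
  · rw [colOf_setCol_of_ne (by simp [NatExp.eval]), h0]
  · rw [colOf_setCol_of_ne (by simp [NatExp.eval]), h1]
  · refine (colOf_setCol_self hn (.const 2) _).trans (funext fun i => ?_)
    have hn' : Function.update ρ (r + 3) (i : ℕ) 0 = n := by rw [hreg _ 0 (by omega), hn]
    rw [hf, Pi.sub_apply, Pi.sub_apply, Pi.mul_apply, Pi.mul_apply, Pi.div_apply, Pi.div_apply,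
      upV_apply (cx := .const 0) (cy := .reg (r + 2)) hn' (by omega) trivial
        (by simp only [NatExp.Below]; omega),
      upV_apply (cx := .const 0) (cy := .const 1) hn' (by omega) trivial trivial]
    simp only [NatExp.eval, hreg _ (r + 2) (by omega), h0, h1, cellV, Function.update_self,
      matOf_congr (e2 20 (by omega)), matOf_congr (e2 21 (by omega)),
      colOf_congr (e2 13 (by omega)), e2 13 (by omega), adjust, Pi.sub_apply, Pi.smul_apply,
      smul_eq_mul]
    rw [← h1]
    rfl

/-- The memory holds the problem and differs from the initial memory `m₀` only in the output and in
array `30`. -/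
structure SearchInv (L : Layout) (P : HQP 𝕜 n 4) (X Z : Matrix (Fin n) (Fin n) 𝕜) (m₀ m : Mem 𝕜) :
    Prop where
  holds : L.Holds P X Z m
  frame : ∀ a, a ≠ 30 → a ≠ L.out → m a = m₀ a

lemma SearchInv.act (hL : L.Valid) {m₀ m : Mem 𝕜} (h : L.SearchInv P X Z m₀ m) {F : Act 𝕜}
    (hF : F.Modifies {30, L.out}) (ρ : ℕ → ℕ) : L.SearchInv P X Z m₀ (F ρ m) where
  holds := h.holds.congr fun a ha => hF ρ m a (by
    have := hL.inputs_lt a ha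
    simp only [Set.mem_insert_iff, Set.mem_singleton_iff]
    omega)
  frame a ha ha' := (hF ρ m a (by simp [ha, ha'])).trans (h.frame a ha ha')

lemma colOf_tryAct (hL : L.Valid) (k : Fin 4) (T : Fin 3 → Val 𝕜) (ρ : ℕ → ℕ) (m : Mem 𝕜) {q : ℕ}
    (hq : q < 3) : colOf n (L.tryAct (r + 3) k T ρ m) 30 q = colOf n m 30 q := by
  have ho := hL.out_lt
  rw [tryAct, Act.then, Act.then]
  rw [colOf_congr (testAct_modifies _ _ 30 (by simp only [Set.mem_singleton_iff]; omega)),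
    colOf_setCol_of_ne (by simp only [NatExp.eval]; omega),
    colOf_setCol_of_ne (by simp only [NatExp.eval]; omega)]

lemma outGood_tries_of_outGood (hL : L.Valid) (hr : 6 ≤ r) (hρ : L.RegsHold P ρ) (k : Fin 4)
    {m₀ : Mem 𝕜} (l : List (Fin 3 → Val 𝕜)) : ∀ m, L.SearchInv P X Z m₀ m → L.OutGood P X m →
      L.OutGood P X (Act.list (l.map (L.tryAct (r + 3) k)) ρ m) := by
  induction l with
  | nil => exact fun _ _ h => h
  | cons T l ih =>
    intro m hm hg
    exact ih _ (hm.act hL (tryAct_modifies k T) ρ)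
      (outGood_try hL (by omega) hρ hm.holds k T (Or.inl hg))

lemma outGood_tries (hL : L.Valid) (hr : 6 ≤ r) (hρ : L.RegsHold P ρ) (k : Fin 4)
    {m₀ m : Mem 𝕜} (hm : L.SearchInv P X Z m₀ m) {l : List (Fin 3 → Val 𝕜)}
    {T : Fin 3 → Val 𝕜} (hT : T ∈ l) {c : Fin 3 → 𝕜}
    (hc : ∀ (ρ' : ℕ → ℕ) (m' : Mem 𝕜), ρ' 0 = n → (∀ a, 20 ≤ a → a ≤ 22 → m' a = m a) →
      (∀ q < 3, colOf n m' 30 q = colOf n m 30 q) → ∀ p, T p ρ' m' = c p)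
    (hg : P.IsGood X (P.rescale X k
      (combine ![colOf n m 30 0, colOf n m 30 1, colOf n m 30 2] c))) :
    L.OutGood P X (Act.list (l.map (L.tryAct (r + 3) k)) ρ m) := by
  have ho := hL.out_lt
  refine Act.list_reaches (List.mem_map_of_mem hT) ρ m
    (fun m' => L.SearchInv P X Z m₀ m' ∧ ∀ q < 3, colOf n m' 30 q = colOf n m 30 q)
    (L.OutGood P X) ⟨hm, fun _ _ => rfl⟩ ?_ ?_ ?_
  · simp only [List.mem_map]
    rintro _ ⟨T', -, rfl⟩ m' ⟨h1, h2⟩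
    exact ⟨h1.act hL (tryAct_modifies k T') ρ, fun q hq =>
      (colOf_tryAct hL k T' ρ m' hq).trans (h2 q hq)⟩
  · simp only [List.mem_map]
    rintro _ ⟨T', -, rfl⟩ m' ⟨h1, h2⟩ hgood
    exact outGood_try hL (by omega) hρ h1.holds k T' (Or.inl hgood)
  · rintro m' ⟨h1, h2⟩
    refine outGood_try hL (by omega) hρ h1.holds k T (Or.inr ⟨c, fun i p => ?_, ?_⟩)
    · refine hc _ m' (by rw [Function.update_of_ne (by omega), hρ.1]) (fun a ha ha' => ?_) h2 p
      rw [h1.frame a (by omega) (by omega), hm.frame a (by omega) (by omega)]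
    · rw [h2 0 (by omega), h2 1 (by omega), h2 2 (by omega)]
      exact hg

/-- The three vectors of the search, for the values `i`, `j`, `l` of the loop registers. -/
noncomputable def searchVecs (n : ℕ) (m : Mem 𝕜) (i j l : ℕ) : Fin 3 → Fin n → 𝕜 :=
  ![colOf n m 25 i, colOf n m 25 j,
    adjust (matOf n m 20) (matOf n m 21) (colOf n m 25 i) (colOf n m 25 j) (colOf n m 13 l)]

/-- For the vectors `y`, some candidate is a good point. -/
def SearchSucceeds (P : HQP 𝕜 n 4) (X : Matrix (Fin n) (Fin n) 𝕜) (k : Fin 4) (m : Mem 𝕜)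
    (y : Fin 3 → Fin n → 𝕜) : Prop :=
  ∃ c ∈ candidates RCLike.I realRoot (gram (matOf n m 20) y) (gram (matOf n m 21) y)
    (gram (matOf n m 22) y), P.IsGood X (P.rescale X k (combine y c))

lemma outGood_body (hL : L.Valid) (hr : 6 ≤ r) (hρ : L.RegsHold P ρ) (k : Fin 4) {m₀ m : Mem 𝕜}
    (hm : L.SearchInv P X Z m₀ m)
    (h : L.OutGood P X m ∨
      SearchSucceeds P X k m₀ (searchVecs n m₀ (ρ r) (ρ (r + 1)) (ρ (r + 2)))) :
    L.OutGood P X (L.bodyAct r k ρ m) := by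
  have ho := hL.out_lt
  obtain ⟨p0, p1, p2⟩ := prepareAct_spec (r := r) hρ.1 m
  have hinv : L.SearchInv P X Z m₀ (prepareAct r ρ m) :=
    hm.act hL (prepareAct_modifies.mono (by simp)) ρ
  rw [bodyAct, Act.then]
  rcases h with h | ⟨c, hc, hg⟩
  · refine outGood_tries_of_outGood hL hr hρ k _ _ hinv ?_
    rwa [OutGood, colOf_congr (prepareAct_modifies ρ m L.out
      (by simp only [Set.mem_singleton_iff]; omega))]
  · have hfr : ∀ a, a ≠ 30 → a ≠ L.out → matOf n m a = matOf n m₀ a := fun a h1 h2 =>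
      matOf_congr (hm.frame a h1 h2)
    have hfc : ∀ a c, a ≠ 30 → a ≠ L.out → colOf n m a c = colOf n m₀ a c := fun a c h1 h2 =>
      colOf_congr (hm.frame a h1 h2) c
    rw [hfc 25 _ (by omega) (by omega)] at p0 p1
    rw [hfr 20 (by omega) (by omega), hfr 21 (by omega) (by omega), hfc 25 _ (by omega) (by omega),
      hfc 25 _ (by omega) (by omega), hfc 13 _ (by omega) (by omega)] at p2
    generalize prepareAct r ρ m = m₁ at *
    have hy' : ![colOf n m₁ 30 0, colOf n m₁ 30 1, colOf n m₁ 30 2] =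
        searchVecs n m₀ (ρ r) (ρ (r + 1)) (ρ (r + 2)) := by rw [p0, p1, p2, searchVecs]
    obtain ⟨T, hT, hTc⟩ := exists_candidateVal (b := r + 4) (by omega) hρ.1 m₁ (c := c) (by
      rw [hy', matOf_congr (hinv.frame 20 (by omega) (by omega)),
        matOf_congr (hinv.frame 21 (by omega) (by omega)),
        matOf_congr (hinv.frame 22 (by omega) (by omega))]
      exact hc)
    refine outGood_tries hL hr hρ k hinv hT hTc ?_
    rw [hy']
    exact hg

lemma bodyAct_modifies (k : Fin 4) : (L.bodyAct r k : Act 𝕜).Modifies {30, L.out} :=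
  Act.Modifies.then (prepareAct_modifies.mono (by simp)) (tries_modifies k)

lemma searchAct_modifies (k : Fin 4) : (L.searchAct r k : Act 𝕜).Modifies {30, L.out} :=
  Act.Modifies.loop (Act.Modifies.loop (Act.Modifies.loop (bodyAct_modifies k)))

lemma outGood_search_of_outGood (hL : L.Valid) (hr : 6 ≤ r) (hρ : L.RegsHold P ρ) (k : Fin 4)
    {m : Mem 𝕜} (hm : L.Holds P X Z m) (h : L.OutGood P X m) :
    L.OutGood P X (L.searchAct r k ρ m) := by
  refine (Act.loop_inv _ _ ρ m (fun _ m' => L.SearchInv P X Z m m' ∧ L.OutGood P X m')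
    ⟨⟨hm, fun _ _ _ => rfl⟩, h⟩ ?_).2
  rintro i - m₁ h₁
  refine Act.loop_inv _ _ _ m₁ (fun _ m' => L.SearchInv P X Z m m' ∧ L.OutGood P X m') h₁ ?_
  rintro j - m₂ h₂
  refine Act.loop_inv _ _ _ m₂ (fun _ m' => L.SearchInv P X Z m m' ∧ L.OutGood P X m') h₂ ?_
  rintro l - m₃ ⟨h₃, h₃'⟩
  exact ⟨h₃.act hL (bodyAct_modifies k) _, outGood_body hL hr
    (((hρ.update hL hr i).update hL (by omega) j).update hL (by omega) l) k h₃ (Or.inl h₃')⟩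

/-- The search finds a good point if some candidate is good. -/
lemma outGood_search (hL : L.Valid) (hr : 6 ≤ r) (hρ : L.RegsHold P ρ) (k : Fin 4)
    {m : Mem 𝕜} (hm : L.Holds P X Z m)
    (h : ∃ l₁ l₂ l₃ : Fin n, SearchSucceeds P X k m (searchVecs n m l₁ l₂ l₃)) :
    L.OutGood P X (L.searchAct r k ρ m) := by
  obtain ⟨l₁, l₂, l₃, hc⟩ := h
  have hinv : ∀ m₁, L.SearchInv P X Z m m₁ → ∀ F : Act 𝕜, F.Modifies {30, L.out} → ∀ ρ,
      L.SearchInv P X Z m (F ρ m₁) := fun m₁ h F hF ρ => h.act hL hF ρ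
  have m1 : (Act.loop (r + 2) (L.bodyAct r k) : Act 𝕜).Modifies {30, L.out} :=
    Act.Modifies.loop (bodyAct_modifies k)
  have m2 : (Act.loop (r + 1) (Act.loop (r + 2) (L.bodyAct r k)) : Act 𝕜).Modifies {30, L.out} :=
    Act.Modifies.loop m1
  have p1 : ∀ ρ : ℕ → ℕ, L.RegsHold P ρ → ∀ m₁, L.SearchInv P X Z m m₁ → L.OutGood P X m₁ →
      L.OutGood P X (Act.loop (r + 2) (L.bodyAct r k) ρ m₁) := by
    intro ρ hρ m₁ h1 h2
    refine (Act.loop_inv _ _ ρ m₁ (fun _ m' => L.SearchInv P X Z m m' ∧ L.OutGood P X m')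
      ⟨h1, h2⟩ ?_).2
    rintro i - m₂ ⟨h3, h4⟩
    exact ⟨hinv _ h3 _ (bodyAct_modifies k) _, outGood_body hL hr (hρ.update hL (by omega) i) k h3
      (Or.inl h4)⟩
  have p2 : ∀ ρ : ℕ → ℕ, L.RegsHold P ρ → ∀ m₁, L.SearchInv P X Z m m₁ → L.OutGood P X m₁ →
      L.OutGood P X (Act.loop (r + 1) (Act.loop (r + 2) (L.bodyAct r k)) ρ m₁) := by
    intro ρ hρ m₁ h1 h2
    refine (Act.loop_inv _ _ ρ m₁ (fun _ m' => L.SearchInv P X Z m m' ∧ L.OutGood P X m')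
      ⟨h1, h2⟩ ?_).2
    rintro i - m₂ ⟨h3, h4⟩
    exact ⟨hinv _ h3 _ m1 _, p1 _ (hρ.update hL (by omega) i) _ h3 h4⟩
  have hlt : ∀ l : Fin n, (l : ℕ) < ρ 0 := fun l => by rw [hρ.1]; exact l.2
  refine Act.loop_reaches _ _ ρ m (L.SearchInv P X Z m) (L.OutGood P X) ⟨hm, fun _ _ _ => rfl⟩
    (fun i m' h => hinv _ h _ m2 _) (fun i m' h h' => p2 _ (hρ.update hL hr i) _ h h')
    (hlt l₁) fun m₁ h₁ => ?_
  have hρ₁ := hρ.update hL hr l₁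
  refine Act.loop_reaches _ _ _ m₁ (L.SearchInv P X Z m) (L.OutGood P X) h₁
    (fun i m' h => hinv _ h _ m1 _)
    (fun i m' h h' => p1 _ (hρ₁.update hL (by omega) i) _ h h')
    (i₀ := l₂) (by rw [hρ₁.1]; exact l₂.2) fun m₂ h₂ => ?_
  have hρ₂ := hρ₁.update hL (show 6 ≤ r + 1 by omega) l₂
  refine Act.loop_reaches _ _ _ m₂ (L.SearchInv P X Z m) (L.OutGood P X) h₂
    (fun i m' h => hinv _ h _ (bodyAct_modifies k) _)
    (fun i m' h h' => outGood_body hL hr (hρ₂.update hL (by omega) i) k h (Or.inl h'))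
    (i₀ := l₃) (by rw [hρ₂.1]; exact l₃.2) fun m₃ h₃ => ?_
  refine outGood_body hL hr (hρ₂.update hL (by omega) l₃) k h₃ (Or.inr ?_)
  have e1 : Function.update (Function.update (Function.update ρ r l₁) (r + 1) l₂) (r + 2) l₃ r =
      l₁ := by
    rw [Function.update_of_ne (by omega), Function.update_of_ne (by omega), Function.update_self]
  have e2 : Function.update (Function.update (Function.update ρ r l₁) (r + 1) l₂) (r + 2) l₃
      (r + 1) = l₂ := by
    rw [Function.update_of_ne (by omega), Function.update_self]
  rw [e1, e2, Function.update_self]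
  exact hc

end Layout

end RealRAM

/-! ### The program -/

namespace RealRAM.Layout

variable {𝕜 : Type} [RCLike 𝕜]

/-- The entries of the identity matrix, for the row and column in registers `r` and `r + 1`. -/
noncomputable def identityV (r : ℕ) : Val 𝕜 :=
  natIteV (.reg r) (.reg (r + 1)) (natIteV (.reg (r + 1)) (.reg r) (intV 1) (intV 0)) (intV 0)

/-- The entries of `HQP.balanced`. -/
noncomputable def balancedV (L : Layout) (r : ℕ) (k j : Fin 4) : Val 𝕜 :=
  cellV (L.matA j) (.reg r) (.reg (r + 1)) -
    innerV (r + 2) (L.matA j) L.matX / innerV (r + 2) (L.matA k) L.matX *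
      cellV (L.matA k) (.reg r) (.reg (r + 1))

/-- Compute a decomposition of `X` in the columns of array `12` and vectors that span the kernel of
`Z` in the columns of array `13`, clear array `16`, and put the zero vector into the output. -/
noncomputable def prologueAct (L : Layout) (r : ℕ) : Act 𝕜 :=
  Act.list [setMat r 10 (identityV r), setMat r 16 (intV 0),
    setMat r 11 (cellV L.matX (.reg r) (.reg (r + 1))), deflateAct r 11 10 12,
    setMat r 13 (identityV r), deflateAct r 13 L.matZ 14, setCol r L.out (.const 0) (intV 0)]

/-- Normalize by the form number `k`: rotate the decomposition of `X` until the forms number `j₁`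
and `j₂` vanish on it, then search, with the form number `i` as the third one. The
tuple `t` is `(k, i, j₁, j₂)`. -/
noncomputable def attemptAct (L : Layout) (r : ℕ) (t : Fin 4 × Fin 4 × Fin 4 × Fin 4) : Act 𝕜 :=
  (Act.list [setMat r 25 (cellV 12 (.reg r) (.reg (r + 1))),
    setMat r 20 (L.balancedV r t.1 t.2.2.1), setMat r 21 (L.balancedV r t.1 t.2.2.2),
    setMat r 22 (L.balancedV r t.1 t.2.1), rotateAct r 25 16 20 31,
    rotateAct r 25 20 21 31]).then (L.searchAct r t.1)

/-- Find a good point: test the origin and all choices of the forms. -/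
noncomputable def solveAct (L : Layout) (r : ℕ) : Act 𝕜 :=
  (L.prologueAct r).then (Act.list (Finset.univ.toList.map (L.attemptAct r)))

section Comp

variable {L : Layout} {r : ℕ}

lemma compE_identity : CompE (r + 2) (identityV r : Val 𝕜) := by
  have h0 : NatExp.Below (r + 2) (.reg r) := Nat.lt_add_of_pos_right two_pos
  have h1 : NatExp.Below (r + 2) (.reg (r + 1)) := Nat.lt_succ_self _
  exact CompE.natIte h0 h1 (CompE.natIte h1 h0 (CompE.int 1) (CompE.int 0)) (CompE.int 0)

lemma compE_entry {a : ℕ} (ha : a < 100) :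
    CompE (r + 2) (cellV a (.reg r) (.reg (r + 1)) : Val 𝕜) :=
  CompE.cell ha (Nat.lt_add_of_pos_right two_pos) (Nat.lt_succ_self _)

lemma compE_balanced (hL : L.Valid) (k j : Fin 4) :
    CompE (r + 2) (L.balancedV r k j : Val 𝕜) :=
  CompE.sub (by omega) (compE_entry (hL.matA_lt j)) (CompE.mul (by omega)
    (CompE.div (by omega) (CompE.inner (by omega) (hL.matA_lt j) hL.matX_lt)
      (CompE.inner (by omega) (hL.matA_lt k) hL.matX_lt)) (compE_entry (hL.matA_lt k)))

lemma compS_prologue (hL : L.Valid) (hr : 6 ≤ r) : CompS r (L.prologueAct r : Act 𝕜) := by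
  have h0 : 0 < r := by omega
  refine CompS.list h0 _ ?_
  simp only [List.mem_cons, List.not_mem_nil, or_false]
  rintro F (rfl | rfl | rfl | rfl | rfl | rfl | rfl)
  exacts [CompS.setMat h0 (by omega) compE_identity, CompS.setMat h0 (by omega) (CompE.int 0),
    CompS.setMat h0 (by omega) (compE_entry hL.matX_lt),
    CompS.deflate h0 (by omega) (by omega) (by omega), CompS.setMat h0 (by omega) compE_identity,
    CompS.deflate h0 (by omega) hL.matZ_lt (by omega),
    CompS.setCol h0 (hL.out_lt.trans (by omega)) trivial (CompE.int 0)]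

lemma compS_attempt (hL : L.Valid) (hr : 6 ≤ r) (t : Fin 4 × Fin 4 × Fin 4 × Fin 4) :
    CompS r (L.attemptAct r t : Act 𝕜) := by
  have h0 : 0 < r := by omega
  refine CompS.then h0 (CompS.list h0 _ ?_) (compS_search hL hr _)
  simp only [List.mem_cons, List.not_mem_nil, or_false]
  rintro F (rfl | rfl | rfl | rfl | rfl | rfl)
  exacts [CompS.setMat h0 (by omega) (compE_entry (by omega)),
    CompS.setMat h0 (by omega) (compE_balanced hL _ _),
    CompS.setMat h0 (by omega) (compE_balanced hL _ _),
    CompS.setMat h0 (by omega) (compE_balanced hL _ _),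
    CompS.rotate h0 (by omega) (by omega) (by omega) (by omega),
    CompS.rotate h0 (by omega) (by omega) (by omega) (by omega)]

lemma compS_solve (hL : L.Valid) (hr : 6 ≤ r) : CompS r (L.solveAct r : Act 𝕜) := by
  refine CompS.then (by omega) (compS_prologue hL hr) (CompS.list (by omega) _ ?_)
  simp only [List.mem_map]
  rintro _ ⟨t, -, rfl⟩
  exact compS_attempt hL hr t

end Comp

variable {L : Layout} {n r : ℕ} {P : HQP 𝕜 n 4} {X Z : Matrix (Fin n) (Fin n) 𝕜} {ρ : ℕ → ℕ}

lemma matOf_setMat_entry {𝕜 : Type} {n r : ℕ} {ρ : ℕ → ℕ} (hn : ρ 0 = n) (m : Mem 𝕜) (a b : ℕ) :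
    matOf n (setMat r a (cellV b (.reg r) (.reg (r + 1))) ρ m) a = matOf n m b := by
  rw [matOf_setMat_self hn]
  ext i j
  simp [cellV, NatExp.eval, matOf]

lemma matOf_setMat_identity (hn : ρ 0 = n) (m : Mem 𝕜) (a : ℕ) :
    matOf n (setMat r a (identityV r) ρ m) a = 1 := by
  rw [matOf_setMat_self hn]
  ext i j
  simp only [identityV, natIteV, NatExp.eval, intV, Matrix.of_apply, Matrix.one_apply,
    Function.update_self, Function.update_of_ne (Nat.lt_succ_self r).ne, Fin.ext_iff]
  split_ifs <;> first | omega | simp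

lemma matOf_setMat_balanced (hn : ρ 0 = n) (hr : 0 < r) {m : Mem 𝕜} (hm : L.Holds P X Z m) (a : ℕ)
    (k j : Fin 4) : matOf n (setMat r a (L.balancedV r k j) ρ m) a = P.balanced X k j := by
  rw [matOf_setMat_self hn]
  ext p q
  have hn' : Function.update (Function.update ρ r (p : ℕ)) (r + 1) (q : ℕ) 0 = n := by
    rw [Function.update_of_ne (by omega), Function.update_of_ne (by omega), hn]
  have hc : ∀ j, m (L.matA j) p q = P.A j p q := fun j => congrFun₂ (hm.constraint j) p q
  simp only [balancedV, Pi.sub_apply, Pi.mul_apply, Pi.div_apply, innerV_apply hn' (Nat.succ_pos _),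
    hm.constraint, hm.primal, HQP.balanced, Matrix.of_apply, cellV, NatExp.eval,
    Function.update_self, Function.update_of_ne (Nat.lt_succ_self r).ne, hc, Matrix.sub_apply,
    Matrix.smul_apply, smul_eq_mul]
  push_cast
  rfl

/-- The result of the prologue: the memory holds the problem, the columns of array `12` decompose
`X`, the columns of array `13` span the kernel of `Z`, and array `16` is zero. -/
structure Ready (L : Layout) (P : HQP 𝕜 n 4) (X Z : Matrix (Fin n) (Fin n) 𝕜) (m : Mem 𝕜) :
    Prop where
  holds : L.Holds P X Z m
  sum_eq : X = ∑ k ∈ Finset.range n, outerSelf (colOf n m 12 k)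
  kernel : ∀ k < n, Z *ᵥ colOf n m 13 k = 0
  span : ∀ x, Z *ᵥ x = 0 → x ∈ Submodule.span 𝕜 (Set.range fun l : Fin n => colOf n m 13 l)
  zero : matOf n m 16 = 0

lemma Ready.congr {m m' : Mem 𝕜} (h : L.Ready P X Z m)
    (hm : ∀ a, a ∈ L.inputs ∨ a = 12 ∨ a = 13 ∨ a = 16 → m' a = m a) : L.Ready P X Z m' := by
  have h13 : ∀ k, colOf n m' 13 k = colOf n m 13 k := colOf_congr (hm 13 (by simp))
  have h12 : ∀ k, colOf n m' 12 k = colOf n m 12 k := colOf_congr (hm 12 (by simp))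
  refine ⟨h.holds.congr fun a ha => hm a (Or.inl ha), ?_, ?_, ?_, ?_⟩
  · simp only [h12]; exact h.sum_eq
  · simp only [h13]; exact h.kernel
  · simp only [h13]; exact h.span
  · rw [matOf_congr (hm 16 (by simp))]; exact h.zero

/-- The deflation of a positive semidefinite matrix by the unit vectors ends at zero. -/
lemma deflate_primal (hn : ρ 0 = n) (hr : 0 < r) {m : Mem 𝕜} (h10 : matOf n m 10 = 1)
    (hS : (matOf n m 11).PosSemidef) : matOf n m 11 =
      ∑ k ∈ Finset.range n, outerSelf (colOf n (deflateAct r 11 10 12 ρ m) 12 k) := by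
  obtain ⟨-, h2, h3, -⟩ := deflateAct_spec (z := 10) (g := 12) hn hr (by omega) (by omega)
    (by omega) m hS
  have h0 : matOf n (deflateAct r 11 10 12 ρ m) 11 = 0 := by
    ext i j
    have h := congrFun (h2 j j.2) i
    have hcol : colOf n m 10 j = Pi.single j 1 := by
      funext l
      have := congrFun₂ h10 l j
      simp only [matOf, Matrix.of_apply] at this
      rw [colOf, this, Matrix.one_apply, Pi.single_apply]
    rw [hcol, Matrix.mulVec_single_one] at h
    exact h
  rw [h0, zero_add] at h3
  exact h3

/-- The deflation of the identity by the columns of `Z` ends at a matrix whose columns span the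
kernel of `Z`. -/
lemma deflate_slack (hn : ρ 0 = n) (hr : 0 < r) {m : Mem 𝕜} {z : ℕ} (hz : z ≠ 13) (hz' : z ≠ 14)
    (h13 : matOf n m 13 = 1) (hZ : (matOf n m z).IsHermitian) :
    (∀ k < n, matOf n m z *ᵥ colOf n (deflateAct r 13 z 14 ρ m) 13 k = 0) ∧
    ∀ x, matOf n m z *ᵥ x = 0 → x ∈ Submodule.span 𝕜
      (Set.range fun l : Fin n => colOf n (deflateAct r 13 z 14 ρ m) 13 l) := by
  obtain ⟨h1, h2, -, h4⟩ := deflateAct_spec (s := 13) (g := 14) hn hr hz.symm (by omega) hz' m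
    (by rw [h13]; exact Matrix.PosSemidef.one)
  set S := matOf n (deflateAct r 13 z 14 ρ m) 13 with hS
  have hSZ : S * matOf n m z = 0 := by
    ext i j
    exact congrFun (h2 j j.2) i
  have hZS : matOf n m z * S = 0 := by
    have := congrArg Matrix.conjTranspose hSZ
    rwa [Matrix.conjTranspose_mul, hZ.eq, h1.isHermitian.eq, Matrix.conjTranspose_zero] at this
  refine ⟨fun k hk => funext fun i => congrFun₂ hZS i ⟨k, hk⟩, fun x hx => ?_⟩
  have hfix := h4 x (by rw [h13, Matrix.one_mulVec]) fun k hk => by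
    have h := congrFun hx ⟨k, hk⟩
    rw [Matrix.mulVec, dotProduct] at h
    rw [dotProduct]
    simp only [Pi.zero_apply] at h ⊢
    rw [← h]
    refine Finset.sum_congr rfl fun i _ => ?_
    rw [← hZ.apply ⟨k, hk⟩ i]
    rfl
  rw [← hfix]
  have : S *ᵥ x = ∑ l, x l • colOf n (deflateAct r 13 z 14 ρ m) 13 l := by
    funext i
    simp only [Matrix.mulVec, dotProduct, Finset.sum_apply, Pi.smul_apply, smul_eq_mul]
    exact Finset.sum_congr rfl fun l _ => mul_comm _ _
  rw [this]
  exact Submodule.sum_mem _ fun l _ => Submodule.smul_mem _ _ (Submodule.subset_span ⟨l, rfl⟩)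

lemma ready_prologue (hL : L.Valid) (hr : 6 ≤ r) (hn : ρ 0 = n) (hX : X.PosSemidef)
    (hZ : Z.IsHermitian) {m : Mem 𝕜} (hm : L.Holds P X Z m) :
    L.Ready P X Z (L.prologueAct r ρ m) ∧ colOf n (L.prologueAct r ρ m) L.out 0 = 0 := by
  have h0 : 0 < r := by omega
  have ho := hL.out_lt
  have hin : ∀ a ∈ L.inputs, (a < 10 ∨ 50 ≤ a) ∧ a ≠ L.out := fun a ha => (hL.inputs_lt a ha).2
  have hXin : L.matX ∈ L.inputs := Or.inr (Or.inr (Or.inl rfl))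
  have hZin : L.matZ ∈ L.inputs := Or.inr (Or.inr (Or.inr (Or.inl rfl)))
  have iX := hin _ hXin
  have iZ := hin _ hZin
  set m₁ := setMat r 10 (identityV r) ρ m with hm₁
  set m₂ := setMat r 16 (intV 0) ρ m₁ with hm₂
  set m₃ := setMat r 11 (cellV L.matX (.reg r) (.reg (r + 1))) ρ m₂ with hm₃
  set m₄ := deflateAct r 11 10 12 ρ m₃ with hm₄
  set m₅ := setMat r 13 (identityV r) ρ m₄ with hm₅
  set m₆ := deflateAct r 13 L.matZ 14 ρ m₅ with hm₆
  set m₇ := setCol r L.out (.const 0) (intV 0) ρ m₆ with hm₇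
  change L.Ready P X Z m₇ ∧ colOf n m₇ L.out 0 = 0
  have e1 : ∀ a, a ≠ 10 → m₁ a = m a := fun a h => setMat_modifies _ _ _ _ _ _ (by simpa)
  have e2 : ∀ a, a ≠ 16 → m₂ a = m₁ a := fun a h => setMat_modifies _ _ _ _ _ _ (by simpa)
  have e3 : ∀ a, a ≠ 11 → m₃ a = m₂ a := fun a h => setMat_modifies _ _ _ _ _ _ (by simpa)
  have e4 : ∀ a, a ≠ 11 → a ≠ 12 → m₄ a = m₃ a := fun a h h' =>
    deflateAct_modifies _ _ _ _ _ _ _ (by simp [h, h'])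
  have e5 : ∀ a, a ≠ 13 → m₅ a = m₄ a := fun a h => setMat_modifies _ _ _ _ _ _ (by simpa)
  have e6 : ∀ a, a ≠ 13 → a ≠ 14 → m₆ a = m₅ a := fun a h h' =>
    deflateAct_modifies _ _ _ _ _ _ _ (by simp [h, h'])
  have e7 : ∀ a, a ≠ L.out → m₇ a = m₆ a := fun a h => setCol_modifies _ _ _ _ _ _ _ (by simpa)
  have i2 : ∀ a ∈ L.inputs, m₂ a = m a := fun a ha => by
    have := hin a ha
    rw [e2 a (by omega), e1 a (by omega)]
  have i5 : ∀ a ∈ L.inputs, m₅ a = m a := fun a ha => by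
    have := hin a ha
    rw [e5 a (by omega), e4 a (by omega) (by omega), e3 a (by omega), i2 a ha]
  have i7 : ∀ a ∈ L.inputs, m₇ a = m a := fun a ha => by
    have := hin a ha
    rw [e7 a (by omega), e6 a (by omega) (by omega), i5 a ha]
  have h10 : matOf n m₃ 10 = 1 := by
    rw [matOf_congr (e3 10 (by omega)), matOf_congr (e2 10 (by omega))]
    exact matOf_setMat_identity hn m 10
  have h11 : matOf n m₃ 11 = X := by
    refine (matOf_setMat_entry hn m₂ 11 L.matX).trans ?_
    rw [matOf_congr (i2 _ hXin), hm.primal]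
  have hsum := deflate_primal hn h0 h10 (by rw [h11]; exact hX)
  have h5Z : matOf n m₅ L.matZ = Z := by rw [matOf_congr (i5 _ hZin), hm.slack]
  obtain ⟨k1, k2⟩ := deflate_slack (ρ := ρ) (z := L.matZ) hn h0 (by omega) (by omega)
    (matOf_setMat_identity hn m₄ 13) (by rw [h5Z]; exact hZ)
  rw [h5Z] at k1 k2
  have c13 : ∀ k, colOf n m₇ 13 k = colOf n m₆ 13 k := colOf_congr (e7 13 (by omega))
  have c12 : ∀ k, colOf n m₇ 12 k = colOf n m₄ 12 k := colOf_congr (by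
    rw [e7 12 (by omega), e6 12 (by omega) (by omega), e5 12 (by omega)])
  refine ⟨⟨hm.congr i7, ?_, ?_, ?_, ?_⟩, ?_⟩
  · simp only [c12]
    rw [← h11]
    exact hsum
  · simp only [c13]; exact k1
  · simp only [c13]; exact k2
  · rw [matOf_congr (show m₇ 16 = m₂ 16 by rw [e7 16 (by omega), e6 16 (by omega) (by omega),
      e5 16 (by omega), e4 16 (by omega) (by omega), e3 16 (by omega)])]
    refine (matOf_setMat_self hn _).trans ?_
    ext i j
    simp [intV]
  · refine (colOf_setCol_self hn (.const 0) _).trans ?_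
    funext i
    simp [intV]

lemma attemptAct_modifies (t : Fin 4 × Fin 4 × Fin 4 × Fin 4) :
    (L.attemptAct r t : Act 𝕜).Modifies {25, 20, 21, 22, 30, 31, L.out} := by
  refine Act.Modifies.then (Act.Modifies.list ?_) ((searchAct_modifies _).mono (by
    rintro a (rfl | rfl) <;> simp))
  simp only [List.mem_cons, List.not_mem_nil, or_false]
  rintro F (rfl | rfl | rfl | rfl | rfl | rfl)
  exacts [(setMat_modifies _ _ _).mono (by simp), (setMat_modifies _ _ _).mono (by simp),
    (setMat_modifies _ _ _).mono (by simp), (setMat_modifies _ _ _).mono (by simp),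
    (rotateAct_modifies _ _ _ _ _).mono (by rintro a (rfl | rfl) <;> simp),
    (rotateAct_modifies _ _ _ _ _).mono (by rintro a (rfl | rfl) <;> simp)]

lemma Ready.attempt (hL : L.Valid) {m : Mem 𝕜} (h : L.Ready P X Z m)
    (t : Fin 4 × Fin 4 × Fin 4 × Fin 4) : L.Ready P X Z (L.attemptAct r t ρ m) := by
  refine h.congr fun a ha => attemptAct_modifies t ρ m a ?_
  have ho := hL.out_lt
  have : a = 12 ∨ a = 13 ∨ a = 16 ∨ ((a < 10 ∨ 50 ≤ a) ∧ a ≠ L.out) := by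
    rcases ha with ha | ha | ha | ha
    · exact Or.inr (Or.inr (Or.inr (hL.inputs_lt a ha).2))
    all_goals simp [ha]
  simp only [Set.mem_insert_iff, Set.mem_singleton_iff]
  omega

lemma outGood_attempt (hL : L.Valid) (hr : 6 ≤ r) (hρ : L.RegsHold P ρ) (hp : P.IsPadded)
    {μ : Fin 4 → ℝ} (hO : P.OptimalPair X Z μ) {m : Mem 𝕜} (hm : L.Ready P X Z m)
    {k i j₁ j₂ : Fin 4} (h : L.OutGood P X m ∨ ((RCLike.I : 𝕜) = 0 → j₂ = 1) ∧
      matInner (P.A k) X ≠ 0 ∧ P.FindsGood X Z k i j₁ j₂) :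
    L.OutGood P X (L.attemptAct r (k, i, j₁, j₂) ρ m) := by
  have h0 : 0 < r := by omega
  have hn := hρ.1
  have ho := hL.out_lt
  have hin : ∀ a ∈ L.inputs, (a < 10 ∨ 50 ≤ a) ∧ a ≠ L.out := fun a ha => (hL.inputs_lt a ha).2
  set m₁ := setMat r 25 (cellV 12 (.reg r) (.reg (r + 1))) ρ m with hm₁
  set m₂ := setMat r 20 (L.balancedV r k j₁) ρ m₁ with hm₂
  set m₃ := setMat r 21 (L.balancedV r k j₂) ρ m₂ with hm₃
  set m₄ := setMat r 22 (L.balancedV r k i) ρ m₃ with hm₄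
  set m₅ := rotateAct r 25 16 20 31 ρ m₄ with hm₅
  set m₆ := rotateAct r 25 20 21 31 ρ m₅ with hm₆
  change L.OutGood P X (L.searchAct r k ρ m₆)
  have e1 : ∀ a, a ≠ 25 → m₁ a = m a := fun a h => setMat_modifies _ _ _ _ _ _ (by simpa)
  have e2 : ∀ a, a ≠ 20 → m₂ a = m₁ a := fun a h => setMat_modifies _ _ _ _ _ _ (by simpa)
  have e3 : ∀ a, a ≠ 21 → m₃ a = m₂ a := fun a h => setMat_modifies _ _ _ _ _ _ (by simpa)
  have e4 : ∀ a, a ≠ 22 → m₄ a = m₃ a := fun a h => setMat_modifies _ _ _ _ _ _ (by simpa)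
  have e5 : ∀ a, a ≠ 25 → a ≠ 31 → m₅ a = m₄ a := fun a h h' =>
    rotateAct_modifies _ _ _ _ _ _ _ _ (by simp [h, h'])
  have e6 : ∀ a, a ≠ 25 → a ≠ 31 → m₆ a = m₅ a := fun a h h' =>
    rotateAct_modifies _ _ _ _ _ _ _ _ (by simp [h, h'])
  have i6 : ∀ a, a < 20 ∨ 50 ≤ a → m₆ a = m a := fun a ha => by
    rw [e6 a (by omega) (by omega), e5 a (by omega) (by omega), e4 a (by omega), e3 a (by omega),
      e2 a (by omega), e1 a (by omega)]
  have hH1 : L.Holds P X Z m₁ := hm.holds.congr fun a ha => by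
    have := hin a ha
    exact e1 a (by omega)
  have hH2 : L.Holds P X Z m₂ := hH1.congr fun a ha => by
    have := hin a ha
    exact e2 a (by omega)
  have hH3 : L.Holds P X Z m₃ := hH2.congr fun a ha => by
    have := hin a ha
    exact e3 a (by omega)
  have hH6 : L.Holds P X Z m₆ := hm.holds.congr fun a ha => by
    have := hin a ha
    exact i6 a (by omega)
  rcases h with h | ⟨hI, hk, hF⟩
  · refine outGood_search_of_outGood hL hr hρ k hH6 ?_
    rwa [OutGood, colOf_congr (i6 L.out (by omega))]
  · have b20 : matOf n m₂ 20 = P.balanced X k j₁ := matOf_setMat_balanced hn h0 hH1 20 k j₁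
    have b21 : matOf n m₃ 21 = P.balanced X k j₂ := matOf_setMat_balanced hn h0 hH2 21 k j₂
    have b22 : matOf n m₄ 22 = P.balanced X k i := matOf_setMat_balanced hn h0 hH3 22 k i
    have f20 : matOf n m₄ 20 = P.balanced X k j₁ := by
      rw [matOf_congr (e4 20 (by omega)), matOf_congr (e3 20 (by omega)), b20]
    have f21 : matOf n m₄ 21 = P.balanced X k j₂ := by rw [matOf_congr (e4 21 (by omega)), b21]
    have f16 : matOf n m₄ 16 = 0 := by
      rw [matOf_congr (e4 16 (by omega)), matOf_congr (e3 16 (by omega)),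
        matOf_congr (e2 16 (by omega)), matOf_congr (e1 16 (by omega)), hm.zero]
    have f25 : ∀ l < n, colOf n m₄ 25 l = colOf n m 12 l := by
      intro l hl
      have h : matOf n m₄ 25 = matOf n m 12 := by
        rw [matOf_congr (e4 25 (by omega)), matOf_congr (e3 25 (by omega)),
          matOf_congr (e2 25 (by omega))]
        exact matOf_setMat_entry hn m 25 12
      exact funext fun p => congrFun₂ h p ⟨l, hl⟩
    have hq0 : ∀ x : Fin n → 𝕜, quadForm (0 : Matrix (Fin n) (Fin n) 𝕜) x = 0 := fun x => by
      rw [quadForm, sesq_zero_matrix, map_zero]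
    have r1 : RotInv X (matOf n m₄ 16) (matOf n m₄ 20) n (colOf n m₅ 25) := by
      refine rotateAct_spec hn h0 (by omega) (by omega) (by omega) (by omega) (by omega) m₄ ?_ ?_
        (Or.inr (Or.inl f16)) (by rw [f20]; exact P.matInner_balanced j₁ hk) ⟨?_, ?_, by simp⟩
      · rw [f16]; exact Matrix.isHermitian_zero
      · rw [f20]; exact P.balanced_isHermitian X k j₁
      · rw [hm.sum_eq]
        exact Finset.sum_congr rfl fun l hl => by rw [f25 l (Finset.mem_range.1 hl)]
      · intro l hl
        rw [f16, hq0]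
    have g20 : matOf n m₅ 20 = P.balanced X k j₁ := by
      rw [matOf_congr (e5 20 (by omega) (by omega)), f20]
    have g21 : matOf n m₅ 21 = P.balanced X k j₂ := by
      rw [matOf_congr (e5 21 (by omega) (by omega)), f21]
    have r2 : RotInv X (matOf n m₅ 20) (matOf n m₅ 21) n (colOf n m₆ 25) := by
      refine rotateAct_spec hn h0 (by omega) (by omega) (by omega) (by omega) (by omega) m₅ ?_ ?_
        ?_ (by rw [g21]; exact P.matInner_balanced j₂ hk) ⟨r1.sum_eq, ?_, by simp⟩
      · rw [g20]; exact P.balanced_isHermitian X k j₁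
      · rw [g21]; exact P.balanced_isHermitian X k j₂
      · by_cases hI0 : (RCLike.I : 𝕜) = 0
        · refine Or.inr (Or.inr ?_)
          rw [g21, hI hI0]
          exact hO.balanced_one hp k hI0
        · exact Or.inl hI0
      · intro l hl
        rw [g20, ← f20]
        exact r1.snd_zero l hl
    have k20 : matOf n m₆ 20 = P.balanced X k j₁ := by
      rw [matOf_congr (e6 20 (by omega) (by omega)), g20]
    have k21 : matOf n m₆ 21 = P.balanced X k j₂ := by
      rw [matOf_congr (e6 21 (by omega) (by omega)), g21]
    have k22 : matOf n m₆ 22 = P.balanced X k i := by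
      rw [matOf_congr (e6 22 (by omega) (by omega)), matOf_congr (e5 22 (by omega) (by omega)), b22]
    have c13 : ∀ l, colOf n m₆ 13 l = colOf n m 13 l := colOf_congr (i6 13 (by omega))
    refine outGood_search hL hr hρ k hH6 ?_
    obtain ⟨l₁, l₂, l₃, hl⟩ := hF (fun l => colOf n m₆ 25 l) (fun l => colOf n m₆ 13 l)
      (by rw [← Finset.sum_range fun l => outerSelf (colOf n m₆ 25 l)]; exact r2.sum_eq)
      (fun l => by rw [← g20]; exact r2.fst_zero l l.2)
      (fun l => by rw [← g21]; exact r2.snd_zero l l.2)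
      (fun l => by rw [c13]; exact hm.kernel l l.2)
      (by simp only [c13]; exact hm.span)
    refine ⟨l₁, l₂, l₃, ?_⟩
    rw [SearchSucceeds, searchVecs, k20, k21, k22]
    exact hl

/-- The program finds a good point unless the pair has the property. -/
lemma outGood_solve (hL : L.Valid) (hr : 6 ≤ r) (hρ : L.RegsHold P ρ) (hp : P.IsPadded)
    {μ : Fin 4 → ℝ} (hO : P.OptimalPair X Z μ) (hc : P.c 3 ≠ 0) (hG : ¬ P.GeneralProperty X Z μ)
    {m : Mem 𝕜} (hm : L.Holds P X Z m) : L.OutGood P X (L.solveAct r ρ m) := by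
  obtain ⟨h1, h2⟩ := ready_prologue hL hr hρ.1 hO.primal.1.1 hO.slack_posSemidef.isHermitian hm
  rw [solveAct, Act.then]
  generalize L.prologueAct r ρ m = m₁ at *
  rcases hO.isGood_zero_or_findsGood hp hc hG with hg | ⟨k, i, j₁, j₂, hF⟩
  · have hpres : ∀ (l : List (Fin 4 × Fin 4 × Fin 4 × Fin 4)) (m' : Mem 𝕜), L.Ready P X Z m' →
        L.OutGood P X m' → L.OutGood P X (Act.list (l.map (L.attemptAct r)) ρ m') := by
      intro l
      induction l with
      | nil => exact fun _ _ h => h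
      | cons t l ih =>
        intro m' h h'
        exact ih _ (h.attempt hL t) (outGood_attempt hL hr hρ hp hO h (Or.inl h'))
    exact hpres _ m₁ h1 (by rwa [OutGood, h2])
  · refine Act.list_reaches (List.mem_map_of_mem (Finset.mem_toList.2
      (Finset.mem_univ (k, i, j₁, j₂)))) ρ m₁ (L.Ready P X Z) (L.OutGood P X) h1 ?_ ?_
      fun m' h => outGood_attempt hL hr hρ hp hO h (Or.inr hF)
    · simp only [List.mem_map]
      rintro _ ⟨t, -, rfl⟩ m' h
      exact h.attempt hL t
    · simp only [List.mem_map]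
      rintro _ ⟨t, -, rfl⟩ m' h h'
      exact outGood_attempt hL hr hρ hp hO h (Or.inl h')

end RealRAM.Layout

/-! ### Good points and optimal values -/

namespace HQP

section Gap

variable {𝕜 : Type} [RCLike 𝕜] {n m : ℕ} {P : HQP 𝕜 n m} {X Z : Matrix (Fin n) (Fin n) 𝕜}

lemma IsSdpOpt.le_quadForm (hX : P.IsSdpOpt X) {x : Fin n → 𝕜} (hx : x ∈ P.feasibleSet) :
    matInner P.A₀ X ≤ quadForm P.A₀ x := by
  rw [← matInner_outerSelf]
  refine hX.2 _ ⟨outerSelf_posSemidef x, fun i => ?_⟩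
  rw [matInner_outerSelf]
  exact hx i

lemma IsGood.isGlobalOpt (hX : P.IsSdpOpt X) {x : Fin n → 𝕜} (hx : P.IsGood X x) :
    P.IsGlobalOpt x :=
  ⟨hx.1, fun _ hy => hx.2.trans (hX.le_quadForm hy)⟩

lemma IsSdpOpt.sdpValue_eq (hX : P.IsSdpOpt X) :
    P.sdpValue = ((matInner P.A₀ X : ℝ) : EReal) :=
  le_antisymm (iInf₂_le X hX.1) (le_iInf₂ fun Y hY => EReal.coe_le_coe_iff.2 (hX.2 Y hY))

/-- There is a gap exactly if there is no good point, since the minimum of a feasible program is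
attained. -/
theorem gap_iff (hD : P.DualSlater) (hX : P.IsSdpOpt X) :
    (P.sdpValue < P.value ∨ P.feasibleSet = ∅) ↔ ∀ x, ¬ P.IsGood X x := by
  rw [hX.sdpValue_eq]
  constructor
  · rintro (h | h) x hx
    · have h1 : P.value ≤ ((quadForm P.A₀ x : ℝ) : EReal) := iInf₂_le x hx.1
      exact absurd hx.2 (not_le.2 (EReal.coe_lt_coe_iff.1 (h.trans_le h1)))
    · have := hx.1
      rw [h] at this
      exact this
  · intro h
    rcases P.feasibleSet.eq_empty_or_nonempty with h0 | h0
    · exact Or.inr h0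
    · obtain ⟨x, hx, hmin⟩ := exists_isGlobalOpt hD h0
      left
      have h1 : ((quadForm P.A₀ x : ℝ) : EReal) ≤ P.value :=
        le_iInf₂ fun y hy => EReal.coe_le_coe_iff.2 (hmin y hy)
      refine lt_of_lt_of_le (EReal.coe_lt_coe_iff.2 ?_) h1
      by_contra hle
      exact h x ⟨hx, not_lt.1 hle⟩

end Gap

/-! ### Four complex constraints -/

section Complex

variable {n : ℕ} {P : HQP ℂ n 4} {X Z : Matrix (Fin n) (Fin n) ℂ} {μ : Fin 4 → ℝ}

/-- For `p₁ = xᴴ B₁ y` and `p₂ = xᴴ B₂ y` the two cross coefficients have different norms exactly if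
`p₁` and `p₂` are independent over the reals. -/
lemma norm_upForm_ne_iff {B₁ B₂ : Matrix (Fin n) (Fin n) ℂ} (h₁ : B₁.IsHermitian)
    (h₂ : B₂.IsHermitian) (x y : Fin n → ℂ) : ‖upForm B₁ B₂ x y‖ ≠ ‖lowForm B₁ B₂ y x‖ ↔
      (sesq B₁ x y).im * (sesq B₂ x y).re - (sesq B₁ x y).re * (sesq B₂ x y).im ≠ 0 := by
  have hup : upForm B₁ B₂ x y = sesq B₁ x y + Complex.I * sesq B₂ x y := by
    rw [upForm, RCLike.I_to_complex, Complex.I_mul_I]; ring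
  have hlow : lowForm B₁ B₂ y x = star (sesq B₁ x y) + Complex.I * star (sesq B₂ x y) := by
    rw [lowForm, RCLike.I_to_complex, Complex.I_mul_I, star_sesq (hA := h₁),
      star_sesq (hA := h₂)]
    ring
  rw [hup, hlow, ne_eq, ← sq_eq_sq₀ (norm_nonneg _) (norm_nonneg _), Complex.sq_norm,
    Complex.sq_norm, Complex.normSq_apply, Complex.normSq_apply]
  simp only [Complex.star_def, Complex.add_re, Complex.add_im, Complex.mul_re, Complex.mul_im,
    Complex.I_re, Complex.I_im, Complex.conj_re, Complex.conj_im]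
  rw [not_iff_not]
  constructor <;> intro h <;> linarith

lemma outerSelf_smul_of_norm_eq_one {e : ℂ} (he : ‖e‖ = 1) (x : Fin n → ℂ) :
    outerSelf (e • x) = outerSelf x := by
  rw [outerSelf_smul, he]; simp

/-- Property I asks for cross terms `p₁` with `Re p₁ ≠ 0` and `p₂ ≠ 0` purely imaginary. Such
numbers are independent over the reals, and conversely a phase factor on `x₂` brings independent
cross terms into this form. -/
theorem propertyIComplex_iff : P.PropertyIComplex X Z μ ↔ P.GeneralProperty X Z μ := by
  have hB := P.reduced_isHermitian 3
  simp only [PropertyIComplex, GeneralProperty, matInner_outerSelf,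
    norm_upForm_ne_iff (hB 0) (hB 1)]
  refine and_congr_right fun _ => and_congr_right fun _ => and_congr_right fun _ => ?_
  constructor
  · rintro ⟨x₁, x₂, hX, ⟨h1, h2, h3⟩, ⟨h4, h5, h6, h7⟩, h8⟩
    refine ⟨x₁, x₂, hX, diagForm_eq_zero (hB 0) (hB 1) h1 h4, diagForm_eq_zero (hB 0) (hB 1) h2 h5,
      ?_, h8⟩
    rw [h6, mul_zero, zero_sub]
    exact neg_ne_zero.2 (mul_ne_zero h3 h7)
  · rintro ⟨x₁, x₂, hX, hd1, hd2, hne, h8⟩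
    have hz : ∀ x, diagForm (P.reduced 3 0) (P.reduced 3 1) x = 0 →
        quadForm (P.reduced 3 0) x = 0 ∧ quadForm (P.reduced 3 1) x = 0 := fun x hx =>
      quadForm_eq_zero_of_diagForm (hB 0) (hB 1) (fun h => absurd h Complex.I_ne_zero) hx
    set p := sesq (P.reduced 3 0) x₁ x₂ with hp
    set q := sesq (P.reduced 3 1) x₁ x₂ with hq
    have hq0 : q ≠ 0 := by
      rintro h0
      rw [h0] at hne
      simp at hne
    have hn : ‖q‖ ≠ 0 := norm_ne_zero_iff.2 hq0
    -- a phase that makes the second cross term imaginary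
    set e : ℂ := Complex.I * star q / (‖q‖ : ℂ) with he
    have hnorm : ‖e‖ = 1 := by
      rw [he, norm_div, norm_mul, Complex.norm_I, norm_star, Complex.norm_real, norm_norm, one_mul,
        div_self hn]
    have hqq : q.re * q.re + q.im * q.im = ‖q‖ * ‖q‖ := by
      rw [← Complex.normSq_apply, Complex.normSq_eq_norm_sq, sq]
    have hre : e.re = q.im / ‖q‖ := by
      rw [he, Complex.div_ofReal_re]; simp
    have him : e.im = q.re / ‖q‖ := by
      rw [he, Complex.div_ofReal_im]; simp
    have hquad : ∀ A, quadForm A (e • x₂) = quadForm A x₂ := fun A => by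
      rw [← matInner_outerSelf, outerSelf_smul_of_norm_eq_one hnorm, matInner_outerSelf]
    refine ⟨x₁, e • x₂, by rw [outerSelf_smul_of_norm_eq_one hnorm, hX],
      ⟨(hz _ hd1).1, by rw [hquad]; exact (hz _ hd2).1, ?_⟩,
      ⟨(hz _ hd1).2, by rw [hquad]; exact (hz _ hd2).2, ?_, ?_⟩, by rw [hquad]; exact h8⟩
    · rw [sesq_smul_right, ← hp, Complex.mul_re, hre, him]
      intro h0
      apply hne
      field_simp at h0
      linarith
    · rw [sesq_smul_right, ← hq, Complex.mul_re, hre, him]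
      field_simp
      ring
    · rw [sesq_smul_right, ← hq, Complex.mul_im, hre, him]
      have : q.im / ‖q‖ * q.im + q.re / ‖q‖ * q.re = ‖q‖ := by
        field_simp
        linarith
      rw [this]
      exact hn

end Complex

/-! ### Three real constraints -/

section Real

variable {n : ℕ}

/-- The extension of a real problem by the constraint `0 = 0`. -/
noncomputable def pad (P : HQP ℝ n 3) : HQP ℝ n 4 where
  A₀ := P.A₀
  A := ![P.A 0, 0, P.A 1, P.A 2]
  c := ![P.c 0, 0, P.c 1, P.c 2]
  isEq := ![P.isEq 0, true, P.isEq 1, P.isEq 2]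
  hermitian₀ := P.hermitian₀
  hermitian := by
    intro i
    fin_cases i
    exacts [P.hermitian 0, Matrix.isHermitian_zero, P.hermitian 1, P.hermitian 2]

variable {P : HQP ℝ n 3} {X Z : Matrix (Fin n) (Fin n) ℝ} {μ : Fin 3 → ℝ}

lemma pad_rel (f : Matrix (Fin n) (Fin n) ℝ → ℝ) (hf : f 0 = 0) :
    (∀ i, P.pad.Rel i (f (P.pad.A i))) ↔ ∀ i, P.Rel i (f (P.A i)) := by
  simp [Fin.forall_fin_succ, Rel, pad, hf]
  rfl

lemma pad_feasibleSet : P.pad.feasibleSet = P.feasibleSet := by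
  ext x
  exact pad_rel (fun A => quadForm A x) (by rw [quadForm, sesq_zero_matrix, map_zero])

lemma pad_isGood (x : Fin n → ℝ) : P.pad.IsGood X x ↔ P.IsGood X x := by
  rw [IsGood, pad_feasibleSet]; rfl

lemma pad_sdpFeasibleSet : P.pad.sdpFeasibleSet = P.sdpFeasibleSet := by
  ext Y
  exact and_congr_right fun _ => pad_rel (fun A => matInner A Y) (by simp [matInner])

lemma pad_slack (μ : Fin 3 → ℝ) : P.pad.slack ![μ 0, 0, μ 1, μ 2] = P.slack μ := by
  simp [slack, pad, Fin.sum_univ_succ]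

lemma pad_isPadded : P.pad.IsPadded := fun _ => ⟨rfl, rfl⟩

lemma OptimalPair.pad (h : P.OptimalPair X Z μ) :
    P.pad.OptimalPair X Z ![μ 0, 0, μ 1, μ 2] where
  slater := by
    obtain ⟨ν, hν, hpos⟩ := h.slater
    refine ⟨![ν 0, 0, ν 1, ν 2], by rwa [pad_slack], ?_⟩
    simpa [Fin.forall_fin_succ, HQP.pad] using hpos
  primal := ⟨by rw [pad_sdpFeasibleSet]; exact h.primal.1, by
    rw [pad_sdpFeasibleSet]; exact h.primal.2⟩
  slack_eq := by rw [pad_slack]; exact h.slack_eq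
  slack_posSemidef := h.slack_posSemidef
  nonneg := by simpa [Fin.forall_fin_succ, HQP.pad] using h.nonneg
  orthogonal := h.orthogonal
  complementary := by
    have := h.complementary
    rw [Fin.forall_fin_succ, Fin.forall_fin_succ, Fin.forall_fin_succ] at this ⊢
    refine ⟨this.1, by simp, ?_⟩
    simpa [Fin.forall_fin_succ, HQP.pad] using this.2

theorem propertyIReal_iff :
    P.PropertyIReal X Z μ ↔ P.pad.GeneralProperty X Z ![μ 0, 0, μ 1, μ 2] := by
  have h0 : P.pad.reduced 3 0 = P.reduced 2 0 := rfl
  have h2 : P.pad.reduced 3 2 = P.reduced 2 1 := rfl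
  have hI : (RCLike.I : ℝ) = 0 := rfl
  have hd : ∀ x, diagForm (P.reduced 2 0) (P.pad.reduced 3 1) x =
      quadForm (P.reduced 2 0) x := by
    intro x
    rw [diagForm, hI, zero_mul, add_zero]; rfl
  have hact : (∀ i, P.pad.isEq i = false → (![μ 0, 0, μ 1, μ 2] : Fin 4 → ℝ) i ≠ 0) ↔
      ∀ i, P.isEq i = false → μ i ≠ 0 := by
    simp [Fin.forall_fin_succ, pad]
  simp only [PropertyIReal, GeneralProperty, matInner_outerSelf, h0, hd, h2, hact, upForm, lowForm,
    hI]
  simp [and_assoc]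

end Real

end HQP

/-! ### Running the program -/

namespace RealRAM.Layout

/-- One program finds a good point for all problems and pairs that are stored according to the
layout `L` and do not have the property. -/
lemma exists_program {𝕜 : Type} [RCLike 𝕜] {L : Layout} (hL : L.Valid) :
    ∃ (prog : Prog) (p : Polynomial ℕ), ∀ (n : ℕ) (P : HQP 𝕜 n 4)
      (X Z : Matrix (Fin n) (Fin n) 𝕜) (μ : Fin 4 → ℝ) (s : Store 𝕜), P.c 3 ≠ 0 → P.IsPadded →
      P.OptimalPair X Z μ → ¬ P.GeneralProperty X Z μ → L.RegsHold P s.regs → L.Holds P X Z s.mem →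
      P.IsGood X ((prog.run s).1.outputVec L.out n) ∧ (prog.run s).2 ≤ p.eval n := by
  obtain ⟨prog, p, h⟩ := (compS_solve (𝕜 := 𝕜) hL le_rfl).prog
  refine ⟨prog, p, fun n P X Z μ s hc hp hO hG hr hs => ?_⟩
  obtain ⟨h1, -, h3⟩ := h s
  have hgood := outGood_solve hL le_rfl hr hp hO hc hG hs
  rw [OutGood, ← colOf_congr (h3 L.out (hL.out_lt.trans (by omega)))] at hgood
  exact ⟨hgood, by rwa [hr.1] at h1⟩

/-- The places of the input and of the output for four constraints. -/
def complexLayout : Layout where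
  matA := ![1, 2, 3, 4]
  matX := 5
  matZ := 6
  vecC := 7
  colC := ![0, 1, 2, 3]
  flag := ![.reg 1, .reg 2, .reg 3, .reg 4]
  out := 8

/-- The places of the input and of the output for three constraints. The dummy constraint is read
from empty memory. -/
def realLayout : Layout where
  matA := ![1, 50, 2, 3]
  matX := 4
  matZ := 5
  vecC := 6
  colC := ![0, 50, 1, 2]
  flag := ![.reg 1, .const 1, .reg 2, .reg 3]
  out := 7

lemma complexLayout_valid : complexLayout.Valid where
  inputs_lt := by
    rintro a (rfl | ⟨j, rfl⟩ | rfl | rfl | rfl)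
    · simp [complexLayout]
    · fin_cases j <;> simp [complexLayout]
    all_goals simp [complexLayout]
  out_lt := by simp [complexLayout]
  flag_below j := by fin_cases j <;> simp [complexLayout, NatExp.Below]

lemma realLayout_valid : realLayout.Valid where
  inputs_lt := by
    rintro a (rfl | ⟨j, rfl⟩ | rfl | rfl | rfl)
    · simp [realLayout]
    · fin_cases j <;> simp [realLayout]
    all_goals simp [realLayout]
  out_lt := by simp [realLayout]
  flag_below j := by fin_cases j <;> simp [realLayout, NatExp.Below]

lemma matOf_padMatrix {𝕜 : Type} [RCLike 𝕜] {n a : ℕ} {m : Mem 𝕜} {M : Matrix (Fin n) (Fin n) 𝕜}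
    (h : ∀ i j, m a i j = padMatrix M i j) : matOf n m a = M := by
  ext i j
  simp [matOf, h, padMatrix]

lemma complexLayout_regsHold {n : ℕ} (P : HQP ℂ n 4) (X Z : Matrix (Fin n) (Fin n) ℂ)
    (μ : Fin 4 → ℝ) : complexLayout.RegsHold P (inputStore P X Z μ).regs := by
  refine ⟨rfl, fun j => ?_⟩
  fin_cases j <;> simp [complexLayout, inputStore, NatExp.eval] <;> split_ifs <;> simp_all

lemma complexLayout_holds {n : ℕ} (P : HQP ℂ n 4) (X Z : Matrix (Fin n) (Fin n) ℂ)
    (μ : Fin 4 → ℝ) : complexLayout.Holds P X Z (inputStore P X Z μ).mem where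
  objective := matOf_padMatrix fun _ _ => rfl
  constraint j := by fin_cases j <;> exact matOf_padMatrix fun _ _ => rfl
  primal := matOf_padMatrix fun _ _ => rfl
  slack := matOf_padMatrix fun _ _ => rfl
  bound j := by fin_cases j <;> rfl

lemma realLayout_regsHold {n : ℕ} (P : HQP ℝ n 3) (X Z : Matrix (Fin n) (Fin n) ℝ)
    (μ : Fin 3 → ℝ) : realLayout.RegsHold P.pad (inputStore P X Z μ).regs := by
  refine ⟨rfl, fun j => ?_⟩
  fin_cases j <;> simp [realLayout, inputStore, NatExp.eval, HQP.pad] <;> split_ifs <;> simp_all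

lemma realLayout_holds {n : ℕ} (P : HQP ℝ n 3) (X Z : Matrix (Fin n) (Fin n) ℝ)
    (μ : Fin 3 → ℝ) : realLayout.Holds P.pad X Z (inputStore P X Z μ).mem where
  objective := matOf_padMatrix fun _ _ => rfl
  constraint j := by
    fin_cases j
    · exact matOf_padMatrix fun _ _ => rfl
    · ext i j
      rfl
    all_goals exact matOf_padMatrix fun _ _ => rfl
  primal := matOf_padMatrix fun _ _ => rfl
  slack := matOf_padMatrix fun _ _ => rfl
  bound j := by fin_cases j <;> rfl

end RealRAM.Layout

theorem mainTheorem1 :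
    -- three real constraints
    ((∀ (n : ℕ) (P : HQP ℝ n 3), P.c 2 ≠ 0 → P.PrimalSlater → P.DualSlater →
        ∀ (X Z : Matrix (Fin n) (Fin n) ℝ) (μ : Fin 3 → ℝ), P.IsSdpOpt X → P.IsDualOpt Z μ →
          ((P.sdpValue < P.value ∨ P.feasibleSet = ∅) ↔ P.PropertyIReal X Z μ)) ∧
      ∃ (prog : RealRAM.Prog) (p : Polynomial ℕ),
        ∀ (n : ℕ) (P : HQP ℝ n 3), P.c 2 ≠ 0 → P.PrimalSlater → P.DualSlater →
        ∀ (X Z : Matrix (Fin n) (Fin n) ℝ) (μ : Fin 3 → ℝ), P.IsSdpOpt X → P.IsDualOpt Z μ →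
          ¬ P.PropertyIReal X Z μ →
          P.IsGlobalOpt ((prog.run (RealRAM.inputStore P X Z μ)).1.outputVec 7 n) ∧
            (prog.run (RealRAM.inputStore P X Z μ)).2 ≤ p.eval n) ∧
    -- four complex constraints
    ((∀ (n : ℕ) (P : HQP ℂ n 4), P.c 3 ≠ 0 → P.PrimalSlater → P.DualSlater →
        ∀ (X Z : Matrix (Fin n) (Fin n) ℂ) (μ : Fin 4 → ℝ), P.IsSdpOpt X → P.IsDualOpt Z μ →
          ((P.sdpValue < P.value ∨ P.feasibleSet = ∅) ↔ P.PropertyIComplex X Z μ)) ∧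
      ∃ (prog : RealRAM.Prog) (p : Polynomial ℕ),
        ∀ (n : ℕ) (P : HQP ℂ n 4), P.c 3 ≠ 0 → P.PrimalSlater → P.DualSlater →
        ∀ (X Z : Matrix (Fin n) (Fin n) ℂ) (μ : Fin 4 → ℝ), P.IsSdpOpt X → P.IsDualOpt Z μ →
          ¬ P.PropertyIComplex X Z μ →
          P.IsGlobalOpt ((prog.run (RealRAM.inputStore P X Z μ)).1.outputVec 8 n) ∧
            (prog.run (RealRAM.inputStore P X Z μ)).2 ≤ p.eval n) := by

  refine ⟨?_, ?_⟩
  · obtain ⟨prog, p, hrun⟩ :=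
      RealRAM.Layout.exists_program (𝕜 := ℝ) RealRAM.Layout.realLayout_valid
    have hgood : ∀ (n : ℕ) (P : HQP ℝ n 3), P.c 2 ≠ 0 → P.PrimalSlater → P.DualSlater →
        ∀ (X Z : Matrix (Fin n) (Fin n) ℝ) (μ : Fin 3 → ℝ), P.IsSdpOpt X → P.IsDualOpt Z μ →
          ¬ P.PropertyIReal X Z μ →
          P.IsGood X ((prog.run (RealRAM.inputStore P X Z μ)).1.outputVec 7 n) ∧
            (prog.run (RealRAM.inputStore P X Z μ)).2 ≤ p.eval n := by
      intro n P hc hS hD X Z μ hX hZ hI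
      have h := hrun n P.pad X Z _ (RealRAM.inputStore P X Z μ) hc HQP.pad_isPadded
        (HQP.optimalPair hS hD hX hZ).pad (fun hG => hI (HQP.propertyIReal_iff.2 hG))
        (RealRAM.Layout.realLayout_regsHold P X Z μ) (RealRAM.Layout.realLayout_holds P X Z μ)
      exact ⟨(HQP.pad_isGood _).1 h.1, h.2⟩
    refine ⟨fun n P hc hS hD X Z μ hX hZ => ?_, prog, p, fun n P hc hS hD X Z μ hX hZ hI => ?_⟩
    · rw [HQP.gap_iff hD hX]
      refine ⟨fun h => ?_, fun h x hx => ?_⟩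
      · by_contra hI
        exact h _ (hgood n P hc hS hD X Z μ hX hZ hI).1
      · exact (HQP.optimalPair hS hD hX hZ).pad.not_isGood hc (HQP.propertyIReal_iff.1 h) x
          ((HQP.pad_isGood x).2 hx)
    · have h := hgood n P hc hS hD X Z μ hX hZ hI
      exact ⟨h.1.isGlobalOpt hX, h.2⟩
  · obtain ⟨prog, p, hrun⟩ :=
      RealRAM.Layout.exists_program (𝕜 := ℂ) RealRAM.Layout.complexLayout_valid
    have hgood : ∀ (n : ℕ) (P : HQP ℂ n 4), P.c 3 ≠ 0 → P.PrimalSlater → P.DualSlater →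
        ∀ (X Z : Matrix (Fin n) (Fin n) ℂ) (μ : Fin 4 → ℝ), P.IsSdpOpt X → P.IsDualOpt Z μ →
          ¬ P.PropertyIComplex X Z μ →
          P.IsGood X ((prog.run (RealRAM.inputStore P X Z μ)).1.outputVec 8 n) ∧
            (prog.run (RealRAM.inputStore P X Z μ)).2 ≤ p.eval n := by
      intro n P hc hS hD X Z μ hX hZ hI
      exact hrun n P X Z μ (RealRAM.inputStore P X Z μ) hc (fun h => absurd h Complex.I_ne_zero)
        (HQP.optimalPair hS hD hX hZ) (fun hG => hI (HQP.propertyIComplex_iff.2 hG))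
        (RealRAM.Layout.complexLayout_regsHold P X Z μ)
        (RealRAM.Layout.complexLayout_holds P X Z μ)
    refine ⟨fun n P hc hS hD X Z μ hX hZ => ?_, prog, p, fun n P hc hS hD X Z μ hX hZ hI => ?_⟩
    · rw [HQP.gap_iff hD hX]
      refine ⟨fun h => ?_, fun h x => ?_⟩
      · by_contra hI
        exact h _ (hgood n P hc hS hD X Z μ hX hZ hI).1
      · exact (HQP.optimalPair hS hD hX hZ).not_isGood hc (HQP.propertyIComplex_iff.1 h) x
    · have h := hgood n P hc hS hD X Z μ hX hZ hI
      exact ⟨h.1.isGlobalOpt hX, h.2⟩
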